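/- **Setting.** Let $(X,d)$ be a non-empty metric space with a Borel measure $\mu$ such that, for some constant $C_0$, $\mu(B(x,2r))\le C_0\,\mu(B(x,r))<\infty$ for all $x\in X$, $r>0$. Let $\mathbb B$ be a (real or complex) Banach space of ($\mu$-classes of) measurable functions on $X$, stable under multiplication by indicator functions of measurable sets and containing the indicator functions of all measurable sets of finite measure. Let $\mathcal T=\{T_t\}_{t>0}$ be bounded linear operators on $\mathbb B$ with $T_s\circ T_t=T_{s+t}$ for $s,t>0$, such that for all $f\in\mathbb B$, $t>0$ and $x\in X$, $T_t(\chi_{B(x,R)}f)\to T_tf$ in measure on every ball centred at $x$ as $R\to\infty$. **Off-diagonal estimates.** Let $\nu$ be $\mu$ or $w\,d\mu$. For a ball $B=B(x,r)$ put $\lambda B=B(x,\lambda r)$, $C_j(B)=2^{j+1}B\setminus 2^jB$ for $j\ge2$, and $\Upsilon(s)=\max\{s,s^{-1}\}$. For $A\subset F$ with $(A,F)=(B,B)$ or $(C_j(B),2^{j+1}B)$, put $|h|_{q,A}=\big(\nu(F)^{-1}\int_A|h|^q\,d\nu\big)^{1/q}$ for $q<\infty$ and $|h|_{\infty,A}=\operatorname{ess\,sup}_A|h|$.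 For $1\le p\le q\le\infty$ write $T_t\in\mathcal O(L^p(\nu)-L^q(\nu))$ if there are $\theta_1,\theta_2,c,C>0$ such that for all $t>0$, all balls $B$ of radius $r$, all $j\ge2$ and all $f\in\mathbb B\cap L^p(\nu)$, $$|T_t(\chi_Bf)|_{q,B}\le C\,\Upsilon\big(\tfrac r{\sqrt t}\big)^{\theta_2}|f|_{p,B},$$ $$|T_t(\chi_{C_j(B)}f)|_{q,B}\le C\,2^{j\theta_1}\Upsilon\big(\tfrac{2^jr}{\sqrt t}\big)^{\theta_2}e^{-c4^jr^2/t}\,|f|_{p,C_j(B)},$$ $$|T_t(\chi_Bf)|_{q,C_j(B)}\le C\,2^{j\theta_1}\Upsilon\big(\tfrac{2^jr}{\sqrt t}\big)^{\theta_2}e^{-c4^jr^2/t}\,|f|_{p,B}.$$ Let $\mathcal J^\nu$ be the set of the exponents $p\in[1,\infty]$ that belong to some pair of exponents $p_1<p_2$ in $[1,\infty]$ with $T_t\in\mathcal O(L^{p_1}(\nu)-L^{p_2}(\nu))$, and let $\widetilde{\mathcal J}^\nu$ be the set of the $p\in[1,\infty]$ such that $\|T_tf\|_{L^p(\nu)}\le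 C\|f\|_{L^p(\nu)}$ for all $t>0$ and $f\in\mathbb B\cap L^p(\nu)$, with $C$ independent of $t$ and $f$. Write $\mathcal J(\mathcal T)=\mathcal J^\mu$, and, for a weight $w$, $\mathcal J_w(\mathcal T)=\mathcal J^{w\,d\mu}$, $\widetilde{\mathcal J}_w(\mathcal T)=\widetilde{\mathcal J}^{w\,d\mu}$. For a set $E\subset[1,\infty]$ let $\operatorname{Int}E$ be the interior of $E\cap\mathbb R$ in $\mathbb R$. **Weights.** A weight is a non-negative, measurable, locally integrable function $w$. With ⨍$_B$ denoting the $\mu$-average over $B$ and with bounds uniform over all balls $B$: $w\in A_s$ ($1<s<\infty$) if (⨍$_Bw$)(⨍$_Bw^{-1/(s-1)}$)$^{s-1}\le C$; $w\in RH_s$ ($1\le s<\infty$) if (⨍$_Bw^s$)$^{1/s}\le C$⨍$_Bw$ (void for $s=1$). For $1\le p_0<q_0\le\infty$ let $$\mathcal W_w(p_0,q_0)=\{p:\ p_0<p<q_0,\ w\in A_{p/p_0}\cap RH_{(q_0/p)'}\},$$ where $s'$ is the conjugate exponent of $s$ and $\infty'=1$. **Statement.** Let $1\le p_0<q_0\le\infty$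 with $(p_0,q_0)\subset\mathcal J(\mathcal T)$, and let $w$ be a weight with $\mathcal W_w(p_0,q_0)\ne\emptyset$. Then: 1. $\mathcal J_w(\mathcal T)$ is the unique set $E\subset[1,\infty]$ such that, for all $1\le p<q\le\infty$, $T_t\in\mathcal O(L^p(w)-L^q(w))$ if and only if $p,q\in E$; moreover $\mathcal J_w(\mathcal T)$ and $\widetilde{\mathcal J}_w(\mathcal T)$ are intervals. 2. $\mathcal W_w(p_0,q_0)\subset\mathcal J_w(\mathcal T)\subset\widetilde{\mathcal J}_w(\mathcal T)$ and $\operatorname{Int}\mathcal J_w(\mathcal T)=\operatorname{Int}\widetilde{\mathcal J}_w(\mathcal T)$. 3. Suppose that for some $r\in(p_0,q_0)$ the family $\mathcal T$ is strongly continuous on $L^r(\mu)$, i.e. it extends from $\mathbb B\cap L^r(\mu)$ to a semigroup of bounded operators $S_t$ on $L^r(\mu)$ with $S_tf\to f$ as $t\to0^+$ for all $f\in L^r(\mu)$. Then for every $p\in\mathcal J_w(\mathcal T)$ with $p\neq\infty$, $\mathcal T$ has an infinitesimal generator on $L^p(w)$: it extends from $\mathbb B\cap L^p(w)$ to a semigroup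 of bounded operators $S_t$ on $L^p(w)$ that is strongly continuous at $0$, and the operator $Af=\lim_{t\to0^+}(S_tf-f)/t$, with domain the set of all $f$ for which the limit exists, is densely defined and closed. -/

import Mathlib

open MeasureTheory Set Filter Topology
open scoped ENNReal NNReal

noncomputable section

namespace OffDiag

variable {X : Type*} [MetricSpace X] [MeasurableSpace X]

/-- The doubling condition on all balls, together with finiteness of the measure of balls. -/
def IsDoubling (μ : Measure X) : Prop :=
  ∃ C₀ : ℝ≥0, ∀ (x : X) (r : ℝ), 0 < r →
    μ (Metric.ball x (2 * r)) ≤ C₀ * μ (Metric.ball x r) ∧ μ (Metric.ball x r) < ∞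

/-! ### Muckenhoupt and reverse Hölder classes -/

/-- The average of an extended non-negative function over the set `A`. -/
def lavg (μ : Measure X) (A : Set X) (h : X → ℝ≥0∞) : ℝ≥0∞ :=
  (μ A)⁻¹ * ∫⁻ x in A, h x ∂μ

/-- The class `A_s`, `1 < s < ∞`. Here `1 - s' = -1 / (s - 1)`, and the negative power of the
weight is taken in `[0, ∞]`, so that it is infinite where the weight vanishes. -/
def MuckenhouptA (μ : Measure X) (s : ℝ) (w : X → ℝ≥0) : Prop :=
  1 < s ∧ ∃ C : ℝ≥0, ∀ (x : X) (r : ℝ), 0 < r →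
    lavg μ (Metric.ball x r) (fun y => (w y : ℝ≥0∞)) *
      (lavg μ (Metric.ball x r) (fun y => (w y : ℝ≥0∞) ^ (-1 / (s - 1)))) ^ (s - 1) ≤ C

/-- The class `RH_s`, `1 ≤ s < ∞` (for `s = 1` the condition is void). -/
def ReverseHolder (μ : Measure X) (s : ℝ) (w : X → ℝ≥0) : Prop :=
  1 ≤ s ∧ ∃ C : ℝ≥0, ∀ (x : X) (r : ℝ), 0 < r →
    (lavg μ (Metric.ball x r) (fun y => (w y : ℝ≥0∞) ^ s)) ^ (1 / s) ≤
      C * lavg μ (Metric.ball x r) (fun y => (w y : ℝ≥0∞))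

/-- The set `W_w(p₀, q₀)` of the `p ∈ (p₀, q₀)` with `w ∈ A_{p/p₀} ∩ RH_{(q₀/p)'}`. -/
def weightSet (μ : Measure X) (w : X → ℝ≥0) (p₀ q₀ : ℝ≥0∞) : Set ℝ≥0∞ :=
  {p | p₀ < p ∧ p < q₀ ∧ MuckenhouptA μ (p / p₀).toReal w ∧
    ReverseHolder μ (ENNReal.conjExponent (q₀ / p)).toReal w}

/-- The measure `dw = w dμ`. -/
def weighted (μ : Measure X) (w : X → ℝ≥0) : Measure X :=
  μ.withDensity fun x => (w x : ℝ≥0∞)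

/-! ### Banach spaces of measurable functions -/

/-- The Banach space `E` is realised as a space of (classes of) `μ`-measurable functions,
stable under truncation by indicator functions of measurable sets, and containing the indicator
functions of the sets of finite measure (hence all integrable simple functions). -/
structure FunctionSpace (𝕜 : Type*) [RCLike 𝕜] (μ : Measure X) (E : Type*)
    [NormedAddCommGroup E] [NormedSpace 𝕜 E] where
  fn : E →ₗ[𝕜] (X →ₘ[μ] 𝕜)
  injective_fn : Function.Injective fn
  exists_trunc : ∀ (A : Set X), MeasurableSet A → ∀ f : E,
    ∃ g : E, (fn g : X → 𝕜) =ᵐ[μ] A.indicator (fn f)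
  exists_indicator : ∀ (A : Set X), MeasurableSet A → μ A < ∞ →
    ∃ g : E, (fn g : X → 𝕜) =ᵐ[μ] A.indicator (fun _ => (1 : 𝕜))

/-- `∂(s) = max {s, s⁻¹}`. -/
def dec (s : ℝ) : ℝ := max s s⁻¹

/-- The annulus `C_j(B) = 2^{j+1} B \ 2^j B` of the ball `B = B(x, r)`, used for `j ≥ 2`. -/
def annulus (x : X) (r : ℝ) (j : ℕ) : Set X :=
  Metric.ball x (2 ^ (j + 1) * r) \ Metric.ball x (2 ^ j * r)

/-- `(ν(F)⁻¹ ∫_A |h|^q dν)^{1/q}`, and the essential supremum of `|h|` on `A` if `q = ∞`. -/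
def avgNorm {𝕜 : Type*} [RCLike 𝕜] (ν : Measure X) (q : ℝ≥0∞) (A F : Set X) (h : X → 𝕜) :
    ℝ≥0∞ :=
  eLpNorm h q ((ν F)⁻¹ • ν.restrict A)

namespace FunctionSpace

variable {𝕜 : Type*} [RCLike 𝕜] {μ : Measure X} {E : Type*}
  [NormedAddCommGroup E] [NormedSpace 𝕜 E]

open Classical in
/-- The truncation `χ_A f` of `f`, as an element of the function space, for measurable `A`. -/
def trunc (𝔹 : FunctionSpace 𝕜 μ E) (A : Set X) (f : E) : E :=
  if hA : MeasurableSet A then (𝔹.exists_trunc A hA f).choose else 0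

theorem fn_trunc (𝔹 : FunctionSpace 𝕜 μ E) {A : Set X} (hA : MeasurableSet A) (f : E) :
    (𝔹.fn (𝔹.trunc A f) : X → 𝕜) =ᵐ[μ] A.indicator (𝔹.fn f) := by
  rw [trunc, dif_pos hA]
  exact (𝔹.exists_trunc A hA f).choose_spec

/-- `T_t (χ_{B(x,R)} f) → T_t f` locally in measure as `R → ∞`, for all `t > 0` and all `f` in
the function space. -/
def TruncationContinuous (𝔹 : FunctionSpace 𝕜 μ E) (T : ℝ → E →L[𝕜] E) : Prop :=
  ∀ t : ℝ, 0 < t → ∀ (f : E) (x : X) (ρ : ℝ), 0 < ρ →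
    TendstoInMeasure (μ.restrict (Metric.ball x ρ))
      (fun (R : ℝ) => (𝔹.fn (T t (𝔹.trunc (Metric.ball x R) f)) : X → 𝕜)) atTop
      (𝔹.fn (T t f) : X → 𝕜)

/-- `L^p(ν) - L^q(ν)` off-diagonal estimates on balls. The measure `ν` is `μ` or `w dμ`. -/
def OffDiagonal (𝔹 : FunctionSpace 𝕜 μ E) (ν : Measure X) (T : ℝ → E →L[𝕜] E)
    (p q : ℝ≥0∞) : Prop :=
  ∃ θ₁ θ₂ c C : ℝ, 0 < θ₁ ∧ 0 < θ₂ ∧ 0 < c ∧ 0 < C ∧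
    ∀ t : ℝ, 0 < t → ∀ (x : X) (r : ℝ), 0 < r → ∀ f : E, MemLp (𝔹.fn f) p ν →
      avgNorm ν q (Metric.ball x r) (Metric.ball x r)
          (𝔹.fn (T t (𝔹.trunc (Metric.ball x r) f))) ≤
        ENNReal.ofReal (C * dec (r / √t) ^ θ₂) *
          avgNorm ν p (Metric.ball x r) (Metric.ball x r) (𝔹.fn f) ∧
      ∀ j : ℕ, 2 ≤ j →
        avgNorm ν q (Metric.ball x r) (Metric.ball x r)
            (𝔹.fn (T t (𝔹.trunc (annulus x r j) f))) ≤
          ENNReal.ofReal (C * (2 : ℝ) ^ (j * θ₁) * dec (2 ^ j * r / √t) ^ θ₂ *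
              Real.exp (-(c * 4 ^ j * r ^ 2 / t))) *
            avgNorm ν p (annulus x r j) (Metric.ball x (2 ^ (j + 1) * r)) (𝔹.fn f) ∧
        avgNorm ν q (annulus x r j) (Metric.ball x (2 ^ (j + 1) * r))
            (𝔹.fn (T t (𝔹.trunc (Metric.ball x r) f))) ≤
          ENNReal.ofReal (C * (2 : ℝ) ^ (j * θ₁) * dec (2 ^ j * r / √t) ^ θ₂ *
              Real.exp (-(c * 4 ^ j * r ^ 2 / t))) *
            avgNorm ν p (Metric.ball x r) (Metric.ball x r) (𝔹.fn f)

/-- `J ⊆ [1, ∞]`, and for all `1 ≤ p < q ≤ ∞` the off-diagonal estimates `L^p(ν) - L^q(ν)` hold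
if and only if `p, q ∈ J`. -/
def CharacterizesOffDiagonal (𝔹 : FunctionSpace 𝕜 μ E) (ν : Measure X) (T : ℝ → E →L[𝕜] E)
    (J : Set ℝ≥0∞) : Prop :=
  J ⊆ Icc 1 ∞ ∧
    ∀ p q : ℝ≥0∞, 1 ≤ p → p < q → (𝔹.OffDiagonal ν T p q ↔ p ∈ J ∧ q ∈ J)

/-- The set of the exponents in `[1, ∞]` that occur in some pair `p < q` for which the
`L^p(ν) - L^q(ν)` off-diagonal estimates hold. If any set at all characterizes the off-diagonal
estimates, and these hold for one pair `p < q`, then it is this set. -/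
def offSet (𝔹 : FunctionSpace 𝕜 μ E) (ν : Measure X) (T : ℝ → E →L[𝕜] E) : Set ℝ≥0∞ :=
  {p | ∃ q, 1 ≤ p ∧ 1 ≤ q ∧
    (p < q ∧ 𝔹.OffDiagonal ν T p q ∨ q < p ∧ 𝔹.OffDiagonal ν T q p)}

/-- The set of the exponents `p ∈ [1, ∞]` such that `T_t` is bounded on `L^p(ν)` uniformly
in `t > 0`. -/
def boundedSet (𝔹 : FunctionSpace 𝕜 μ E) (ν : Measure X) (T : ℝ → E →L[𝕜] E) : Set ℝ≥0∞ :=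
  {p | 1 ≤ p ∧ ∃ C : ℝ≥0, ∀ t : ℝ, 0 < t → ∀ f : E, MemLp (𝔹.fn f) p ν →
    eLpNorm (𝔹.fn (T t f)) p ν ≤ C * eLpNorm (𝔹.fn f) p ν}

/-- `S` is a semigroup of bounded operators on `L^p(ν)` that extends `T` and is strongly
continuous at `0`. -/
structure IsC0Extension (𝔹 : FunctionSpace 𝕜 μ E) (ν : Measure X) (p : ℝ≥0∞) [Fact (1 ≤ p)]
    (T : ℝ → E →L[𝕜] E) (S : ℝ → Lp 𝕜 p ν →L[𝕜] Lp 𝕜 p ν) : Prop where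
  extends_T : ∀ t : ℝ, 0 < t → ∀ (f : E) (hf : MemLp (𝔹.fn f) p ν),
    (S t (hf.toLp (𝔹.fn f)) : X → 𝕜) =ᵐ[ν] 𝔹.fn (T t f)
  comp : ∀ s t : ℝ, 0 < s → 0 < t → S s ∘L S t = S (s + t)
  tendsto : ∀ f : Lp 𝕜 p ν, Tendsto (fun t => S t f) (𝓝[>] 0) (𝓝 f)

/-- `T` is strongly continuous on `L^p(ν)`. -/
def StronglyContinuous (𝔹 : FunctionSpace 𝕜 μ E) (ν : Measure X) (p : ℝ≥0∞) [Fact (1 ≤ p)]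
    (T : ℝ → E →L[𝕜] E) : Prop :=
  ∃ S, 𝔹.IsC0Extension ν p T S

/-- `A` is the infinitesimal generator of `S`: its domain consists of the `f` for which
`(S_t f - f) / t` converges as `t → 0⁺`, and `A f` is the limit. -/
def IsGenerator {F : Type*} [NormedAddCommGroup F] [NormedSpace 𝕜 F] (S : ℝ → F →L[𝕜] F)
    (A : F →ₗ.[𝕜] F) : Prop :=
  ∀ f g : F, (f, g) ∈ A.graph ↔
    Tendsto (fun t : ℝ => ((t⁻¹ : ℝ) : 𝕜) • (S t f - f)) (𝓝[>] 0) (𝓝 g)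

/-- `T` extends to a strongly continuous semigroup on `L^p(ν)`, with a densely defined closed
infinitesimal generator. -/
def HasGenerator (𝔹 : FunctionSpace 𝕜 μ E) (ν : Measure X) (p : ℝ≥0∞) [Fact (1 ≤ p)]
    (T : ℝ → E →L[𝕜] E) : Prop :=
  ∃ S, 𝔹.IsC0Extension ν p T S ∧ ∃ A : Lp 𝕜 p ν →ₗ.[𝕜] Lp 𝕜 p ν,
    IsGenerator S A ∧ Dense (A.domain : Set (Lp 𝕜 p ν)) ∧ A.IsClosed

end FunctionSpace

/-- The interior in `ℝ` of the finite part of a set of exponents in `[1, ∞]`. -/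
def realInterior (J : Set ℝ≥0∞) : Set ℝ :=
  interior {t : ℝ | 0 ≤ t ∧ ENNReal.ofReal t ∈ J}

end OffDiag

end

/-! Everything is reduced to one scale. By doubling, off-diagonal estimates on balls of all radii
are equivalent to a Gaussian bound for `T t` between any two balls of radius `√t`
(`OffDiagonal.scaleBound`, `ScaleBound.offDiagonal`): larger sets are cut along a `√t`-net, and the
polynomial losses in volumes and cardinalities go into the factors that the definition allows. In
this form, estimates compose by the semigroup law (`ScaleBound.comp`), and Schur's test over a net
gives uniform boundedness (`ScaleBound.mem_boundedSet`). Together with Hölder's inequality for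
averages, this handles pairs of exponents that overlap.

Pairs that do not overlap, and the comparison with uniform boundedness, need interpolation. A
uniform bound on L^r, read between balls, loses only a ratio of volumes, so it is a Gaussian bound
of rate `-ε` for every `ε > 0`. Interpolated with a bound of positive rate, it leaves a positive
rate. The interpolation splits a function along its dyadic level sets
(`eLpNorm_apply_le_of_interpolate`) and loses a little in the source exponent, which is harmless
because a pair `p < q` leaves room. This gives `OffDiagonal.exists_around`; from it,
`OffDiagonal.bridge` closes gaps by a supremum argument, and `mem_offSet_of_between` shows that the
two exponent sets differ at most by endpoints.

For the weights, the conditions A_s and RH_s are open, by a Gehring lemma. Hence for `p` in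
`weightSet` there are `a > p₀`, `Q > p` and `b < q₀` such that averages in L^p(w) control those in
L^a(μ), and averages in L^b(μ) control those in L^Q(w). The estimate from L^a(μ) to L^b(μ) thus
becomes one from L^p(w) to L^Q(w) with `p < Q` (`weightSet_subset_offSet`).

For the generator, strong continuity on one L^r(μ) is used only as local convergence in measure of
`T t g` to `g`, for `g` the indicator of a bounded set. If estimates hold for a pair with `p` as the
smaller exponent, boundedness in the larger one upgrades this to L^p convergence. If `p` is the
larger exponent, no integrability is left to spare. Then `T s g` with `s > 0` is a vector of
continuity by smoothing, and averages of `T t g` over well chosen small times converge to `g`,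
because the differences `T t g - g` are almost disjoint and their p-th powers add up
(`exists_averages`). The generator then exists by classical semigroup theory
(`IsBoundedC0.exists_generator`). -/

namespace OffDiag

set_option linter.unusedSectionVars false

/-! ### Doubling geometry: volume growth, separated nets, Gaussian sums. -/

section Geometry

variable {X : Type*} [MetricSpace X] [MeasurableSpace X]

/-- All balls have positive finite measure, with polynomial volume growth of order `D`. -/
structure HasGrowth (ν : Measure X) (D : ℕ) : Prop where
  one_le : 1 ≤ D
  pos : ∀ (x : X) (r : ℝ), 0 < r → ν (Metric.ball x r) ≠ 0
  fin : ∀ (x : X) (r : ℝ), ν (Metric.ball x r) ≠ ∞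
  growth : ∀ (x : X) (r L : ℝ), 0 < r → 1 ≤ L →
    ν (Metric.ball x (L * r)) ≤ ENNReal.ofReal ((2 * L) ^ D) * ν (Metric.ball x r)

theorem HasGrowth.growth_of_subset {ν : Measure X} {D : ℕ} (h : HasGrowth ν D) {A : Set X} {x : X}
    {r L : ℝ} (hr : 0 < r) (hL : 1 ≤ L) (hA : A ⊆ Metric.ball x (L * r)) :
    ν A ≤ ENNReal.ofReal ((2 * L) ^ D) * ν (Metric.ball x r) :=
  (measure_mono hA).trans (h.growth x r L hr hL)

theorem IsDoubling.ball_ne_top {μ : Measure X} (hμ : IsDoubling μ) (x : X) (r : ℝ) :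
    μ (Metric.ball x r) ≠ ∞ := by
  obtain ⟨C₀, hC⟩ := hμ
  rcases le_or_gt r 0 with hr | hr
  · simp [Metric.ball_eq_empty.2 hr]
  · exact (hC x r hr).2.ne

theorem IsDoubling.pow_le {μ : Measure X} {C₀ : ℝ≥0}
    (hC : ∀ (x : X) (r : ℝ), 0 < r → μ (Metric.ball x (2 * r)) ≤ C₀ * μ (Metric.ball x r))
    (x : X) {r : ℝ} (hr : 0 < r) (k : ℕ) :
    μ (Metric.ball x (2 ^ k * r)) ≤ (C₀ : ℝ≥0∞) ^ k * μ (Metric.ball x r) := by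
  induction k with
  | zero => simp
  | succ k ih =>
    calc μ (Metric.ball x (2 ^ (k + 1) * r)) = μ (Metric.ball x (2 * (2 ^ k * r))) := by
          congr 2; ring
      _ ≤ C₀ * μ (Metric.ball x (2 ^ k * r)) := hC x _ (by positivity)
      _ ≤ C₀ * ((C₀ : ℝ≥0∞) ^ k * μ (Metric.ball x r)) := by gcongr
      _ = _ := by ring

/-- Choose `k` with `L ≤ 2 ^ k ≤ 2 * L` and double `k` times: the constant `C₀ ^ k` is at most a
power of `2 * L`. The base `2 * L ≥ 2` makes a separate multiplicative constant unnecessary. -/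
theorem IsDoubling.exists_hasGrowth {μ : Measure X} (hμ : IsDoubling μ)
    (hpos : ∀ (x : X) (r : ℝ), 0 < r → μ (Metric.ball x r) ≠ 0) : ∃ D, HasGrowth μ D := by
  have hfin := hμ.ball_ne_top
  obtain ⟨C₀, hC⟩ := hμ
  obtain ⟨D, hD⟩ : ∃ D : ℕ, (C₀ : ℝ) < 2 ^ D := pow_unbounded_of_one_lt _ (by norm_num)
  refine ⟨D + 1, by omega, hpos, hfin, fun x r L hr hL => ?_⟩
  obtain ⟨k, hk1, hk2⟩ : ∃ k : ℕ, L ≤ 2 ^ k ∧ (2 : ℝ) ^ k ≤ 2 * L := by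
    obtain ⟨n, hn1, hn2⟩ := exists_nat_pow_near hL (by norm_num : (1 : ℝ) < 2)
    exact ⟨n + 1, hn2.le, by rw [pow_succ]; linarith⟩
  have h1 : (C₀ : ℝ≥0∞) ≤ ENNReal.ofReal (2 ^ (D + 1)) := by
    rw [← ENNReal.ofReal_coe_nnreal]
    exact ENNReal.ofReal_le_ofReal (hD.le.trans (pow_le_pow_right₀ (by norm_num) (by omega)))
  calc μ (Metric.ball x (L * r)) ≤ μ (Metric.ball x (2 ^ k * r)) :=
        measure_mono (Metric.ball_subset_ball (by gcongr))
    _ ≤ (C₀ : ℝ≥0∞) ^ k * μ (Metric.ball x r) := IsDoubling.pow_le (fun x r hr => (hC x r hr).1) x hr k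
    _ ≤ (ENNReal.ofReal (2 ^ (D + 1))) ^ k * μ (Metric.ball x r) := by gcongr
    _ ≤ _ := by
      gcongr
      rw [← ENNReal.ofReal_pow (by positivity)]
      refine ENNReal.ofReal_le_ofReal ?_
      rw [← pow_mul, mul_comm, pow_mul]
      gcongr

/-- If one ball were null, doubling would make all concentric balls null, and these exhaust the
space. -/
theorem IsDoubling.ball_pos {μ : Measure X} (hμ : IsDoubling μ) (h0 : μ ≠ 0) (x : X) {r : ℝ}
    (hr : 0 < r) : μ (Metric.ball x r) ≠ 0 := by
  intro h
  obtain ⟨C₀, hC⟩ := hμ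
  apply h0
  rw [← Measure.measure_univ_eq_zero, ← Metric.iUnion_ball_nat x, measure_iUnion_null_iff]
  intro n
  obtain ⟨k, hk⟩ : ∃ k : ℕ, (n : ℝ) / r < 2 ^ k := pow_unbounded_of_one_lt _ (by norm_num)
  rw [div_lt_iff₀ hr] at hk
  refine measure_mono_null (Metric.ball_subset_ball hk.le) ?_
  have := IsDoubling.pow_le (fun x r hr => (hC x r hr).1) x hr k
  rw [h, mul_zero] at this
  exact le_antisymm this bot_le

theorem HasGrowth.sigmaFinite [Nonempty X] [OpensMeasurableSpace X] {ν : Measure X} {D : ℕ}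
    (h : HasGrowth ν D) : SigmaFinite ν := by
  obtain ⟨x⟩ := ‹Nonempty X›
  refine ⟨⟨⟨fun n : ℕ => Metric.ball x n, fun n => trivial, fun n => (h.fin x n).lt_top,
    Metric.iUnion_ball_nat x⟩⟩⟩

theorem exists_maximal_separated (ρ : ℝ) :
    ∃ Z : Set X, (Z.Pairwise fun a b => ρ ≤ dist a b) ∧ ∀ x, 0 < ρ → ∃ z ∈ Z, dist x z < ρ := by
  obtain ⟨Z, hZ⟩ := zorn_subset {Z : Set X | Z.Pairwise fun a b => ρ ≤ dist a b} (by
    intro c hc hcc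
    refine ⟨⋃₀ c, ?_, fun s hs => subset_sUnion_of_mem hs⟩
    rw [mem_ofPred_eq, pairwise_sUnion hcc.directedOn]
    exact fun s hs => hc hs)
  refine ⟨Z, hZ.1, fun x hρ => ?_⟩
  by_contra! hcon
  have h1 : (insert x Z).Pairwise fun a b => ρ ≤ dist a b := by
    refine hZ.1.insert fun b hb _ => ⟨hcon b hb, ?_⟩
    rw [dist_comm]; exact hcon b hb
  have h2 : x ∈ Z := hZ.2 h1 (subset_insert x Z) (mem_insert x Z)
  have := hcon x h2
  rw [dist_self] at this
  linarith

/-- The balls of radius `ρ / 2` around the points are disjoint and of positive measure in a σ-finite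
space. -/
theorem HasGrowth.countable_of_separated [Nonempty X] [OpensMeasurableSpace X] {ν : Measure X}
    {D : ℕ} (h : HasGrowth ν D) {ρ : ℝ} (hρ : 0 < ρ) {Z : Set X}
    (hZ : Z.Pairwise fun a b => ρ ≤ dist a b) : Z.Countable := by
  have := h.sigmaFinite
  have h1 := Measure.countable_meas_pos_of_disjoint_iUnion (μ := ν)
    (As := fun z : Z => Metric.ball (z : X) (ρ / 2)) (fun _ => measurableSet_ball) (by
      intro a b hab
      refine Metric.ball_disjoint_ball ?_
      have := hZ a.2 b.2 (fun e => hab (Subtype.ext e))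
      linarith)
  have h2 : {i : Z | 0 < ν (Metric.ball (i : X) (ρ / 2))} = univ :=
    eq_univ_of_forall fun i => pos_iff_ne_zero.2 (h.pos _ _ (by linarith))
  rw [h2] at h1
  exact countable_coe_iff.1 (countable_univ_iff.1 h1)

theorem HasGrowth.secondCountable [Nonempty X] [OpensMeasurableSpace X] {ν : Measure X} {D : ℕ}
    (h : HasGrowth ν D) : SecondCountableTopology X := by
  refine Metric.secondCountable_of_almost_dense_set fun ε hε => ?_
  obtain ⟨Z, hZ, hd⟩ := exists_maximal_separated (X := X) ε
  exact ⟨Z, h.countable_of_separated hε hZ, fun x =>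
    let ⟨z, hz, hxz⟩ := hd x hε; ⟨z, hz, hxz.le⟩⟩

/-- A maximal separated set together with a subordinate measurable partition. -/
structure Net (X : Type*) [MetricSpace X] [MeasurableSpace X] (ρ : ℝ) where
  pts : Set X
  cell : X → Set X
  separated : pts.Pairwise fun a b => ρ ≤ dist a b
  measurable : ∀ z, MeasurableSet (cell z)
  subset : ∀ z, cell z ⊆ Metric.ball z ρ
  disjoint : pts.PairwiseDisjoint cell
  cover : ∀ x, ∃ z ∈ pts, x ∈ cell z

theorem HasGrowth.exists_net [Nonempty X] [OpensMeasurableSpace X] {ν : Measure X} {D : ℕ}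
    (h : HasGrowth ν D) {ρ : ℝ} (hρ : 0 < ρ) : Nonempty (Net X ρ) := by
  obtain ⟨Z, hZ, hd⟩ := exists_maximal_separated (X := X) ρ
  have hc := h.countable_of_separated hρ hZ
  obtain ⟨e, he⟩ := countable_iff_exists_injOn.1 hc
  -- The balls are made disjoint along an enumeration `e` of the net: a point belongs to the cell of
  -- the first centre within distance `ρ`.
  refine ⟨⟨Z, fun z => Metric.ball z ρ \ ⋃ z' ∈ {z' ∈ Z | e z' < e z}, Metric.ball z' ρ, hZ,
    fun z => ?_, fun z => sdiff_subset, ?_, fun x => ?_⟩⟩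
  · exact measurableSet_ball.diff (MeasurableSet.biUnion (hc.mono (sep_subset _ _))
      fun _ _ => measurableSet_ball)
  · intro a ha b hb hab
    rw [Function.onFun, Set.disjoint_left]
    rintro x ⟨hxa, hxa'⟩ ⟨hxb, hxb'⟩
    rcases lt_trichotomy (e a) (e b) with hlt | heq | hlt
    · exact hxb' (mem_biUnion (⟨ha, hlt⟩ : a ∈ {z' ∈ Z | e z' < e b}) hxa)
    · exact hab (he ha hb heq)
    · exact hxa' (mem_biUnion (⟨hb, hlt⟩ : b ∈ {z' ∈ Z | e z' < e a}) hxb)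
  · have hne : ∃ n, ∃ z ∈ Z, e z = n ∧ dist x z < ρ := by
      obtain ⟨z, hz, hxz⟩ := hd x hρ
      exact ⟨e z, z, hz, rfl, hxz⟩
    classical
    obtain ⟨z, hz, hzn, hxz⟩ := Nat.find_spec hne
    refine ⟨z, hz, hxz, ?_⟩
    simp only [mem_iUnion, not_exists]
    rintro z' ⟨hz', hlt⟩ hx
    exact Nat.find_min hne (hzn ▸ hlt) ⟨z', hz', rfl, hx⟩

/-- Packing: the half balls are disjoint and lie in `B(x, 2Lρ)`, while this ball lies in `B(z,
3Lρ)`, that is, in the half ball at `z` enlarged `6L` times. So each half ball carries at least the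
fraction `(12 * L) ^ (-D)` of the total mass. -/
theorem HasGrowth.card_le [OpensMeasurableSpace X] {ν : Measure X} {D : ℕ}
    (h : HasGrowth ν D) {ρ : ℝ} (hρ : 0 < ρ) {s : Finset X}
    (hs : (s : Set X).Pairwise fun a b => ρ ≤ dist a b) {x : X} {L : ℝ} (hL : 1 ≤ L)
    (hx : ∀ z ∈ s, dist z x < L * ρ) : (s.card : ℝ) ≤ (12 * L) ^ D := by
  have hL0 : (0 : ℝ) < L * ρ := by positivity
  set V := ν (Metric.ball x (2 * (L * ρ))) with hV
  have hV0 : V ≠ 0 := h.pos _ _ (by positivity)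
  have hVt : V ≠ ∞ := h.fin _ _
  have h1 : ∀ z ∈ s, V ≤ ENNReal.ofReal ((12 * L) ^ D) * ν (Metric.ball z (ρ / 2)) := by
    intro z hz
    have := h.growth_of_subset (A := Metric.ball x (2 * (L * ρ))) (x := z) (r := ρ / 2)
      (L := 6 * L) (by positivity) (by linarith) (Metric.ball_subset_ball' (by
        have := hx z hz
        rw [dist_comm] at this
        linarith))
    rwa [show 2 * (6 * L) = 12 * L by ring] at this
  have h2 : ∑ z ∈ s, ν (Metric.ball z (ρ / 2)) ≤ V := by
    rw [← measure_biUnion_finset _ (fun _ _ => measurableSet_ball)]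
    · refine measure_mono (iUnion₂_subset fun z hz => Metric.ball_subset_ball' ?_)
      have := hx z hz
      nlinarith
    · intro a ha b hb hab
      refine Metric.ball_disjoint_ball ?_
      have := hs ha hb hab
      linarith
  have h3 : (s.card : ℝ≥0∞) * V ≤ ENNReal.ofReal ((12 * L) ^ D) * V := by
    calc (s.card : ℝ≥0∞) * V = ∑ z ∈ s, V := by simp
      _ ≤ ∑ z ∈ s, ENNReal.ofReal ((12 * L) ^ D) * ν (Metric.ball z (ρ / 2)) :=
        Finset.sum_le_sum h1
      _ ≤ _ := by rw [← Finset.mul_sum]; gcongr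
  have h4 : (s.card : ℝ≥0∞) ≤ ENNReal.ofReal ((12 * L) ^ D) :=
    (ENNReal.mul_le_mul_iff_left hV0 hVt).1 h3
  rw [← ENNReal.ofReal_natCast] at h4
  exact (ENNReal.ofReal_le_ofReal_iff (by positivity)).1 h4

/-- Polynomials are dominated by Gaussians. -/
theorem exists_rpow_le_exp_sq (a : ℝ) {ε : ℝ} (hε : 0 < ε) :
    ∃ K : ℝ, 0 < K ∧ ∀ s : ℝ, 0 ≤ s → (1 + s) ^ a ≤ K * Real.exp (ε * s ^ 2) := by
  obtain ⟨n, hn⟩ := exists_nat_ge a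
  -- `(1+s)^n ≤ n! exp(1+s)` and `s ≤ ε s² + 1/(4ε)`
  refine ⟨n.factorial * Real.exp (1 + 1 / (4 * ε)), by positivity, fun s hs => ?_⟩
  have h1 : (1 + s) ^ a ≤ (1 + s) ^ n := by
    rw [← Real.rpow_natCast]
    exact Real.rpow_le_rpow_of_exponent_le (by linarith) hn
  have h2 : (1 + s) ^ n ≤ n.factorial * Real.exp (1 + s) := by
    have := Real.pow_div_factorial_le_exp (1 + s) (by linarith) n
    rw [div_le_iff₀ (by positivity)] at this
    linarith
  have h3 : s ≤ ε * s ^ 2 + 1 / (4 * ε) := by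
    have : 0 ≤ ε * (s - 1 / (2 * ε)) ^ 2 := by positivity
    have e : ε * (s - 1 / (2 * ε)) ^ 2 = ε * s ^ 2 - s + 1 / (4 * ε) := by
      field_simp; ring
    linarith
  calc (1 + s) ^ a ≤ n.factorial * Real.exp (1 + s) := h1.trans h2
    _ ≤ n.factorial * Real.exp ((1 + 1 / (4 * ε)) + ε * s ^ 2) :=
        mul_le_mul_of_nonneg_left (Real.exp_le_exp.2 (by linarith)) (by positivity)
    _ = _ := by rw [Real.exp_add]; ring

/-- Gaussian sums over separated sets are bounded, uniformly in the scale. -/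
theorem HasGrowth.exists_sum_exp_le [OpensMeasurableSpace X] {ν : Measure X} {D : ℕ}
    (h : HasGrowth ν D) {c : ℝ} (hc : 0 < c) :
    ∃ S : ℝ, 0 < S ∧ ∀ (ρ : ℝ), 0 < ρ → ∀ (s : Finset X),
      ((s : Set X).Pairwise fun a b => ρ ≤ dist a b) → ∀ x : X,
      ∑ z ∈ s, Real.exp (-(c * dist z x ^ 2 / ρ ^ 2)) ≤ S := by
  have hsum : Summable fun n : ℕ => (12 * ((n : ℝ) + 1)) ^ D * Real.exp (-(c * (n : ℝ) ^ 2)) := by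
    obtain ⟨K, hK, hb⟩ := exists_rpow_le_exp_sq (D + 2 : ℝ) hc
    have hs : Summable fun n : ℕ => 12 ^ D * K * (1 / ((n : ℝ) + 1) ^ 2) := by
      refine Summable.mul_left _ ?_
      have := (summable_nat_add_iff 1).2 (Real.summable_one_div_nat_pow.2 (by norm_num : 1 < 2))
      simpa using this
    refine Summable.of_nonneg_of_le (fun n => by positivity) (fun n => ?_) hs
    have h1 := hb n (by positivity)
    rw [show ((D : ℝ) + 2) = ((D + 2 : ℕ) : ℝ) by push_cast; ring, Real.rpow_natCast, pow_add] at h1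
    rw [Real.exp_neg, mul_pow, ← div_eq_mul_inv, div_le_iff₀ (by positivity)]
    have h2 : (0 : ℝ) < ((n : ℝ) + 1) ^ 2 := by positivity
    rw [mul_assoc, mul_assoc]
    refine mul_le_mul_of_nonneg_left ?_ (by positivity)
    rw [mul_left_comm, one_div, ← div_eq_inv_mul, le_div_iff₀ h2, add_comm (n : ℝ) 1]
    exact h1
  refine ⟨(∑' n : ℕ, (12 * ((n : ℝ) + 1)) ^ D * Real.exp (-(c * (n : ℝ) ^ 2))) + 1, ?_, ?_⟩
  · have : 0 ≤ ∑' n : ℕ, (12 * ((n : ℝ) + 1)) ^ D * Real.exp (-(c * (n : ℝ) ^ 2)) :=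
      tsum_nonneg fun n => by positivity
    linarith
  intro ρ hρ s hs x
  classical
  -- Grouping by the integer part of `dist z x / ρ`: the shell `n` holds at most `(12 * (n + 1)) ^
  -- D` points.
  set t : Finset ℕ := s.image fun z => ⌊dist z x / ρ⌋₊ with ht
  have h1 : ∑ z ∈ s, Real.exp (-(c * dist z x ^ 2 / ρ ^ 2)) =
      ∑ n ∈ t, ∑ z ∈ s with ⌊dist z x / ρ⌋₊ = n, Real.exp (-(c * dist z x ^ 2 / ρ ^ 2)) :=
    (Finset.sum_fiberwise_of_maps_to (fun z hz => Finset.mem_image_of_mem _ hz) _).symm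
  have h2 : ∀ n ∈ t, ∑ z ∈ s with ⌊dist z x / ρ⌋₊ = n, Real.exp (-(c * dist z x ^ 2 / ρ ^ 2)) ≤
      (12 * ((n : ℝ) + 1)) ^ D * Real.exp (-(c * (n : ℝ) ^ 2)) := by
    intro n _
    have hb : ∀ z ∈ s.filter (fun z => ⌊dist z x / ρ⌋₊ = n),
        Real.exp (-(c * dist z x ^ 2 / ρ ^ 2)) ≤ Real.exp (-(c * (n : ℝ) ^ 2)) := by
      intro z hz
      rw [Finset.mem_filter] at hz
      have : (n : ℝ) ≤ dist z x / ρ := by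
        rw [← hz.2]; exact Nat.floor_le (by positivity)
      rw [mul_div_assoc, ← div_pow]
      gcongr
    refine (Finset.sum_le_card_nsmul _ _ _ hb).trans ?_
    rw [nsmul_eq_mul]
    gcongr
    refine h.card_le hρ (hs.mono (Finset.coe_subset.2 (Finset.filter_subset _ _))) (x := x)
      (by linarith [(Nat.cast_nonneg n : (0 : ℝ) ≤ n)]) fun z hz => ?_
    rw [Finset.mem_filter] at hz
    rw [← div_lt_iff₀ hρ, ← hz.2]
    exact Nat.lt_floor_add_one _
  rw [h1]
  refine (Finset.sum_le_sum h2).trans ?_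
  have := hsum.sum_le_tsum t (fun n _ => by positivity)
  linarith

theorem Net.finite_inter_ball [OpensMeasurableSpace X] {ν : Measure X} {D : ℕ}
    (h : HasGrowth ν D) {ρ : ℝ} (hρ : 0 < ρ) (N : Net X ρ) (x : X) (R : ℝ) :
    {z ∈ N.pts | dist z x < R}.Finite := by
  by_contra hinf
  obtain ⟨n, hn⟩ := exists_nat_gt ((12 * (max 1 (R / ρ))) ^ D)
  obtain ⟨s, hs, hcard⟩ := (show {z ∈ N.pts | dist z x < R}.Infinite from hinf).exists_subset_card_eq n
  have := h.card_le hρ (s := s) (N.separated.mono fun z hz => (hs hz).1) (x := x)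
    (L := max 1 (R / ρ)) (le_max_left _ _) fun z hz => by
      have h1 := (hs hz).2
      have h2 : R / ρ * ρ ≤ max 1 (R / ρ) * ρ := by gcongr; exact le_max_right _ _
      rw [div_mul_cancel₀ _ hρ.ne'] at h2
      linarith
  rw [hcard] at this
  linarith

end Geometry

/-! ### Averaged norms. -/

section AvgNorm

variable {X : Type*} [MetricSpace X] [MeasurableSpace X] {ν : Measure X}
  {𝕜 : Type*} [RCLike 𝕜]

theorem inv_smul_restrict_ac (ν : Measure X) (A F : Set X) :
    (ν F)⁻¹ • ν.restrict A ≪ ν.restrict A := Measure.smul_absolutelyContinuous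

theorem avgNorm_congr {q : ℝ≥0∞} {A F : Set X} {g h : X → 𝕜} (hgh : g =ᵐ[ν.restrict A] h) :
    avgNorm ν q A F g = avgNorm ν q A F h :=
  eLpNorm_congr_ae ((inv_smul_restrict_ac ν A F).ae_le hgh)

theorem eLpNorm_restrict_eq_avgNorm {F : Set X} (h0 : ν F ≠ 0) (ht : ν F ≠ ∞) (q : ℝ≥0∞)
    (A : Set X) (h : X → 𝕜) :
    eLpNorm h q (ν.restrict A) = (ν F) ^ (1 / q).toReal * avgNorm ν q A F h := by
  rw [avgNorm, eLpNorm_smul_measure_of_ne_zero (ENNReal.inv_ne_zero.2 ht), smul_eq_mul,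
    ← mul_assoc, ENNReal.inv_rpow, ENNReal.mul_inv_cancel, one_mul]
  · exact (ENNReal.rpow_pos (pos_iff_ne_zero.2 h0) ht).ne'
  · exact (ENNReal.rpow_lt_top_of_nonneg ENNReal.toReal_nonneg ht).ne

theorem avgNorm_eq_mul {F : Set X} (ht : ν F ≠ ∞) (q : ℝ≥0∞) (A : Set X) (h : X → 𝕜) :
    avgNorm ν q A F h = ((ν F) ^ (1 / q).toReal)⁻¹ * eLpNorm h q (ν.restrict A) := by
  rw [avgNorm, eLpNorm_smul_measure_of_ne_zero (ENNReal.inv_ne_zero.2 ht), smul_eq_mul,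
    ENNReal.inv_rpow]

/-- Keeps the constants of volume comparisons independent of the exponent, with `q = ∞` included. -/
theorem rpow_one_div_le {L q : ℝ≥0∞} (hL : 1 ≤ L) (hq : 1 ≤ q) : L ^ (1 / q).toReal ≤ L := by
  calc L ^ (1 / q).toReal ≤ L ^ (1 : ℝ) := by
        refine ENNReal.rpow_le_rpow_of_exponent_le hL ?_
        refine ENNReal.toReal_le_of_le_ofReal zero_le_one ?_
        simpa using hq
    _ = L := ENNReal.rpow_one _

/-- Comparison of averaged norms over nested sets with comparable normalisations. -/
theorem avgNorm_le_of_subset {q : ℝ≥0∞} (hq : 1 ≤ q) {A A' F F' : Set X} (hA : A ⊆ A')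
    {L : ℝ≥0∞} (hL : 1 ≤ L) (h0 : ν F' ≠ 0) (ht : ν F ≠ ∞) (ht' : ν F' ≠ ∞)
    (hF : ν F' ≤ L * ν F) (h : X → 𝕜) :
    avgNorm ν q A F h ≤ L * avgNorm ν q A' F' h := by
  have hF0 : ν F ≠ 0 := by
    rintro h1
    rw [h1, mul_zero] at hF
    exact h0 (le_antisymm hF bot_le)
  have h1 : (ν F)⁻¹ ≤ L * (ν F')⁻¹ := by
    calc (ν F)⁻¹ = (ν F)⁻¹ * (ν F' * (ν F')⁻¹) := by
          rw [ENNReal.mul_inv_cancel h0 ht', mul_one]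
      _ ≤ (ν F)⁻¹ * (L * ν F * (ν F')⁻¹) := by gcongr
      _ = ((ν F)⁻¹ * ν F) * (L * (ν F')⁻¹) := by ring
      _ = _ := by rw [ENNReal.inv_mul_cancel hF0 ht, one_mul]
  have h2 : (ν F)⁻¹ • ν.restrict A ≤ L • ((ν F')⁻¹ • ν.restrict A') := by
    rw [smul_smul]
    refine Measure.le_iff'.2 fun s => ?_
    simp only [Measure.smul_apply, smul_eq_mul]
    exact mul_le_mul' h1 (Measure.restrict_mono hA le_rfl s)
  calc avgNorm ν q A F h ≤ eLpNorm h q (L • ((ν F')⁻¹ • ν.restrict A')) :=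
        eLpNorm_mono_measure _ h2
    _ ≤ L ^ (1 / q).toReal • eLpNorm h q ((ν F')⁻¹ • ν.restrict A') :=
        eLpNorm_smul_measure_le _ _ _ _
    _ ≤ L * avgNorm ν q A' F' h := by
        rw [smul_eq_mul, avgNorm]
        gcongr
        exact rpow_one_div_le hL hq

theorem avgNorm_mono_set {q : ℝ≥0∞} {A A' F : Set X} (hA : A ⊆ A') (h : X → 𝕜) :
    avgNorm ν q A F h ≤ avgNorm ν q A' F h := by
  refine eLpNorm_mono_measure _ ?_
  refine Measure.le_iff'.2 fun s => ?_
  simp only [Measure.smul_apply, smul_eq_mul]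
  exact mul_le_mul' le_rfl (Measure.restrict_mono hA le_rfl s)

/-- Since `A ⊆ F`, the measure `(ν F)⁻¹ • ν.restrict A` has mass at most one, so Hölder's inequality
costs no constant, on annuli as well as on balls. -/
theorem avgNorm_mono_exponent {p q : ℝ≥0∞} (hp : 1 ≤ p) (hpq : p ≤ q) {A F : Set X} (hA : A ⊆ F)
    {h : X → 𝕜} (hh : AEStronglyMeasurable h ν) :
    avgNorm ν p A F h ≤ avgNorm ν q A F h := by
  refine (eLpNorm_le_eLpNorm_mul_rpow_measure_univ hpq (hh.mono_ac
    ((inv_smul_restrict_ac ν A F).trans Measure.absolutelyContinuous_restrict))).trans ?_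
  refine mul_le_of_le_one_right' (ENNReal.rpow_le_one ?_ ?_)
  · simp only [Measure.smul_apply, smul_eq_mul, Measure.restrict_apply_univ]
    calc (ν F)⁻¹ * ν A ≤ (ν F)⁻¹ * ν F := by gcongr
      _ ≤ 1 := ENNReal.inv_mul_le_one _
  · rw [sub_nonneg]
    rcases eq_or_ne q ∞ with rfl | hq
    · simp
    · have h1 : 0 < p.toReal := ENNReal.toReal_pos (by positivity) (ne_top_of_le_ne_top hq hpq)
      exact one_div_le_one_div_of_le h1 (ENNReal.toReal_mono hq hpq)

theorem avgNorm_indicator {q : ℝ≥0∞} {A F : Set X} (hA : MeasurableSet A) (h : X → 𝕜) :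
    avgNorm ν q A F (A.indicator h) = avgNorm ν q A F h :=
  avgNorm_congr (indicator_ae_eq_restrict hA)

theorem avgNorm_ne_top {q : ℝ≥0∞} {A F : Set X} (h0 : ν F ≠ 0) {h : X → 𝕜} (hh : MemLp h q ν) :
    avgNorm ν q A F h ≠ ∞ := by
  refine ne_top_of_le_ne_top ?_ (eLpNorm_smul_measure_le _ _ _ _)
  rw [smul_eq_mul]
  exact ENNReal.mul_ne_top (ENNReal.rpow_lt_top_of_nonneg ENNReal.toReal_nonneg
    (ENNReal.inv_ne_top.2 h0)).ne (hh.restrict A).eLpNorm_ne_top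

/-- A bound on all balls around a point is a global bound. -/
theorem eLpNorm_le_of_forall_ball [OpensMeasurableSpace X] {q : ℝ≥0∞} {h : X → 𝕜}
    (hh : AEStronglyMeasurable h ν) (B : Set X) (x : X) {M : ℝ≥0∞}
    (hM : ∀ n : ℕ, eLpNorm h q (ν.restrict (Metric.ball x n ∩ B)) ≤ M) :
    eLpNorm h q (ν.restrict B) ≤ M := by
  have h1 : ∀ n : ℕ, eLpNorm ((Metric.ball x n).indicator h) q (ν.restrict B) ≤ M := by
    intro n
    rw [eLpNorm_indicator_eq_eLpNorm_restrict measurableSet_ball,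
      Measure.restrict_restrict measurableSet_ball]
    exact hM n
  refine (Lp.eLpNorm_lim_le_liminf_eLpNorm (fun n : ℕ => (hh.restrict).indicator
    (measurableSet_ball (x := x) (ε := (n : ℝ)))) h ?_).trans ?_
  · refine Eventually.of_forall fun y => ?_
    refine tendsto_const_nhds.congr' ?_
    obtain ⟨n, hn⟩ := exists_nat_gt (dist y x)
    filter_upwards [eventually_ge_atTop n] with m hm
    rw [indicator_of_mem]
    exact hn.trans_le (by exact_mod_cast hm)
  · exact liminf_le_of_frequently_le' (Frequently.of_forall h1)

end AvgNorm

/-! ### Supports and truncations in the function space; bounds between balls. -/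

namespace FunctionSpace

variable {X : Type*} [MetricSpace X] [MeasurableSpace X]
  {𝕜 : Type*} [RCLike 𝕜] {μ : Measure X} {E : Type*}
  [NormedAddCommGroup E] [NormedSpace 𝕜 E] (𝔹 : FunctionSpace 𝕜 μ E)

theorem ext_ae {f g : E} (h : (𝔹.fn f : X → 𝕜) =ᵐ[μ] 𝔹.fn g) : f = g :=
  𝔹.injective_fn (AEEqFun.ext h)

theorem aesm (f : E) {m : Measure X} (hm : m ≪ μ) : AEStronglyMeasurable (𝔹.fn f : X → 𝕜) m :=
  (𝔹.fn f).aestronglyMeasurable.mono_ac hm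

theorem fn_add (f g : E) : (𝔹.fn (f + g) : X → 𝕜) =ᵐ[μ] ⇑(𝔹.fn f) + ⇑(𝔹.fn g) := by
  rw [map_add]; exact AEEqFun.coeFn_add _ _

theorem fn_sub (f g : E) : (𝔹.fn (f - g) : X → 𝕜) =ᵐ[μ] ⇑(𝔹.fn f) - ⇑(𝔹.fn g) := by
  rw [map_sub]; exact AEEqFun.coeFn_sub _ _

theorem fn_smul (c : 𝕜) (f : E) : (𝔹.fn (c • f) : X → 𝕜) =ᵐ[μ] c • ⇑(𝔹.fn f) := by
  rw [map_smul]; exact AEEqFun.coeFn_smul _ _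

theorem fn_zero : (𝔹.fn (0 : E) : X → 𝕜) =ᵐ[μ] 0 := by
  rw [map_zero]; exact AEEqFun.coeFn_zero

/-- `f` vanishes outside `A`. -/
def Supp (f : E) (A : Set X) : Prop := (𝔹.fn f : X → 𝕜) =ᵐ[μ] A.indicator (𝔹.fn f)

theorem supp_trunc {A B : Set X} (hA : MeasurableSet A) (hAB : A ⊆ B) (f : E) :
    𝔹.Supp (𝔹.trunc A f) B := by
  have h := 𝔹.fn_trunc hA f
  filter_upwards [h] with x hx
  by_cases hB : x ∈ B
  · rw [indicator_of_mem hB]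
  · rw [indicator_of_notMem hB, hx, indicator_of_notMem (fun h => hB (hAB h))]

theorem Supp.mono {f : E} {A B : Set X} (h : 𝔹.Supp f A) (hAB : A ⊆ B) : 𝔹.Supp f B := by
  filter_upwards [h] with x hx
  by_cases hB : x ∈ B
  · rw [indicator_of_mem hB]
  · rw [indicator_of_notMem hB, hx, indicator_of_notMem (fun h => hB (hAB h))]

theorem trunc_eq_of_supp {f : E} {A : Set X} (hA : MeasurableSet A) (h : 𝔹.Supp f A) :
    𝔹.trunc A f = f :=
  𝔹.ext_ae ((𝔹.fn_trunc hA f).trans h.symm)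

theorem trunc_trunc {A B : Set X} (hA : MeasurableSet A) (hB : MeasurableSet B) (f : E) :
    𝔹.trunc A (𝔹.trunc B f) = 𝔹.trunc (A ∩ B) f := by
  refine 𝔹.ext_ae ?_
  filter_upwards [𝔹.fn_trunc hA (𝔹.trunc B f), 𝔹.fn_trunc hB f, 𝔹.fn_trunc (hA.inter hB) f]
    with x h1 h2 h3
  rw [h1, h3, ← indicator_indicator]
  by_cases hx : x ∈ A
  · rw [indicator_of_mem hx, indicator_of_mem hx, h2]
  · rw [indicator_of_notMem hx, indicator_of_notMem hx]

theorem trunc_union {A B : Set X} (hA : MeasurableSet A) (hB : MeasurableSet B)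
    (hAB : Disjoint A B) (f : E) :
    𝔹.trunc (A ∪ B) f = 𝔹.trunc A f + 𝔹.trunc B f := by
  refine 𝔹.ext_ae ?_
  filter_upwards [𝔹.fn_trunc hA f, 𝔹.fn_trunc hB f, 𝔹.fn_trunc (hA.union hB) f,
    𝔹.fn_add (𝔹.trunc A f) (𝔹.trunc B f)] with x h1 h2 h3 h4
  rw [h3, h4, Pi.add_apply, h1, h2, indicator_union_of_disjoint hAB]

theorem trunc_empty (f : E) : 𝔹.trunc ∅ f = 0 := by
  refine 𝔹.ext_ae ?_
  filter_upwards [𝔹.fn_trunc MeasurableSet.empty f, 𝔹.fn_zero] with x h1 h2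
  rw [h1, h2, indicator_empty]; rfl

theorem trunc_biUnion {ι : Type*} (s : Finset ι) (A : ι → Set X) (hA : ∀ i, MeasurableSet (A i))
    (hd : (s : Set ι).PairwiseDisjoint A) (f : E) :
    𝔹.trunc (⋃ i ∈ s, A i) f = ∑ i ∈ s, 𝔹.trunc (A i) f := by
  classical
  induction s using Finset.induction_on with
  | empty => simp [trunc_empty]
  | insert a s ha ih =>
    rw [Finset.set_biUnion_insert, Finset.sum_insert ha, ← ih (hd.subset (by simp))]
    refine 𝔹.trunc_union (hA a) (Finset.measurableSet_biUnion _ fun i _ => hA i) ?_ f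
    refine disjoint_iUnion₂_right.2 fun i hi => ?_
    exact hd (by simp) (by simp [hi]) (fun e => ha (e ▸ hi))

theorem eLpNorm_fn_sum_le {ι : Type*} (s : Finset ι) (g : ι → E) {m : Measure X} (hm : m ≪ μ)
    {q : ℝ≥0∞} (hq : 1 ≤ q) :
    eLpNorm (𝔹.fn (∑ i ∈ s, g i) : X → 𝕜) q m ≤ ∑ i ∈ s, eLpNorm (𝔹.fn (g i) : X → 𝕜) q m := by
  classical
  induction s using Finset.induction_on with
  | empty =>
    rw [Finset.sum_empty, Finset.sum_empty, eLpNorm_congr_ae (hm.ae_le 𝔹.fn_zero), eLpNorm_zero]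
  | insert a s ha ih =>
    rw [Finset.sum_insert ha, Finset.sum_insert ha,
      eLpNorm_congr_ae (hm.ae_le (𝔹.fn_add (g a) _))]
    exact (eLpNorm_add_le (𝔹.aesm _ hm) (𝔹.aesm _ hm) hq).trans (by gcongr)

theorem eLpNorm_fn_add_le (f g : E) {m : Measure X} (hm : m ≪ μ) {q : ℝ≥0∞} (hq : 1 ≤ q) :
    eLpNorm (𝔹.fn (f + g) : X → 𝕜) q m ≤
      eLpNorm (𝔹.fn f : X → 𝕜) q m + eLpNorm (𝔹.fn g : X → 𝕜) q m := by
  rw [eLpNorm_congr_ae (hm.ae_le (𝔹.fn_add f g))]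
  exact eLpNorm_add_le (𝔹.aesm _ hm) (𝔹.aesm _ hm) hq

variable {ν : Measure X}

theorem eLpNorm_trunc (hν : ν ≪ μ) {A : Set X} (hA : MeasurableSet A) (f : E) (p : ℝ≥0∞) :
    eLpNorm (𝔹.fn (𝔹.trunc A f) : X → 𝕜) p ν = eLpNorm (𝔹.fn f : X → 𝕜) p (ν.restrict A) := by
  rw [eLpNorm_congr_ae (hν.ae_le (𝔹.fn_trunc hA f)), eLpNorm_indicator_eq_eLpNorm_restrict hA]

theorem avgNorm_trunc (hν : ν ≪ μ) {A : Set X} (hA : MeasurableSet A) (f : E) (p : ℝ≥0∞)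
    (F : Set X) : avgNorm ν p A F (𝔹.fn (𝔹.trunc A f) : X → 𝕜) = avgNorm ν p A F (𝔹.fn f) := by
  rw [avgNorm_congr (Measure.absolutelyContinuous_restrict.ae_le (hν.ae_le (𝔹.fn_trunc hA f))),
    avgNorm_indicator hA]

theorem memLp_trunc (hν : ν ≪ μ) {A : Set X} (hA : MeasurableSet A) {f : E} {p : ℝ≥0∞}
    (hf : MemLp (𝔹.fn f : X → 𝕜) p (ν.restrict A)) : MemLp (𝔹.fn (𝔹.trunc A f) : X → 𝕜) p ν :=
  ⟨𝔹.aesm _ hν, by rw [𝔹.eLpNorm_trunc hν hA]; exact hf.2⟩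

theorem eLpNorm_of_supp (hν : ν ≪ μ) {A : Set X} (hA : MeasurableSet A) {f : E}
    (hf : 𝔹.Supp f A) (p : ℝ≥0∞) :
    eLpNorm (𝔹.fn f : X → 𝕜) p (ν.restrict A) = eLpNorm (𝔹.fn f : X → 𝕜) p ν := by
  rw [← 𝔹.eLpNorm_trunc hν hA, 𝔹.trunc_eq_of_supp hA hf]

theorem memLp_of_supp (hν : ν ≪ μ) {A : Set X} (hA : MeasurableSet A) (hfin : ν A ≠ ∞) {f : E}
    (hf : 𝔹.Supp f A) {p q : ℝ≥0∞} (hpq : p ≤ q) (hq : MemLp (𝔹.fn f : X → 𝕜) q ν) :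
    MemLp (𝔹.fn f : X → 𝕜) p ν := by
  have : IsFiniteMeasure (ν.restrict A) := ⟨by simpa using hfin.lt_top⟩
  refine ⟨𝔹.aesm _ hν, ?_⟩
  rw [← 𝔹.eLpNorm_of_supp hν hA hf]
  exact ((hq.restrict A).mono_exponent hpq).2

/-- Fatou: bounds for the truncations pass to the limit. -/
theorem eLpNorm_apply_le_of_trunc {T : ℝ → E →L[𝕜] E} (hTtr : 𝔹.TruncationContinuous T) {t : ℝ}
    (ht : 0 < t) (f : E) {x : X} {ρ : ℝ} (hρ : 0 < ρ) {m : Measure X}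
    (hm : m ≪ μ.restrict (Metric.ball x ρ)) {q M : ℝ≥0∞}
    (hM : ∀ R : ℝ, 0 < R →
      eLpNorm (𝔹.fn (T t (𝔹.trunc (Metric.ball x R) f)) : X → 𝕜) q m ≤ M) :
    eLpNorm (𝔹.fn (T t f) : X → 𝕜) q m ≤ M := by
  obtain ⟨ns, hns, hlim⟩ := (hTtr t ht f x ρ hρ).exists_seq_tendsto_ae'
  have hmμ : m ≪ μ := hm.trans Measure.absolutelyContinuous_restrict
  refine (Lp.eLpNorm_lim_le_liminf_eLpNorm (fun n => 𝔹.aesm _ hmμ) _ (hm.ae_le hlim)).trans ?_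
  refine liminf_le_of_frequently_le' (Eventually.frequently ?_)
  filter_upwards [hns.eventually_gt_atTop 0] with n hn using hM _ hn

/-- Bound for a single operator from `L^p` on one ball to `L^q` on another one. -/
def LocalBound (ν : Measure X) (T : E →L[𝕜] E) (p q : ℝ≥0∞) (x y : X) (ρ : ℝ) (M : ℝ≥0∞) : Prop :=
  ∀ g : E, MemLp (𝔹.fn g : X → 𝕜) p ν → 𝔹.Supp g (Metric.ball x ρ) →
    avgNorm ν q (Metric.ball y ρ) (Metric.ball y ρ) (𝔹.fn (T g) : X → 𝕜) ≤
      M * avgNorm ν p (Metric.ball x ρ) (Metric.ball x ρ) (𝔹.fn g : X → 𝕜)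

/-- Gaussian estimates between the balls of radius `√(κ t)`. -/
def ScaleBound (ν : Measure X) (T : ℝ → E →L[𝕜] E) (κ : ℝ) (p q : ℝ≥0∞) : Prop :=
  ∃ c C : ℝ, 0 < c ∧ 0 < C ∧ ∀ t : ℝ, 0 < t → ∀ x y : X,
    𝔹.LocalBound ν (T t) p q x y (√(κ * t))
      (ENNReal.ofReal (C * Real.exp (-(c * dist x y ^ 2 / t))))

end FunctionSpace

theorem dec_of_one_le {u : ℝ} (hu : 1 ≤ u) : dec u = u :=
  max_eq_left ((inv_le_one_of_one_le₀ hu).trans hu)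

theorem one_le_dec {u : ℝ} (hu : 0 < u) : 1 ≤ dec u := by
  rcases le_total 1 u with h | h
  · exact h.trans (le_max_left _ _)
  · exact (one_le_inv₀ hu |>.2 h).trans (le_max_right _ _)

theorem dec_two_mul_le {u : ℝ} (hu : 0 < u) : dec (2 * u) ≤ 2 * dec u := by
  refine max_le ?_ ?_
  · have := le_max_left u u⁻¹
    unfold dec; linarith
  · have h1 := le_max_right u u⁻¹
    have h2 : (0 : ℝ) < u⁻¹ := by positivity
    rw [mul_inv]
    unfold dec; linarith

/-- With `s` the distance of the centres over the radius (and `k = √κ` in the application), the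
volume ratio, the factor `2 ^ (i * θ₁)` and the factor from `dec` are all powers of `20 * k * (1 +
s)`. As `4 ^ i ≥ s ^ 2 / 8`, the Gaussian gives the rate `c / 8`, and half of it absorbs the power
of `1 + s`. -/
theorem gaussian_annulus_le {D i : ℕ} {θ₁ θ₂ c C k κ s K : ℝ} (hθ₁ : 0 < θ₁) (hθ₂ : 0 < θ₂)
    (hc : 0 < c) (hC : 0 < C) (hk1 : 1 ≤ k) (hκ : 1 ≤ κ) (hs8 : 8 ≤ s) (hi2 : (2 : ℝ) ^ i ≤ 2 * s)
    (hj2 : s ≤ 16 / 7 * 2 ^ i) (hK : 0 < K)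
    (hKb : (1 + s) ^ ((D : ℝ) + θ₁ + θ₂) ≤ K * Real.exp (c / 16 * s ^ 2)) :
    (2 * (5 * s)) ^ D * (C * 2 ^ (i * θ₁) * (2 ^ i * k) ^ θ₂ * Real.exp (-(c * 4 ^ i * κ))) ≤
      C * (20 * k) ^ ((D : ℝ) + θ₁ + θ₂) * K * Real.exp (-(c / 16 * (s ^ 2 * κ))) := by
  have hsk : 0 ≤ s * (k - 1) := mul_nonneg (by linarith) (by linarith)
  have hik := mul_le_mul_of_nonneg_right hi2 (show 0 ≤ k by linarith)
  have hs0 : 0 < s := by linarith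
  have hk0 : 0 < k := by linarith
  have hsq : s ^ 2 ≤ s ^ 2 * κ := le_mul_of_one_le_right (by positivity) hκ
  have e1 : (2 * (5 * s)) ^ D ≤ (20 * k * (1 + s)) ^ (D : ℝ) := by
    rw [← Real.rpow_natCast]
    exact Real.rpow_le_rpow (by positivity) (by linarith) (by positivity)
  have e2 : (2 : ℝ) ^ (i * θ₁) ≤ (20 * k * (1 + s)) ^ θ₁ := by
    rw [Real.rpow_mul (by norm_num), Real.rpow_natCast]
    exact Real.rpow_le_rpow (by positivity) (by linarith) (by positivity)
  have e3 : (2 ^ i * k) ^ θ₂ ≤ (20 * k * (1 + s)) ^ θ₂ :=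
    Real.rpow_le_rpow (by positivity) (by linarith) (by positivity)
  have e4 : Real.exp (-(c * 4 ^ i * κ)) ≤ Real.exp (-(c / 8 * (s ^ 2 * κ))) := by
    rw [Real.exp_le_exp, neg_le_neg_iff]
    have h4 : (4 : ℝ) ^ i = (2 ^ i) ^ 2 := by
      rw [← pow_mul, mul_comm, pow_mul]; norm_num
    have h5 : s ^ 2 ≤ (16 / 7 * 2 ^ i) ^ 2 := by gcongr
    have : s ^ 2 / 8 ≤ 4 ^ i := by
      rw [h4]
      nlinarith [sq_nonneg ((2 : ℝ) ^ i)]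
    have hcκ : 0 < c * κ := by positivity
    calc c / 8 * (s ^ 2 * κ) = c * κ * (s ^ 2 / 8) := by ring
      _ ≤ c * κ * 4 ^ i := by gcongr
      _ = _ := by ring
  have e5 : (1 + s) ^ ((D : ℝ) + θ₁ + θ₂) ≤ K * Real.exp (c / 16 * (s ^ 2 * κ)) :=
    hKb.trans (by gcongr)
  calc _ ≤ (20 * k * (1 + s)) ^ (D : ℝ) * (C * (20 * k * (1 + s)) ^ θ₁ *
          (20 * k * (1 + s)) ^ θ₂ * Real.exp (-(c / 8 * (s ^ 2 * κ)))) := by gcongr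
    _ = C * (20 * k) ^ ((D : ℝ) + θ₁ + θ₂) * (1 + s) ^ ((D : ℝ) + θ₁ + θ₂) *
          Real.exp (-(c / 8 * (s ^ 2 * κ))) := by
        simp only [Real.mul_rpow (show 0 ≤ 20 * k by positivity) (show 0 ≤ 1 + s by positivity),
          Real.rpow_add (show 0 < 20 * k by positivity), Real.rpow_add (show 0 < 1 + s by positivity)]
        ring
    _ ≤ C * (20 * k) ^ ((D : ℝ) + θ₁ + θ₂) * (K * Real.exp (c / 16 * (s ^ 2 * κ))) *
          Real.exp (-(c / 8 * (s ^ 2 * κ))) := by gcongr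
    _ = C * (20 * k) ^ ((D : ℝ) + θ₁ + θ₂) * K * (Real.exp (c / 16 * (s ^ 2 * κ)) *
          Real.exp (-(c / 8 * (s ^ 2 * κ)))) := by ring
    _ = _ := by
        rw [← Real.exp_add]
        congr 2
        ring

section AvgNorm

variable {X : Type*} [MetricSpace X] [MeasurableSpace X] {ν : Measure X}
  {𝕜 : Type*} [RCLike 𝕜]

theorem eLpNorm_restrict_le_sum {m : Measure X} {q : ℝ≥0∞} (hq : 1 ≤ q) {ι : Type*}
    (s : Finset ι) (A : Set X) (c : ι → Set X) (hc : ∀ i, MeasurableSet (c i))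
    (hA : A ⊆ ⋃ i ∈ s, c i) {h : X → 𝕜} (hh : AEStronglyMeasurable h m) :
    eLpNorm h q (m.restrict A) ≤ ∑ i ∈ s, eLpNorm h q (m.restrict (c i ∩ A)) := by
  have h1 : ∀ i, eLpNorm h q (m.restrict (c i ∩ A)) =
      eLpNorm ((c i).indicator fun x => ‖h x‖) q (m.restrict A) := by
    intro i
    rw [eLpNorm_indicator_eq_eLpNorm_restrict (hc i), Measure.restrict_restrict (hc i),
      eLpNorm_norm]
  simp_rw [h1]
  refine le_trans ?_ (eLpNorm_sum_le (fun i _ => (hh.norm.restrict).indicator (hc i)) hq)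
  have hAae : ∀ᵐ x ∂m.restrict A, x ∈ ⋃ i ∈ s, c i := by
    refine (ae_restrict_iff' ?_).2 ?_ |> fun h => ae_restrict_of_ae_restrict_of_subset hA h
    · exact Finset.measurableSet_biUnion _ fun i _ => hc i
    · exact Eventually.of_forall fun x hx => hx
  refine eLpNorm_mono_ae ?_
  filter_upwards [hAae] with x hx
  simp only [mem_iUnion] at hx
  obtain ⟨i, hi, hxi⟩ := hx
  have hnn : ∀ j, 0 ≤ (c j).indicator (fun x => ‖h x‖) x :=
    fun j => Set.indicator_nonneg (fun a _ => norm_nonneg (h a)) x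
  rw [Finset.sum_apply, Real.norm_of_nonneg (Finset.sum_nonneg fun j _ => hnn j)]
  refine le_trans (le_of_eq ?_) (Finset.single_le_sum (f := fun j => (c j).indicator
    (fun x => ‖h x‖) x) (fun j _ => hnn j) hi)
  exact (indicator_of_mem hxi fun x => ‖h x‖).symm

theorem avgNorm_le_sum {q : ℝ≥0∞} (hq : 1 ≤ q) {ι : Type*}
    (s : Finset ι) (A F : Set X) (c : ι → Set X) (hc : ∀ i, MeasurableSet (c i))
    (hA : A ⊆ ⋃ i ∈ s, c i) {h : X → 𝕜} (hh : AEStronglyMeasurable h ν) :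
    avgNorm ν q A F h ≤ ∑ i ∈ s, avgNorm ν q (c i ∩ A) F h := by
  have := eLpNorm_restrict_le_sum (m := (ν F)⁻¹ • ν) hq s A c hc hA
    (hh.mono_ac Measure.smul_absolutelyContinuous)
  simp only [Measure.restrict_smul] at this
  exact this

theorem avgNorm_of_ae_indicator {q : ℝ≥0∞} {A B F : Set X} (hA : MeasurableSet A) (hAB : A ⊆ B)
    {g : X → 𝕜} (hg : g =ᵐ[ν] A.indicator g) : avgNorm ν q B F g = avgNorm ν q A F g := by
  rw [avgNorm_congr (Measure.absolutelyContinuous_restrict.ae_le hg)]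
  have := eLpNorm_indicator_eq_eLpNorm_restrict (f := g) (p := q)
    (μ := (ν F)⁻¹ • ν.restrict B) hA
  rw [Measure.restrict_smul, Measure.restrict_restrict hA, inter_eq_left.2 hAB] at this
  exact this

end AvgNorm

/-! ### Off-diagonal estimates and Gaussian bounds between balls of radius √t. -/

namespace FunctionSpace

variable {X : Type*} [MetricSpace X] [MeasurableSpace X] [OpensMeasurableSpace X]
  {𝕜 : Type*} [RCLike 𝕜] {μ : Measure X} {E : Type*}
  [NormedAddCommGroup E] [NormedSpace 𝕜 E] (𝔹 : FunctionSpace 𝕜 μ E)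
  {ν : Measure X} {D : ℕ} {T : ℝ → E →L[𝕜] E} {p q : ℝ≥0∞}

theorem measurableSet_annulus (x : X) (r : ℝ) (j : ℕ) : MeasurableSet (annulus x r j) :=
  measurableSet_ball.diff measurableSet_ball

/-- With `s = dist x y / ρ`, the distances from `x` to points of the ball lie between `(s - 1) * ρ`
and `(s + 1) * ρ`. Taking `2 ^ j ≤ s - 1 < 2 ^ (j + 1)`, two consecutive annuli suffice. The factor
`16 / 7` is twice `8 / 7`, which bounds `s / (s - 1)` for `s ≥ 8`. -/
theorem ball_subset_annuli {x y : X} {ρ : ℝ} (hρ : 0 < ρ) (hd : 8 * ρ ≤ dist x y) :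
    ∃ j : ℕ, 2 ≤ j ∧ Metric.ball y ρ ⊆ annulus x ρ j ∪ annulus x ρ (j + 1) ∧
      (2 : ℝ) ^ j ≤ dist x y / ρ ∧ dist x y / ρ ≤ (16 / 7) * 2 ^ j := by
  set s := dist x y / ρ with hs
  have hs8 : 8 ≤ s := (le_div_iff₀ hρ).2 hd
  have hds : dist x y = s * ρ := by rw [hs, div_mul_cancel₀ _ hρ.ne']
  obtain ⟨j, hj1, hj2⟩ := exists_nat_pow_near (by linarith : 1 ≤ s - 1) (by norm_num : (1 : ℝ) < 2)
  rw [pow_succ] at hj2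
  have hj : 2 ≤ j := by
    by_contra hcon
    have : j ≤ 1 := by omega
    have h2 : (2 : ℝ) ^ j ≤ 2 ^ 1 := pow_le_pow_right₀ (by norm_num) this
    linarith
  refine ⟨j, hj, fun z hz => ?_, by linarith, by linarith⟩
  rw [Metric.mem_ball] at hz
  have h1 : dist x y ≤ dist z x + dist z y := by
    rw [dist_comm z x]; exact dist_triangle x z y
  have h2 : dist z x ≤ dist z y + dist x y := by
    rw [dist_comm x y]; exact dist_triangle z y x
  have h3 : 2 ^ j * ρ ≤ (s - 1) * ρ := by gcongr
  have h4 : (s - 1) * ρ < 2 ^ j * 2 * ρ := by gcongr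
  have h5 : (4 : ℝ) ≤ 2 ^ j := by
    calc (4 : ℝ) = 2 ^ 2 := by norm_num
      _ ≤ 2 ^ j := pow_le_pow_right₀ (by norm_num) hj
  have h6 : 4 * ρ ≤ 2 ^ j * ρ := by gcongr
  by_cases hc : dist z x < 2 ^ (j + 1) * ρ
  · left
    refine ⟨hc, ?_⟩
    rw [Metric.mem_ball, not_lt]
    nlinarith
  · right
    refine ⟨?_, hc⟩
    rw [Metric.mem_ball, pow_succ, pow_succ]
    nlinarith

/-- Off-diagonal estimates give Gaussian bounds between balls of radius `√(κ t)`. -/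
theorem OffDiagonal.scaleBound (hν : ν ≪ μ) (hD : HasGrowth ν D) (hp : 1 ≤ p) (hq : 1 ≤ q)
    (h : 𝔹.OffDiagonal ν T p q) {κ : ℝ} (hκ : 1 ≤ κ) : 𝔹.ScaleBound ν T κ p q := by
  obtain ⟨θ₁, θ₂, c, C, hθ₁, hθ₂, hc, hC, h⟩ := h
  set k := √κ with hk
  have hk1 : 1 ≤ k := Real.one_le_sqrt.2 hκ
  have hk2 : k ^ 2 = κ := Real.sq_sqrt (by linarith)
  obtain ⟨K, hK, hKb⟩ := exists_rpow_le_exp_sq ((D : ℝ) + θ₁ + θ₂) (ε := c / 16) (by positivity)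
  set C₁ : ℝ := 34 ^ D * (C * (9 * k) ^ θ₂) * Real.exp (c / 16 * (64 * κ)) with hC₁
  set C₂ : ℝ := 2 * (C * (20 * k) ^ ((D : ℝ) + θ₁ + θ₂) * K) with hC₂
  have hC₁0 : 0 < C₁ := by positivity
  have hC₂0 : 0 < C₂ := by positivity
  refine ⟨c / 16, C₁ + C₂, by positivity, by positivity, fun t ht x y g hg hgs => ?_⟩
  set ρ := √(κ * t) with hρd
  have hst : 0 < √t := Real.sqrt_pos.2 ht
  have hρk : ρ = k * √t := Real.sqrt_mul (by linarith) t
  have hρ : 0 < ρ := by rw [hρk]; positivity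
  have hρt : ρ / √t = k := by rw [hρk]; field_simp
  have hρ2 : ρ ^ 2 = κ * t := Real.sq_sqrt (by positivity)
  set N := avgNorm ν p (Metric.ball x ρ) (Metric.ball x ρ) (𝔹.fn g : X → 𝕜) with hN
  set d := dist x y with hd
  have hd0 : 0 ≤ d := dist_nonneg
  have hgν : (𝔹.fn g : X → 𝕜) =ᵐ[ν] (Metric.ball x ρ).indicator (𝔹.fn g) := hν.ae_le hgs
  -- Near case: both balls lie in `B(x, 9ρ)`, where the estimate on a single ball applies. The
  -- Gaussian factor is bounded below there, and `C₁` pays for it. Far case: the second ball meets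
  -- at most two annuli around the first, with `2 ^ j` comparable to `d / ρ`.
  rcases lt_or_ge d (8 * ρ) with hlt | hge
  · have h1 := (h t ht x (9 * ρ) (by positivity) g hg).1
    rw [𝔹.trunc_eq_of_supp measurableSet_ball (Supp.mono 𝔹 hgs (Metric.ball_subset_ball
      (by linarith)))] at h1
    have h2 : avgNorm ν p (Metric.ball x (9 * ρ)) (Metric.ball x (9 * ρ)) (𝔹.fn g : X → 𝕜) ≤ N := by
      rw [avgNorm_of_ae_indicator measurableSet_ball (Metric.ball_subset_ball (by linarith)) hgν]
      have := avgNorm_le_of_subset (ν := ν) hp (A := Metric.ball x ρ) (A' := Metric.ball x ρ)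
        (F := Metric.ball x (9 * ρ)) (F' := Metric.ball x ρ) Subset.rfl le_rfl
        (hD.pos x _ hρ) (hD.fin _ _) (hD.fin _ _)
        (by rw [one_mul]; exact measure_mono (Metric.ball_subset_ball (by linarith)))
        (𝔹.fn g : X → 𝕜)
      rwa [one_mul] at this
    have h3 : avgNorm ν q (Metric.ball y ρ) (Metric.ball y ρ) (𝔹.fn (T t g) : X → 𝕜) ≤
        ENNReal.ofReal (34 ^ D) *
          avgNorm ν q (Metric.ball x (9 * ρ)) (Metric.ball x (9 * ρ)) (𝔹.fn (T t g) : X → 𝕜) := by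
      refine avgNorm_le_of_subset hq (Metric.ball_subset_ball' ?_) ?_ (hD.pos _ _ (by positivity))
        (hD.fin _ _) (hD.fin _ _) ?_ _
      · rw [dist_comm]; linarith
      · rw [ENNReal.one_le_ofReal]; exact one_le_pow₀ (by norm_num)
      · have := hD.growth_of_subset (A := Metric.ball x (9 * ρ)) (x := y) (r := ρ) (L := 17) hρ
          (by norm_num) (Metric.ball_subset_ball' (by linarith))
        norm_num at this ⊢
        exact this
    have hdec : dec (9 * ρ / √t) = 9 * k := by
      rw [mul_div_assoc, hρt, dec_of_one_le (by linarith)]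
    rw [hdec] at h1
    calc _ ≤ ENNReal.ofReal (34 ^ D) * (ENNReal.ofReal (C * (9 * k) ^ θ₂) * N) :=
          h3.trans (by gcongr; exact h1.trans (by gcongr))
      _ = ENNReal.ofReal (34 ^ D * (C * (9 * k) ^ θ₂)) * N := by
          rw [← mul_assoc, ← ENNReal.ofReal_mul (by positivity)]
      _ ≤ _ := by
          refine mul_le_mul_left (ENNReal.ofReal_le_ofReal ?_) _
          have e1 : c / 16 * d ^ 2 / t ≤ c / 16 * (64 * κ) := by
            rw [div_le_iff₀ ht]
            have : d ^ 2 ≤ 64 * (κ * t) := by rw [← hρ2]; nlinarith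
            nlinarith
          have e2 : 1 ≤ Real.exp (c / 16 * (64 * κ)) * Real.exp (-(c / 16 * d ^ 2 / t)) := by
            rw [← Real.exp_add]; exact Real.one_le_exp (by linarith)
          calc 34 ^ D * (C * (9 * k) ^ θ₂)
              ≤ 34 ^ D * (C * (9 * k) ^ θ₂) *
                (Real.exp (c / 16 * (64 * κ)) * Real.exp (-(c / 16 * d ^ 2 / t))) :=
                le_mul_of_one_le_right (by positivity) e2
            _ = C₁ * Real.exp (-(c / 16 * d ^ 2 / t)) := by rw [hC₁]; ring
            _ ≤ _ := mul_le_mul_of_nonneg_right (by linarith) (Real.exp_pos _).le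
  · obtain ⟨j, hj, hsub, hj1, hj2⟩ := ball_subset_annuli hρ hge
    set s := d / ρ with hs
    have hs8 : 8 ≤ s := (le_div_iff₀ hρ).2 hge
    have hds : d = s * ρ := by rw [hs, div_mul_cancel₀ _ hρ.ne']
    have hdt : d ^ 2 / t = s ^ 2 * κ := by
      rw [hds, mul_pow, hρ2]; field_simp
    -- one annulus
    have key : ∀ i ∈ ({j, j + 1} : Finset ℕ),
        avgNorm ν q (annulus x ρ i ∩ Metric.ball y ρ) (Metric.ball y ρ) (𝔹.fn (T t g) : X → 𝕜) ≤
          ENNReal.ofReal (C * (20 * k) ^ ((D : ℝ) + θ₁ + θ₂) * K *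
            Real.exp (-(c / 16 * d ^ 2 / t))) * N := by
      intro i hi
      have hij : j ≤ i ∧ i ≤ j + 1 := by
        simp only [Finset.mem_insert, Finset.mem_singleton] at hi; omega
      have hi2 : (2 : ℝ) ^ i ≤ 2 * s := by
        calc (2 : ℝ) ^ i ≤ 2 ^ (j + 1) := pow_le_pow_right₀ (by norm_num) hij.2
          _ ≤ 2 * s := by rw [pow_succ]; linarith
      have hi1 : (2 : ℝ) ^ j ≤ 2 ^ i := pow_le_pow_right₀ (by norm_num) hij.1
      have h1 := ((h t ht x ρ hρ g hg).2 i (by omega)).2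
      rw [𝔹.trunc_eq_of_supp measurableSet_ball hgs] at h1
      have h3 : avgNorm ν q (annulus x ρ i ∩ Metric.ball y ρ) (Metric.ball y ρ)
          (𝔹.fn (T t g) : X → 𝕜) ≤ ENNReal.ofReal ((2 * (5 * s)) ^ D) *
            avgNorm ν q (annulus x ρ i) (Metric.ball x (2 ^ (i + 1) * ρ))
              (𝔹.fn (T t g) : X → 𝕜) := by
        refine avgNorm_le_of_subset hq inter_subset_left ?_ (hD.pos _ _ (by positivity))
          (hD.fin _ _) (hD.fin _ _) ?_ _
        · rw [ENNReal.one_le_ofReal]; exact one_le_pow₀ (by linarith)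
        · refine hD.growth_of_subset hρ (by linarith) (Metric.ball_subset_ball' ?_)
          have : (2 : ℝ) ^ (i + 1) * ρ ≤ 2 * (2 * s) * ρ := by
            rw [pow_succ]
            have := mul_le_mul_of_nonneg_right hi2 hρ.le
            linarith
          linarith
      have hpos : (0 : ℝ) < 2 ^ i := by positivity
      have hdec : dec (2 ^ i * ρ / √t) = 2 ^ i * k := by
        rw [mul_div_assoc, hρt, dec_of_one_le]
        have : (1 : ℝ) ≤ 2 ^ i := one_le_pow₀ (by norm_num)
        nlinarith
      rw [hdec] at h1
      refine (h3.trans (mul_le_mul_right h1 _)).trans ?_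
      rw [← mul_assoc, ← ENNReal.ofReal_mul (by positivity)]
      refine mul_le_mul_left (ENNReal.ofReal_le_ofReal ?_) _
      rw [hρ2, show c * 4 ^ i * (κ * t) / t = c * 4 ^ i * κ by field_simp,
        show c / 16 * d ^ 2 / t = c / 16 * (s ^ 2 * κ) by rw [← hdt]; ring]
      exact gaussian_annulus_le hθ₁ hθ₂ hc hC hk1 hκ hs8 hi2 (hj2.trans (by gcongr)) hK
        (hKb s (by linarith))
    have hcov : Metric.ball y ρ ⊆ ⋃ i ∈ ({j, j + 1} : Finset ℕ), annulus x ρ i := by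
      simpa using hsub
    calc _ ≤ ∑ i ∈ ({j, j + 1} : Finset ℕ), avgNorm ν q (annulus x ρ i ∩ Metric.ball y ρ)
            (Metric.ball y ρ) (𝔹.fn (T t g) : X → 𝕜) :=
          avgNorm_le_sum hq _ _ _ _ (fun i => measurableSet_annulus x ρ i) hcov (𝔹.aesm _ hν)
      _ ≤ ∑ i ∈ ({j, j + 1} : Finset ℕ), ENNReal.ofReal (C * (20 * k) ^ ((D : ℝ) + θ₁ + θ₂) * K *
            Real.exp (-(c / 16 * d ^ 2 / t))) * N := Finset.sum_le_sum key
      _ = ENNReal.ofReal (C₂ * Real.exp (-(c / 16 * d ^ 2 / t))) * N := by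
          rw [Finset.sum_const, Finset.card_pair (by omega), nsmul_eq_mul, ← mul_assoc, hC₂]
          congr 1
          rw [← ENNReal.ofReal_natCast, ← ENNReal.ofReal_mul (by positivity)]
          congr 1
          push_cast
          ring
      _ ≤ _ := mul_le_mul_left (ENNReal.ofReal_le_ofReal
          (mul_le_mul_of_nonneg_right (by linarith) (Real.exp_pos _).le)) _

/-- Gaussian bounds at the scale `√t` give estimates between two subsets of a ball. -/
theorem ScaleBound.exists_bound_of_subset [Nonempty X] (hν : ν ≪ μ) (hD : HasGrowth ν D)
    (hp : 1 ≤ p) (hq : 1 ≤ q) (h : 𝔹.ScaleBound ν T 1 p q) :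
    ∃ c C : ℝ, 0 < c ∧ 0 < C ∧ ∀ t : ℝ, 0 < t → ∀ (x : X) (R : ℝ), 0 < R → ∀ A A' : Set X,
      MeasurableSet A → A ⊆ Metric.ball x R → A' ⊆ Metric.ball x R → ∀ δ : ℝ, 0 ≤ δ →
      (∀ a ∈ A, ∀ a' ∈ A', δ ≤ dist a a') → ∀ g : E, MemLp (𝔹.fn g : X → 𝕜) p ν → 𝔹.Supp g A →
      avgNorm ν q A' (Metric.ball x R) (𝔹.fn (T t g) : X → 𝕜) ≤
        ENNReal.ofReal (C * dec (R / √t) ^ (4 * D) * Real.exp (-(c * δ ^ 2 / t))) *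
          avgNorm ν p A (Metric.ball x R) (𝔹.fn g : X → 𝕜) := by
  classical
  obtain ⟨c, C, hc, hC, h⟩ := h
  -- With `Υ = dec (R / √t)`, there are two cell counts of at most `(24 * Υ) ^ D` and two volume
  -- ratios of at most `(6 * Υ) ^ D`; hence the power `4 * D` of `dec` and the constant `144 ^ (2 *
  -- D)`. The halved rate and `exp (4 * c)` pay for measuring distances between centres of cells.
  refine ⟨c / 2, 144 ^ (2 * D) * C * Real.exp (4 * c), by positivity, by positivity, ?_⟩
  intro t ht x R hR A A' hA hAR hA'R δ hδ hdist g hg hgs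
  have hρ : 0 < √t := Real.sqrt_pos.2 ht
  set ρ := √t with hρd
  have hρ2 : ρ ^ 2 = t := Real.sq_sqrt ht.le
  have hdec0 : 0 < R / ρ := by positivity
  set Υ := dec (R / ρ) with hΥ
  have hΥ1 : 1 ≤ Υ := one_le_dec hdec0
  have hΥR : R / ρ ≤ Υ := le_max_left _ _
  have hΥρ : ρ / R ≤ Υ := by
    rw [← inv_div]
    exact le_max_right _ _
  have hR1 : R ≤ Υ * ρ := (div_le_iff₀ hρ).1 hΥR
  have hρ1 : ρ ≤ Υ * R := (div_le_iff₀ hR).1 hΥρ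
  have hRR : R ≤ Υ * R := le_mul_of_one_le_left hR.le hΥ1
  have hρρ : ρ ≤ Υ * ρ := le_mul_of_one_le_left hρ.le hΥ1
  obtain ⟨N⟩ := hD.exists_net hρ
  set s := (N.finite_inter_ball hD hρ x (R + ρ)).toFinset with hs
  have hmem : ∀ z, z ∈ s ↔ z ∈ N.pts ∧ dist z x < R + ρ := fun z => by simp [hs]
  have hcov : Metric.ball x R ⊆ ⋃ z ∈ s, N.cell z := by
    intro y hy
    obtain ⟨z, hz, hyz⟩ := N.cover y
    refine mem_biUnion ((hmem z).2 ⟨hz, ?_⟩) hyz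
    have h1 := N.subset z hyz
    rw [Metric.mem_ball] at h1 hy
    have := dist_triangle z y x
    rw [dist_comm z y] at this
    linarith
  have hsep : (s : Set X).Pairwise fun a b => ρ ≤ dist a b :=
    N.separated.mono fun z hz => ((hmem z).1 hz).1
  have hcard : (s.card : ℝ) ≤ (24 * Υ) ^ D := by
    have := hD.card_le hρ hsep (x := x) (L := 2 * Υ) (by linarith) fun z hz => by
      have := ((hmem z).1 hz).2
      linarith
    rwa [show 12 * (2 * Υ) = 24 * Υ by ring] at this
  set F := Metric.ball x R with hF
  set Ng := avgNorm ν p A F (𝔹.fn g : X → 𝕜) with hNg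
  -- decomposition of `g`
  have hdec : g = ∑ z ∈ s, 𝔹.trunc (N.cell z ∩ A) g := by
    rw [← 𝔹.trunc_biUnion s (fun z => N.cell z ∩ A) (fun z => (N.measurable z).inter hA)]
    · rw [← iUnion₂_inter, inter_eq_right.2 (hAR.trans hcov), 𝔹.trunc_eq_of_supp hA hgs]
    · exact (N.disjoint.subset fun z hz => ((hmem z).1 hz).1).mono fun z => inter_subset_left
  have hL1 : (1 : ℝ≥0∞) ≤ ENNReal.ofReal ((6 * Υ) ^ D) := by
    rw [ENNReal.one_le_ofReal]; exact one_le_pow₀ (by linarith)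
  set b := ENNReal.ofReal ((6 * Υ) ^ D) * (ENNReal.ofReal (C * (Real.exp (4 * c) *
    Real.exp (-(c / 2 * δ ^ 2 / t)))) * (ENNReal.ofReal ((6 * Υ) ^ D) * Ng)) with hb
  have pair : ∀ z ∈ s, ∀ z' ∈ s, avgNorm ν q (N.cell z' ∩ A') F
      (𝔹.fn (T t (𝔹.trunc (N.cell z ∩ A) g)) : X → 𝕜) ≤ b := by
    intro z hz z' hz'
    rcases (N.cell z' ∩ A').eq_empty_or_nonempty with he | ⟨a', ha'1, ha'2⟩
    · rw [he, avgNorm, Measure.restrict_empty, smul_zero, eLpNorm_measure_zero]; exact bot_le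
    rcases (N.cell z ∩ A).eq_empty_or_nonempty with he | ⟨a, ha1, ha2⟩
    · rw [he, 𝔹.trunc_empty, map_zero, avgNorm_congr (Measure.absolutelyContinuous_restrict.ae_le
        (hν.ae_le 𝔹.fn_zero)), avgNorm, eLpNorm_zero]
      exact bot_le
    have hm : MeasurableSet (N.cell z ∩ A) := (N.measurable z).inter hA
    have hsub : N.cell z ∩ A ⊆ Metric.ball z ρ := inter_subset_left.trans (N.subset z)
    have h1 : avgNorm ν q (N.cell z' ∩ A') F
        (𝔹.fn (T t (𝔹.trunc (N.cell z ∩ A) g)) : X → 𝕜) ≤ ENNReal.ofReal ((6 * Υ) ^ D) *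
          avgNorm ν q (Metric.ball z' ρ) (Metric.ball z' ρ)
            (𝔹.fn (T t (𝔹.trunc (N.cell z ∩ A) g)) : X → 𝕜) := by
      refine avgNorm_le_of_subset hq (inter_subset_left.trans (N.subset z')) hL1
        (hD.pos _ _ hρ) (hD.fin _ _) (hD.fin _ _) ?_ _
      rw [show 6 * Υ = 2 * (3 * Υ) by ring]
      refine hD.growth_of_subset hR (by linarith) (Metric.ball_subset_ball' ?_)
      have := ((hmem z').1 hz').2
      linarith
    have h2 := h t ht z z' (𝔹.trunc (N.cell z ∩ A) g)
      (𝔹.memLp_trunc hν hm (hg.restrict _))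
    rw [one_mul] at h2
    replace h2 := h2 (𝔹.supp_trunc hm hsub g)
    have h3 : avgNorm ν p (Metric.ball z ρ) (Metric.ball z ρ)
        (𝔹.fn (𝔹.trunc (N.cell z ∩ A) g) : X → 𝕜) ≤ ENNReal.ofReal ((6 * Υ) ^ D) * Ng := by
      rw [avgNorm_of_ae_indicator hm hsub (hν.ae_le (𝔹.supp_trunc hm Subset.rfl g)),
        𝔹.avgNorm_trunc hν hm]
      refine avgNorm_le_of_subset hp inter_subset_right hL1 (hD.pos _ _ hR) (hD.fin _ _)
        (hD.fin _ _) ?_ _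
      rw [show 6 * Υ = 2 * (3 * Υ) by ring]
      refine hD.growth_of_subset hρ (by linarith) (Metric.ball_subset_ball' ?_)
      have := ((hmem z).1 hz).2
      rw [dist_comm] at this
      linarith
    refine h1.trans ?_
    rw [hb]
    refine mul_le_mul_right (h2.trans (mul_le_mul' ?_ h3)) _
    refine ENNReal.ofReal_le_ofReal (mul_le_mul_of_nonneg_left ?_ hC.le)
    rw [← Real.exp_add, Real.exp_le_exp]
    -- Both cells meet the sets `A` and `A'`, which are `δ` apart, so the centres are at least `δ -
    -- 2 * ρ` apart.
    have e1 : δ ≤ dist z z' + 2 * ρ := by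
      have k1 := hdist a ha2 a' ha'2
      have k2 := N.subset z ha1
      have k3 := N.subset z' ha'1
      rw [Metric.mem_ball] at k2 k3
      have k4 := dist_triangle4 a z z' a'
      rw [dist_comm z' a'] at k4
      linarith
    have e2 : δ ^ 2 ≤ 2 * dist z z' ^ 2 + 8 * t := by
      rw [← hρ2]
      have : δ ^ 2 ≤ (dist z z' + 2 * ρ) ^ 2 := by gcongr
      nlinarith [sq_nonneg (dist z z' - 2 * ρ)]
    have e3 : c / 2 * δ ^ 2 / t ≤ c * dist z z' ^ 2 / t + 4 * c := by
      rw [div_add' _ _ _ ht.ne']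
      gcongr
      nlinarith
    linarith
  calc avgNorm ν q A' F (𝔹.fn (T t g) : X → 𝕜)
      ≤ ∑ z ∈ s, avgNorm ν q A' F (𝔹.fn (T t (𝔹.trunc (N.cell z ∩ A) g)) : X → 𝕜) := by
        conv_lhs => rw [hdec, map_sum]
        exact 𝔹.eLpNorm_fn_sum_le s _ ((inv_smul_restrict_ac ν A' F).trans
          (Measure.absolutelyContinuous_restrict.trans hν)) hq
    _ ≤ ∑ z ∈ s, ∑ z' ∈ s, avgNorm ν q (N.cell z' ∩ A') F
          (𝔹.fn (T t (𝔹.trunc (N.cell z ∩ A) g)) : X → 𝕜) :=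
        Finset.sum_le_sum fun z _ => avgNorm_le_sum hq s A' F N.cell N.measurable
          (hA'R.trans hcov) (𝔹.aesm _ hν)
    _ ≤ ∑ z ∈ s, ∑ z' ∈ s, b :=
        Finset.sum_le_sum fun z hz => Finset.sum_le_sum fun z' hz' => pair z hz z' hz'
    _ = (s.card : ℝ≥0∞) * (s.card * b) := by simp
    _ ≤ ENNReal.ofReal ((24 * Υ) ^ D) * (ENNReal.ofReal ((24 * Υ) ^ D) * b) := by
        have : (s.card : ℝ≥0∞) ≤ ENNReal.ofReal ((24 * Υ) ^ D) := by
          rw [← ENNReal.ofReal_natCast]; exact ENNReal.ofReal_le_ofReal hcard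
        gcongr
    _ = _ := by
        rw [hb]
        simp only [← mul_assoc]
        congr 1
        simp only [← ENNReal.ofReal_mul' (show 0 ≤ (6 * Υ) ^ D by positivity),
          ← ENNReal.ofReal_mul' (show 0 ≤ (24 * Υ) ^ D by positivity),
          ← ENNReal.ofReal_mul' (show 0 ≤ C * Real.exp (4 * c) *
            Real.exp (-(c / 2 * δ ^ 2 / t)) by positivity)]
        congr 1
        rw [show (144 : ℝ) ^ (2 * D) = 24 ^ D * 24 ^ D * (6 ^ D * 6 ^ D) by
          rw [two_mul, pow_add, show (144 : ℝ) = 24 * 6 by norm_num, mul_pow]; ring]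
        simp only [mul_pow]
        ring

/-- Gaussian bounds at the scale `√t` give off-diagonal estimates. -/
theorem ScaleBound.offDiagonal [Nonempty X] (hν : ν ≪ μ) (hD : HasGrowth ν D)
    (hp : 1 ≤ p) (hq : 1 ≤ q) (h : 𝔹.ScaleBound ν T 1 p q) : 𝔹.OffDiagonal ν T p q := by
  obtain ⟨c, C, hc, hC, h⟩ := h.exists_bound_of_subset 𝔹 hν hD hp hq
  have hD1 : (1 : ℝ) ≤ D := by exact_mod_cast hD.one_le
  -- For `j ≥ 2` the annulus is at distance at least `3 / 4 * (2 ^ j * r)` from the ball, whence `9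
  -- / 16` in the rate. The volume ratio `(2 * 2 ^ (j + 1)) ^ D` gives `θ₁ = D` and a factor `4 ^
  -- D`. Passing from `dec` at `2 ^ (j + 1) * r` to `dec` at `2 ^ j * r` gives another `2 ^ (4 *
  -- D)`.
  refine ⟨D, (4 * D : ℕ), c * (9 / 16), 64 ^ D * C, by linarith, ?_, by positivity,
    by positivity, ?_⟩
  · push_cast; linarith
  intro t ht x r hr f hf
  have hst : 0 < √t := Real.sqrt_pos.2 ht
  have h64 : (1 : ℝ) ≤ 64 ^ D := one_le_pow₀ (by norm_num)
  have hmb : ∀ r : ℝ, MeasurableSet (Metric.ball x r) := fun r => measurableSet_ball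
  refine ⟨?_, fun j hj => ?_⟩
  · have h1 := h t ht x r hr (Metric.ball x r) (Metric.ball x r) (hmb r) Subset.rfl Subset.rfl 0
      le_rfl (fun a _ a' _ => dist_nonneg) (𝔹.trunc (Metric.ball x r) f)
      (𝔹.memLp_trunc hν (hmb r) (hf.restrict _)) (𝔹.supp_trunc (hmb r) Subset.rfl f)
    rw [𝔹.avgNorm_trunc hν (hmb r)] at h1
    refine h1.trans ?_
    refine mul_le_mul_left (ENNReal.ofReal_le_ofReal ?_) _
    rw [Real.rpow_natCast]
    have := one_le_dec (u := r / √t) (by positivity)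
    simp only [ne_eq, OfNat.ofNat_ne_zero, not_false_eq_true, zero_pow, mul_zero, zero_div,
      neg_zero, Real.exp_zero, mul_one]
    gcongr
    exact le_mul_of_one_le_left hC.le h64
  · have h2j : (4 : ℝ) ≤ 2 ^ j := by
      calc (4 : ℝ) = 2 ^ 2 := by norm_num
        _ ≤ 2 ^ j := pow_le_pow_right₀ (by norm_num) hj
    set F := Metric.ball x (2 ^ (j + 1) * r) with hF
    have hR : 0 < 2 ^ (j + 1) * r := by positivity
    have hBF : Metric.ball x r ⊆ F := Metric.ball_subset_ball (by
      rw [pow_succ]; nlinarith)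
    have hAF : annulus x r j ⊆ F := sdiff_subset
    have hma := measurableSet_annulus x r j
    have hsep : ∀ a ∈ annulus x r j, ∀ b ∈ Metric.ball x r, 3 / 4 * (2 ^ j * r) ≤ dist a b := by
      intro a ha b hb
      have h1 := ha.2
      rw [Metric.mem_ball, not_lt] at h1
      rw [Metric.mem_ball] at hb
      have h2 := dist_triangle a b x
      nlinarith
    have hdec : dec (2 ^ (j + 1) * r / √t) ≤ 2 * dec (2 ^ j * r / √t) := by
      rw [pow_succ, show (2 : ℝ) ^ j * 2 * r / √t = 2 * (2 ^ j * r / √t) by ring]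
      exact dec_two_mul_le (by positivity)
    have hdec0 : 0 ≤ dec (2 ^ (j + 1) * r / √t) := zero_le_one.trans (one_le_dec (by positivity))
    have hdec1 : 1 ≤ dec (2 ^ j * r / √t) := one_le_dec (by positivity)
    have hpow : (2 : ℝ) ^ ((j : ℝ) * D) = (2 ^ j) ^ D := by
      rw [Real.rpow_mul (by norm_num), Real.rpow_natCast, Real.rpow_natCast]
    have hexp : c * (3 / 4 * (2 ^ j * r)) ^ 2 / t = c * (9 / 16) * 4 ^ j * r ^ 2 / t := by
      rw [show (4 : ℝ) ^ j = (2 ^ j) ^ 2 by rw [← pow_mul, mul_comm, pow_mul]; norm_num]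
      ring
    have hconst : (2 * 2 ^ (j + 1)) ^ D * (C * dec (2 ^ (j + 1) * r / √t) ^ (4 * D) *
        Real.exp (-(c * (9 / 16) * 4 ^ j * r ^ 2 / t))) ≤
        64 ^ D * C * 2 ^ ((j : ℝ) * D) * dec (2 ^ j * r / √t) ^ (((4 * D : ℕ) : ℝ)) *
        Real.exp (-(c * (9 / 16) * 4 ^ j * r ^ 2 / t)) := by
      rw [hpow, Real.rpow_natCast]
      calc _ ≤ (2 * 2 ^ (j + 1)) ^ D * (C * (2 * dec (2 ^ j * r / √t)) ^ (4 * D) *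
            Real.exp (-(c * (9 / 16) * 4 ^ j * r ^ 2 / t))) := by gcongr
        _ = _ := by
          rw [pow_succ, show (64 : ℝ) = 4 * 2 ^ 4 by norm_num]
          simp only [mul_pow, pow_mul]
          rw [show (4 : ℝ) = 2 * 2 by norm_num]
          simp only [mul_pow]
          ring
    constructor
    · have h1 := h t ht x _ hR (annulus x r j) (Metric.ball x r) hma hAF hBF
        (3 / 4 * (2 ^ j * r)) (by positivity) hsep (𝔹.trunc (annulus x r j) f)
        (𝔹.memLp_trunc hν hma (hf.restrict _)) (𝔹.supp_trunc hma Subset.rfl f)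
      rw [𝔹.avgNorm_trunc hν hma, hexp] at h1
      have h2 := avgNorm_le_of_subset (ν := ν) hq (A := Metric.ball x r) (A' := Metric.ball x r)
        (F := Metric.ball x r) (F' := F) Subset.rfl (L := ENNReal.ofReal ((2 * 2 ^ (j + 1)) ^ D))
        (by rw [ENNReal.one_le_ofReal]; exact one_le_pow₀ (by rw [pow_succ]; linarith))
        (hD.pos _ _ hR) (hD.fin _ _) (hD.fin _ _)
        (hD.growth x r (2 ^ (j + 1)) hr (one_le_pow₀ (by norm_num)))
        (𝔹.fn (T t (𝔹.trunc (annulus x r j) f)) : X → 𝕜)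
      refine (h2.trans (mul_le_mul_right h1 _)).trans ?_
      rw [← mul_assoc, ← ENNReal.ofReal_mul (by positivity)]
      exact mul_le_mul_left (ENNReal.ofReal_le_ofReal hconst) _
    · have h1 := h t ht x _ hR (Metric.ball x r) (annulus x r j) (hmb r) hBF hAF
        (3 / 4 * (2 ^ j * r)) (by positivity)
        (fun a ha b hb => by rw [dist_comm]; exact hsep b hb a ha) (𝔹.trunc (Metric.ball x r) f)
        (𝔹.memLp_trunc hν (hmb r) (hf.restrict _)) (𝔹.supp_trunc (hmb r) Subset.rfl f)
      rw [𝔹.avgNorm_trunc hν (hmb r), hexp] at h1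
      have h2 := avgNorm_le_of_subset (ν := ν) hp (A := Metric.ball x r) (A' := Metric.ball x r)
        (F := F) (F' := Metric.ball x r) Subset.rfl le_rfl (hD.pos _ _ hr) (hD.fin _ _)
        (hD.fin _ _) (by rw [one_mul]; exact measure_mono hBF) (𝔹.fn f : X → 𝕜)
      rw [one_mul] at h2
      refine h1.trans (mul_le_mul' (ENNReal.ofReal_le_ofReal ?_) h2)
      refine le_trans ?_ hconst
      refine le_mul_of_one_le_left (by positivity) (one_le_pow₀ ?_)
      rw [pow_succ]; linarith

end FunctionSpace

/-- Schur test for finite non-negative matrices. -/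
theorem sum_rpow_le_of_schur {p : ℝ} (hp : 1 ≤ p) {ι ι' : Type*} (s : Finset ι) (s' : Finset ι')
    (κ : ι' → ι → ℝ≥0∞) (a : ι' → ℝ≥0∞) (b : ι → ℝ≥0∞) {S : ℝ≥0∞}
    (ha : ∀ m ∈ s', a m ≤ ∑ k ∈ s, κ m k * b k) (h1 : ∀ m ∈ s', ∑ k ∈ s, κ m k ≤ S)
    (h2 : ∀ k ∈ s, ∑ m ∈ s', κ m k ≤ S) :
    ∑ m ∈ s', a m ^ p ≤ S ^ p * ∑ k ∈ s, b k ^ p := by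
  have hp0 : 0 < p := by linarith
  have key : ∀ m ∈ s', a m ^ p ≤ S ^ (p - 1) * ∑ k ∈ s, κ m k * b k ^ p := by
    intro m hm
    calc a m ^ p ≤ (∑ k ∈ s, κ m k * b k) ^ p := ENNReal.rpow_le_rpow (ha m hm) hp0.le
      _ ≤ ((∑ k ∈ s, κ m k) ^ (1 - p⁻¹) * (∑ k ∈ s, κ m k * b k ^ p) ^ p⁻¹) ^ p :=
          ENNReal.rpow_le_rpow (ENNReal.inner_le_weight_mul_Lp_of_nonneg s hp _ _) hp0.le
      _ = (∑ k ∈ s, κ m k) ^ (p - 1) * ∑ k ∈ s, κ m k * b k ^ p := by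
          rw [ENNReal.mul_rpow_of_nonneg _ _ hp0.le, ← ENNReal.rpow_mul, ← ENNReal.rpow_mul,
            inv_mul_cancel₀ hp0.ne', ENNReal.rpow_one, sub_mul, one_mul, inv_mul_cancel₀ hp0.ne']
      _ ≤ _ := by
          exact mul_le_mul_left (ENNReal.rpow_le_rpow (h1 m hm) (by linarith)) _
  calc ∑ m ∈ s', a m ^ p ≤ ∑ m ∈ s', S ^ (p - 1) * ∑ k ∈ s, κ m k * b k ^ p :=
        Finset.sum_le_sum key
    _ = S ^ (p - 1) * ∑ k ∈ s, (∑ m ∈ s', κ m k) * b k ^ p := by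
        rw [← Finset.mul_sum, Finset.sum_comm]
        simp_rw [Finset.sum_mul]
    _ ≤ S ^ (p - 1) * ∑ k ∈ s, S * b k ^ p := by
        gcongr with k hk
        exact h2 k hk
    _ = _ := by
        rw [← Finset.mul_sum, ← mul_assoc]
        congr 1
        nth_rewrite 2 [← ENNReal.rpow_one S]
        rw [← ENNReal.rpow_add_of_nonneg _ _ (by linarith) zero_le_one, sub_add_cancel]

/-! ### Monotonicity in the exponents, composition, uniform boundedness. -/

namespace FunctionSpace

variable {X : Type*} [MetricSpace X] [MeasurableSpace X] [OpensMeasurableSpace X]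
  {𝕜 : Type*} [RCLike 𝕜] {μ : Measure X} {E : Type*}
  [NormedAddCommGroup E] [NormedSpace 𝕜 E] (𝔹 : FunctionSpace 𝕜 μ E)
  {ν : Measure X} {D : ℕ} {T : ℝ → E →L[𝕜] E} {p q : ℝ≥0∞}

/-- Hölder's inequality for averages: raising the source exponent or lowering the target exponent
weakens the estimate, with the same constants. -/
theorem OffDiagonal.mono (hν : ν ≪ μ) (hD : HasGrowth ν D) {p' q' : ℝ≥0∞} (hp : 1 ≤ p)
    (hpp : p ≤ p') (hq' : 1 ≤ q') (hqq : q' ≤ q) (h : 𝔹.OffDiagonal ν T p q) :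
    𝔹.OffDiagonal ν T p' q' := by
  obtain ⟨θ₁, θ₂, c, C, hθ₁, hθ₂, hc, hC, h⟩ := h
  refine ⟨θ₁, θ₂, c, C, hθ₁, hθ₂, hc, hC, fun t ht x r hr f hf => ?_⟩
  -- A function in L^p' need not be in L^p, but its truncations to bounded sets are; the estimate is
  -- applied to the truncation, which a second truncation leaves unchanged.
  have main : ∀ A F : Set X, MeasurableSet A → A ⊆ F → ν F ≠ ∞ →
      MemLp (𝔹.fn (𝔹.trunc A f) : X → 𝕜) p ν ∧ 𝔹.trunc A (𝔹.trunc A f) = 𝔹.trunc A f ∧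
      avgNorm ν p A F (𝔹.fn (𝔹.trunc A f) : X → 𝕜) ≤ avgNorm ν p' A F (𝔹.fn f : X → 𝕜) := by
    intro A F hA hAF hF
    refine ⟨𝔹.memLp_of_supp hν hA (ne_top_of_le_ne_top hF (measure_mono hAF))
      (𝔹.supp_trunc hA Subset.rfl f) hpp (𝔹.memLp_trunc hν hA (hf.restrict A)), ?_, ?_⟩
    · rw [𝔹.trunc_trunc hA hA, inter_self]
    · rw [𝔹.avgNorm_trunc hν hA]
      exact avgNorm_mono_exponent hp hpp hAF (𝔹.aesm _ hν)
  have lo : ∀ A F : Set X, A ⊆ F → ∀ g : E,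
      avgNorm ν q' A F (𝔹.fn g : X → 𝕜) ≤ avgNorm ν q A F (𝔹.fn g : X → 𝕜) :=
    fun A F hAF g => avgNorm_mono_exponent hq' hqq hAF (𝔹.aesm _ hν)
  obtain ⟨hB1, hB2, hB3⟩ := main (Metric.ball x r) (Metric.ball x r) measurableSet_ball Subset.rfl
    (hD.fin _ _)
  have hB := h t ht x r hr _ hB1
  rw [hB2] at hB
  refine ⟨(lo _ _ Subset.rfl _).trans (hB.1.trans (mul_le_mul_right hB3 _)), fun j hj => ⟨?_, ?_⟩⟩
  · obtain ⟨hA1, hA2, hA3⟩ := main (annulus x r j) (Metric.ball x (2 ^ (j + 1) * r))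
      (measurableSet_annulus x r j) sdiff_subset (hD.fin _ _)
    have hA := ((h t ht x r hr _ hA1).2 j hj).1
    rw [hA2] at hA
    exact (lo _ _ Subset.rfl _).trans (hA.trans (mul_le_mul_right hA3 _))
  · exact (lo _ _ sdiff_subset _).trans ((hB.2 j hj).2.trans (mul_le_mul_right hB3 _))

/-- Composition of Gaussian bounds, with the time doubled. -/
theorem ScaleBound.comp [Nonempty X] (hν : ν ≪ μ) (hD : HasGrowth ν D)
    (hTtr : 𝔹.TruncationContinuous T) (hT : ∀ s t : ℝ, 0 < s → 0 < t → T s ∘L T t = T (s + t))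
    {r : ℝ≥0∞} (hr : 1 ≤ r) (h₁ : 𝔹.ScaleBound ν T 2 p q)
    (h₂ : 𝔹.ScaleBound ν T 2 q r) : 𝔹.ScaleBound ν T 1 p r := by
  obtain ⟨c₁, C₁, hc₁, hC₁, h₁⟩ := h₁
  obtain ⟨c₂, C₂, hc₂, hC₂, h₂⟩ := h₂
  set c := min c₁ c₂ with hc
  have hc0 : 0 < c := lt_min hc₁ hc₂
  obtain ⟨S, hS, hsum⟩ := hD.exists_sum_exp_le hc0
  refine ⟨c / 2, C₂ * C₁ * S, by positivity, by positivity, fun t ht x y g hg hgs => ?_⟩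
  have hρ : 0 < √t := Real.sqrt_pos.2 ht
  rw [one_mul] at hgs ⊢
  set ρ := √t with hρd
  have hρ2 : ρ ^ 2 = t := Real.sq_sqrt ht.le
  have ht2 : 0 < t / 2 := by positivity
  -- The reason for assuming the bounds with `κ = 2`: at time `t / 2` the balls then have the radius
  -- `√t` wanted at time `t`.
  have hsc : √(2 * (t / 2)) = ρ := by rw [mul_div_cancel₀ _ (by norm_num : (2 : ℝ) ≠ 0)]
  set N := avgNorm ν p (Metric.ball x ρ) (Metric.ball x ρ) (𝔹.fn g : X → 𝕜) with hN
  have hNt : N ≠ ∞ := avgNorm_ne_top (hD.pos _ _ hρ) hg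
  set u := T (t / 2) g with hu
  have hTu : T t g = T (t / 2) u := by
    rw [hu, ← ContinuousLinearMap.comp_apply, hT _ _ ht2 ht2, add_halves]
  obtain ⟨Z⟩ := hD.exists_net hρ
  rw [hTu]
  -- The function `u = T (t / 2) g` has no bounded support, so it is truncated, cut along the net,
  -- and the truncation is removed by Fatou's lemma.
  refine 𝔹.eLpNorm_apply_le_of_trunc hTtr ht2 u (x := y) hρ ((inv_smul_restrict_ac _ _ _).trans
    (hν.restrict _)) fun R hR => ?_
  set s := (Z.finite_inter_ball hD hρ y (R + ρ)).toFinset with hs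
  have hmem : ∀ z, z ∈ s ↔ z ∈ Z.pts ∧ dist z y < R + ρ := fun z => by simp [hs]
  have hcov : Metric.ball y R ⊆ ⋃ z ∈ s, Z.cell z := by
    intro w hw
    obtain ⟨z, hz, hwz⟩ := Z.cover w
    refine mem_biUnion ((hmem z).2 ⟨hz, ?_⟩) hwz
    have h1 := Z.subset z hwz
    rw [Metric.mem_ball] at h1 hw
    have := dist_triangle z w y
    rw [dist_comm z w] at this
    linarith
  have hdec : 𝔹.trunc (Metric.ball y R) u =
      ∑ z ∈ s, 𝔹.trunc (Z.cell z ∩ Metric.ball y R) u := by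
    rw [← 𝔹.trunc_biUnion s (fun z => Z.cell z ∩ Metric.ball y R)
      (fun z => (Z.measurable z).inter measurableSet_ball)]
    · rw [← iUnion₂_inter, inter_eq_right.2 hcov]
    · exact (Z.disjoint.subset fun z hz => ((hmem z).1 hz).1).mono fun z => inter_subset_left
  have pair : ∀ z ∈ s, avgNorm ν r (Metric.ball y ρ) (Metric.ball y ρ)
      (𝔹.fn (T (t / 2) (𝔹.trunc (Z.cell z ∩ Metric.ball y R) u)) : X → 𝕜) ≤
      ENNReal.ofReal (C₂ * C₁ * Real.exp (-(c / 2 * dist x y ^ 2 / t)) *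
        Real.exp (-(c * dist z x ^ 2 / ρ ^ 2))) * N := by
    intro z hz
    have hm : MeasurableSet (Z.cell z ∩ Metric.ball y R) := (Z.measurable z).inter measurableSet_ball
    have hsub : Z.cell z ∩ Metric.ball y R ⊆ Metric.ball z ρ :=
      inter_subset_left.trans (Z.subset z)
    have k1 := h₁ (t / 2) ht2 x z g hg (by rw [hsc]; exact hgs)
    rw [hsc] at k1
    have k0 : MemLp (𝔹.fn (𝔹.trunc (Z.cell z ∩ Metric.ball y R) u) : X → 𝕜) q ν := by
      refine ⟨𝔹.aesm _ hν, ?_⟩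
      rw [𝔹.eLpNorm_trunc hν hm]
      refine (eLpNorm_mono_measure _ (Measure.restrict_mono hsub le_rfl)).trans_lt ?_
      rw [eLpNorm_restrict_eq_avgNorm (hD.pos z ρ hρ) (hD.fin _ _)]
      refine ENNReal.mul_lt_top (ENNReal.rpow_lt_top_of_nonneg ENNReal.toReal_nonneg
        (hD.fin _ _)) (k1.trans_lt (ENNReal.mul_lt_top ENNReal.ofReal_lt_top hNt.lt_top))
    have k2 := h₂ (t / 2) ht2 z y _ k0 (by rw [hsc]; exact 𝔹.supp_trunc hm hsub u)
    rw [hsc] at k2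
    have k3 : avgNorm ν q (Metric.ball z ρ) (Metric.ball z ρ)
        (𝔹.fn (𝔹.trunc (Z.cell z ∩ Metric.ball y R) u) : X → 𝕜) ≤
        avgNorm ν q (Metric.ball z ρ) (Metric.ball z ρ) (𝔹.fn u : X → 𝕜) := by
      rw [avgNorm_of_ae_indicator hm hsub (hν.ae_le (𝔹.supp_trunc hm Subset.rfl u)),
        𝔹.avgNorm_trunc hν hm]
      exact avgNorm_mono_set hsub _
    refine (k2.trans (mul_le_mul_right (k3.trans k1) _)).trans ?_
    rw [← mul_assoc, ← ENNReal.ofReal_mul (by positivity)]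
    refine mul_le_mul_left (ENNReal.ofReal_le_ofReal ?_) _
    rw [mul_mul_mul_comm, ← Real.exp_add, mul_assoc (C₂ * C₁), ← Real.exp_add, hρ2]
    refine mul_le_mul_of_nonneg_left (Real.exp_le_exp.2 ?_) (by positivity)
    have e1 : dist x y ^ 2 ≤ 2 * dist x z ^ 2 + 2 * dist z y ^ 2 := by
      have h3 : dist x y ^ 2 ≤ (dist x z + dist z y) ^ 2 := by
        gcongr; exact dist_triangle x z y
      nlinarith [sq_nonneg (dist x z - dist z y)]
    have e2 : c * dist z y ^ 2 ≤ c₂ * dist z y ^ 2 := by gcongr; exact min_le_right _ _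
    have e3 : c * dist x z ^ 2 ≤ c₁ * dist x z ^ 2 := by gcongr; exact min_le_left _ _
    rw [dist_comm z x]
    -- Halving the time doubles the exponents. Part of this surplus controls `dist x y` by the
    -- triangle inequality; the rest is the Gaussian in `dist z x` that makes the sum over the net
    -- converge.
    have e4 : c / 2 * dist x y ^ 2 / t + c * dist x z ^ 2 / t ≤
        c₂ * dist z y ^ 2 / (t / 2) + c₁ * dist x z ^ 2 / (t / 2) := by
      have e5 : c / 2 * dist x y ^ 2 ≤ c / 2 * (2 * dist x z ^ 2 + 2 * dist z y ^ 2) := by gcongr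
      have e6 : 0 ≤ c * dist z y ^ 2 := by positivity
      rw [← add_div, ← add_div, div_div_eq_mul_div]
      gcongr
      linarith
    linarith
  calc _ ≤ ∑ z ∈ s, avgNorm ν r (Metric.ball y ρ) (Metric.ball y ρ)
          (𝔹.fn (T (t / 2) (𝔹.trunc (Z.cell z ∩ Metric.ball y R) u)) : X → 𝕜) := by
        rw [hdec, map_sum]
        exact 𝔹.eLpNorm_fn_sum_le s _ ((inv_smul_restrict_ac ν _ _).trans
          (Measure.absolutelyContinuous_restrict.trans hν)) hr
    _ ≤ ∑ z ∈ s, ENNReal.ofReal (C₂ * C₁ * Real.exp (-(c / 2 * dist x y ^ 2 / t)) *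
        Real.exp (-(c * dist z x ^ 2 / ρ ^ 2))) * N := Finset.sum_le_sum pair
    _ = ENNReal.ofReal (C₂ * C₁ * Real.exp (-(c / 2 * dist x y ^ 2 / t)) *
        ∑ z ∈ s, Real.exp (-(c * dist z x ^ 2 / ρ ^ 2))) * N := by
        rw [← Finset.sum_mul, ← ENNReal.ofReal_sum_of_nonneg (fun z _ => by positivity),
          Finset.mul_sum]
    _ ≤ _ := by
        refine mul_le_mul_left (ENNReal.ofReal_le_ofReal ?_) _
        have := hsum ρ hρ s (Z.separated.mono fun z hz => ((hmem z).1 hz).1) x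
        calc _ ≤ C₂ * C₁ * Real.exp (-(c / 2 * dist x y ^ 2 / t)) * S := by gcongr
          _ = _ := by ring

theorem OffDiagonal.comp [Nonempty X] (hν : ν ≪ μ) (hD : HasGrowth ν D)
    (hTtr : 𝔹.TruncationContinuous T) (hT : ∀ s t : ℝ, 0 < s → 0 < t → T s ∘L T t = T (s + t))
    {r : ℝ≥0∞} (hp : 1 ≤ p) (hq : 1 ≤ q) (hr : 1 ≤ r) (h₁ : 𝔹.OffDiagonal ν T p q)
    (h₂ : 𝔹.OffDiagonal ν T q r) : 𝔹.OffDiagonal ν T p r :=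
  (ScaleBound.comp 𝔹 hν hD hTtr hT hr (h₁.scaleBound 𝔹 hν hD hp hq one_le_two)
    (h₂.scaleBound 𝔹 hν hD hq hr one_le_two)).offDiagonal 𝔹 hν hD hp hr

theorem _root_.OffDiag.eLpNorm_rpow_toReal {X : Type*} [MeasurableSpace X] {m : Measure X} {h : X → 𝕜}
    (hp : 1 ≤ p) (hpt : p ≠ ∞) :
    eLpNorm h p m ^ p.toReal = ∫⁻ x, ‖h x‖ₑ ^ p.toReal ∂m := by
  have h0 : p ≠ 0 := (zero_lt_one.trans_le hp).ne'
  rw [eLpNorm_eq_lintegral_rpow_enorm_toReal h0 hpt, ← ENNReal.rpow_mul, one_div,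
    inv_mul_cancel₀ (ENNReal.toReal_pos h0 hpt).ne', ENNReal.rpow_one]

/-- Gluing local estimates over a partition by the Schur test. -/
theorem eLpNorm_le_of_schur {m m' : Measure X} (hp : 1 ≤ p) (s s' : Finset X) (cell : X → Set X)
    (hcell : ∀ z, MeasurableSet (cell z)) (hdis : (s : Set X).PairwiseDisjoint cell)
    (A : Set X) (hA : A ⊆ ⋃ z ∈ s', cell z)
    (f h : X → 𝕜) (κ : X → X → ℝ≥0∞) {S : ℝ≥0∞}
    (ha : ∀ z' ∈ s', eLpNorm h p (m'.restrict (cell z')) ≤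
      ∑ z ∈ s, κ z' z * eLpNorm f p (m.restrict (cell z)))
    (h1 : ∀ z' ∈ s', ∑ z ∈ s, κ z' z ≤ S) (h2 : ∀ z ∈ s, ∑ z' ∈ s', κ z' z ≤ S) :
    eLpNorm h p (m'.restrict A) ≤ S * eLpNorm f p m := by
  rcases eq_or_ne p ∞ with rfl | hpt
  · have h3 : ∀ z' ∈ s', eLpNorm h ∞ (m'.restrict (cell z')) ≤ S * eLpNorm f ∞ m := by
      intro z' hz'
      refine (ha z' hz').trans ?_
      calc _ ≤ ∑ z ∈ s, κ z' z * eLpNorm f ∞ m := by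
            gcongr
            exact Measure.restrict_le_self
        _ ≤ _ := by rw [← Finset.sum_mul]; gcongr; exact h1 z' hz'
    rw [eLpNorm_exponent_top]
    refine eLpNormEssSup_le_of_ae_enorm_bound ?_
    refine ae_restrict_of_ae_restrict_of_subset hA ?_
    rw [ae_restrict_biUnion_finset_iff]
    intro z' hz'
    have h4 := h3 z' hz'
    rw [eLpNorm_exponent_top] at h4
    filter_upwards [enorm_ae_le_eLpNormEssSup h (m'.restrict (cell z'))] with x hx
    exact hx.trans h4
  · have h0 : p ≠ 0 := (zero_lt_one.trans_le hp).ne'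
    have hp0 : 0 < p.toReal := ENNReal.toReal_pos h0 hpt
    have hp1 : 1 ≤ p.toReal := by
      rw [← ENNReal.toReal_one]; exact ENNReal.toReal_mono hpt hp
    rw [← ENNReal.rpow_le_rpow_iff hp0, ENNReal.mul_rpow_of_nonneg _ _ hp0.le,
      eLpNorm_rpow_toReal hp hpt, eLpNorm_rpow_toReal hp hpt]
    have h3 := sum_rpow_le_of_schur hp1 s s' κ _ _ ha h1 h2
    simp_rw [eLpNorm_rpow_toReal hp hpt] at h3
    calc _ ≤ ∫⁻ x in ⋃ z ∈ s', cell z, ‖h x‖ₑ ^ p.toReal ∂m' := lintegral_mono_set hA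
      _ ≤ ∑ z ∈ s', ∫⁻ x in cell z, ‖h x‖ₑ ^ p.toReal ∂m' := by
          rw [← lintegral_finsetSum_measure]
          refine lintegral_mono' ?_ le_rfl
          refine Measure.le_iff.2 fun B hB => ?_
          rw [Measure.restrict_apply hB, Measure.finsetSum_apply, inter_iUnion₂]
          refine (measure_biUnion_finset_le _ _).trans (Finset.sum_le_sum fun z _ => ?_)
          rw [Measure.restrict_apply hB]
      _ ≤ _ := h3
      _ ≤ _ := by
          gcongr
          rw [← lintegral_biUnion_finset hdis (fun z _ => hcell z)]
          exact setLIntegral_le_lintegral _ _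

/-- Gaussian bounds at the scale `√t` give uniform boundedness. -/
theorem ScaleBound.mem_boundedSet [Nonempty X] (hν : ν ≪ μ) (hD : HasGrowth ν D)
    (hTtr : 𝔹.TruncationContinuous T) (hp : 1 ≤ p) (h : 𝔹.ScaleBound ν T 1 p p) :
    p ∈ 𝔹.boundedSet ν T := by
  classical
  obtain ⟨c, C, hc, hC, h⟩ := h
  obtain ⟨K, hK, hKb⟩ := exists_rpow_le_exp_sq (D : ℝ) (ε := c / 2) (by positivity)
  obtain ⟨S, hS, hsum⟩ := hD.exists_sum_exp_le (show 0 < c / 2 by positivity)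
  obtain ⟨x₀⟩ := ‹Nonempty X›
  have : Nonempty X := ⟨x₀⟩
  set C' := C * 2 ^ D * K with hC'
  have hC'0 : 0 < C' := by positivity
  refine ⟨hp, (C' * S).toNNReal, fun t ht f hf => ?_⟩
  have hρ : 0 < √t := Real.sqrt_pos.2 ht
  simp only [one_mul] at h
  set ρ := √t with hρd
  have hρ2 : ρ ^ 2 = t := Real.sq_sqrt ht.le
  obtain ⟨Z⟩ := hD.exists_net hρ
  rw [← Measure.restrict_univ (μ := ν)]
  refine eLpNorm_le_of_forall_ball (𝔹.aesm _ hν) univ x₀ fun n => ?_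
  rw [inter_univ]
  rcases Nat.eq_zero_or_pos n with rfl | hn
  · simp
  refine 𝔹.eLpNorm_apply_le_of_trunc hTtr ht f (x := x₀) (ρ := n) (by exact_mod_cast hn)
    (hν.restrict _) fun R hR => ?_
  rw [Measure.restrict_univ]
  have hmemf : ∀ R' : ℝ, ∃ s : Finset X, (∀ z ∈ s, z ∈ Z.pts) ∧
      Metric.ball x₀ R' ⊆ ⋃ z ∈ s, Z.cell z := by
    intro R'
    refine ⟨(Z.finite_inter_ball hD hρ x₀ (R' + ρ)).toFinset, fun z hz => ?_, fun w hw => ?_⟩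
    · simp at hz; exact hz.1
    · obtain ⟨z, hz, hwz⟩ := Z.cover w
      refine mem_biUnion ?_ hwz
      have h1 := Z.subset z hwz
      rw [Metric.mem_ball] at h1 hw
      have := dist_triangle z w x₀
      rw [dist_comm z w] at this
      simp only [Finite.coe_toFinset]
      exact ⟨hz, by linarith⟩
  obtain ⟨s, hsZ, hcov⟩ := hmemf R
  obtain ⟨s', hsZ', hcov'⟩ := hmemf n
  have hdis : (s : Set X).PairwiseDisjoint Z.cell := Z.disjoint.subset hsZ
  have hdec : 𝔹.trunc (Metric.ball x₀ R) f =
      ∑ z ∈ s, 𝔹.trunc (Z.cell z ∩ Metric.ball x₀ R) f := by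
    rw [← 𝔹.trunc_biUnion s (fun z => Z.cell z ∩ Metric.ball x₀ R)
      (fun z => (Z.measurable z).inter measurableSet_ball)]
    · rw [← iUnion₂_inter, inter_eq_right.2 hcov]
    · exact hdis.mono fun z => inter_subset_left
  have pair : ∀ z' z, eLpNorm (𝔹.fn (T t (𝔹.trunc (Z.cell z ∩ Metric.ball x₀ R) f)) : X → 𝕜) p
      (ν.restrict (Z.cell z')) ≤ ENNReal.ofReal (C' * Real.exp (-(c / 2 * dist z z' ^ 2 / ρ ^ 2))) *
        eLpNorm (𝔹.fn f : X → 𝕜) p (ν.restrict (Z.cell z)) := by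
    intro z' z
    have hm : MeasurableSet (Z.cell z ∩ Metric.ball x₀ R) := (Z.measurable z).inter measurableSet_ball
    have hsub : Z.cell z ∩ Metric.ball x₀ R ⊆ Metric.ball z ρ := inter_subset_left.trans (Z.subset z)
    set g := 𝔹.trunc (Z.cell z ∩ Metric.ball x₀ R) f with hg
    have k1 := h t ht z z' g (𝔹.memLp_trunc hν hm (hf.restrict _)) (𝔹.supp_trunc hm hsub f)
    set V := ν (Metric.ball z ρ)
    set V' := ν (Metric.ball z' ρ)
    set e := (1 / p).toReal
    have he : 0 ≤ e := ENNReal.toReal_nonneg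
    have hV0 : V ≠ 0 := hD.pos _ _ hρ
    have hVt : V ≠ ∞ := hD.fin _ _
    set d := dist z z' with hd
    have hds : 0 ≤ d / ρ := by positivity
    -- The averages on the two sides are normalised by different balls. The ratio of their volumes
    -- is polynomial in `d / ρ`, and half of the Gaussian absorbs it.
    have hVV : V' ^ e ≤ ENNReal.ofReal ((2 * (1 + d / ρ)) ^ D) * V ^ e := by
      have k2 : V' ≤ ENNReal.ofReal ((2 * (1 + d / ρ)) ^ D) * V := by
        refine hD.growth_of_subset hρ (by linarith) (Metric.ball_subset_ball' ?_)
        rw [add_mul, div_mul_cancel₀ _ hρ.ne', dist_comm z' z]; linarith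
      calc V' ^ e ≤ (ENNReal.ofReal ((2 * (1 + d / ρ)) ^ D) * V) ^ e :=
            ENNReal.rpow_le_rpow k2 he
        _ = ENNReal.ofReal ((2 * (1 + d / ρ)) ^ D) ^ e * V ^ e :=
            ENNReal.mul_rpow_of_nonneg _ _ he
        _ ≤ _ := by
            gcongr
            refine rpow_one_div_le ?_ hp
            rw [ENNReal.one_le_ofReal]
            exact one_le_pow₀ (by linarith)
    have k3 : eLpNorm (𝔹.fn g : X → 𝕜) p (ν.restrict (Metric.ball z ρ)) ≤
        eLpNorm (𝔹.fn f : X → 𝕜) p (ν.restrict (Z.cell z)) := by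
      rw [𝔹.eLpNorm_of_supp hν measurableSet_ball (𝔹.supp_trunc hm hsub f), 𝔹.eLpNorm_trunc hν hm]
      exact eLpNorm_mono_measure _ (Measure.restrict_mono inter_subset_left le_rfl)
    have hVe0 : V ^ e ≠ 0 := (ENNReal.rpow_pos (pos_iff_ne_zero.2 hV0) hVt).ne'
    have hVet : V ^ e ≠ ∞ := (ENNReal.rpow_lt_top_of_nonneg he hVt).ne
    calc _ ≤ eLpNorm (𝔹.fn (T t g) : X → 𝕜) p (ν.restrict (Metric.ball z' ρ)) :=
          eLpNorm_mono_measure _ (Measure.restrict_mono (Z.subset z') le_rfl)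
      _ = V' ^ e * avgNorm ν p (Metric.ball z' ρ) (Metric.ball z' ρ) (𝔹.fn (T t g) : X → 𝕜) :=
          eLpNorm_restrict_eq_avgNorm (hD.pos _ _ hρ) (hD.fin _ _) _ _ _
      _ ≤ (ENNReal.ofReal ((2 * (1 + d / ρ)) ^ D) * V ^ e) *
            (ENNReal.ofReal (C * Real.exp (-(c * d ^ 2 / t))) *
            ((V ^ e)⁻¹ * eLpNorm (𝔹.fn f : X → 𝕜) p (ν.restrict (Z.cell z)))) := by
          refine mul_le_mul' hVV (k1.trans (mul_le_mul_right ?_ _))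
          rw [avgNorm_eq_mul hVt]
          exact mul_le_mul_right k3 _
      _ = (V ^ e * (V ^ e)⁻¹) * (ENNReal.ofReal ((2 * (1 + d / ρ)) ^ D) *
            ENNReal.ofReal (C * Real.exp (-(c * d ^ 2 / t)))) *
            eLpNorm (𝔹.fn f : X → 𝕜) p (ν.restrict (Z.cell z)) := by ring
      _ ≤ _ := by
          rw [ENNReal.mul_inv_cancel hVe0 hVet, one_mul, ← ENNReal.ofReal_mul (by positivity)]
          refine mul_le_mul_left (ENNReal.ofReal_le_ofReal ?_) _
          have k4 := hKb (d / ρ) hds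
          rw [Real.rpow_natCast, div_pow] at k4
          calc (2 * (1 + d / ρ)) ^ D * (C * Real.exp (-(c * d ^ 2 / t)))
              = 2 ^ D * (1 + d / ρ) ^ D * (C * Real.exp (-(c * d ^ 2 / t))) := by rw [mul_pow]
            _ ≤ 2 ^ D * (K * Real.exp (c / 2 * (d ^ 2 / ρ ^ 2))) *
                  (C * Real.exp (-(c * d ^ 2 / t))) := by gcongr
            _ = C' * (Real.exp (c / 2 * (d ^ 2 / ρ ^ 2)) * Real.exp (-(c * d ^ 2 / t))) := by
                rw [hC']; ring
            _ = _ := by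
                rw [← Real.exp_add, hρ2]
                congr 2
                ring
  have hsep : ∀ s : Finset X, (∀ z ∈ s, z ∈ Z.pts) → ∀ y,
      ∑ z ∈ s, ENNReal.ofReal (C' * Real.exp (-(c / 2 * dist z y ^ 2 / ρ ^ 2))) ≤
        ENNReal.ofReal (C' * S) := by
    intro s hs y
    rw [← ENNReal.ofReal_sum_of_nonneg (fun z _ => by positivity), ← Finset.mul_sum]
    refine ENNReal.ofReal_le_ofReal (mul_le_mul_of_nonneg_left ?_ hC'0.le)
    exact hsum ρ hρ s (Z.separated.mono hs) y
  refine eLpNorm_le_of_schur hp s s' Z.cell Z.measurable hdis _ hcov' _ _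
    (fun z' z => ENNReal.ofReal (C' * Real.exp (-(c / 2 * dist z z' ^ 2 / ρ ^ 2)))) ?_ ?_ ?_
  · intro z' _
    rw [hdec, map_sum]
    exact (𝔹.eLpNorm_fn_sum_le s _ (Measure.absolutelyContinuous_restrict.trans hν) hp).trans
      (Finset.sum_le_sum fun z _ => pair z' z)
  · intro z' _
    exact hsep s hsZ z'
  · intro z _
    simp_rw [dist_comm z]
    exact hsep s' hsZ' z

end FunctionSpace

/-- Logarithmic convexity of the `L^q` norms in `1/q`. -/
theorem eLpNorm_le_rpow_mul_rpow {X F : Type*} [MeasurableSpace X] [NormedAddCommGroup F]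
    {m : Measure X} {q q₁ q₂ : ℝ≥0∞} (hq : 1 ≤ q) (hq₁ : 1 ≤ q₁) (hq₂ : 1 ≤ q₂) {θ : ℝ}
    (h0 : 0 < θ) (h1 : θ < 1)
    (h : q.toReal⁻¹ = (1 - θ) * q₁.toReal⁻¹ + θ * q₂.toReal⁻¹) {f : X → F}
    (hf : AEStronglyMeasurable f m) :
    eLpNorm f q m ≤ eLpNorm f q₁ m ^ (1 - θ) * eLpNorm f q₂ m ^ θ := by
  have h1' : 0 < 1 - θ := by linarith
  have hfin : ∀ {r : ℝ≥0∞}, 1 ≤ r → r⁻¹ ≠ ∞ := fun hr =>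
    ENNReal.inv_ne_top.2 (zero_lt_one.trans_le hr).ne'
  have key : q₁⁻¹ * ENNReal.ofReal (1 - θ) + q₂⁻¹ * ENNReal.ofReal θ = q⁻¹ := by
    have t1 := ENNReal.mul_ne_top (hfin hq₁) (ENNReal.ofReal_ne_top (r := 1 - θ))
    have t2 := ENNReal.mul_ne_top (hfin hq₂) (ENNReal.ofReal_ne_top (r := θ))
    rw [← ENNReal.toReal_eq_toReal_iff' (ENNReal.add_ne_top.2 ⟨t1, t2⟩) (hfin hq),
      ENNReal.toReal_add t1 t2, ENNReal.toReal_mul, ENNReal.toReal_mul, ENNReal.toReal_inv,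
      ENNReal.toReal_inv, ENNReal.toReal_inv, ENNReal.toReal_ofReal h1'.le,
      ENNReal.toReal_ofReal h0.le, h]
    ring
  have o1 : ENNReal.ofReal (1 - θ) ≠ 0 := by simpa using h1
  have o2 : ENNReal.ofReal θ ≠ 0 := by simpa using h0
  have : ENNReal.HolderTriple (q₁ / ENNReal.ofReal (1 - θ)) (q₂ / ENNReal.ofReal θ) q := by
    constructor
    rw [ENNReal.inv_div (Or.inl ENNReal.ofReal_ne_top) (Or.inl o1),
      ENNReal.inv_div (Or.inl ENNReal.ofReal_ne_top) (Or.inl o2), ← key, div_eq_mul_inv,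
      div_eq_mul_inv, mul_comm, mul_comm (ENNReal.ofReal θ)]
  have e : ∀ x, ‖f x‖ = ‖((fun x => ‖f x‖ ^ (1 - θ)) • fun x => ‖f x‖ ^ θ) x‖ := by
    intro x
    rw [Pi.smul_apply', smul_eq_mul, Real.norm_of_nonneg (by positivity)]
    rcases eq_or_ne (‖f x‖) 0 with h0' | h0'
    · rw [h0', Real.zero_rpow h1'.ne', zero_mul]
    · rw [← Real.rpow_add (by positivity), sub_add_cancel, Real.rpow_one]
  calc eLpNorm f q m = eLpNorm ((fun x => ‖f x‖ ^ (1 - θ)) • fun x => ‖f x‖ ^ θ) q m :=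
        eLpNorm_congr_norm_ae (Eventually.of_forall e)
    _ ≤ eLpNorm (fun x => ‖f x‖ ^ (1 - θ)) (q₁ / ENNReal.ofReal (1 - θ)) m *
          eLpNorm (fun x => ‖f x‖ ^ θ) (q₂ / ENNReal.ofReal θ) m := by
        refine eLpNorm_smul_le_mul_eLpNorm ?_ ?_
        · exact (hf.norm.aemeasurable.pow_const _).aestronglyMeasurable
        · exact (hf.norm.aemeasurable.pow_const _).aestronglyMeasurable
    _ = _ := by
        rw [eLpNorm_norm_rpow _ h1', eLpNorm_norm_rpow _ h0,
          ENNReal.div_mul_cancel o1 ENNReal.ofReal_ne_top,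
          ENNReal.div_mul_cancel o2 ENNReal.ofReal_ne_top]

/-- Fatou: an `L^q` bound survives convergence in some `L^{q₁}`. -/
theorem eLpNorm_le_of_tendsto {X F : Type*} [MeasurableSpace X] [NormedAddCommGroup F]
    {m : Measure X} {q q₁ M : ℝ≥0∞} (hq₁ : q₁ ≠ 0) {f : ℕ → X → F} {g : X → F}
    (hf : ∀ n, AEStronglyMeasurable (f n) m) (hg : AEStronglyMeasurable g m)
    (hfg : Tendsto (fun n => eLpNorm (f n - g) q₁ m) atTop (𝓝 0))
    (hM : ∀ n, eLpNorm (f n) q m ≤ M) : eLpNorm g q m ≤ M := by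
  obtain ⟨ns, -, hlim⟩ := (tendstoInMeasure_of_tendsto_eLpNorm hq₁ hf hg hfg).exists_seq_tendsto_ae
  refine (Lp.eLpNorm_lim_le_liminf_eLpNorm (fun n => hf (ns n)) _ hlim).trans ?_
  exact liminf_le_of_frequently_le' (Frequently.of_forall fun n => hM _)

/-- The slice between heights `2 ^ k` and `2 ^ (k + 1)` lives on a set of measure at most `2 ^ (-k *
p)`. Its contribution, with exponent `u`, is geometric of ratio `2 ^ (1 - p * u)`, summable exactly
when `u > 1 / p`. -/
theorem two_rpow_level {p u : ℝ} (k : ℕ) :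
    (((2 : ℝ≥0∞) ^ k)⁻¹ ^ p) ^ u * 2 ^ (k + 1) = 2 * ((2 : ℝ≥0∞) ^ (1 - p * u)) ^ k := by
  have h2 : (2 : ℝ≥0∞) ≠ 0 := by norm_num
  have h2' : (2 : ℝ≥0∞) ≠ ∞ := by norm_num
  rw [pow_succ, ← ENNReal.rpow_natCast, ← ENNReal.rpow_natCast, ← ENNReal.rpow_neg,
    ← ENNReal.rpow_mul, ← ENNReal.rpow_mul, ← ENNReal.rpow_mul, ← mul_assoc,
    ← ENNReal.rpow_add _ _ h2 h2', mul_comm]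
  congr 2
  ring

/-! ### Interpolation along dyadic level sets. -/

namespace FunctionSpace

variable {X : Type*} [MetricSpace X] [MeasurableSpace X]
  {𝕜 : Type*} [RCLike 𝕜] {μ : Measure X} {E : Type*}
  [NormedAddCommGroup E] [NormedSpace 𝕜 E] (𝔹 : FunctionSpace 𝕜 μ E)

theorem Supp.trunc {f : E} {A B : Set X} (h : 𝔹.Supp f A) (hB : MeasurableSet B) :
    𝔹.Supp (𝔹.trunc B f) A := by
  have h' := h
  unfold Supp at h'
  filter_upwards [h', 𝔹.fn_trunc hB f] with x h1 h2
  by_cases hA : x ∈ A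
  · rw [indicator_of_mem hA]
  · rw [indicator_of_notMem hA] at h1 ⊢
    rw [h2, indicator_apply_eq_zero]
    exact fun _ => h1

theorem measurableSet_level (f : E) (a : ℝ≥0∞) :
    MeasurableSet {x | ‖(𝔹.fn f : X → 𝕜) x‖ₑ ≤ a} :=
  measurableSet_le (𝔹.fn f).stronglyMeasurable.enorm measurable_const

/-- Interpolation between two strong type bounds with a loss in the first exponent, by splitting
a function along its dyadic level sets. -/
theorem eLpNorm_apply_le_of_interpolate {T : E →L[𝕜] E} {m m' : Measure X} (hm : m ≪ μ)
    (hm' : m' ≪ μ) (hm1 : m univ ≤ 1) {p p₁ p₂ q q₁ q₂ : ℝ≥0∞} (hp : 1 ≤ p) (hpt : p ≠ ∞)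
    (hp₁ : 1 ≤ p₁) (hp₂ : 1 ≤ p₂) (hq : 1 ≤ q) (hq₁ : 1 ≤ q₁) (hq₂ : 1 ≤ q₂) {θ : ℝ}
    (h0 : 0 < θ) (h1 : θ < 1)
    (hu : p.toReal⁻¹ < (1 - θ) * p₁.toReal⁻¹ + θ * p₂.toReal⁻¹)
    (hv : q.toReal⁻¹ = (1 - θ) * q₁.toReal⁻¹ + θ * q₂.toReal⁻¹)
    {A : Set X} {M₁ M₂ : ℝ≥0∞} (hM₁ : M₁ ≠ ∞) (hM₂ : M₂ ≠ ∞)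
    (H₁ : ∀ g : E, 𝔹.Supp g A → eLpNorm (𝔹.fn g : X → 𝕜) p₁ m ≠ ∞ →
      eLpNorm (𝔹.fn (T g) : X → 𝕜) q₁ m' ≤ M₁ * eLpNorm (𝔹.fn g : X → 𝕜) p₁ m)
    (H₂ : ∀ g : E, 𝔹.Supp g A → eLpNorm (𝔹.fn g : X → 𝕜) p₂ m ≠ ∞ →
      eLpNorm (𝔹.fn (T g) : X → 𝕜) q₂ m' ≤ M₂ * eLpNorm (𝔹.fn g : X → 𝕜) p₂ m)
    (g : E) (hg : 𝔹.Supp g A) (hga : eLpNorm (𝔹.fn g : X → 𝕜) p m ≠ ∞) :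
    eLpNorm (𝔹.fn (T g) : X → 𝕜) q m' ≤
      M₁ ^ (1 - θ) * M₂ ^ θ * (1 + 2 * (1 - (2 : ℝ≥0∞) ^ (1 - p.toReal *
        ((1 - θ) * p₁.toReal⁻¹ + θ * p₂.toReal⁻¹)))⁻¹) * eLpNorm (𝔹.fn g : X → 𝕜) p m := by
  have h1' : 0 < 1 - θ := by linarith
  have hp0 : p ≠ 0 := (zero_lt_one.trans_le hp).ne'
  have hpr : 0 < p.toReal := ENNReal.toReal_pos hp0 hpt
  have ae : ∀ f : E, AEStronglyMeasurable (𝔹.fn f : X → 𝕜) m' := fun f => 𝔹.aesm f hm'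
  set u := (1 - θ) * p₁.toReal⁻¹ + θ * p₂.toReal⁻¹ with hud
  set a := eLpNorm (𝔹.fn g : X → 𝕜) p m with ha
  set M := M₁ ^ (1 - θ) * M₂ ^ θ with hM
  set r := (2 : ℝ≥0∞) ^ (1 - p.toReal * u) with hr
  have logc : ∀ f : E, eLpNorm (𝔹.fn (T f) : X → 𝕜) q m' ≤
      eLpNorm (𝔹.fn (T f) : X → 𝕜) q₁ m' ^ (1 - θ) * eLpNorm (𝔹.fn (T f) : X → 𝕜) q₂ m' ^ θ :=
    fun f => eLpNorm_le_rpow_mul_rpow hq hq₁ hq₂ h0 h1 hv (ae _)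
  rcases eq_or_ne a 0 with ha0 | ha0
  · have hg0 : (𝔹.fn g : X → 𝕜) =ᵐ[m] 0 :=
      (eLpNorm_eq_zero_iff (𝔹.aesm g hm) hp0).1 ha0
    have z1 : eLpNorm (𝔹.fn g : X → 𝕜) p₁ m = 0 := by rw [eLpNorm_congr_ae hg0, eLpNorm_zero]
    have k1 := H₁ g hg (by rw [z1]; exact ENNReal.zero_ne_top)
    rw [z1, mul_zero] at k1
    have k2 := logc g
    rw [le_antisymm k1 bot_le, ENNReal.zero_rpow_of_pos h1', zero_mul] at k2
    exact k2.trans bot_le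
  -- the level sets
  set G : ℕ → Set X := fun k => {x | ‖(𝔹.fn g : X → 𝕜) x‖ₑ ≤ 2 ^ k * a} with hG
  have hGm : ∀ k, MeasurableSet (G k) := fun k => 𝔹.measurableSet_level g _
  have h2k : ∀ k : ℕ, (2 : ℝ≥0∞) ^ k * a ≠ 0 := fun k =>
    mul_ne_zero (pow_ne_zero _ (by norm_num)) ha0
  have h2kt : ∀ k : ℕ, (2 : ℝ≥0∞) ^ k * a ≠ ∞ := fun k =>
    ENNReal.mul_ne_top (ENNReal.pow_ne_top (by norm_num)) hga
  have hGc : ∀ k, m (G k)ᶜ ≤ ((2 : ℝ≥0∞) ^ k)⁻¹ ^ p.toReal := by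
    intro k
    have c1 := meas_ge_le_mul_pow_eLpNorm_enorm m hp0 hpt (𝔹.aesm g hm) (h2k k)
      (fun h => absurd h (h2kt k))
    rw [← ENNReal.mul_rpow_of_nonneg _ _ hpr.le, ENNReal.mul_inv (Or.inr hga) (Or.inr ha0),
      mul_assoc, ENNReal.inv_mul_cancel ha0 hga, mul_one] at c1
    refine (measure_mono fun x hx => ?_).trans c1
    simp only [hG, mem_compl_iff, mem_ofPred_eq, not_le] at hx ⊢
    exact hx.le
  -- A slice of height at most `b` on a set of measure at most `y` has L^p' norm at most `b * y ^ (1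
  -- / p')` for every `p'`. Both endpoint bounds apply to it, and logarithmic convexity of the
  -- target norms combines them into `y ^ u * b`.
  have level : ∀ (S : Set X), MeasurableSet S → ∀ b : ℝ≥0∞, b ≠ ∞ →
      (∀ x ∈ S, ‖(𝔹.fn g : X → 𝕜) x‖ₑ ≤ b) → ∀ y : ℝ≥0∞, y ≤ 1 → m S ≤ y →
      eLpNorm (𝔹.fn (T (𝔹.trunc S g)) : X → 𝕜) q m' ≤ M * (y ^ u * b) := by
    intro S hS b hb hSb y hy1 hy
    have hyt : y ≠ ∞ := ne_top_of_le_ne_top ENNReal.one_ne_top hy1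
    have e1 : ∀ p' : ℝ≥0∞, eLpNorm (𝔹.fn (𝔹.trunc S g) : X → 𝕜) p' m ≤ b * y ^ p'.toReal⁻¹ := by
      intro p'
      rw [𝔹.eLpNorm_trunc hm hS]
      refine (eLpNorm_le_of_ae_enorm_bound (C := b) ?_).trans ?_
      · exact (ae_restrict_iff' hS).2 (Eventually.of_forall hSb)
      · rw [smul_eq_mul, Measure.restrict_apply_univ]
        gcongr
    have e2 : ∀ p' : ℝ≥0∞, b * y ^ p'.toReal⁻¹ ≠ ∞ := fun p' =>
      ENNReal.mul_ne_top hb (ENNReal.rpow_lt_top_of_nonneg (by positivity) hyt).ne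
    have hs := hg.trunc 𝔹 hS
    have k1 := (H₁ _ hs (ne_top_of_le_ne_top (e2 _) (e1 p₁))).trans (mul_le_mul_right (e1 p₁) _)
    have k2 := (H₂ _ hs (ne_top_of_le_ne_top (e2 _) (e1 p₂))).trans (mul_le_mul_right (e1 p₂) _)
    calc _ ≤ (M₁ * (b * y ^ p₁.toReal⁻¹)) ^ (1 - θ) * (M₂ * (b * y ^ p₂.toReal⁻¹)) ^ θ :=
          (logc _).trans (mul_le_mul' (ENNReal.rpow_le_rpow k1 h1'.le)
            (ENNReal.rpow_le_rpow k2 h0.le))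
      _ = M * ((y ^ (p₁.toReal⁻¹ * (1 - θ)) * y ^ (p₂.toReal⁻¹ * θ)) *
            (b ^ (1 - θ) * b ^ θ)) := by
          simp only [ENNReal.mul_rpow_of_nonneg _ _ h1'.le, ENNReal.mul_rpow_of_nonneg _ _ h0.le,
            ENNReal.rpow_mul, hM]
          ring
      _ = _ := by
          rw [← ENNReal.rpow_add_of_nonneg _ _ h1'.le h0.le, sub_add_cancel, ENNReal.rpow_one,
            ← ENNReal.rpow_add_of_nonneg _ _ (by positivity) (by positivity), hud]
          congr 3
          ring
  -- sums over the levels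
  have sums : ∀ N : ℕ, eLpNorm (𝔹.fn (T (𝔹.trunc (G N) g)) : X → 𝕜) q m' ≤
      M * a * (1 + 2 * ∑ k ∈ Finset.range N, r ^ k) := by
    intro N
    induction N with
    | zero =>
      have := level (G 0) (hGm 0) _ (h2kt 0) (fun x hx => hx) 1 le_rfl
        ((measure_mono (subset_univ _)).trans hm1)
      rw [ENNReal.one_rpow, pow_zero, one_mul, one_mul] at this
      simpa using this
    | succ N ih =>
      have hdisj : Disjoint (G N) (G (N + 1) \ G N) := disjoint_sdiff_right
      have hun : G (N + 1) = G N ∪ (G (N + 1) \ G N) := by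
        rw [union_sdiff_self, union_eq_right.2]
        intro x hx
        simp only [hG, mem_ofPred_eq] at hx ⊢
        refine hx.trans ?_
        gcongr
        · norm_num
        · omega
      have hlev := level (G (N + 1) \ G N) ((hGm _).diff (hGm _)) _ (h2kt (N + 1))
        (fun x hx => hx.1) (((2 : ℝ≥0∞) ^ N)⁻¹ ^ p.toReal)
        (ENNReal.rpow_le_one (ENNReal.inv_le_one.2 (one_le_pow₀ (by norm_num))) hpr.le)
        ((measure_mono fun x hx => hx.2).trans (hGc N))
      rw [← mul_assoc (_ ^ u), two_rpow_level] at hlev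
      rw [hun, 𝔹.trunc_union (hGm N) ((hGm _).diff (hGm _)) hdisj, map_add,
        Finset.sum_range_succ]
      calc _ ≤ M * a * (1 + 2 * ∑ k ∈ Finset.range N, r ^ k) + M * (2 * r ^ N * a) :=
            (𝔹.eLpNorm_fn_add_le _ _ hm' hq).trans (add_le_add ih hlev)
        _ = _ := by ring
  have bound : ∀ N : ℕ, eLpNorm (𝔹.fn (T (𝔹.trunc (G N) g)) : X → 𝕜) q m' ≤
      M * (1 + 2 * (1 - r)⁻¹) * a := by
    intro N
    refine (sums N).trans ?_
    rw [mul_right_comm]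
    gcongr
    rw [← ENNReal.tsum_geometric]
    exact ENNReal.sum_le_tsum _
  -- passage to the limit
  obtain ⟨p', q', M', hq', hM', hp', H⟩ : ∃ p' q' M' : ℝ≥0∞, 1 ≤ q' ∧ M' ≠ ∞ ∧
      (1 ≤ p' ∧ p.toReal⁻¹ < p'.toReal⁻¹) ∧
      ∀ g : E, 𝔹.Supp g A → eLpNorm (𝔹.fn g : X → 𝕜) p' m ≠ ∞ →
        eLpNorm (𝔹.fn (T g) : X → 𝕜) q' m' ≤ M' * eLpNorm (𝔹.fn g : X → 𝕜) p' m := by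
    -- A weighted mean of the two endpoint reciprocals exceeds `1 / p`, so one endpoint exponent
    -- lies strictly below `p`. In that exponent the truncations to the level sets converge to `g`,
    -- and the operator is bounded.
    rcases lt_or_ge p.toReal⁻¹ p₁.toReal⁻¹ with hlt | hge
    · exact ⟨p₁, q₁, M₁, hq₁, hM₁, ⟨hp₁, hlt⟩, H₁⟩
    · refine ⟨p₂, q₂, M₂, hq₂, hM₂, ⟨hp₂, ?_⟩, H₂⟩
      by_contra hcon
      have c1 : (1 - θ) * p₁.toReal⁻¹ ≤ (1 - θ) * p.toReal⁻¹ := by gcongr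
      have c2 : θ * p₂.toReal⁻¹ ≤ θ * p.toReal⁻¹ :=
        mul_le_mul_of_nonneg_left (not_lt.1 hcon) h0.le
      linarith
  have hp'0 : 0 < p'.toReal := by
    have : 0 < p'.toReal⁻¹ := lt_trans (by positivity) hp'.2
    exact inv_pos.1 this
  have hp't : p' ≠ ∞ := fun h => by simp [h] at hp'0
  have hp'p : p' ≤ p := by
    rw [← ENNReal.toReal_le_toReal hp't hpt]
    exact ((inv_lt_inv₀ hpr hp'0).1 hp'.2).le
  have hη : 0 < 1 / p'.toReal - 1 / p.toReal := by
    rw [one_div, one_div]; linarith [hp'.2]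
  have small : ∀ N, eLpNorm (𝔹.fn (g - 𝔹.trunc (G N) g) : X → 𝕜) p' m ≤
      a * (((2 : ℝ≥0∞) ^ N)⁻¹ ^ p.toReal) ^ (1 / p'.toReal - 1 / p.toReal) := by
    intro N
    have e1 : (𝔹.fn (g - 𝔹.trunc (G N) g) : X → 𝕜) =ᵐ[μ] (G N)ᶜ.indicator (𝔹.fn g) := by
      filter_upwards [𝔹.fn_sub g (𝔹.trunc (G N) g), 𝔹.fn_trunc (hGm N) g] with x k1 k2
      rw [k1, Pi.sub_apply, k2, indicator_compl, Pi.sub_apply]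
    rw [eLpNorm_congr_ae (hm.ae_le e1), eLpNorm_indicator_eq_eLpNorm_restrict (hGm N).compl]
    refine (eLpNorm_le_eLpNorm_mul_rpow_measure_univ hp'p (𝔹.aesm g
      (Measure.absolutelyContinuous_restrict.trans hm))).trans ?_
    rw [Measure.restrict_apply_univ]
    exact mul_le_mul' (eLpNorm_mono_measure _ Measure.restrict_le_self)
      (ENNReal.rpow_le_rpow (hGc N) hη.le)
  have tend0 : Tendsto (fun N : ℕ => a * (((2 : ℝ≥0∞) ^ N)⁻¹ ^ p.toReal) ^
      (1 / p'.toReal - 1 / p.toReal)) atTop (𝓝 0) := by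
    have t1 : Tendsto (fun N : ℕ => ((2 : ℝ≥0∞) ^ N)⁻¹) atTop (𝓝 0) := by
      simp_rw [ENNReal.inv_pow]
      exact ENNReal.tendsto_pow_atTop_nhds_zero_of_lt_one (by norm_num)
    have t2 := ((ENNReal.continuous_rpow_const (y := p.toReal)).tendsto 0).comp t1
    rw [ENNReal.zero_rpow_of_pos hpr] at t2
    have t3 := ((ENNReal.continuous_rpow_const (y := 1 / p'.toReal - 1 / p.toReal)).tendsto 0).comp t2
    rw [ENNReal.zero_rpow_of_pos hη] at t3
    have t4 := ENNReal.Tendsto.const_mul t3 (Or.inr hga)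
    rw [mul_zero] at t4
    exact t4
  refine eLpNorm_le_of_tendsto (q₁ := q') (zero_lt_one.trans_le hq').ne' (fun N => ae _) (ae _) ?_
    bound
  have tend1 : Tendsto (fun N : ℕ => M' * (a * (((2 : ℝ≥0∞) ^ N)⁻¹ ^ p.toReal) ^
      (1 / p'.toReal - 1 / p.toReal))) atTop (𝓝 0) := by
    have := ENNReal.Tendsto.const_mul tend0 (Or.inr hM')
    rwa [mul_zero] at this
  refine tendsto_of_tendsto_of_tendsto_of_le_of_le tendsto_const_nhds tend1 (fun _ => bot_le)
    fun N => ?_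
  have e2 : eLpNorm (⇑(𝔹.fn (T (𝔹.trunc (G N) g))) - ⇑(𝔹.fn (T g)) : X → 𝕜) q' m' =
      eLpNorm (𝔹.fn (T (g - 𝔹.trunc (G N) g)) : X → 𝕜) q' m' := by
    rw [eLpNorm_sub_comm, map_sub]
    exact (eLpNorm_congr_ae (hm'.ae_le (𝔹.fn_sub _ _))).symm
  have hsupp : 𝔹.Supp (g - 𝔹.trunc (G N) g) A := by
    have k0 := hg
    unfold Supp at k0
    have k3 := hg.trunc 𝔹 (hGm N)
    unfold Supp at k3
    filter_upwards [𝔹.fn_sub g (𝔹.trunc (G N) g), k0, k3] with x k1 k2 k3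
    by_cases hA : x ∈ A
    · rw [indicator_of_mem hA]
    · rw [indicator_of_notMem hA] at k2 k3 ⊢
      rw [k1, Pi.sub_apply, k2, k3, sub_zero]
  have hfin : a * (((2 : ℝ≥0∞) ^ N)⁻¹ ^ p.toReal) ^ (1 / p'.toReal - 1 / p.toReal) ≠ ∞ := by
    refine ENNReal.mul_ne_top hga (ENNReal.rpow_lt_top_of_nonneg hη.le
      (ENNReal.rpow_lt_top_of_nonneg hpr.le ?_).ne).ne
    exact ENNReal.inv_ne_top.2 (pow_ne_zero _ (by norm_num))
  change eLpNorm (⇑(𝔹.fn (T (𝔹.trunc (G N) g))) - ⇑(𝔹.fn (T g)) : X → 𝕜) q' m' ≤ _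
  rw [e2]
  exact (H _ hsupp (ne_top_of_le_ne_top hfin (small N))).trans (mul_le_mul_right (small N) _)

end FunctionSpace

/-- Since `∞.toReal = 0` and `0⁻¹ = 0`, the expression `q.toReal⁻¹` is the true reciprocal for every
exponent, infinity included. Interpolation is written in it throughout. -/
theorem inv_toReal_lt_inv_toReal {p q : ℝ≥0∞} (hp : 1 ≤ p) (hpq : p < q) :
    q.toReal⁻¹ < p.toReal⁻¹ := by
  have hp0 : 0 < p.toReal := ENNReal.toReal_pos (zero_lt_one.trans_le hp).ne' hpq.ne_top
  rcases eq_or_ne q ∞ with rfl | hq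
  · simpa using hp0
  · exact inv_strictAnti₀ hp0 ((ENNReal.toReal_lt_toReal hpq.ne_top hq).2 hpq)

theorem inv_toReal_le_inv_toReal {p q : ℝ≥0∞} (hp : 1 ≤ p) (hpq : p ≤ q) :
    q.toReal⁻¹ ≤ p.toReal⁻¹ := by
  rcases hpq.eq_or_lt with rfl | h
  · exact le_rfl
  · exact (inv_toReal_lt_inv_toReal hp h).le

theorem lt_of_inv_toReal_lt {p q : ℝ≥0∞} (hq : 1 ≤ q) (h : q.toReal⁻¹ < p.toReal⁻¹) : p < q := by
  by_contra hcon
  exact absurd (inv_toReal_le_inv_toReal hq (not_lt.1 hcon)) (not_le.2 h)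

theorem inv_toReal_le_one {p : ℝ≥0∞} (hp : 1 ≤ p) : p.toReal⁻¹ ≤ 1 := by
  simpa using inv_toReal_le_inv_toReal le_rfl hp

theorem exists_inv_toReal_eq {v : ℝ} (h0 : 0 ≤ v) (h1 : v ≤ 1) :
    ∃ q : ℝ≥0∞, 1 ≤ q ∧ q.toReal⁻¹ = v := by
  refine ⟨(ENNReal.ofReal v)⁻¹, ?_, ?_⟩
  · rw [ENNReal.one_le_inv]; exact ENNReal.ofReal_le_one.2 h1
  · rw [ENNReal.toReal_inv, inv_inv, ENNReal.toReal_ofReal h0]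

/-! ### Gaussian bounds of arbitrary rate; order structure of the exponents. -/

namespace FunctionSpace

variable {X : Type*} [MetricSpace X] [MeasurableSpace X] [OpensMeasurableSpace X]
  {𝕜 : Type*} [RCLike 𝕜] {μ : Measure X} {E : Type*}
  [NormedAddCommGroup E] [NormedSpace 𝕜 E] (𝔹 : FunctionSpace 𝕜 μ E)
  {ν : Measure X} {D : ℕ} {T : ℝ → E →L[𝕜] E}

/-- Gaussian bounds at the scale `√t` with a rate `c` of arbitrary sign. -/
def GaussBound (ν : Measure X) (T : ℝ → E →L[𝕜] E) (p q : ℝ≥0∞) (c : ℝ) : Prop :=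
  ∃ C : ℝ, 0 < C ∧ ∀ t : ℝ, 0 < t → ∀ x y : X,
    𝔹.LocalBound ν (T t) p q x y (√t)
      (ENNReal.ofReal (C * Real.exp (-(c * dist x y ^ 2 / t))))

theorem scaleBound_iff {p q : ℝ≥0∞} :
    𝔹.ScaleBound ν T 1 p q ↔ ∃ c, 0 < c ∧ 𝔹.GaussBound ν T p q c := by
  simp only [ScaleBound, GaussBound, one_mul]
  constructor
  · rintro ⟨c, C, hc, hC, h⟩; exact ⟨c, hc, C, hC, h⟩
  · rintro ⟨c, hc, C, hC, h⟩; exact ⟨c, C, hc, hC, h⟩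

theorem GaussBound.mono {p q : ℝ≥0∞} {c c' : ℝ} (hc : c' ≤ c) (h : 𝔹.GaussBound ν T p q c) :
    𝔹.GaussBound ν T p q c' := by
  obtain ⟨C, hC, h⟩ := h
  refine ⟨C, hC, fun t ht x y g hg hgs => (h t ht x y g hg hgs).trans ?_⟩
  gcongr

/-- The constants combine as `M₁ ^ (1 - θ) * M₂ ^ θ`, so the rates combine linearly whatever their
signs. The strict inequality in `hu` makes the geometric series over the level sets finite. -/
theorem GaussBound.interpolate (hν : ν ≪ μ) (hD : HasGrowth ν D)
    {p p₁ p₂ q q₁ q₂ : ℝ≥0∞} (hp : 1 ≤ p) (hpt : p ≠ ∞)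
    (hp₁ : 1 ≤ p₁) (hp₂ : 1 ≤ p₂) (hq : 1 ≤ q) (hq₁ : 1 ≤ q₁) (hq₂ : 1 ≤ q₂) {θ : ℝ}
    (h0 : 0 < θ) (h1 : θ < 1)
    (hu : p.toReal⁻¹ < (1 - θ) * p₁.toReal⁻¹ + θ * p₂.toReal⁻¹)
    (hv : q.toReal⁻¹ = (1 - θ) * q₁.toReal⁻¹ + θ * q₂.toReal⁻¹) {c₁ c₂ : ℝ}
    (H₁ : 𝔹.GaussBound ν T p₁ q₁ c₁) (H₂ : 𝔹.GaussBound ν T p₂ q₂ c₂) :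
    𝔹.GaussBound ν T p q ((1 - θ) * c₁ + θ * c₂) := by
  obtain ⟨C₁, hC₁, H₁⟩ := H₁
  obtain ⟨C₂, hC₂, H₂⟩ := H₂
  have h1' : 0 < 1 - θ := by linarith
  set K : ℝ≥0∞ := 1 + 2 * (1 - (2 : ℝ≥0∞) ^ (1 - p.toReal *
        ((1 - θ) * p₁.toReal⁻¹ + θ * p₂.toReal⁻¹)))⁻¹ with hK
  have hKt : K ≠ ∞ := by
    have hpr : 0 < p.toReal := ENNReal.toReal_pos (zero_lt_one.trans_le hp).ne' hpt
    have hlt : (2 : ℝ≥0∞) ^ (1 - p.toReal * ((1 - θ) * p₁.toReal⁻¹ + θ * p₂.toReal⁻¹)) < 1 := by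
      refine ENNReal.rpow_lt_one_of_one_lt_of_neg (by norm_num) ?_
      have := mul_lt_mul_of_pos_left hu hpr
      rw [mul_inv_cancel₀ hpr.ne'] at this
      linarith
    refine ENNReal.add_ne_top.2 ⟨ENNReal.one_ne_top, ENNReal.mul_ne_top (by norm_num) ?_⟩
    exact ENNReal.inv_ne_top.2 (tsub_pos_of_lt hlt).ne'
  refine ⟨C₁ ^ (1 - θ) * C₂ ^ θ * (K.toReal + 1), by positivity, fun t ht x y g hg hgs => ?_⟩
  have hρ : 0 < √t := Real.sqrt_pos.2 ht
  set B := Metric.ball x (√t) with hB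
  set B' := Metric.ball y (√t) with hB'
  have hm : (ν B)⁻¹ • ν.restrict B ≪ μ :=
    (inv_smul_restrict_ac ν _ _).trans (Measure.absolutelyContinuous_restrict.trans hν)
  have hm' : (ν B')⁻¹ • ν.restrict B' ≪ μ :=
    (inv_smul_restrict_ac ν _ _).trans (Measure.absolutelyContinuous_restrict.trans hν)
  have hmem : ∀ g : E, 𝔹.Supp g B → ∀ r : ℝ≥0∞,
      eLpNorm (𝔹.fn g : X → 𝕜) r ((ν B)⁻¹ • ν.restrict B) ≠ ∞ → MemLp (𝔹.fn g : X → 𝕜) r ν := by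
    intro g hg r hr
    refine ⟨𝔹.aesm g hν, ?_⟩
    rw [← 𝔹.eLpNorm_of_supp hν measurableSet_ball hg,
      eLpNorm_restrict_eq_avgNorm (hD.pos x _ hρ) (hD.fin _ _)]
    exact ENNReal.mul_lt_top (ENNReal.rpow_lt_top_of_nonneg ENNReal.toReal_nonneg (hD.fin _ _))
      (lt_top_iff_ne_top.2 hr)
  have main := 𝔹.eLpNorm_apply_le_of_interpolate (T := T t) hm hm' (by
      rw [Measure.smul_apply, Measure.restrict_apply_univ, smul_eq_mul]
      exact ENNReal.inv_mul_le_one _) hp hpt hp₁ hp₂ hq hq₁ hq₂ h0 h1 hu hv (A := B)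
      (M₁ := ENNReal.ofReal (C₁ * Real.exp (-(c₁ * dist x y ^ 2 / t))))
      (M₂ := ENNReal.ofReal (C₂ * Real.exp (-(c₂ * dist x y ^ 2 / t))))
      ENNReal.ofReal_ne_top ENNReal.ofReal_ne_top
      (fun g hg hr => H₁ t ht x y g (hmem g hg _ hr) hg)
      (fun g hg hr => H₂ t ht x y g (hmem g hg _ hr) hg) g hgs
      (avgNorm_ne_top (hD.pos _ _ hρ) hg)
  refine main.trans ?_
  rw [← hK]
  refine mul_le_mul_left ?_ _
  rw [ENNReal.ofReal_rpow_of_nonneg (by positivity) h1'.le,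
    ENNReal.ofReal_rpow_of_nonneg (by positivity) h0.le, ← ENNReal.ofReal_mul (by positivity),
    ← ENNReal.ofReal_toReal hKt, ← ENNReal.ofReal_mul (by positivity)]
  refine ENNReal.ofReal_le_ofReal ?_
  rw [Real.mul_rpow hC₁.le (Real.exp_pos _).le, Real.mul_rpow hC₂.le (Real.exp_pos _).le,
    ← Real.exp_mul, ← Real.exp_mul, ENNReal.toReal_ofReal ENNReal.toReal_nonneg]
  calc _ = C₁ ^ (1 - θ) * C₂ ^ θ * K.toReal * (Real.exp (-(c₁ * dist x y ^ 2 / t) * (1 - θ)) *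
        Real.exp (-(c₂ * dist x y ^ 2 / t) * θ)) := by ring
    _ = C₁ ^ (1 - θ) * C₂ ^ θ * K.toReal *
        Real.exp (-(((1 - θ) * c₁ + θ * c₂) * dist x y ^ 2 / t)) := by
        rw [← Real.exp_add]; congr 2; ring
    _ ≤ _ := by gcongr; linarith

/-- A global bound restricts to balls without any decay. Passing to averages costs the ratio of two
volumes, which is polynomial in `dist x y / √t` and so at most a multiple of `exp (ε * dist x y ^ 2
/ t)`. -/
theorem gaussBound_of_mem_boundedSet (hν : ν ≪ μ) (hD : HasGrowth ν D) {p : ℝ≥0∞}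
    (h : p ∈ 𝔹.boundedSet ν T) {ε : ℝ} (hε : 0 < ε) : 𝔹.GaussBound ν T p p (-ε) := by
  obtain ⟨hp, C, h⟩ := h
  obtain ⟨K, hK, hKb⟩ := exists_rpow_le_exp_sq (D : ℝ) hε
  refine ⟨(C + 1) * (2 ^ D * K), by positivity, fun t ht x y g hg hgs => ?_⟩
  have hρ : 0 < √t := Real.sqrt_pos.2 ht
  have hρ2 : √t ^ 2 = t := Real.sq_sqrt ht.le
  set ρ := √t with hρd
  set V := ν (Metric.ball x ρ) with hV
  set V' := ν (Metric.ball y ρ) with hV'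
  have hV0 : V ≠ 0 := hD.pos _ _ hρ
  have hVt : V ≠ ∞ := hD.fin _ _
  have hV'0 : V' ≠ 0 := hD.pos _ _ hρ
  have hV't : V' ≠ ∞ := hD.fin _ _
  set e := (1 / p).toReal with he'
  have he : 0 ≤ e := ENNReal.toReal_nonneg
  set d := dist x y with hd
  have hds : 0 ≤ d / ρ := by positivity
  have hVV : V ^ e ≤ ENNReal.ofReal ((2 * (1 + d / ρ)) ^ D) * V' ^ e := by
    have k2 : V ≤ ENNReal.ofReal ((2 * (1 + d / ρ)) ^ D) * V' := by
      refine hD.growth_of_subset hρ (by linarith) (Metric.ball_subset_ball' ?_)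
      rw [add_mul, div_mul_cancel₀ _ hρ.ne', hd]; linarith
    calc V ^ e ≤ (ENNReal.ofReal ((2 * (1 + d / ρ)) ^ D) * V') ^ e :=
          ENNReal.rpow_le_rpow k2 he
      _ = ENNReal.ofReal ((2 * (1 + d / ρ)) ^ D) ^ e * V' ^ e :=
          ENNReal.mul_rpow_of_nonneg _ _ he
      _ ≤ _ := by
          gcongr
          refine rpow_one_div_le ?_ hp
          rw [ENNReal.one_le_ofReal]
          exact one_le_pow₀ (by linarith)
  have hVe0 : V' ^ e ≠ 0 := (ENNReal.rpow_pos (pos_iff_ne_zero.2 hV'0) hV't).ne'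
  have hVet : V' ^ e ≠ ∞ := (ENNReal.rpow_lt_top_of_nonneg he hV't).ne
  have k3 : eLpNorm (𝔹.fn g : X → 𝕜) p ν =
      V ^ e * avgNorm ν p (Metric.ball x ρ) (Metric.ball x ρ) (𝔹.fn g : X → 𝕜) := by
    rw [← 𝔹.eLpNorm_of_supp hν measurableSet_ball hgs,
      eLpNorm_restrict_eq_avgNorm hV0 hVt]
  set N := avgNorm ν p (Metric.ball x ρ) (Metric.ball x ρ) (𝔹.fn g : X → 𝕜)
  rw [avgNorm_eq_mul hV't]
  calc (V' ^ e)⁻¹ * eLpNorm (𝔹.fn (T t g) : X → 𝕜) p (ν.restrict (Metric.ball y ρ))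
      ≤ (V' ^ e)⁻¹ * (C * (ENNReal.ofReal ((2 * (1 + d / ρ)) ^ D) * V' ^ e * N)) := by
        gcongr
        refine (eLpNorm_mono_measure _ Measure.restrict_le_self).trans ((h t ht g hg).trans ?_)
        rw [k3]
        gcongr
    _ = ((V' ^ e)⁻¹ * V' ^ e) * ((C : ℝ≥0∞) * ENNReal.ofReal ((2 * (1 + d / ρ)) ^ D)) * N := by ring
    _ ≤ _ := by
        rw [ENNReal.inv_mul_cancel hVe0 hVet, one_mul]
        refine mul_le_mul_left ?_ _
        rw [← ENNReal.ofReal_coe_nnreal, ← ENNReal.ofReal_mul (NNReal.coe_nonneg C)]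
        refine ENNReal.ofReal_le_ofReal ?_
        have k4 := hKb (d / ρ) hds
        rw [Real.rpow_natCast, div_pow, hρ2] at k4
        rw [mul_pow, show -(-ε * d ^ 2 / t) = ε * (d ^ 2 / t) by ring]
        calc (C : ℝ) * (2 ^ D * (1 + d / ρ) ^ D)
            ≤ (C + 1) * (2 ^ D * (K * Real.exp (ε * (d ^ 2 / t)))) := by gcongr; linarith
          _ = _ := by ring

/-- Interpolation of off-diagonal estimates with a bound of arbitrarily slow Gaussian growth. -/
theorem OffDiagonal.exists_around [Nonempty X] (hν : ν ≪ μ) (hD : HasGrowth ν D)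
    {p₁ q₁ p₂ q₂ s : ℝ≥0∞} (hp₁ : 1 ≤ p₁) (hpq₁ : p₁ < q₁) (h : 𝔹.OffDiagonal ν T p₁ q₁)
    (hp₂ : 1 ≤ p₂) (hpq₂ : p₂ ≤ q₂) (h₂ : ∀ ε : ℝ, 0 < ε → 𝔹.GaussBound ν T p₂ q₂ (-ε))
    (hs : 1 ≤ s) (hst : (s.toReal⁻¹ < (p₁.toReal⁻¹ + q₁.toReal⁻¹) / 2 ∧
        (p₂.toReal⁻¹ + q₂.toReal⁻¹) / 2 < s.toReal⁻¹) ∨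
      ((p₁.toReal⁻¹ + q₁.toReal⁻¹) / 2 < s.toReal⁻¹ ∧
        s.toReal⁻¹ < (p₂.toReal⁻¹ + q₂.toReal⁻¹) / 2)) :
    ∃ a b, 1 ≤ a ∧ a < s ∧ s < b ∧ 𝔹.OffDiagonal ν T a b := by
  have hq₁ := hp₁.trans hpq₁.le
  have hq₂ := hp₂.trans hpq₂
  obtain ⟨c, hc, hG⟩ := (𝔹.scaleBound_iff).1 (h.scaleBound 𝔹 hν hD hp₁ hq₁ le_rfl)
  set u₁ := p₁.toReal⁻¹
  set u₂ := p₂.toReal⁻¹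
  set v₁ := q₁.toReal⁻¹
  set v₂ := q₂.toReal⁻¹
  set σ := s.toReal⁻¹
  have hvu₁ : v₁ < u₁ := inv_toReal_lt_inv_toReal hp₁ hpq₁
  have hvu₂ : v₂ ≤ u₂ := inv_toReal_le_inv_toReal hp₂ hpq₂
  have hv₁0 : 0 ≤ v₁ := by positivity
  have hv₂0 : 0 ≤ v₂ := by positivity
  have hu₁1 : u₁ ≤ 1 := inv_toReal_le_one hp₁
  have hu₂1 : u₂ ≤ 1 := inv_toReal_le_one hp₂
  obtain ⟨θ, h0, h1, hθ⟩ : ∃ θ : ℝ, 0 < θ ∧ θ < 1 ∧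
      σ = (1 - θ) * ((u₁ + v₁) / 2) + θ * ((u₂ + v₂) / 2) := by
    rcases hst with ⟨k1, k2⟩ | ⟨k1, k2⟩
    · have k3 : 0 < (u₁ + v₁) / 2 - (u₂ + v₂) / 2 := by linarith
      refine ⟨((u₁ + v₁) / 2 - σ) / ((u₁ + v₁) / 2 - (u₂ + v₂) / 2), div_pos (by linarith) k3,
        (div_lt_one k3).2 (by linarith), ?_⟩
      have := div_mul_cancel₀ ((u₁ + v₁) / 2 - σ) k3.ne'
      linarith
    · have k3 : 0 < (u₂ + v₂) / 2 - (u₁ + v₁) / 2 := by linarith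
      refine ⟨(σ - (u₁ + v₁) / 2) / ((u₂ + v₂) / 2 - (u₁ + v₁) / 2), div_pos (by linarith) k3,
        (div_lt_one k3).2 (by linarith), ?_⟩
      have := div_mul_cancel₀ (σ - (u₁ + v₁) / 2) k3.ne'
      linarith
  have h1' : 0 < 1 - θ := by linarith
  set U := (1 - θ) * u₁ + θ * u₂ with hU
  set V := (1 - θ) * v₁ + θ * v₂ with hV
  have hUV : V < U := by
    have e1 := mul_lt_mul_of_pos_left hvu₁ h1'
    have e2 := mul_le_mul_of_nonneg_left hvu₂ h0.le
    linarith
  have hσ : σ = (U + V) / 2 := by rw [hθ, hU, hV]; ring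
  have hU1 : U ≤ 1 := by
    have e1 := mul_le_mul_of_nonneg_left hu₁1 h1'.le
    have e2 := mul_le_mul_of_nonneg_left hu₂1 h0.le
    linarith
  have hV0 : 0 ≤ V := by positivity
  obtain ⟨b, hb1, hb⟩ := exists_inv_toReal_eq hV0 (hUV.le.trans hU1)
  -- Interpolation would end at the reciprocals `U > V`, whose midpoint is that of `s`. Stopping
  -- halfway between `U` and `σ` pays for the loss in the source exponent and still leaves `a < s`.
  obtain ⟨a, ha1, ha⟩ := exists_inv_toReal_eq (v := (U + σ) / 2) (by linarith) (by linarith)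
  have has : a < s := lt_of_inv_toReal_lt hs (by change σ < _; linarith)
  refine ⟨a, b, ha1, has, lt_of_inv_toReal_lt hb1 (by change _ < σ; linarith), ?_⟩
  -- The growth rate is chosen so small that half of the positive contribution `(1 - θ) * c`
  -- survives.
  have hG' := GaussBound.interpolate 𝔹 hν hD ha1 has.ne_top hp₁ hp₂ hb1 hq₁ hq₂ h0 h1
    (by change _ < U; linarith) hb hG (h₂ ((1 - θ) * c / (2 * θ)) (by positivity))
  refine ScaleBound.offDiagonal 𝔹 hν hD ha1 hb1 ((𝔹.scaleBound_iff).2 ⟨_, ?_, hG'⟩)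
  have : θ * -((1 - θ) * c / (2 * θ)) = -((1 - θ) * c / 2) := by field_simp
  rw [this]
  have := mul_pos h1' hc
  linarith

theorem OffDiagonal.gaussBound_neg (hν : ν ≪ μ) (hD : HasGrowth ν D) {p q : ℝ≥0∞} (hp : 1 ≤ p)
    (hq : 1 ≤ q) (h : 𝔹.OffDiagonal ν T p q) {ε : ℝ} (hε : 0 < ε) :
    𝔹.GaussBound ν T p q (-ε) := by
  obtain ⟨c, hc, hG⟩ := (𝔹.scaleBound_iff).1 (h.scaleBound 𝔹 hν hD hp hq le_rfl)
  exact hG.mono 𝔹 (by linarith)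

section Order

variable [Nonempty X] (hν : ν ≪ μ) (hD : HasGrowth ν D) (hTtr : 𝔹.TruncationContinuous T)
  (hT : ∀ s t : ℝ, 0 < s → 0 < t → T s ∘L T t = T (s + t))

include hν hD hTtr hT in
-- If neither pair settles the claim by monotonicity, then `a < c ≤ b < d`, and the two estimates
-- compose at the exponent `c`.
theorem OffDiagonal.join {a b c d : ℝ≥0∞} (ha : 1 ≤ a) (hc : 1 ≤ c)
    (h₁ : 𝔹.OffDiagonal ν T a b) (h₂ : 𝔹.OffDiagonal ν T c d) (hcb : c ≤ b) (had : a < d) :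
    𝔹.OffDiagonal ν T a d := by
  rcases le_or_gt d b with hdb | hbd
  · exact h₁.mono 𝔹 hν hD ha le_rfl (ha.trans had.le) hdb
  rcases le_or_gt c a with hca | hac
  · exact h₂.mono 𝔹 hν hD hc hca (ha.trans had.le) le_rfl
  · exact OffDiagonal.comp 𝔹 hν hD hTtr hT ha hc (ha.trans had.le)
      (h₁.mono 𝔹 hν hD ha le_rfl hc hcb) h₂

include hν hD hTtr hT in
-- Let `m` be the supremum of the exponents in `[q₁, p₂]` that can be reached from `p₁`.
-- Interpolation between the two given pairs yields an estimate for some pair `a < m < b`. It joins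
-- with one already reached above `a`, so `b` is reached as well. This contradicts the choice of `m`
-- unless `b ≥ p₂`, and then the second pair can be joined.
theorem OffDiagonal.bridge {p₁ q₁ p₂ q₂ : ℝ≥0∞} (hp₁ : 1 ≤ p₁) (hpq₁ : p₁ < q₁)
    (hpq₂ : p₂ < q₂) (h₁ : 𝔹.OffDiagonal ν T p₁ q₁) (h₂ : 𝔹.OffDiagonal ν T p₂ q₂)
    (hlt : q₁ < p₂) : 𝔹.OffDiagonal ν T p₁ q₂ := by
  have hq₁ := hp₁.trans hpq₁.le
  have hp₂ := hq₁.trans hlt.le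
  set S : Set ℝ≥0∞ := {s | q₁ ≤ s ∧ s ≤ p₂ ∧ 𝔹.OffDiagonal ν T p₁ s} with hS
  have hq₁S : q₁ ∈ S := ⟨le_rfl, hlt.le, h₁⟩
  have hm1 : q₁ ≤ sSup S := le_sSup hq₁S
  have hm2 : sSup S ≤ p₂ := sSup_le fun s hs => hs.2.1
  have hm0 := hq₁.trans hm1
  have e1 := inv_toReal_lt_inv_toReal hp₁ hpq₁
  have e2 := inv_toReal_lt_inv_toReal hp₂ hpq₂
  have e3 := inv_toReal_le_inv_toReal hq₁ hm1
  have e4 := inv_toReal_le_inv_toReal hm0 hm2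
  obtain ⟨a, b, ha1, ham, hmb, hab⟩ := OffDiagonal.exists_around 𝔹 hν hD hp₁ hpq₁ h₁ hp₂ hpq₂.le
    (fun ε hε => h₂.gaussBound_neg 𝔹 hν hD hp₂ (hp₂.trans hpq₂.le) hε) hm0
    (Or.inl ⟨by linarith, by linarith⟩)
  obtain ⟨s, hs, has⟩ := lt_sSup_iff.1 ham
  have hpb : p₁ < b := hpq₁.trans_le (hm1.trans hmb.le)
  have h₃ := OffDiagonal.join 𝔹 hν hD hTtr hT hp₁ ha1 hs.2.2 hab has.le hpb
  rcases le_or_gt p₂ b with hle | hgt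
  · exact OffDiagonal.join 𝔹 hν hD hTtr hT hp₁ hp₂ h₃ h₂ hle (hpq₁.trans (hlt.trans hpq₂))
  · exact absurd (le_sSup (show b ∈ S from ⟨hm1.trans hmb.le, hgt.le, h₃⟩)) (not_le.2 hmb)

theorem exists_pair_of_mem_offSet {p : ℝ≥0∞} (h : p ∈ 𝔹.offSet ν T) :
    ∃ a b, 1 ≤ a ∧ a < b ∧ a ≤ p ∧ p ≤ b ∧ 𝔹.OffDiagonal ν T a b := by
  obtain ⟨q, hp, hq, ⟨hlt, h⟩ | ⟨hlt, h⟩⟩ := h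
  · exact ⟨p, q, hp, hlt, le_rfl, hlt.le, h⟩
  · exact ⟨q, p, hq, hlt, hlt.le, le_rfl, h⟩

include hν hD hTtr hT in
theorem offDiagonal_of_mem_offSet {p q : ℝ≥0∞} (hp : p ∈ 𝔹.offSet ν T) (hq : q ∈ 𝔹.offSet ν T)
    (hpq : p < q) : 𝔹.OffDiagonal ν T p q := by
  obtain ⟨p₁, q₁, h1, hlt₁, hp₁, hq₁, h₁⟩ := 𝔹.exists_pair_of_mem_offSet hp
  obtain ⟨p₂, q₂, h2, hlt₂, hp₂, hq₂, h₂⟩ := 𝔹.exists_pair_of_mem_offSet hq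
  have key : 𝔹.OffDiagonal ν T p₁ q₂ := by
    rcases le_or_gt p₂ q₁ with hle | hgt
    · exact OffDiagonal.join 𝔹 hν hD hTtr hT h1 h2 h₁ h₂ hle (hp₁.trans_lt (hpq.trans_le hq₂))
    · exact OffDiagonal.bridge 𝔹 hν hD hTtr hT h1 hlt₁ hlt₂ h₁ h₂ hgt
  exact key.mono 𝔹 hν hD h1 hp₁ (h1.trans (hp₁.trans hpq.le)) hq₂

theorem mem_offSet_left {p q : ℝ≥0∞} (hp : 1 ≤ p) (hpq : p < q) (h : 𝔹.OffDiagonal ν T p q) :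
    p ∈ 𝔹.offSet ν T := ⟨q, hp, hp.trans hpq.le, Or.inl ⟨hpq, h⟩⟩

theorem mem_offSet_right {p q : ℝ≥0∞} (hp : 1 ≤ p) (hpq : p < q) (h : 𝔹.OffDiagonal ν T p q) :
    q ∈ 𝔹.offSet ν T := ⟨p, hp.trans hpq.le, hp, Or.inr ⟨hpq, h⟩⟩

include hν hD hTtr hT in
-- Nonemptiness is essential for uniqueness: if no estimate held, every set of at most one exponent
-- would characterise as well. One valid pair provides each element of `J` with a distinct partner
-- in `J`, hence with an estimate.
theorem characterizes_iff (hne : (𝔹.offSet ν T).Nonempty) (J : Set ℝ≥0∞) :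
    𝔹.CharacterizesOffDiagonal ν T J ↔ J = 𝔹.offSet ν T := by
  constructor
  · rintro ⟨hJ, h⟩
    obtain ⟨p₀, hp₀⟩ := hne
    obtain ⟨a, b, ha, hab, -, -, hO⟩ := 𝔹.exists_pair_of_mem_offSet hp₀
    obtain ⟨haJ, hbJ⟩ := (h a b ha hab).1 hO
    have two : ∀ p ∈ J, ∀ c ∈ J, p ≠ c → p ∈ 𝔹.offSet ν T := by
      intro p hp c hc hne
      rcases lt_or_gt_of_ne hne with hlt | hgt
      · exact 𝔹.mem_offSet_left (hJ hp).1 hlt ((h p c (hJ hp).1 hlt).2 ⟨hp, hc⟩)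
      · exact 𝔹.mem_offSet_right (hJ hc).1 hgt ((h c p (hJ hc).1 hgt).2 ⟨hc, hp⟩)
    ext p
    constructor
    · intro hp
      rcases eq_or_ne p a with rfl | hpa
      · exact two p hp b hbJ hab.ne
      · exact two p hp a haJ hpa
    · rintro ⟨q, hp, hq, ⟨hlt, hO⟩ | ⟨hlt, hO⟩⟩
      · exact ((h p q hp hlt).1 hO).1
      · exact ((h q p hq hlt).1 hO).2
  · rintro rfl
    refine ⟨fun p hp => ⟨?_, le_top⟩, fun p q hp hpq => ⟨fun h => ?_, fun h => ?_⟩⟩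
    · obtain ⟨_, h, _⟩ := hp; exact h
    · exact ⟨𝔹.mem_offSet_left hp hpq h, 𝔹.mem_offSet_right hp hpq h⟩
    · exact 𝔹.offDiagonal_of_mem_offSet hν hD hTtr hT h.1 h.2 hpq

theorem mem_offSet_of_mem_Icc (hν : ν ≪ μ) (hD : HasGrowth ν D) {a b s : ℝ≥0∞} (ha : 1 ≤ a)
    (hab : a < b) (h : 𝔹.OffDiagonal ν T a b) (has : a ≤ s) (hsb : s ≤ b) :
    s ∈ 𝔹.offSet ν T := by
  rcases hsb.eq_or_lt with rfl | hlt
  · exact 𝔹.mem_offSet_right ha hab h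
  · exact 𝔹.mem_offSet_left (ha.trans has) hlt
      (h.mono 𝔹 hν hD ha has (ha.trans hab.le) le_rfl)

include hν hD hTtr hT in
theorem ordConnected_offSet : (𝔹.offSet ν T).OrdConnected := by
  refine ⟨fun p hp q hq s hs => ?_⟩
  rcases (hs.1.trans hs.2).eq_or_lt with rfl | hlt
  · rwa [le_antisymm hs.2 hs.1]
  · have h := 𝔹.offDiagonal_of_mem_offSet hν hD hTtr hT hp hq hlt
    obtain ⟨_, hp1, _⟩ := hp
    exact 𝔹.mem_offSet_of_mem_Icc hν hD hp1 hlt h hs.1 hs.2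

include hν hD hTtr in
-- Hölder's inequality shrinks a pair around `p` to the degenerate pair of `p` with itself, whose
-- Gaussian decay feeds the Schur test.
theorem offSet_subset_boundedSet : 𝔹.offSet ν T ⊆ 𝔹.boundedSet ν T := by
  intro p hp
  obtain ⟨a, b, ha, hab, hap, hpb, h⟩ := 𝔹.exists_pair_of_mem_offSet hp
  have hp1 := ha.trans hap
  have h' := h.mono 𝔹 hν hD ha hap hp1 hpb
  exact (h'.scaleBound 𝔹 hν hD hp1 hp1 le_rfl).mem_boundedSet 𝔹 hν hD hTtr hp1

/-- The decay of the known pair survives interpolation with mere boundedness at `r`. As `s` may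
touch the pair but is strictly on the near side of `r`, its reciprocal lies strictly between that of
`r` and the midpoint of the pair. -/
theorem mem_offSet_of_between (hν : ν ≪ μ) (hD : HasGrowth ν D) {p q s r : ℝ≥0∞}
    (hp : 1 ≤ p) (hpq : p < q) (h : 𝔹.OffDiagonal ν T p q) (hr : r ∈ 𝔹.boundedSet ν T)
    (hs : (r < s ∧ s ≤ p) ∨ (q ≤ s ∧ s < r)) : s ∈ 𝔹.offSet ν T := by
  have hr1 := hr.1
  have e1 := inv_toReal_lt_inv_toReal hp hpq
  have hs1 : 1 ≤ s := by
    rcases hs with hs | hs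
    · exact hr1.trans hs.1.le
    · exact hp.trans (hpq.le.trans hs.1)
  obtain ⟨a, b, ha1, has, hsb, hab⟩ := OffDiagonal.exists_around 𝔹 hν hD hp hpq h hr1 le_rfl
    (fun ε hε => 𝔹.gaussBound_of_mem_boundedSet hν hD hr hε) hs1 (by
      rcases hs with hs | hs
      · right
        have e2 := inv_toReal_lt_inv_toReal hr1 hs.1
        have e3 := inv_toReal_le_inv_toReal hs1 hs.2
        constructor <;> linarith
      · left
        have e2 := inv_toReal_lt_inv_toReal hs1 hs.2
        have e3 := inv_toReal_le_inv_toReal (hp.trans hpq.le) hs.1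
        constructor <;> linarith)
  exact 𝔹.mem_offSet_of_mem_Icc hν hD ha1 (has.trans hsb) hab has.le hsb.le

include hν hD hTtr in
-- A point strictly between two exponents of boundedness either lies in a known pair or between that
-- pair and one of the two exponents; in both cases off-diagonal estimates hold there.
theorem ordConnected_boundedSet (hne : (𝔹.offSet ν T).Nonempty) :
    (𝔹.boundedSet ν T).OrdConnected := by
  obtain ⟨p₀, hp₀⟩ := hne
  obtain ⟨a, b, ha, hab, -, -, h⟩ := 𝔹.exists_pair_of_mem_offSet hp₀
  refine ⟨fun p hp q hq s hs => ?_⟩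
  rcases hs.1.eq_or_lt with rfl | hps
  · exact hp
  rcases hs.2.eq_or_lt with rfl | hsq
  · exact hq
  refine 𝔹.offSet_subset_boundedSet hν hD hTtr ?_
  rcases le_total s a with hsa | has
  · exact 𝔹.mem_offSet_of_between hν hD ha hab h hp (Or.inl ⟨hps, hsa⟩)
  rcases le_total b s with hbs | hsb
  · exact 𝔹.mem_offSet_of_between hν hD ha hab h hq (Or.inr ⟨hbs, hsq⟩)
  · exact 𝔹.mem_offSet_of_mem_Icc hν hD ha hab h has hsb

include hν hD hTtr in
-- An interior point has exponents of boundedness on both sides; the one lying away from a known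
-- pair is the endpoint for the interpolation.
theorem realInterior_offSet_eq (hne : (𝔹.offSet ν T).Nonempty) :
    realInterior (𝔹.offSet ν T) = realInterior (𝔹.boundedSet ν T) := by
  refine Subset.antisymm (interior_mono fun t ht =>
    ⟨ht.1, 𝔹.offSet_subset_boundedSet hν hD hTtr ht.2⟩) ?_
  obtain ⟨p₀, hp₀⟩ := hne
  obtain ⟨a, b, ha, hab, -, -, h⟩ := 𝔹.exists_pair_of_mem_offSet hp₀
  refine interior_maximal (fun t ht => ?_) isOpen_interior
  have ht' := interior_subset ht
  refine ⟨ht'.1, ?_⟩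
  obtain ⟨ε, hε, hball⟩ := Metric.mem_nhds_iff.1 (mem_interior_iff_mem_nhds.1 ht)
  have ht1 : 1 ≤ t := ENNReal.one_le_ofReal.1 ht'.2.1
  have hlo : t - ε / 2 ∈ Metric.ball t ε := by
    rw [Metric.mem_ball, Real.dist_eq, abs_lt]; constructor <;> linarith
  have hhi : t + ε / 2 ∈ Metric.ball t ε := by
    rw [Metric.mem_ball, Real.dist_eq, abs_lt]; constructor <;> linarith
  rcases le_total (ENNReal.ofReal t) a with hsa | has
  · exact 𝔹.mem_offSet_of_between hν hD ha hab h (hball hlo).2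
      (Or.inl ⟨(ENNReal.ofReal_lt_ofReal_iff (by linarith)).2 (by linarith), hsa⟩)
  rcases le_total b (ENNReal.ofReal t) with hbs | hsb
  · exact 𝔹.mem_offSet_of_between hν hD ha hab h (hball hhi).2
      (Or.inr ⟨hbs, (ENNReal.ofReal_lt_ofReal_iff (by linarith)).2 (by linarith)⟩)
  · exact 𝔹.mem_offSet_of_mem_Icc hν hD ha hab h has hsb

end Order

end FunctionSpace

/-! ### Higher integrability from decay over level sets. -/

section LevelDecay

/-- A geometric sum is dominated by its last term. The hypothesis on `K` is what the induction
needs, and `K = β / (β - 1)` satisfies it with equality. -/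
theorem sum_level_le {β K : ℝ≥0∞} (h1 : 1 ≤ β) (hK1 : 1 ≤ K) (hK : K + β ≤ K * β) (s v : ℝ≥0∞)
    (n : ℕ) :
    ∑ i ∈ Finset.range n, (if s * β ^ i < v then s * β ^ i else 0) ≤
      K * (if s < v then v else 0) := by
  classical
  have hs : ∀ n : ℕ, ∑ i ∈ Finset.range (n + 1), s * β ^ i ≤ K * (s * β ^ n) := by
    intro n
    induction n with
    | zero => simpa using le_mul_of_one_le_left (zero_le (a := s)) hK1
    | succ n ih =>
      rw [Finset.sum_range_succ]
      calc _ ≤ K * (s * β ^ n) + s * β ^ (n + 1) := by gcongr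
        _ = s * β ^ n * (K + β) := by ring
        _ ≤ s * β ^ n * (K * β) := by gcongr
        _ = _ := by ring
  induction n with
  | zero => simp
  | succ n ih =>
    by_cases h : s * β ^ n < v
    · have hsv : s < v := lt_of_le_of_lt (le_mul_of_one_le_right zero_le (one_le_pow₀ h1)) h
      rw [if_pos hsv]
      calc _ ≤ ∑ i ∈ Finset.range (n + 1), s * β ^ i :=
            Finset.sum_le_sum fun i _ => by split_ifs <;> simp
        _ ≤ K * (s * β ^ n) := hs n
        _ ≤ K * v := by gcongr
    · rw [Finset.sum_range_succ, if_neg h, add_zero]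
      exact ih

/-- Above `s`, the value `v` lies in one interval from `s * β ^ k` to `s * β ^ (k + 1)`, where `v ^
δ` is at most the power of the upper end. -/
theorem rpow_le_tsum_level {β : ℝ≥0∞} (h1 : 1 < β) {s v : ℝ≥0∞} (hs : s ≠ 0)
    (hv : v ≠ ∞) {δ : ℝ} (hδ : 0 < δ) :
    v ^ (1 + δ) ≤ s ^ δ * v +
      ∑' k : ℕ, (s * β ^ (k + 1)) ^ δ * (if s * β ^ k < v then v else 0) := by
  rcases eq_or_ne v 0 with rfl | hv0
  · rw [ENNReal.zero_rpow_of_pos (by linarith)]; exact zero_le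
  have hsplit : v ^ (1 + δ) = v ^ δ * v := by
    rw [add_comm, ENNReal.rpow_add _ _ hv0 hv, ENNReal.rpow_one]
  rw [hsplit]
  by_cases hle : v ≤ s
  · exact le_add_right (by gcongr)
  push Not at hle
  have hst : s ≠ ∞ := (hle.trans_le le_top).ne
  have hex : ∃ n : ℕ, v ≤ s * β ^ n := by
    have ht : Tendsto (fun n : ℕ => s * β ^ n) atTop (𝓝 ∞) := by
      have := ENNReal.Tendsto.const_mul (a := s) (ENNReal.tendsto_pow_atTop_nhds_top_iff.2 h1)
        (Or.inl ENNReal.top_ne_zero)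
      rwa [ENNReal.mul_top hs] at this
    exact (ht.eventually (lt_mem_nhds (lt_top_iff_ne_top.2 hv))).exists.imp fun n h => h.le
  classical
  obtain ⟨k, hk⟩ : ∃ k, Nat.find hex = k + 1 := by
    refine Nat.exists_eq_succ_of_ne_zero fun h0 => ?_
    have := Nat.find_spec hex
    rw [h0, pow_zero, mul_one] at this
    exact absurd this (not_le.2 hle)
  have h2 : v ≤ s * β ^ (k + 1) := hk ▸ Nat.find_spec hex
  have h3 : s * β ^ k < v := not_le.1 (Nat.find_min hex (by omega))
  refine le_add_left (le_trans ?_ (ENNReal.le_tsum k))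
  rw [if_pos h3]
  gcongr

/-- The tails satisfy `S (k + 1) ≤ K * A k` and `S k = A k + S (k + 1)`, hence `(1 + K) * S (k + 1)
≤ K * S k`. This additive form avoids subtraction and covers infinite values. -/
theorem le_geometric_of_tail_sum_le (K : ℝ≥0) (A : ℕ → ℝ≥0∞)
    (h : ∀ k n, ∑ i ∈ Finset.range n, A (i + (k + 1)) ≤ K * A k) (k : ℕ) :
    A k ≤ ((K / (1 + K) : ℝ≥0) : ℝ≥0∞) ^ k * ((1 + K) * A 0) := by
  set θ : ℝ≥0 := K / (1 + K) with hθ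
  set S : ℕ → ℝ≥0∞ := fun k => ∑' i, A (i + k) with hS
  have hSs : ∀ k, S k = A k + S (k + 1) := by
    intro k
    have h1 : S k = A (0 + k) + ∑' i, A (i + 1 + k) := tsum_eq_zero_add' ENNReal.summable
    rw [h1, zero_add]
    refine congrArg (A k + ·) (tsum_congr fun i => ?_)
    rw [add_assoc, add_comm 1 k]
  have hS1 : ∀ k, S (k + 1) ≤ K * A k := fun k => ENNReal.tsum_le_of_sum_range_le (h k)
  have hSθ : ∀ k, S (k + 1) ≤ θ * S k := by
    intro k
    have h1 : (1 + K : ℝ≥0∞) * S (k + 1) ≤ K * S k := by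
      calc _ = S (k + 1) + K * S (k + 1) := by ring
        _ ≤ K * A k + K * S (k + 1) := by gcongr; exact hS1 k
        _ = K * S k := by rw [hSs k]; ring
    have h0 : (1 + K : ℝ≥0∞) ≠ 0 := by simp
    have ht : (1 + K : ℝ≥0∞) ≠ ∞ := by simp
    have e : (θ : ℝ≥0∞) = (1 + K : ℝ≥0∞)⁻¹ * K := by
      rw [hθ, ENNReal.coe_div (by positivity), ENNReal.div_eq_inv_mul]; push_cast; rfl
    calc S (k + 1) = (1 + K : ℝ≥0∞)⁻¹ * ((1 + K : ℝ≥0∞) * S (k + 1)) := by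
          rw [← mul_assoc, ENNReal.inv_mul_cancel h0 ht, one_mul]
      _ ≤ (1 + K : ℝ≥0∞)⁻¹ * (K * S k) := by gcongr
      _ = _ := by rw [e, mul_assoc]
  have hSk : ∀ k, S k ≤ θ ^ k * ((1 + K) * A 0) := by
    intro k
    induction k with
    | zero =>
      rw [pow_zero, one_mul, hSs]
      calc _ ≤ A 0 + K * A 0 := by gcongr; exact hS1 0
        _ = (1 + K) * A 0 := by ring
    | succ k ih =>
      refine (hSθ k).trans ?_
      calc _ ≤ θ * (θ ^ k * ((1 + K) * A 0)) := by gcongr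
        _ = _ := by ring
  exact (by rw [hSs k]; exact le_self_add : A k ≤ S k).trans (hSk k)

section

variable {α : Type*} [MeasurableSpace α] {m : Measure α} {V : α → ℝ≥0∞}

theorem measurableSet_lt_apply (hV : Measurable V) (c : ℝ≥0∞) : MeasurableSet {x | c < V x} :=
  measurableSet_lt measurable_const hV

theorem lintegral_ite_lt (hV : Measurable V) (c : ℝ≥0∞) (g : α → ℝ≥0∞) :
    ∫⁻ x, (if c < V x then g x else 0) ∂m = ∫⁻ x in {x | c < V x}, g x ∂m := by
  rw [← lintegral_indicator (measurableSet_lt_apply hV c)]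
  refine lintegral_congr fun x => ?_
  by_cases h : c < V x
  · rw [if_pos h, indicator_of_mem (by exact h)]
  · rw [if_neg h, indicator_of_notMem (by exact h)]

/-- Each integral over a level set is controlled by a height times the measure of the previous level
set. Summed pointwise, the heights below `V` give at most a multiple of `V` itself, so the tail sum
is controlled by its preceding term. -/
theorem sum_lintegral_level_le (hV : Measurable V) {β K K₂ : ℝ≥0∞} (h1 : 1 ≤ β) (hK1 : 1 ≤ K₂)
    (hK : K₂ + β ≤ K₂ * β) {s : ℝ≥0∞}
    (h : ∀ i : ℕ, ∫⁻ x in {x | s * β ^ (i + 1) < V x}, V x ∂m ≤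
        K * (s * β ^ i * m {x | s * β ^ i < V x})) (k n : ℕ) :
    ∑ i ∈ Finset.range n, ∫⁻ x in {x | s * β ^ (i + (k + 1)) < V x}, V x ∂m ≤
      K * K₂ * ∫⁻ x in {x | s * β ^ k < V x}, V x ∂m := by
  have hite : ∀ c : ℝ≥0∞, Measurable fun x => if c < V x then c else 0 := fun c =>
    Measurable.ite (measurableSet_lt_apply hV c) measurable_const measurable_const
  calc _ ≤ ∑ i ∈ Finset.range n, K * ∫⁻ x, (if s * β ^ k * β ^ i < V x
              then s * β ^ k * β ^ i else 0) ∂m := by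
        refine Finset.sum_le_sum fun i _ => ?_
        have hi := h (k + i)
        rw [show i + (k + 1) = k + i + 1 by ring, lintegral_ite_lt hV, setLIntegral_const,
          mul_assoc s, ← pow_add]
        exact hi
    _ = K * ∫⁻ x, ∑ i ∈ Finset.range n, (if s * β ^ k * β ^ i < V x
              then s * β ^ k * β ^ i else 0) ∂m := by
        rw [← Finset.mul_sum, lintegral_finsetSum]
        exact fun i _ => hite _
    _ ≤ K * ∫⁻ x, K₂ * (if s * β ^ k < V x then V x else 0) ∂m := by
        refine mul_le_mul_right (lintegral_mono fun x => ?_) _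
        exact sum_level_le h1 hK1 hK _ _ _
    _ = _ := by
        rw [lintegral_const_mul _ (Measurable.ite (measurableSet_lt_apply hV _) hV
          measurable_const), lintegral_ite_lt hV, mul_assoc]

end

/-- The integrals over the level sets decay like `θ ^ k` with `θ < 1`, and any `δ` with `β ^ δ * θ <
1` may be added to the exponent. Such a `δ` depends on `β` and `K` only, which is why it is chosen
before the measure space: one value must serve all balls. -/
theorem exists_lintegral_rpow_le_of_levels {β : ℝ≥0} (hβ : 1 < β) (K : ℝ≥0) :
    ∃ δ : ℝ, 0 < δ ∧ ∃ C : ℝ≥0, ∀ {α : Type*} [MeasurableSpace α] (m : Measure α)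
      (V : α → ℝ≥0∞), Measurable V → ∫⁻ x, V x ∂m ≠ ∞ → ∀ s : ℝ≥0∞, s ≠ 0 →
      (∀ i : ℕ, ∫⁻ x in {x | s * (β : ℝ≥0∞) ^ (i + 1) < V x}, V x ∂m ≤
        K * (s * (β : ℝ≥0∞) ^ i * m {x | s * (β : ℝ≥0∞) ^ i < V x})) →
      ∫⁻ x, V x ^ (1 + δ) ∂m ≤ C * s ^ δ * ∫⁻ x, V x ∂m := by
  have hβ0 : (1 : ℝ) < β := by exact_mod_cast hβ
  obtain ⟨K₂, e1, e2⟩ : ∃ K₂ : ℝ≥0, (1 : ℝ≥0∞) ≤ K₂ ∧ (K₂ : ℝ≥0∞) + β ≤ K₂ * β := by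
    have hb1 : (0 : ℝ) < β - 1 := by linarith
    have hK2r : ((β / (β - 1) : ℝ≥0) : ℝ) = β / (β - 1) := by
      rw [NNReal.coe_div, NNReal.coe_sub hβ.le, NNReal.coe_one]
    refine ⟨β / (β - 1), ?_, ?_⟩
    · have : (1 : ℝ≥0) ≤ β / (β - 1) := by
        rw [← NNReal.coe_le_coe, hK2r, NNReal.coe_one, one_le_div hb1]; linarith
      exact_mod_cast this
    · have : β / (β - 1) + β ≤ β / (β - 1) * β := by
        rw [← NNReal.coe_le_coe, NNReal.coe_add, NNReal.coe_mul, hK2r]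
        apply le_of_eq; field_simp; ring
      exact_mod_cast this
  set K' : ℝ≥0 := K * K₂ with hK'
  set θ : ℝ≥0 := K' / (1 + K') with hθ
  have hθ1 : θ < 1 := by
    rw [hθ, div_lt_one (by positivity)]; exact lt_add_of_pos_left _ one_pos
  obtain ⟨δ, hδ0, hδ⟩ : ∃ δ : ℝ, 0 < δ ∧ (β : ℝ) ^ δ * θ < 1 := by
    have ht : Tendsto (fun δ : ℝ => (β : ℝ) ^ δ * θ) (𝓝[>] 0) (𝓝 ((β : ℝ) ^ (0 : ℝ) * θ)) := by
      refine (Tendsto.mul_const _ ?_).mono_left nhdsWithin_le_nhds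
      exact (Real.continuous_const_rpow (by linarith : (β : ℝ) ≠ 0)).tendsto 0
    rw [Real.rpow_zero, one_mul] at ht
    have := ht.eventually (gt_mem_nhds (show (θ : ℝ) < 1 by exact_mod_cast hθ1))
    obtain ⟨δ, h1, h2⟩ := (this.and self_mem_nhdsWithin).exists
    exact ⟨δ, h2, h1⟩
  set q : ℝ≥0 := β ^ δ * θ with hq
  have hq1 : q < 1 := by
    rw [← NNReal.coe_lt_coe, hq]; push_cast; exact hδ
  have hqe : (q : ℝ≥0∞) = (β : ℝ≥0∞) ^ δ * θ := by
    rw [hq, ENNReal.coe_mul, ENNReal.coe_rpow_of_nonneg _ hδ0.le]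
  refine ⟨δ, hδ0, 1 + β ^ δ * (1 + K') * (1 - q)⁻¹, ?_⟩
  intro α _ m V hV hint s hs hlev
  set I := ∫⁻ x, V x ∂m with hI
  set A : ℕ → ℝ≥0∞ := fun k => ∫⁻ x in {x | s * (β : ℝ≥0∞) ^ k < V x}, V x ∂m with hA
  have hAk : ∀ k, A k ≤ θ ^ k * ((1 + K') * I) := by
    intro k
    refine (le_geometric_of_tail_sum_le K' A (fun k n => ?_) k).trans ?_
    · have := sum_lintegral_level_le hV (by exact_mod_cast hβ.le) e1 e2 hlev k n
      rw [hK', ENNReal.coe_mul]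
      exact this
    · exact mul_le_mul_right (mul_le_mul_right (setLIntegral_le_lintegral _ _) _) _
  have hVfin : ∀ᵐ x ∂m, V x ≠ ∞ := by
    filter_upwards [ae_lt_top hV hint] with x hx using hx.ne
  have hmi : ∀ k : ℕ, Measurable fun x => if s * (β : ℝ≥0∞) ^ k < V x then V x else 0 := fun k =>
    Measurable.ite (measurableSet_lt_apply hV _) hV measurable_const
  calc ∫⁻ x, V x ^ (1 + δ) ∂m
      ≤ ∫⁻ x, (s ^ δ * V x + ∑' k : ℕ, (s * (β : ℝ≥0∞) ^ (k + 1)) ^ δ *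
          (if s * (β : ℝ≥0∞) ^ k < V x then V x else 0)) ∂m := by
        refine lintegral_mono_ae ?_
        filter_upwards [hVfin] with x hx
        exact rpow_le_tsum_level (by exact_mod_cast hβ) hs hx hδ0
    _ = s ^ δ * I + ∑' k : ℕ, (s * (β : ℝ≥0∞) ^ (k + 1)) ^ δ * A k := by
        rw [lintegral_add_left (hV.const_mul _), lintegral_const_mul _ hV, lintegral_tsum]
        · congr 1
          refine tsum_congr fun k => ?_
          rw [lintegral_const_mul _ (hmi k), lintegral_ite_lt hV]
        · exact fun k => ((hmi k).const_mul _).aemeasurable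
    _ ≤ s ^ δ * I + ∑' k : ℕ, s ^ δ * ((β : ℝ≥0∞) ^ δ * ((1 + K') * I)) * (q : ℝ≥0∞) ^ k := by
        refine add_le_add le_rfl (ENNReal.tsum_le_tsum fun k => ?_)
        rw [ENNReal.mul_rpow_of_nonneg _ _ hδ0.le]
        calc _ ≤ s ^ δ * ((β : ℝ≥0∞) ^ (k + 1)) ^ δ * (θ ^ k * ((1 + K') * I)) :=
              mul_le_mul_right (hAk k) _
          _ = _ := by
              rw [hqe, mul_pow,
                ← ENNReal.rpow_natCast, ← ENNReal.rpow_mul, mul_comm ((k + 1 : ℕ) : ℝ) δ,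
                ENNReal.rpow_mul, ENNReal.rpow_natCast, pow_succ]
              ring
    _ = _ := by
        have h0 : (1 - q) ≠ 0 := (tsub_pos_of_lt hq1).ne'
        rw [ENNReal.tsum_mul_left, ENNReal.tsum_geometric, ← ENNReal.coe_one, ← ENNReal.coe_sub,
          ← ENNReal.coe_inv h0]
        push_cast
        rw [ENNReal.coe_rpow_of_nonneg _ hδ0.le]
        ring

end LevelDecay

/-! ### Gehring's lemma. -/

section Gehring

variable {X : Type*} [MetricSpace X] [MeasurableSpace X] [BorelSpace X] {μ : Measure X} {D : ℕ}

theorem lavg_le_mul_lavg {A A' : Set X} (hA : A ⊆ A') {c : ℝ≥0∞} (hc : c ≠ 0) (hct : c ≠ ∞)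
    (h : μ A' ≤ c * μ A) (f : X → ℝ≥0∞) : lavg μ A f ≤ c * lavg μ A' f := by
  have h1 : (μ A)⁻¹ ≤ c * (μ A')⁻¹ := by
    calc (μ A)⁻¹ = c * (c * μ A)⁻¹ := by
          rw [ENNReal.mul_inv (Or.inl hc) (Or.inl hct), ← mul_assoc,
            ENNReal.mul_inv_cancel hc hct, one_mul]
      _ ≤ c * (μ A')⁻¹ := mul_le_mul_right (ENNReal.inv_le_inv.2 h) _
  rw [lavg, lavg, ← mul_assoc]
  exact mul_le_mul' h1 (lintegral_mono_set hA)

theorem mul_lavg {A : Set X} (h0 : μ A ≠ 0) (ht : μ A ≠ ∞) (f : X → ℝ≥0∞) :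
    μ A * lavg μ A f = ∫⁻ x in A, f x ∂μ := by
  rw [lavg, ← mul_assoc, ENNReal.mul_inv_cancel h0 ht, one_mul]

theorem HasGrowth.isUnifLocDoublingMeasure (h : HasGrowth μ D) : IsUnifLocDoublingMeasure μ := by
  refine ⟨⟨Real.toNNReal (8 ^ D), ?_⟩⟩
  filter_upwards [self_mem_nhdsWithin] with ε hε x
  have hε : 0 < ε := hε
  calc μ (Metric.closedBall x (2 * ε)) ≤ ENNReal.ofReal ((2 * 4) ^ D) * μ (Metric.ball x ε) :=
        h.growth_of_subset hε (by norm_num) (Metric.closedBall_subset_ball (by linarith))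
    _ ≤ _ := by
        rw [show ((2 : ℝ) * 4) ^ D = 8 ^ D by norm_num]
        exact mul_le_mul_right (measure_mono Metric.ball_subset_closedBall) _

theorem HasGrowth.isLocallyFiniteMeasure (h : HasGrowth μ D) : IsLocallyFiniteMeasure μ :=
  ⟨fun x => ⟨Metric.ball x 1, Metric.ball_mem_nhds _ one_pos, (h.fin x 1).lt_top⟩⟩

/-- Lebesgue differentiation along closed balls of radius `r / 2`; the constant `4 ^ D` pays for the
passage to the open ball of radius `r`. -/
theorem HasGrowth.ae_eventually_lt_lavg [Nonempty X] (h : HasGrowth μ D) {f : X → ℝ≥0∞}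
    (hf : Measurable f) (hfi : ∫⁻ x, f x ∂μ ≠ ∞) :
    ∀ᵐ x ∂μ, ∀ c < f x, ∀ᶠ r in 𝓝[>] (0 : ℝ),
      c < ENNReal.ofReal (4 ^ D) * lavg μ (Metric.ball x r) f := by
  have := h.isUnifLocDoublingMeasure
  have := h.isLocallyFiniteMeasure
  have := h.secondCountable
  filter_upwards [(IsUnifLocDoublingMeasure.vitaliFamily μ 0).ae_tendsto_lintegral_div
    hf.aemeasurable hfi] with x hx c hc
  have hδ : Tendsto (fun r : ℝ => r / 2) (𝓝[>] 0) (𝓝[>] 0) := by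
    refine tendsto_nhdsWithin_iff.2 ⟨?_, ?_⟩
    · have : Tendsto (fun r : ℝ => r / 2) (𝓝 0) (𝓝 (0 / 2)) := tendsto_id.div_const 2
      rw [zero_div] at this
      exact this.mono_left nhdsWithin_le_nhds
    · filter_upwards [self_mem_nhdsWithin] with r hr
      exact half_pos (mem_Ioi.1 hr)
  have h1 := hx.comp (IsUnifLocDoublingMeasure.tendsto_closedBall_filterAt μ (K := 0)
    (fun _ => x) (fun r : ℝ => r / 2) hδ (Eventually.of_forall fun r => by simp))
  filter_upwards [h1.eventually (lt_mem_nhds hc), self_mem_nhdsWithin] with r hr hr0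
  have hr0 : 0 < r := hr0
  refine hr.trans_le ?_
  rw [Function.comp_apply, ENNReal.div_eq_inv_mul]
  refine lavg_le_mul_lavg (Metric.closedBall_subset_ball (by linarith)) (by positivity)
    ENNReal.ofReal_ne_top ?_ f
  calc μ (Metric.ball x r) ≤ ENNReal.ofReal ((2 * 2) ^ D) * μ (Metric.ball x (r / 2)) :=
        h.growth_of_subset (by linarith) (by norm_num)
          (Metric.ball_subset_ball (by linarith))
    _ ≤ _ := by
        rw [show ((2 : ℝ) * 2) ^ D = 4 ^ D by norm_num]
        exact mul_le_mul_right (measure_mono Metric.ball_subset_closedBall) _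

/-- The normalised distance to the complement of the ball `B(x₀, 2R)`. -/
noncomputable def relDist (x₀ : X) (R : ℝ) (y : X) : ℝ := (2 * R - dist y x₀) / R

theorem relDist_pos {x₀ y : X} {R : ℝ} (hR : 0 < R) (hy : y ∈ Metric.ball x₀ (2 * R)) :
    0 < relDist x₀ R y := div_pos (by rw [Metric.mem_ball] at hy; linarith) hR

theorem relDist_le {x₀ : X} {R : ℝ} (hR : 0 < R) (y : X) : relDist x₀ R y ≤ 2 := by
  rw [relDist, div_le_iff₀ hR]; linarith [dist_nonneg (x := y) (y := x₀)]

theorem measurable_relDist (x₀ : X) (R : ℝ) : Measurable (relDist x₀ R) := by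
  have : Continuous (relDist x₀ R) := by unfold relDist; fun_prop
  exact this.measurable

/-- The relative distance is Lipschitz with constant `1 / R`, so on a ball that is small compared
with the distance to the boundary it varies by bounded factors only. -/
theorem abs_relDist_sub_le {x₀ x y : X} {R : ℝ} (hR : 0 < R)
    (hy : dist y x ≤ relDist x₀ R x * R / 2) :
    relDist x₀ R x / 2 ≤ relDist x₀ R y ∧ relDist x₀ R y ≤ 3 / 2 * relDist x₀ R x := by
  have e : ∀ z, relDist x₀ R z * R = 2 * R - dist z x₀ := fun z => by
    rw [relDist, div_mul_cancel₀ _ hR.ne']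
  have h1 := dist_triangle y x x₀
  have h2 := dist_triangle x y x₀
  rw [dist_comm x y] at h2
  constructor
  · refine le_of_mul_le_mul_right ?_ hR
    have := e x; have := e y; linarith
  · refine le_of_mul_le_mul_right ?_ hR
    have := e x; have := e y; linarith

theorem ball_subset_of_le_relDist {x₀ x : X} {R ρ : ℝ} (hR : 0 < R)
    (hρ : ρ ≤ relDist x₀ R x * R) : Metric.ball x ρ ⊆ Metric.ball x₀ (2 * R) := by
  refine Metric.ball_subset_ball' ?_
  rw [relDist, div_mul_cancel₀ _ hR.ne'] at hρ
  linarith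

/-- Halve the radius, starting from half the distance to the boundary, and stop when the weighted
average first exceeds `lam`. The weight `relDist ^ D` exactly compensates the volume ratio between
`B(x₀, 2R)` and a small ball near its boundary. So the first four radii cannot be stopping radii,
and the ball of radius `8 * ρ` was examined before. -/
theorem HasGrowth.exists_stopping_radius (h : HasGrowth μ D) {v : X → ℝ≥0∞} {x₀ x : X} {R : ℝ}
    (hR : 0 < R) (hx : x ∈ Metric.ball x₀ (2 * R)) {lam : ℝ≥0∞}
    (hlam : ENNReal.ofReal (128 ^ D) * lavg μ (Metric.ball x₀ (2 * R)) v ≤ lam)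
    (hev : ∀ᶠ r in 𝓝[>] (0 : ℝ),
      lam < ENNReal.ofReal (relDist x₀ R x ^ D) * lavg μ (Metric.ball x r) v) :
    ∃ ρ : ℝ, 0 < ρ ∧ 8 * ρ ≤ relDist x₀ R x * R / 2 ∧
      lam < ENNReal.ofReal (relDist x₀ R x ^ D) * lavg μ (Metric.ball x ρ) v ∧
      ENNReal.ofReal (relDist x₀ R x ^ D) * lavg μ (Metric.ball x (8 * ρ)) v ≤ lam := by
  set d := relDist x₀ R x with hd
  have hd0 : 0 < d := relDist_pos hR hx
  have hd2 : d ≤ 2 := relDist_le hR x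
  have hden : d * R = 2 * R - dist x x₀ := by rw [hd, relDist, div_mul_cancel₀ _ hR.ne']
  set ρ : ℕ → ℝ := fun m => d * R / 2 * (1 / 2) ^ m with hρ
  have hρ0 : ∀ m, 0 < ρ m := fun m => by positivity
  have hρm : ∀ m, ρ m ≤ d * R / 2 := fun m =>
    mul_le_of_le_one_right (by positivity) (pow_le_one₀ (by norm_num) (by norm_num))
  have hlim : Tendsto ρ atTop (𝓝[>] 0) := by
    refine tendsto_nhdsWithin_iff.2 ⟨?_, Eventually.of_forall hρ0⟩
    have := (tendsto_pow_atTop_nhds_zero_of_lt_one (r := (1 / 2 : ℝ)) (by norm_num)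
      (by norm_num)).const_mul (d * R / 2)
    rwa [mul_zero] at this
  have hex : ∃ m, lam < ENNReal.ofReal (d ^ D) * lavg μ (Metric.ball x (ρ m)) v :=
    (hlim.eventually hev).exists
  classical
  set m := Nat.find hex with hm
  have hm1 := Nat.find_spec hex
  have hmin : ∀ k < m, ENNReal.ofReal (d ^ D) * lavg μ (Metric.ball x (ρ k)) v ≤ lam :=
    fun k hk => not_lt.1 (Nat.find_min hex hk)
  have hm3 : 3 < m := by
    by_contra hle
    push Not at hle
    refine absurd hm1 (not_lt.2 (le_trans ?_ hlam))
    have hpow : (1 / 8 : ℝ) ≤ (1 / 2) ^ m := by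
      calc (1 / 8 : ℝ) = (1 / 2) ^ 3 := by norm_num
        _ ≤ _ := pow_le_pow_of_le_one (by norm_num) (by norm_num) hle
    have hρR : d * R / 16 ≤ ρ m := by
      calc d * R / 16 = d * R / 2 * (1 / 8) := by ring
        _ ≤ d * R / 2 * (1 / 2) ^ m := by gcongr
    have h2 : lavg μ (Metric.ball x (ρ m)) v ≤
        ENNReal.ofReal ((2 * (64 / d)) ^ D) * lavg μ (Metric.ball x₀ (2 * R)) v := by
      refine lavg_le_mul_lavg (ball_subset_of_le_relDist hR ((hρm m).trans ?_))
        (by positivity) ENNReal.ofReal_ne_top ?_ v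
      · have : 0 < d * R := by positivity
        linarith
      · refine h.growth_of_subset (hρ0 m) ?_ (Metric.ball_subset_ball' ?_)
        · rw [le_div_iff₀ hd0]; linarith
        · rw [Metric.mem_ball, dist_comm] at hx
          calc 2 * R + dist x₀ x ≤ 64 / d * (d * R / 16) := by
                rw [show 64 / d * (d * R / 16) = 4 * R by field_simp; ring]; linarith
            _ ≤ _ := by gcongr
    calc _ ≤ ENNReal.ofReal (d ^ D) * (ENNReal.ofReal ((2 * (64 / d)) ^ D) *
          lavg μ (Metric.ball x₀ (2 * R)) v) := mul_le_mul_right h2 _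
      _ = _ := by
        rw [← mul_assoc, ← ENNReal.ofReal_mul (by positivity), ← mul_pow]
        congr 3
        field_simp; ring
  have h8 : 8 * ρ m = ρ (m - 3) := by
    obtain ⟨k, hk⟩ : ∃ k, m = k + 3 := ⟨m - 3, by omega⟩
    rw [hk, Nat.add_sub_cancel]
    simp only [hρ, pow_add]
    ring
  refine ⟨ρ m, hρ0 m, ?_, hm1, ?_⟩
  · rw [h8]; exact hρm _
  · rw [h8]; exact hmin _ (by omega)

/-- The ball of radius `8 * ρ` has weighted average at most `lam`, so its integral is at most a
multiple of `lam * μ (B(x, ρ))`. By hypothesis, half of the stopping ball carries values above `γ`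
times an average that exceeds `lam`. The factor `24` is `3 / 2 * 16`, from the variation of the
weight and from doubling. -/
theorem HasGrowth.setLIntegral_ball_le (h : HasGrowth μ D) {v : X → ℝ≥0∞} {γ : ℝ≥0∞}
    (H : ∀ (x : X) (r : ℝ), 0 < r → μ (Metric.ball x r) ≤
      2 * μ {y ∈ Metric.ball x r | γ * lavg μ (Metric.ball x r) v < v y})
    {x₀ x : X} {R ρ : ℝ} (hR : 0 < R) (hx : x ∈ Metric.ball x₀ (2 * R)) {lam : ℝ≥0∞}
    (hρ : 0 < ρ) (hρR : 8 * ρ ≤ relDist x₀ R x * R / 2)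
    (h1 : lam < ENNReal.ofReal (relDist x₀ R x ^ D) * lavg μ (Metric.ball x ρ) v)
    (h2 : ENNReal.ofReal (relDist x₀ R x ^ D) * lavg μ (Metric.ball x (8 * ρ)) v ≤ lam) :
    ∫⁻ y in Metric.ball x (8 * ρ), ENNReal.ofReal (relDist x₀ R y ^ D) * v y ∂μ ≤
      ENNReal.ofReal (2 * 24 ^ D) * lam * μ (Metric.ball x ρ ∩
        {y | γ * ENNReal.ofReal ((1 / 2) ^ D) * lam < ENNReal.ofReal (relDist x₀ R y ^ D) * v y}) := by
  set d := relDist x₀ R x with hd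
  have hd0 : 0 < d := relDist_pos hR hx
  have hB := h.pos x (8 * ρ) (by positivity)
  calc _ ≤ ∫⁻ y in Metric.ball x (8 * ρ), ENNReal.ofReal ((3 / 2 * d) ^ D) * v y ∂μ := by
        refine setLIntegral_mono' Metric.isOpen_ball.measurableSet fun y hy => ?_
        have h3 := abs_relDist_sub_le (x₀ := x₀) (x := x) (y := y) hR
          ((Metric.mem_ball.1 hy).le.trans hρR)
        refine mul_le_mul_left (ENNReal.ofReal_le_ofReal ?_) _
        exact pow_le_pow_left₀ (by rw [← hd] at h3; linarith) h3.2 D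
    _ = ENNReal.ofReal ((3 / 2) ^ D) * (ENNReal.ofReal (d ^ D) *
          lavg μ (Metric.ball x (8 * ρ)) v) * μ (Metric.ball x (8 * ρ)) := by
        rw [lintegral_const_mul' _ _ ENNReal.ofReal_ne_top, ← mul_lavg hB (h.fin _ _) v, mul_pow,
          ENNReal.ofReal_mul (by positivity)]
        ring
    _ ≤ ENNReal.ofReal ((3 / 2) ^ D) * lam *
          (ENNReal.ofReal ((2 * 8) ^ D) * μ (Metric.ball x ρ)) := by
        refine mul_le_mul' (mul_le_mul_right h2 _) (h.growth x ρ 8 hρ (by norm_num))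
    _ ≤ ENNReal.ofReal ((3 / 2) ^ D) * lam * (ENNReal.ofReal ((2 * 8) ^ D) *
          (2 * μ {y ∈ Metric.ball x ρ | γ * lavg μ (Metric.ball x ρ) v < v y})) :=
        mul_le_mul_right (mul_le_mul_right (H x ρ hρ) _) _
    _ = ENNReal.ofReal (2 * 24 ^ D) * lam *
          μ {y ∈ Metric.ball x ρ | γ * lavg μ (Metric.ball x ρ) v < v y} := by
        have e24 : ENNReal.ofReal (24 ^ D) =
            ENNReal.ofReal ((3 / 2) ^ D) * ENNReal.ofReal ((2 * 8) ^ D) := by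
          rw [← ENNReal.ofReal_mul (by positivity), ← mul_pow]; norm_num
        rw [ENNReal.ofReal_mul (by norm_num), e24, ENNReal.ofReal_ofNat]
        ring
    _ ≤ _ := by
        refine mul_le_mul_right (measure_mono ?_) _
        rintro y ⟨hy, hvy⟩
        refine ⟨hy, ?_⟩
        have h3 := (abs_relDist_sub_le (x₀ := x₀) (x := x) (y := y) hR
          ((Metric.mem_ball.1 hy).le.trans (by linarith))).1
        rw [← hd] at h3
        have e0 : ENNReal.ofReal ((d / 2) ^ D) ≠ 0 := by positivity
        simp only [mem_ofPred_eq]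
        calc γ * ENNReal.ofReal ((1 / 2) ^ D) * lam
            ≤ γ * ENNReal.ofReal ((1 / 2) ^ D) * (ENNReal.ofReal (d ^ D) *
                lavg μ (Metric.ball x ρ) v) := mul_le_mul_right h1.le _
          _ = ENNReal.ofReal ((d / 2) ^ D) * (γ * lavg μ (Metric.ball x ρ) v) := by
              rw [show d / 2 = 1 / 2 * d by ring, mul_pow, ENNReal.ofReal_mul (by positivity)]
              ring
          _ < ENNReal.ofReal ((d / 2) ^ D) * v y :=
              (ENNReal.mul_lt_mul_iff_right e0 ENNReal.ofReal_ne_top).2 hvy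
          _ ≤ _ := mul_le_mul_left (ENNReal.ofReal_le_ofReal
              (pow_le_pow_left₀ (by positivity) h3 D)) _

/-- Almost every point of the level set is the centre of a stopping ball. Vitali's lemma selects
disjoint stopping balls whose eightfold enlargements cover, and the bounds on single balls add up by
disjointness. The result controls the integral above a high level by the measure above a lower one.
-/
theorem HasGrowth.setLIntegral_level_le [Nonempty X] (h : HasGrowth μ D) {v : X → ℝ≥0∞}
    (hv : Measurable v) {γ : ℝ≥0∞}
    (H : ∀ (x : X) (r : ℝ), 0 < r → μ (Metric.ball x r) ≤
      2 * μ {y ∈ Metric.ball x r | γ * lavg μ (Metric.ball x r) v < v y})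
    {x₀ : X} {R : ℝ} (hR : 0 < R) (hvi : ∫⁻ x in Metric.ball x₀ (2 * R), v x ∂μ ≠ ∞) {lam : ℝ≥0∞}
    (hlam : ENNReal.ofReal (128 ^ D) * lavg μ (Metric.ball x₀ (2 * R)) v ≤ lam) :
    ∫⁻ y in {y | ENNReal.ofReal (4 ^ D) * lam < ENNReal.ofReal (relDist x₀ R y ^ D) * v y},
        ENNReal.ofReal (relDist x₀ R y ^ D) * v y ∂(μ.restrict (Metric.ball x₀ (2 * R))) ≤
      ENNReal.ofReal (2 * 24 ^ D) * lam * μ.restrict (Metric.ball x₀ (2 * R))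
        {y | γ * ENNReal.ofReal ((1 / 2) ^ D) * lam <
          ENNReal.ofReal (relDist x₀ R y ^ D) * v y} := by
  have := h.secondCountable
  set V : X → ℝ≥0∞ := fun y => ENNReal.ofReal (relDist x₀ R y ^ D) * v y with hV
  have hVm : Measurable V := ((measurable_relDist x₀ R).pow_const D).ennreal_ofReal.mul hv
  set B := Metric.ball x₀ (2 * R) with hB
  have hBm : MeasurableSet B := Metric.isOpen_ball.measurableSet
  set S : Set X := {y | ENNReal.ofReal (4 ^ D) * lam < V y} with hS
  set L : Set X := {y | γ * ENNReal.ofReal ((1 / 2) ^ D) * lam < V y} with hL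
  have hLm : MeasurableSet L := measurableSet_lt measurable_const hVm
  have hSm : MeasurableSet S := measurableSet_lt measurable_const hVm
  -- Cutting `v` off outside the ball makes it integrable, as differentiation requires; averages of
  -- the cut function are at most those of `v`.
  have hae := h.ae_eventually_lt_lavg (hv.indicator hBm) (by rwa [lintegral_indicator hBm])
  set G : Set X := {x | ∀ c < B.indicator v x, ∀ᶠ r in 𝓝[>] (0 : ℝ),
      c < ENNReal.ofReal (4 ^ D) * lavg μ (Metric.ball x r) (B.indicator v)} with hG
  have hch : ∀ x ∈ S ∩ B ∩ G, ∃ ρ : ℝ, 0 < ρ ∧ 8 * ρ ≤ relDist x₀ R x * R / 2 ∧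
      lam < ENNReal.ofReal (relDist x₀ R x ^ D) * lavg μ (Metric.ball x ρ) v ∧
      ENNReal.ofReal (relDist x₀ R x ^ D) * lavg μ (Metric.ball x (8 * ρ)) v ≤ lam := by
    rintro x ⟨⟨hxS, hxB⟩, hxG⟩
    refine h.exists_stopping_radius hR hxB hlam ?_
    have hd0 : 0 < relDist x₀ R x := relDist_pos hR hxB
    have e0 : ENNReal.ofReal (relDist x₀ R x ^ D) ≠ 0 := by positivity
    have hc : ENNReal.ofReal (4 ^ D) * lam / ENNReal.ofReal (relDist x₀ R x ^ D) <
        B.indicator v x := by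
      rw [indicator_of_mem hxB, ENNReal.div_lt_iff (Or.inl e0) (Or.inl ENNReal.ofReal_ne_top),
        mul_comm (v x)]
      exact hxS
    filter_upwards [hxG _ hc] with r hr
    rw [ENNReal.div_lt_iff (Or.inl e0) (Or.inl ENNReal.ofReal_ne_top), mul_assoc] at hr
    have hr2 := lt_of_mul_lt_mul_left' hr
    rw [mul_comm] at hr2
    refine hr2.trans_le (mul_le_mul_right (mul_le_mul_right (lintegral_mono fun y => ?_) _) _)
    exact indicator_le_self _ _ _
  choose! ρ hρ0 hρR hρ1 hρ2 using hch
  obtain ⟨u, hut, hud, huc⟩ := Vitali.exists_disjoint_subfamily_covering_enlargement_closedBall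
    (S ∩ B ∩ G) (fun x => x) ρ R (fun x hx => by
      have h1 := hρR x hx
      have h2 := relDist_le (x₀ := x₀) hR x
      have h3 := hρ0 x hx
      nlinarith) 5 (by norm_num)
  have hud' : u.PairwiseDisjoint fun a => Metric.ball a (ρ a) :=
    hud.mono fun a => Metric.ball_subset_closedBall
  have hucount : u.Countable := hud'.countable_of_isOpen (fun a _ => Metric.isOpen_ball)
    fun a ha => ⟨a, Metric.mem_ball_self (hρ0 a (hut ha))⟩
  have := hucount.to_subtype
  have hcov : (S ∩ B : Set X) ≤ᵐ[μ] (⋃ b : u, Metric.ball (b : X) (8 * ρ b) : Set X) := by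
    filter_upwards [hae] with x hx hxS
    have hxS : x ∈ S ∩ B := hxS
    show x ∈ ⋃ b : u, Metric.ball (b : X) (8 * ρ b)
    obtain ⟨b, hb, hsub⟩ := huc x ⟨hxS, hx⟩
    refine mem_iUnion.2 ⟨⟨b, hb⟩, ?_⟩
    have := hsub (Metric.mem_closedBall_self (hρ0 x ⟨hxS, hx⟩).le)
    exact Metric.closedBall_subset_ball (by linarith [hρ0 b (hut hb)]) this
  calc ∫⁻ y in S, V y ∂μ.restrict B = ∫⁻ y in S ∩ B, V y ∂μ := by
        rw [Measure.restrict_restrict hSm]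
    _ ≤ ∫⁻ y in ⋃ b : u, Metric.ball (b : X) (8 * ρ b), V y ∂μ :=
        lintegral_mono' (Measure.restrict_mono_ae hcov) le_rfl
    _ ≤ ∑' b : u, ∫⁻ y in Metric.ball (b : X) (8 * ρ b), V y ∂μ := lintegral_iUnion_le _ _
    _ ≤ ∑' b : u, ENNReal.ofReal (2 * 24 ^ D) * lam * μ (Metric.ball (b : X) (ρ b) ∩ L) :=
        ENNReal.tsum_le_tsum fun b => h.setLIntegral_ball_le H hR (hut b.2).1.2
          (hρ0 b (hut b.2)) (hρR b (hut b.2)) (hρ1 b (hut b.2)) (hρ2 b (hut b.2))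
    _ = ENNReal.ofReal (2 * 24 ^ D) * lam * μ (⋃ b : u, Metric.ball (b : X) (ρ b) ∩ L) := by
        rw [ENNReal.tsum_mul_left, measure_iUnion]
        · intro a b hab
          exact (hud' a.2 b.2 (fun hh => hab (Subtype.ext hh))).mono inter_subset_left
            inter_subset_left
        · exact fun b => Metric.isOpen_ball.measurableSet.inter hLm
    _ ≤ _ := by
        rw [Measure.restrict_apply hLm]
        refine mul_le_mul_right (measure_mono (iUnion_subset fun b => ?_)) _
        have hb := hut b.2
        refine fun y hy => ⟨hy.2, ball_subset_of_le_relDist hR ?_ hy.1⟩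
        have h1 := hρR b hb
        have h2 := hρ0 b hb
        linarith

/-- Gehring's lemma: a function whose level sets above a fixed fraction of the average fill
half of each ball satisfies a reverse Hölder inequality. -/
theorem HasGrowth.exists_lavg_rpow_le [Nonempty X] (h : HasGrowth μ D) {γ : ℝ≥0} (hγ0 : 0 < γ)
    (hγ1 : γ ≤ 1) : ∃ δ : ℝ, 0 < δ ∧ ∃ C : ℝ≥0, ∀ v : X → ℝ≥0∞, Measurable v →
      (∀ (x : X) (r : ℝ), 0 < r → μ (Metric.ball x r) ≤
        2 * μ {y ∈ Metric.ball x r | γ * lavg μ (Metric.ball x r) v < v y}) →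
      ∀ (x₀ : X) (R : ℝ), 0 < R → ∫⁻ x in Metric.ball x₀ (2 * R), v x ∂μ ≠ ∞ →
        lavg μ (Metric.ball x₀ R) (fun x => v x ^ (1 + δ)) ≤
          C * lavg μ (Metric.ball x₀ (2 * R)) v ^ (1 + δ) := by
  have hγt : (γ : ℝ≥0∞) ≠ 0 := by simpa using hγ0.ne'
  -- The ratio of the thresholds `4 ^ D * lam` and `γ * (1 / 2) ^ D * lam`, so that the upper
  -- threshold of one step is the lower threshold of the next. The constant `2 * 48 ^ D / γ` is `2 *
  -- 24 ^ D` rewritten relative to the lower threshold.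
  set β : ℝ≥0 := 8 ^ D / γ with hβ
  have hβ1 : 1 < β := by
    rw [hβ, one_lt_div hγ0]
    exact hγ1.trans_lt (one_lt_pow₀ (by norm_num) (by have := h.one_le; omega))
  obtain ⟨δ, hδ, C, hC⟩ := exists_lintegral_rpow_le_of_levels hβ1 (2 * 48 ^ D / γ)
  refine ⟨δ, hδ, C * (128 ^ D) ^ δ * 2 ^ D * 4 ^ D, fun v hv H x₀ R hR hvi => ?_⟩
  set a := lavg μ (Metric.ball x₀ (2 * R)) v with ha
  set V : X → ℝ≥0∞ := fun y => ENNReal.ofReal (relDist x₀ R y ^ D) * v y with hV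
  have hVm : Measurable V := ((measurable_relDist x₀ R).pow_const D).ennreal_ofReal.mul hv
  have hBm : MeasurableSet (Metric.ball x₀ (2 * R)) := Metric.isOpen_ball.measurableSet
  have h0 := h.pos x₀ R hR
  have ht := h.fin x₀ R
  have h20 := h.pos x₀ (2 * R) (by positivity)
  have h2t := h.fin x₀ (2 * R)
  have hsub : Metric.ball x₀ R ⊆ Metric.ball x₀ (2 * R) := Metric.ball_subset_ball (by linarith)
  have hmul : μ (Metric.ball x₀ (2 * R)) * a = ∫⁻ x in Metric.ball x₀ (2 * R), v x ∂μ :=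
    mul_lavg h20 h2t v
  have hat : a ≠ ∞ := ENNReal.mul_ne_top (ENNReal.inv_ne_top.2 h20) hvi
  rcases eq_or_ne a 0 with ha0 | ha0
  · have hz : ∀ᵐ x ∂μ.restrict (Metric.ball x₀ R), v x = 0 := by
      rw [ha0, mul_zero] at hmul
      have := (lintegral_eq_zero_iff hv).1 hmul.symm
      exact ae_restrict_of_ae_restrict_of_subset hsub this
    have : lavg μ (Metric.ball x₀ R) (fun x => v x ^ (1 + δ)) = 0 := by
      rw [lavg, lintegral_congr_ae (g := fun _ => 0), lintegral_zero, mul_zero]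
      filter_upwards [hz] with x hx
      rw [hx, ENNReal.zero_rpow_of_pos (by linarith)]
    rw [this]; exact zero_le
  have hVle : ∫⁻ x in Metric.ball x₀ (2 * R), V x ∂μ ≤
      2 ^ D * ∫⁻ x in Metric.ball x₀ (2 * R), v x ∂μ := by
    rw [← lintegral_const_mul _ hv]
    refine setLIntegral_mono' hBm fun x hx => mul_le_mul_left ?_ _
    rw [ENNReal.ofReal_pow (relDist_pos hR hx).le]
    refine pow_le_pow_left₀ zero_le ?_ D
    rw [← ENNReal.ofReal_ofNat]
    exact ENNReal.ofReal_le_ofReal (relDist_le hR x)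
  set s : ℝ≥0∞ := γ * ENNReal.ofReal ((1 / 2) ^ D) * (ENNReal.ofReal (128 ^ D) * a) with hs
  have hs0 : s ≠ 0 := by
    rw [hs]
    refine mul_ne_zero (mul_ne_zero hγt ?_) (mul_ne_zero ?_ ha0) <;> positivity
  have hβe : γ * ENNReal.ofReal ((1 / 2) ^ D) * (β : ℝ≥0∞) = ENNReal.ofReal (4 ^ D) := by
    have : γ * (1 / 2) ^ D * β = 4 ^ D := by
      rw [hβ, mul_comm γ, mul_assoc, mul_div_cancel₀ _ hγ0.ne', ← mul_pow]
      congr 1; norm_num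
    have h2 : ENNReal.ofReal ((1 / 2) ^ D) = (((1 / 2) ^ D : ℝ≥0) : ℝ≥0∞) := by
      rw [← ENNReal.ofReal_coe_nnreal]; push_cast; rfl
    have h3 : ENNReal.ofReal (4 ^ D) = ((4 ^ D : ℝ≥0) : ℝ≥0∞) := by
      rw [← ENNReal.ofReal_coe_nnreal]; push_cast; rfl
    rw [h2, h3, ← this]; push_cast; ring
  have hKe : ((2 * 48 ^ D / γ : ℝ≥0) : ℝ≥0∞) * (γ * ENNReal.ofReal ((1 / 2) ^ D)) =
      ENNReal.ofReal (2 * 24 ^ D) := by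
    have : 2 * 48 ^ D / γ * (γ * (1 / 2) ^ D) = 2 * 24 ^ D := by
      rw [← mul_assoc, div_mul_cancel₀ _ hγ0.ne', mul_assoc, ← mul_pow]
      congr 2; rw [← NNReal.coe_inj]; push_cast; norm_num
    have h2 : ENNReal.ofReal ((1 / 2) ^ D) = (((1 / 2) ^ D : ℝ≥0) : ℝ≥0∞) := by
      rw [← ENNReal.ofReal_coe_nnreal]; push_cast; rfl
    have h3 : ENNReal.ofReal (2 * 24 ^ D) = ((2 * 24 ^ D : ℝ≥0) : ℝ≥0∞) := by
      rw [← ENNReal.ofReal_coe_nnreal]; push_cast; rfl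
    rw [h2, h3, ← this]; push_cast; ring
  have hlev : ∀ i : ℕ, ∫⁻ x in {x | s * (β : ℝ≥0∞) ^ (i + 1) < V x}, V x
        ∂(μ.restrict (Metric.ball x₀ (2 * R))) ≤
      ((2 * 48 ^ D / γ : ℝ≥0) : ℝ≥0∞) * (s * (β : ℝ≥0∞) ^ i *
        μ.restrict (Metric.ball x₀ (2 * R)) {x | s * (β : ℝ≥0∞) ^ i < V x}) := by
    intro i
    have hl := h.setLIntegral_level_le hv H (x₀ := x₀) hR hvi
      (lam := ENNReal.ofReal (128 ^ D) * a * (β : ℝ≥0∞) ^ i)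
      (le_mul_of_one_le_right zero_le (one_le_pow₀ (by exact_mod_cast hβ1.le)))
    have e1 : s * (β : ℝ≥0∞) ^ (i + 1) =
        ENNReal.ofReal (4 ^ D) * (ENNReal.ofReal (128 ^ D) * a * (β : ℝ≥0∞) ^ i) := by
      rw [← hβe, hs]; ring
    have e2 : s * (β : ℝ≥0∞) ^ i = γ * ENNReal.ofReal ((1 / 2) ^ D) *
        (ENNReal.ofReal (128 ^ D) * a * (β : ℝ≥0∞) ^ i) := by
      rw [hs]; ring
    rw [e1, e2]
    refine hl.trans (le_of_eq ?_)
    rw [← hKe]; ring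
  have hfin := hC (μ.restrict (Metric.ball x₀ (2 * R))) V hVm
    (hVle.trans_lt (ENNReal.mul_lt_top (by finiteness) hvi.lt_top)).ne s hs0 hlev
  have hsle : s ≤ 128 ^ D * a := by
    have h128 : ENNReal.ofReal (128 ^ D) = 128 ^ D := by
      rw [ENNReal.ofReal_pow (by norm_num), ENNReal.ofReal_ofNat]
    rw [hs, h128]
    refine mul_le_of_le_one_left zero_le (mul_le_one₀ (by exact_mod_cast hγ1) zero_le ?_)
    rw [← ENNReal.ofReal_one]
    exact ENNReal.ofReal_le_ofReal (pow_le_one₀ (by norm_num) (by norm_num))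
  have hgr : μ (Metric.ball x₀ (2 * R)) ≤ 4 ^ D * μ (Metric.ball x₀ R) := by
    have := h.growth x₀ R 2 hR (by norm_num)
    rwa [ENNReal.ofReal_pow (by norm_num), show (2 : ℝ) * 2 = 4 by norm_num,
      ENNReal.ofReal_ofNat] at this
  have hsplit : a ^ (1 + δ) = a ^ δ * a := by
    rw [add_comm, ENNReal.rpow_add _ _ ha0 hat, ENNReal.rpow_one]
  calc lavg μ (Metric.ball x₀ R) (fun x => v x ^ (1 + δ))
      ≤ (μ (Metric.ball x₀ R))⁻¹ * ∫⁻ x in Metric.ball x₀ R, V x ^ (1 + δ) ∂μ := by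
        -- On the inner ball the relative distance is at least one, so `V` dominates `v`.
        refine mul_le_mul_right (setLIntegral_mono' Metric.isOpen_ball.measurableSet
          fun x hx => ENNReal.rpow_le_rpow ?_ (by linarith)) _
        refine le_mul_of_one_le_left zero_le ?_
        rw [← ENNReal.ofReal_one]
        refine ENNReal.ofReal_le_ofReal (one_le_pow₀ ?_)
        rw [relDist, le_div_iff₀ hR]
        rw [Metric.mem_ball] at hx
        linarith
    _ ≤ (μ (Metric.ball x₀ R))⁻¹ * (C * s ^ δ * (2 ^ D * (4 ^ D * μ (Metric.ball x₀ R) * a))) := by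
        refine mul_le_mul_right (((lintegral_mono_set hsub).trans hfin).trans
          (mul_le_mul_right (hVle.trans (mul_le_mul_right ?_ _)) _)) _
        rw [← hmul]
        exact mul_le_mul_left hgr _
    _ = ((μ (Metric.ball x₀ R))⁻¹ * μ (Metric.ball x₀ R)) * (C * s ^ δ * (2 ^ D * (4 ^ D * a))) := by
        ring
    _ ≤ C * ((128 ^ D) ^ δ * a ^ δ) * (2 ^ D * (4 ^ D * a)) := by
        rw [ENNReal.inv_mul_cancel h0 ht, one_mul, ← ENNReal.mul_rpow_of_nonneg _ _ hδ.le]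
        exact mul_le_mul_left (mul_le_mul_right (ENNReal.rpow_le_rpow hsle hδ.le) _) _
    _ = _ := by
        rw [hsplit]
        push_cast
        rw [ENNReal.coe_rpow_of_nonneg _ hδ.le]
        push_cast
        ring

end Gehring

/-! ### Muckenhoupt weights: duality, doubling, reverse Hölder, openness. -/

section Weights

variable {X : Type*} [MetricSpace X] [MeasurableSpace X] [BorelSpace X] {μ : Measure X} {D : ℕ}
  {s : ℝ} {v : X → ℝ≥0∞}

/-- Almost everywhere positive and finite weights in the class `A_s`. -/
structure ApWeight (μ : Measure X) (s : ℝ) (v : X → ℝ≥0∞) : Prop where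
  one_lt : 1 < s
  meas : Measurable v
  ne_zero : ∀ᵐ x ∂μ, v x ≠ 0
  ne_top : ∀ᵐ x ∂μ, v x ≠ ∞
  bound : ∃ C : ℝ≥0, ∀ (x : X) (r : ℝ), 0 < r →
    lavg μ (Metric.ball x r) v *
      (lavg μ (Metric.ball x r) (fun y => v y ^ (-1 / (s - 1)))) ^ (s - 1) ≤ C

/-- The same inequality raised to the power `1 / (s - 1)`. Openness of A_s comes from the reverse
Hölder inequality of this dual weight. -/
theorem ApWeight.dual (h : ApWeight μ s v) :
    ApWeight μ (1 + 1 / (s - 1)) (fun y => v y ^ (-1 / (s - 1))) := by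
  have hs : 0 < s - 1 := by linarith [h.one_lt]
  refine ⟨by linarith [one_div_pos.2 hs], h.meas.pow_const _, ?_, ?_, ?_⟩
  · filter_upwards [h.ne_zero, h.ne_top] with x h0 ht
    exact (ENNReal.rpow_pos (pos_iff_ne_zero.2 h0) ht).ne'
  · filter_upwards [h.ne_zero, h.ne_top] with x h0 ht
    exact ENNReal.rpow_ne_top_of_ne_zero h0 ht
  · obtain ⟨C, hC⟩ := h.bound
    refine ⟨C ^ (1 / (s - 1)), fun x r hr => ?_⟩
    have e : ∀ y, (v y ^ (-1 / (s - 1))) ^ (-1 / (1 + 1 / (s - 1) - 1)) = v y := fun y => by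
      rw [← ENNReal.rpow_mul, show -1 / (s - 1) * (-1 / (1 + 1 / (s - 1) - 1)) = 1 by
        rw [add_sub_cancel_left]; field_simp, ENNReal.rpow_one]
    simp only [e]
    rw [ENNReal.coe_rpow_of_nonneg _ (by positivity), add_sub_cancel_left]
    refine le_trans (le_of_eq ?_) (ENNReal.rpow_le_rpow (hC x r hr) (by positivity))
    rw [ENNReal.mul_rpow_of_nonneg _ _ (by positivity), ← ENNReal.rpow_mul, mul_one_div_cancel hs.ne',
      ENNReal.rpow_one, mul_comm]

theorem lavg_ne_zero {A : Set X} (h0 : μ A ≠ 0) (ht : μ A ≠ ∞) (hv : Measurable v)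
    (hv0 : ∀ᵐ x ∂μ, v x ≠ 0) : lavg μ A v ≠ 0 := by
  refine mul_ne_zero (ENNReal.inv_ne_zero.2 ht) fun h => ?_
  rw [lintegral_eq_zero_iff hv] at h
  have h1 : ∀ᵐ x ∂μ.restrict A, False := by
    filter_upwards [h, ae_restrict_of_ae hv0] with x h2 h3 using h3 h2
  rw [ae_iff] at h1
  simp only [not_false_eq_true] at h1
  exact h0 (by simpa using h1)

/-- An infinite average would force the average of the dual weight to vanish, but that weight is
almost everywhere nonzero. Finiteness on all balls thus follows from the A_s bound itself. -/
theorem ApWeight.lavg_ne_top (h : ApWeight μ s v) (hD : HasGrowth μ D) (x : X) {r : ℝ}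
    (hr : 0 < r) : lavg μ (Metric.ball x r) v ≠ ∞ := by
  obtain ⟨C, hC⟩ := h.bound
  have hs : 0 < s - 1 := by linarith [h.one_lt]
  have h0 := lavg_ne_zero (hD.pos x r hr) (hD.fin x r) h.dual.meas h.dual.ne_zero
  intro ht
  have := hC x r hr
  rw [ht, ENNReal.top_mul] at this
  · exact absurd this (by simp)
  · intro hz
    rw [ENNReal.rpow_eq_zero_iff] at hz
    rcases hz with hz | hz
    · exact h0 hz.1
    · linarith [hz.2]

theorem ApWeight.setLIntegral_ne_top (h : ApWeight μ s v) (hD : HasGrowth μ D) (x : X) (r : ℝ) :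
    ∫⁻ y in Metric.ball x r, v y ∂μ ≠ ∞ := by
  rcases le_or_gt r 0 with hr | hr
  · simp [Metric.ball_eq_empty.2 hr]
  · rw [← mul_lavg (hD.pos x r hr) (hD.fin x r)]
    exact ENNReal.mul_ne_top (hD.fin x r) (h.lavg_ne_top hD x hr)

theorem lavg_eq_lintegral (A : Set X) (f : X → ℝ≥0∞) :
    lavg μ A f = ∫⁻ x, f x ∂((μ A)⁻¹ • μ.restrict A) := by
  rw [lintegral_smul_measure]; rfl

/-- Hölder's inequality with exponents `s` and `s / (s - 1)`, applied to the factorisation of `g ^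
(1 / s)` as `(g * v) ^ (1 / s)` times `v ^ (-1 / s)`. -/
theorem ApWeight.exists_lavg_rpow_mul_le (h : ApWeight μ s v) :
    ∃ C : ℝ≥0, ∀ (x : X) (r : ℝ), 0 < r → ∀ g : X → ℝ≥0∞, AEMeasurable g μ →
      lavg μ (Metric.ball x r) (fun y => g y ^ (1 / s)) ^ s * lavg μ (Metric.ball x r) v ≤
        C * lavg μ (Metric.ball x r) (fun y => g y * v y) := by
  obtain ⟨C, hC⟩ := h.bound
  have hs1 := h.one_lt
  have hs : 0 < s - 1 := by linarith
  have hs0 : 0 < s := by linarith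
  refine ⟨C, fun x r hr g hg => ?_⟩
  set B := Metric.ball x r with hB
  have hconj : s.HolderConjugate (s / (s - 1)) := Real.HolderConjugate.conjExponent hs1
  have hac : (μ B)⁻¹ • μ.restrict B ≪ μ :=
    Measure.smul_absolutelyContinuous.trans Measure.absolutelyContinuous_restrict
  have h1 : lavg μ B (fun y => g y ^ (1 / s)) ≤ lavg μ B (fun y => g y * v y) ^ (1 / s) *
      lavg μ B (fun y => v y ^ (-1 / (s - 1))) ^ ((s - 1) / s) := by
    simp only [lavg_eq_lintegral]
    calc _ = ∫⁻ y, (g y * v y) ^ (1 / s) * v y ^ (-(1 / s)) ∂((μ B)⁻¹ • μ.restrict B) := by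
          refine lintegral_congr_ae ?_
          filter_upwards [hac.ae_le h.ne_zero, hac.ae_le h.ne_top] with y h0 ht
          rw [ENNReal.mul_rpow_of_nonneg _ _ (by positivity), mul_assoc,
            ← ENNReal.rpow_add _ _ h0 ht, add_neg_cancel, ENNReal.rpow_zero, mul_one]
      _ ≤ (∫⁻ y, ((g y * v y) ^ (1 / s)) ^ s ∂((μ B)⁻¹ • μ.restrict B)) ^ (1 / s) *
            (∫⁻ y, (v y ^ (-(1 / s))) ^ (s / (s - 1)) ∂((μ B)⁻¹ • μ.restrict B)) ^
              (1 / (s / (s - 1))) :=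
          ENNReal.lintegral_mul_le_Lp_mul_Lq _ hconj
            (((hg.mono_ac hac).mul h.meas.aemeasurable).pow_const _)
            (h.meas.pow_const _).aemeasurable
      _ = _ := by
          have e1 : ∀ y, ((g y * v y) ^ (1 / s)) ^ s = g y * v y := fun y => by
            rw [← ENNReal.rpow_mul, one_div_mul_cancel hs0.ne', ENNReal.rpow_one]
          have e2 : ∀ y, (v y ^ (-(1 / s))) ^ (s / (s - 1)) = v y ^ (-1 / (s - 1)) := fun y => by
            rw [← ENNReal.rpow_mul]; congr 1; field_simp
          simp only [e1, e2, one_div_div]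
  calc _ ≤ (lavg μ B (fun y => g y * v y) ^ (1 / s) *
        lavg μ B (fun y => v y ^ (-1 / (s - 1))) ^ ((s - 1) / s)) ^ s * lavg μ B v :=
        mul_le_mul_left (ENNReal.rpow_le_rpow h1 hs0.le) _
    _ = lavg μ B v * lavg μ B (fun y => v y ^ (-1 / (s - 1))) ^ (s - 1) *
        lavg μ B (fun y => g y * v y) := by
        rw [ENNReal.mul_rpow_of_nonneg _ _ hs0.le, ← ENNReal.rpow_mul, ← ENNReal.rpow_mul,
          one_div_mul_cancel hs0.ne', ENNReal.rpow_one, div_mul_cancel₀ _ hs0.ne']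
        ring
    _ ≤ _ := mul_le_mul_left (hC x r hr) _

/-- The previous inequality for the indicator of `A`: a subset that is large for `μ` is large for
the weight. Doubling of the weighted measure and the hypothesis of Gehring's lemma both follow from
it. -/
theorem ApWeight.exists_measure_rpow_le (h : ApWeight μ s v) (hD : HasGrowth μ D) :
    ∃ C : ℝ≥0, ∀ (x : X) (r : ℝ), 0 < r → ∀ A ⊆ Metric.ball x r, MeasurableSet A →
      μ A ^ s * ∫⁻ y in Metric.ball x r, v y ∂μ ≤
        C * μ (Metric.ball x r) ^ s * ∫⁻ y in A, v y ∂μ := by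
  obtain ⟨C, hC⟩ := h.exists_lavg_rpow_mul_le
  have hs0 : 0 < s := by linarith [h.one_lt]
  refine ⟨C, fun x r hr A hA hAm => ?_⟩
  set B := Metric.ball x r with hB
  have hB0 : μ B ≠ 0 := hD.pos x r hr
  have hBt : μ B ≠ ∞ := hD.fin x r
  have h1 := hC x r hr (A.indicator 1) (aemeasurable_one.indicator hAm)
  have e1 : lavg μ B (fun y => A.indicator (1 : X → ℝ≥0∞) y ^ (1 / s)) = (μ B)⁻¹ * μ A := by
    have : (fun y => A.indicator (1 : X → ℝ≥0∞) y ^ (1 / s)) = A.indicator 1 := by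
      ext y
      by_cases hy : y ∈ A
      · simp [hy]
      · simp [hy, hs0]
    rw [this, lavg, lintegral_indicator_one hAm, Measure.restrict_apply hAm,
      inter_eq_self_of_subset_left hA]
  have e2 : lavg μ B (fun y => A.indicator (1 : X → ℝ≥0∞) y * v y) =
      (μ B)⁻¹ * ∫⁻ y in A, v y ∂μ := by
    have : (fun y => A.indicator (1 : X → ℝ≥0∞) y * v y) = A.indicator v := by
      ext y
      by_cases hy : y ∈ A <;> simp [hy]
    rw [this, lavg, lintegral_indicator hAm, Measure.restrict_restrict hAm,
      inter_eq_self_of_subset_left hA]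
  rw [← hB, e1, e2] at h1
  calc _ = μ B ^ s * μ B * (((μ B)⁻¹ * μ A) ^ s * lavg μ B v) := by
        rw [ENNReal.mul_rpow_of_nonneg _ _ hs0.le, ← mul_lavg hB0 hBt v, ENNReal.inv_rpow]
        have hb0 : μ B ^ s ≠ 0 := (ENNReal.rpow_pos (pos_iff_ne_zero.2 hB0) hBt).ne'
        have hbt : μ B ^ s ≠ ∞ := ENNReal.rpow_ne_top_of_nonneg hs0.le hBt
        calc _ = μ B ^ s * (μ B ^ s)⁻¹ * (μ A ^ s * (μ B * lavg μ B v)) := by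
              rw [ENNReal.mul_inv_cancel hb0 hbt, one_mul]
          _ = _ := by ring
    _ ≤ μ B ^ s * μ B * (C * ((μ B)⁻¹ * ∫⁻ y in A, v y ∂μ)) := mul_le_mul_right h1 _
    _ = μ B * (μ B)⁻¹ * (C * μ B ^ s * ∫⁻ y in A, v y ∂μ) := by ring
    _ = _ := by rw [ENNReal.mul_inv_cancel hB0 hBt, one_mul]

/-- On the part `E` of the ball where `v ≤ γ * a`, with `a` the average, the weight has mass at most
`γ * a * μ E`. The A_s comparison then gives `(μ E / μ B) ^ (s - 1) ≤ C * γ`, and `γ` is taken small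
enough to force `μ E ≤ μ B / 2`. -/
theorem ApWeight.exists_half_le (h : ApWeight μ s v) (hD : HasGrowth μ D) :
    ∃ γ : ℝ≥0, 0 < γ ∧ γ ≤ 1 ∧ ∀ (x : X) (r : ℝ), 0 < r → μ (Metric.ball x r) ≤
        2 * μ {y ∈ Metric.ball x r | γ * lavg μ (Metric.ball x r) v < v y} := by
  obtain ⟨C, hC⟩ := h.exists_measure_rpow_le hD
  have hs : 0 < s - 1 := by linarith [h.one_lt]
  set c : ℝ≥0 := (1 / 2) ^ (s - 1) with hc
  have hc0 : 0 < c := NNReal.rpow_pos (by norm_num)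
  have hc1 : c ≤ 1 := NNReal.rpow_le_one (by rw [← NNReal.coe_le_coe]; push_cast; norm_num) hs.le
  have hCγ : C * (c / (C + 1)) < c := by
    rw [mul_div_assoc', div_lt_iff₀ (by positivity), mul_comm]
    exact mul_lt_mul_of_pos_left (lt_add_of_pos_right _ one_pos) hc0
  refine ⟨c / (C + 1), by positivity, ?_, fun x r hr => ?_⟩
  · rw [div_le_one (by positivity)]; exact hc1.trans le_add_self
  set γ : ℝ≥0 := c / (C + 1) with hγ
  set B := Metric.ball x r with hB
  set a := lavg μ B v with ha
  have hB0 : μ B ≠ 0 := hD.pos x r hr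
  have hBt : μ B ≠ ∞ := hD.fin x r
  have ha0 : a ≠ 0 := lavg_ne_zero hB0 hBt h.meas h.ne_zero
  have hat : a ≠ ∞ := h.lavg_ne_top hD x hr
  set E : Set X := {y ∈ B | v y ≤ γ * a} with hE
  have hEm : MeasurableSet E :=
    Metric.isOpen_ball.measurableSet.inter (measurableSet_le h.meas measurable_const)
  have hEB : E ⊆ B := fun y hy => hy.1
  have hcompl : B \ E ⊆ {y ∈ B | γ * a < v y} := fun y hy => ⟨hy.1, not_le.1 fun hle => hy.2 ⟨hy.1, hle⟩⟩
  suffices hle : μ E ≤ μ B / 2 by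
    have h1 : μ B / 2 ≤ μ (B \ E) := by
      have h2 : μ B = μ E + μ (B \ E) := by
        have h3 := measure_inter_add_sdiff (μ := μ) B hEm
        rw [inter_eq_self_of_subset_right hEB] at h3
        exact h3.symm
      by_contra hlt
      push Not at hlt
      have h3 : μ E + μ (B \ E) < μ B / 2 + μ B / 2 :=
        ENNReal.add_lt_add_of_le_of_lt ((measure_mono hEB).trans_lt hBt.lt_top).ne hle hlt
      rw [ENNReal.add_halves, ← h2] at h3
      exact lt_irrefl _ h3
    calc μ B = 2 * (μ B / 2) := (ENNReal.mul_div_cancel (by simp) (by simp)).symm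
      _ ≤ _ := mul_le_mul_right (h1.trans (measure_mono hcompl)) _
  by_contra hlt
  push Not at hlt
  have hE0 : μ E ≠ 0 := (zero_le.trans_lt hlt).ne'
  have hEt : μ E ≠ ∞ := ((measure_mono hEB).trans_lt hBt.lt_top).ne
  have h1 := hC x r hr E hEB hEm
  have h2 : ∫⁻ y in E, v y ∂μ ≤ γ * a * μ E := by
    rw [← setLIntegral_const]
    exact setLIntegral_mono' hEm fun y hy => hy.2
  rw [← hB, ← mul_lavg hB0 hBt v, ← ha] at h1
  have e : ∀ z : ℝ≥0∞, z ≠ 0 → z ≠ ∞ → z ^ s = z ^ (s - 1) * z := fun z h0 ht => by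
    nth_rewrite 3 [← ENNReal.rpow_one z]
    rw [← ENNReal.rpow_add _ _ h0 ht]; congr 1; ring
  have h3 : (a * μ E * μ B) * μ E ^ (s - 1) ≤ (a * μ E * μ B) * (C * γ * μ B ^ (s - 1)) := by
    calc _ = μ E ^ s * (μ B * a) := by rw [e _ hE0 hEt]; ring
      _ ≤ _ := h1
      _ ≤ C * μ B ^ s * (γ * a * μ E) := mul_le_mul_right h2 _
      _ = _ := by rw [e _ hB0 hBt]; ring
  rw [ENNReal.mul_le_mul_iff_right (mul_ne_zero (mul_ne_zero ha0 hE0) hB0)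
    (ENNReal.mul_ne_top (ENNReal.mul_ne_top hat hEt) hBt)] at h3
  have h4 : μ B ^ (s - 1) * c ≤ μ B ^ (s - 1) * (C * γ) := by
    calc _ = (μ B / 2) ^ (s - 1) := by
          rw [hc, ENNReal.coe_rpow_of_nonneg _ hs.le, ← ENNReal.mul_rpow_of_nonneg _ _ hs.le,
            ENNReal.div_eq_inv_mul, mul_comm]
          congr 2
          rw [one_div, ENNReal.coe_inv (by norm_num)]; rfl
      _ ≤ _ := ENNReal.rpow_le_rpow hlt.le hs.le
      _ ≤ _ := h3
      _ = _ := by ring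
  rw [ENNReal.mul_le_mul_iff_right (ENNReal.rpow_pos (pos_iff_ne_zero.2 hB0) hBt).ne'
    (ENNReal.rpow_ne_top_of_nonneg hs.le hBt)] at h4
  exact absurd h4 (not_le.2 (by exact_mod_cast hCγ))

theorem ApWeight.exists_growth (h : ApWeight μ s v) (hD : HasGrowth μ D) :
    ∃ D', HasGrowth (μ.withDensity v) D' := by
  obtain ⟨C, hC⟩ := h.exists_measure_rpow_le hD
  have hs0 : 0 < s := by linarith [h.one_lt]
  obtain ⟨m, hm⟩ : ∃ m : ℕ, (C : ℝ) < 2 ^ m := pow_unbounded_of_one_lt _ (by norm_num)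
  obtain ⟨n, hn⟩ := exists_nat_ge (D * s)
  have hball : ∀ (x : X) (r : ℝ), (μ.withDensity v) (Metric.ball x r) =
      ∫⁻ y in Metric.ball x r, v y ∂μ := fun x r =>
    withDensity_apply _ Metric.isOpen_ball.measurableSet
  refine ⟨n + m + 1, by omega, fun x r hr => ?_, fun x r => ?_, fun x r L hr hL => ?_⟩
  · rw [hball, ← mul_lavg (hD.pos x r hr) (hD.fin x r)]
    exact mul_ne_zero (hD.pos x r hr) (lavg_ne_zero (hD.pos x r hr) (hD.fin x r) h.meas h.ne_zero)
  · rw [hball]; exact h.setLIntegral_ne_top hD x r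
  · rw [hball, hball]
    have hLr : r ≤ L * r := le_mul_of_one_le_left hr.le hL
    have h1 := hC x (L * r) (by positivity) _ (Metric.ball_subset_ball hLr)
      Metric.isOpen_ball.measurableSet
    have hg := ENNReal.rpow_le_rpow (hD.growth x r L hr hL) hs0.le
    have hb0 : μ (Metric.ball x r) ^ s ≠ 0 :=
      (ENNReal.rpow_pos (pos_iff_ne_zero.2 (hD.pos x r hr)) (hD.fin x r)).ne'
    have hbt : μ (Metric.ball x r) ^ s ≠ ∞ := ENNReal.rpow_ne_top_of_nonneg hs0.le (hD.fin x r)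
    rw [← ENNReal.mul_le_mul_iff_right hb0 hbt]
    refine h1.trans ?_
    rw [ENNReal.mul_rpow_of_nonneg _ _ hs0.le] at hg
    calc _ ≤ C * (ENNReal.ofReal ((2 * L) ^ D) ^ s * μ (Metric.ball x r) ^ s) *
          ∫⁻ y in Metric.ball x r, v y ∂μ := by gcongr
      _ = μ (Metric.ball x r) ^ s * (C * ENNReal.ofReal ((2 * L) ^ D) ^ s *
          ∫⁻ y in Metric.ball x r, v y ∂μ) := by ring
      _ ≤ _ := by
        refine mul_le_mul_right (mul_le_mul_left ?_ _) _
        rw [ENNReal.ofReal_rpow_of_nonneg (by positivity) hs0.le, ← ENNReal.ofReal_coe_nnreal,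
          ← ENNReal.ofReal_mul (NNReal.coe_nonneg C)]
        refine ENNReal.ofReal_le_ofReal ?_
        have h2L : 1 ≤ 2 * L := by linarith
        calc (C : ℝ) * ((2 * L) ^ D) ^ s ≤ (2 * L) ^ m * (2 * L) ^ n := by
              refine mul_le_mul (hm.le.trans (pow_le_pow_left₀ (by norm_num) (by linarith) m)) ?_
                (by positivity) (by positivity)
              rw [← Real.rpow_natCast, ← Real.rpow_natCast, ← Real.rpow_mul (by linarith)]
              exact Real.rpow_le_rpow_of_exponent_le h2L hn
          _ ≤ _ := by
              rw [← pow_add]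
              exact pow_le_pow_right₀ h2L (by omega)

/-- Weights in `A_s` satisfy a reverse Hölder inequality. -/
theorem ApWeight.exists_reverseHolder [Nonempty X] (h : ApWeight μ s v) (hD : HasGrowth μ D) :
    ∃ δ : ℝ, 0 < δ ∧ ∃ C : ℝ≥0, ∀ (x : X) (r : ℝ), 0 < r →
      lavg μ (Metric.ball x r) (fun y => v y ^ (1 + δ)) ≤
        C * lavg μ (Metric.ball x r) v ^ (1 + δ) := by
  obtain ⟨γ, hγ0, hγ1, H⟩ := h.exists_half_le hD
  obtain ⟨δ, hδ, C, hC⟩ := hD.exists_lavg_rpow_le hγ0 hγ1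
  obtain ⟨D', hD'⟩ := h.exists_growth hD
  have hδ1 : 0 ≤ 1 + δ := by linarith
  refine ⟨δ, hδ, C * (Real.toNNReal ((2 * 2) ^ D')) ^ (1 + δ), fun x r hr => ?_⟩
  refine (hC v h.meas H x r hr (h.setLIntegral_ne_top hD x _)).trans ?_
  have h1 : lavg μ (Metric.ball x (2 * r)) v ≤
      ENNReal.ofReal ((2 * 2) ^ D') * lavg μ (Metric.ball x r) v := by
    have h2 := hD'.growth x r 2 hr (by norm_num)
    rw [withDensity_apply _ Metric.isOpen_ball.measurableSet,
      withDensity_apply _ Metric.isOpen_ball.measurableSet] at h2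
    rw [lavg, lavg, mul_left_comm]
    exact mul_le_mul' (ENNReal.inv_le_inv.2 (measure_mono (Metric.ball_subset_ball (by linarith)))) h2
  calc _ ≤ C * (ENNReal.ofReal ((2 * 2) ^ D') * lavg μ (Metric.ball x r) v) ^ (1 + δ) :=
        mul_le_mul_right (ENNReal.rpow_le_rpow h1 hδ1) _
    _ = _ := by
        rw [ENNReal.mul_rpow_of_nonneg _ _ hδ1, ENNReal.coe_mul, ENNReal.coe_rpow_of_nonneg _ hδ1,
          mul_assoc]
        rfl

/-- The classes `A_s` are open in `s`. -/
theorem ApWeight.exists_lt [Nonempty X] (h : ApWeight μ s v) (hD : HasGrowth μ D) :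
    ∃ s' < s, ApWeight μ s' v := by
  have hs : 0 < s - 1 := by linarith [h.one_lt]
  obtain ⟨δ, hδ, C, hC⟩ := h.dual.exists_reverseHolder hD
  obtain ⟨K, hK⟩ := h.bound
  -- The power `-1 / e` of `v` is the power `1 + δ` of the dual weight, so the reverse Hölder
  -- inequality of the dual weight is exactly the passage from `s - 1` to `e`.
  set e := (s - 1) / (1 + δ) with he
  have he0 : 0 < e := by positivity
  have hes : e < s - 1 := by
    rw [he, div_lt_iff₀ (by linarith)]; nlinarith
  refine ⟨1 + e, by linarith, by linarith, h.meas, h.ne_zero, h.ne_top, K * C ^ e,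
    fun x r hr => ?_⟩
  rw [add_sub_cancel_left]
  have e1 : ∀ y, (v y ^ (-1 / (s - 1))) ^ (1 + δ) = v y ^ (-1 / e) := fun y => by
    rw [← ENNReal.rpow_mul]; congr 1; rw [he]; field_simp
  have h1 := hC x r hr
  simp only [e1] at h1
  have e2 : (1 + δ) * e = s - 1 := by rw [he]; field_simp
  calc _ ≤ lavg μ (Metric.ball x r) v * (C * lavg μ (Metric.ball x r)
          (fun y => v y ^ (-1 / (s - 1))) ^ (1 + δ)) ^ e :=
        mul_le_mul_right (ENNReal.rpow_le_rpow h1 he0.le) _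
    _ = (C : ℝ≥0∞) ^ e * (lavg μ (Metric.ball x r) v * lavg μ (Metric.ball x r)
          (fun y => v y ^ (-1 / (s - 1))) ^ (s - 1)) := by
        rw [ENNReal.mul_rpow_of_nonneg _ _ he0.le, ← ENNReal.rpow_mul, e2]; ring
    _ ≤ (C : ℝ≥0∞) ^ e * K := mul_le_mul_right (hK x r hr) _
    _ = _ := by rw [ENNReal.coe_mul, ENNReal.coe_rpow_of_nonneg _ he0.le, mul_comm]

/-- Reverse Hölder exponents of `A_s` weights can be increased. -/
theorem ApWeight.exists_gt_reverseHolder [Nonempty X] (h : ApWeight μ s v) (hD : HasGrowth μ D)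
    {σ : ℝ} (hσ : 1 ≤ σ) {C₀ : ℝ≥0} (hRH : ∀ (x : X) (r : ℝ), 0 < r →
      lavg μ (Metric.ball x r) (fun y => v y ^ σ) ≤ C₀ * lavg μ (Metric.ball x r) v ^ σ) :
    ∃ σ' > σ, ∃ C : ℝ≥0, ∀ (x : X) (r : ℝ), 0 < r →
      lavg μ (Metric.ball x r) (fun y => v y ^ σ') ≤ C * lavg μ (Metric.ball x r) v ^ σ' := by
  have hs : 0 < s - 1 := by linarith [h.one_lt]
  have hσ0 : 0 < σ := by linarith
  obtain ⟨K, hK⟩ := h.bound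
  -- The given reverse Hölder inequality turns the A_s bound of `v` into a Muckenhoupt bound for `v
  -- ^ σ`; the reverse Hölder inequality of this power raises `σ` to `σ * (1 + δ)`.
  have hA : ApWeight μ (1 + σ * (s - 1)) (fun y => v y ^ σ) := by
    refine ⟨by nlinarith, h.meas.pow_const _, ?_, ?_, C₀ * K ^ σ, fun x r hr => ?_⟩
    · filter_upwards [h.ne_zero, h.ne_top] with x h0 ht
      exact (ENNReal.rpow_pos (pos_iff_ne_zero.2 h0) ht).ne'
    · filter_upwards [h.ne_zero, h.ne_top] with x h0 ht
      exact ENNReal.rpow_ne_top_of_ne_zero h0 ht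
    · rw [add_sub_cancel_left]
      have e1 : ∀ y, (v y ^ σ) ^ (-1 / (σ * (s - 1))) = v y ^ (-1 / (s - 1)) := fun y => by
        rw [← ENNReal.rpow_mul]; congr 1; field_simp
      simp only [e1]
      calc _ ≤ C₀ * lavg μ (Metric.ball x r) v ^ σ * lavg μ (Metric.ball x r)
            (fun y => v y ^ (-1 / (s - 1))) ^ (σ * (s - 1)) := mul_le_mul_left (hRH x r hr) _
        _ = C₀ * (lavg μ (Metric.ball x r) v * lavg μ (Metric.ball x r)
            (fun y => v y ^ (-1 / (s - 1))) ^ (s - 1)) ^ σ := by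
            rw [ENNReal.mul_rpow_of_nonneg _ _ hσ0.le, ← ENNReal.rpow_mul, mul_comm σ, mul_assoc]
        _ ≤ C₀ * (K : ℝ≥0∞) ^ σ :=
            mul_le_mul_right (ENNReal.rpow_le_rpow (hK x r hr) hσ0.le) _
        _ = _ := by rw [ENNReal.coe_mul, ENNReal.coe_rpow_of_nonneg _ hσ0.le]
  obtain ⟨δ, hδ, C, hC⟩ := hA.exists_reverseHolder hD
  refine ⟨σ * (1 + δ), by nlinarith, C * C₀ ^ (1 + δ), fun x r hr => ?_⟩
  have h1 := hC x r hr
  simp only [← ENNReal.rpow_mul] at h1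
  have hδ1 : 0 ≤ 1 + δ := by linarith
  refine h1.trans ?_
  calc _ ≤ C * (C₀ * lavg μ (Metric.ball x r) v ^ σ) ^ (1 + δ) :=
        mul_le_mul_right (ENNReal.rpow_le_rpow (hRH x r hr) hδ1) _
    _ = _ := by
        rw [ENNReal.mul_rpow_of_nonneg _ _ hδ1, ← ENNReal.rpow_mul, ENNReal.coe_mul,
          ENNReal.coe_rpow_of_nonneg _ hδ1, mul_assoc]

/-- If `w` vanished on a set of positive measure, its negative power would have infinite average on
all large balls, and the A_s bound would make `w` null on each of them. As `0 * ∞ = 0`, the A_s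
bound does not exclude a null weight, so nontriviality has to be assumed. -/
theorem MuckenhouptA.apWeight {w : X → ℝ≥0} (h : MuckenhouptA μ s w) (hw : Measurable w)
    (hD : HasGrowth μ D) [Nonempty X] (h0 : weighted μ w ≠ 0) :
    ApWeight μ s (fun x => (w x : ℝ≥0∞)) := by
  obtain ⟨hs, C, hC⟩ := h
  have hs1 : 0 < s - 1 := by linarith
  refine ⟨hs, hw.coe_nnreal_ennreal, ?_, ae_of_all _ fun x => ENNReal.coe_ne_top, C, hC⟩
  by_contra hz
  apply h0
  have hwm : Measurable fun x => (w x : ℝ≥0∞) := hw.coe_nnreal_ennreal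
  obtain ⟨x₀⟩ := ‹Nonempty X›
  set Z : Set X := {x | (w x : ℝ≥0∞) = 0} with hZ
  have hZ0 : μ Z ≠ 0 := by
    intro hh
    apply hz
    rw [ae_iff]
    simpa only [ne_eq, not_not] using hh
  obtain ⟨n, hn⟩ : ∃ n : ℕ, μ (Z ∩ Metric.ball x₀ n) ≠ 0 := by
    by_contra hall
    push Not at hall
    apply hZ0
    rw [← inter_univ Z, ← Metric.iUnion_ball_nat x₀, inter_iUnion]
    exact measure_iUnion_null hall
  have hzero : ∀ m : ℕ, n < m → ∫⁻ y in Metric.ball x₀ m, (w y : ℝ≥0∞) ∂μ = 0 := by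
    intro m hnm
    have hm0 : (0 : ℝ) < m := by exact_mod_cast (Nat.zero_le n).trans_lt hnm
    have hb0 := hD.pos x₀ m hm0
    have hbt := hD.fin x₀ m
    have htop : lavg μ (Metric.ball x₀ m) (fun y => (w y : ℝ≥0∞) ^ (-1 / (s - 1))) = ∞ := by
      have h1 : ∫⁻ y in Metric.ball x₀ m, (w y : ℝ≥0∞) ^ (-1 / (s - 1)) ∂μ = ∞ := by
        refine top_le_iff.1 ?_
        calc ∞ = ∫⁻ y in Z ∩ Metric.ball x₀ n, ∞ ∂μ := by
              rw [setLIntegral_const, ENNReal.top_mul hn]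
          _ = ∫⁻ y in Z ∩ Metric.ball x₀ n, (w y : ℝ≥0∞) ^ (-1 / (s - 1)) ∂μ := by
              refine setLIntegral_congr_fun ((hwm (measurableSet_singleton 0)).inter
                Metric.isOpen_ball.measurableSet) fun y hy => ?_
              have hy0 : (w y : ℝ≥0∞) = 0 := hy.1
              simp only [hy0]
              rw [ENNReal.zero_rpow_of_neg (div_neg_of_neg_of_pos (by norm_num) hs1)]
          _ ≤ _ := lintegral_mono_set (inter_subset_right.trans
              (Metric.ball_subset_ball (by exact_mod_cast hnm.le)))
      rw [lavg, h1, ENNReal.mul_top (ENNReal.inv_ne_zero.2 hbt)]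
    have := hC x₀ m hm0
    rw [htop, ENNReal.top_rpow_of_pos hs1] at this
    rw [← mul_lavg hb0 hbt]
    by_contra hne
    rw [ENNReal.mul_top (right_ne_zero_of_mul hne)] at this
    exact absurd this (by simp)
  rw [← Measure.measure_univ_eq_zero, ← Metric.iUnion_ball_nat x₀, measure_iUnion_null_iff]
  intro m
  refine measure_mono_null (Metric.ball_subset_ball (?_ : (m : ℝ) ≤ ((m + n + 1 : ℕ) : ℝ))) ?_
  · exact_mod_cast (by omega : m ≤ m + n + 1)
  · rw [weighted, withDensity_apply _ Metric.isOpen_ball.measurableSet]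
    exact hzero _ (by omega)

theorem exists_lavg_mul_le {σ : ℝ} (hσ : 1 < σ) (hv : Measurable v) {C₀ : ℝ≥0}
    (hRH : ∀ (x : X) (r : ℝ), 0 < r →
      lavg μ (Metric.ball x r) (fun y => v y ^ σ) ≤ C₀ * lavg μ (Metric.ball x r) v ^ σ) :
    ∃ C : ℝ≥0, ∀ (x : X) (r : ℝ), 0 < r → ∀ g : X → ℝ≥0∞, AEMeasurable g μ →
      lavg μ (Metric.ball x r) (fun y => g y * v y) ≤
        C * (lavg μ (Metric.ball x r) (fun y => g y ^ (σ / (σ - 1))) ^ ((σ - 1) / σ) *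
          lavg μ (Metric.ball x r) v) := by
  have hσ0 : 0 < σ := by linarith
  have hσ1 : 0 < σ - 1 := by linarith
  refine ⟨C₀ ^ (1 / σ), fun x r hr g hg => ?_⟩
  set B := Metric.ball x r with hB
  have hac : (μ B)⁻¹ • μ.restrict B ≪ μ :=
    Measure.smul_absolutelyContinuous.trans Measure.absolutelyContinuous_restrict
  calc lavg μ B (fun y => g y * v y)
      ≤ lavg μ B (fun y => g y ^ (σ / (σ - 1))) ^ (1 / (σ / (σ - 1))) *
          lavg μ B (fun y => v y ^ σ) ^ (1 / σ) := by
        simp only [lavg_eq_lintegral]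
        exact ENNReal.lintegral_mul_le_Lp_mul_Lq _
          (Real.HolderConjugate.conjExponent hσ).symm (hg.mono_ac hac) hv.aemeasurable
    _ ≤ lavg μ B (fun y => g y ^ (σ / (σ - 1))) ^ (1 / (σ / (σ - 1))) *
          (C₀ * lavg μ B v ^ σ) ^ (1 / σ) :=
        mul_le_mul_right (ENNReal.rpow_le_rpow (hRH x r hr) (by positivity)) _
    _ = _ := by
        rw [ENNReal.mul_rpow_of_nonneg _ _ (by positivity), ← ENNReal.rpow_mul,
          mul_one_div_cancel hσ0.ne', ENNReal.rpow_one, one_div_div,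
          ENNReal.coe_rpow_of_nonneg _ (by positivity)]
        ring

theorem ApWeight.lavg_withDensity (h : ApWeight μ s v) (hD : HasGrowth μ D) (x : X) {r : ℝ}
    (hr : 0 < r) {g : X → ℝ≥0∞} (hg : AEMeasurable g μ) :
    lavg μ (Metric.ball x r) v * lavg (μ.withDensity v) (Metric.ball x r) g =
      lavg μ (Metric.ball x r) (fun y => g y * v y) := by
  set B := Metric.ball x r with hB
  have hB0 : μ B ≠ 0 := hD.pos x r hr
  have hBt : μ B ≠ ∞ := hD.fin x r
  have hBm : MeasurableSet B := Metric.isOpen_ball.measurableSet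
  have hv0 : ∫⁻ y in B, v y ∂μ ≠ 0 := by
    rw [← mul_lavg hB0 hBt]
    exact mul_ne_zero hB0 (lavg_ne_zero hB0 hBt h.meas h.ne_zero)
  rw [lavg, lavg, lavg, withDensity_apply _ hBm, restrict_withDensity hBm,
    lintegral_withDensity_eq_lintegral_mul₀ h.meas.aemeasurable hg.restrict, mul_assoc,
    ← mul_assoc (∫⁻ y in B, v y ∂μ), ENNReal.mul_inv_cancel hv0 (h.setLIntegral_ne_top hD x r),
    one_mul]
  simp only [Pi.mul_apply, mul_comm]

end Weights

/-! ### Transfer of estimates from μ to w dμ. -/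

section Transfer

variable {X : Type*} [MetricSpace X] [MeasurableSpace X] [BorelSpace X] {μ : Measure X} {D : ℕ}
  {s : ℝ} {v : X → ℝ≥0∞} {𝕜 : Type*} [RCLike 𝕜]

theorem avgNorm_ofReal {q : ℝ} (hq : 0 < q) (ν : Measure X) (B : Set X) (f : X → 𝕜) :
    avgNorm ν (ENNReal.ofReal q) B B f = lavg ν B (fun y => ‖f y‖ₑ ^ q) ^ (1 / q) := by
  rw [avgNorm, eLpNorm_eq_lintegral_rpow_enorm_toReal (by simpa using hq) ENNReal.ofReal_ne_top,
    ENNReal.toReal_ofReal hq.le, lavg_eq_lintegral]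

theorem ApWeight.lavg_pos (h : ApWeight μ s v) (hD : HasGrowth μ D) (x : X) {r : ℝ} (hr : 0 < r) :
    lavg μ (Metric.ball x r) v ≠ 0 :=
  lavg_ne_zero (hD.pos x r hr) (hD.fin x r) h.meas h.ne_zero

/-- The source side of the transfer, by `ApWeight.exists_lavg_rpow_mul_le` with `g` the power `P` of
the norm of `f`. The target side, just below, uses a reverse Hölder inequality instead. -/
theorem ApWeight.exists_avgNorm_le (h : ApWeight μ s v) (hD : HasGrowth μ D) {P : ℝ}
    (hP : 0 < P) : ∃ C : ℝ≥0, ∀ (x : X) (r : ℝ), 0 < r → ∀ f : X → 𝕜, AEStronglyMeasurable f μ →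
      avgNorm μ (ENNReal.ofReal (P / s)) (Metric.ball x r) (Metric.ball x r) f ≤
        C * avgNorm (μ.withDensity v) (ENNReal.ofReal P) (Metric.ball x r) (Metric.ball x r) f := by
  obtain ⟨C, hC⟩ := h.exists_lavg_rpow_mul_le
  have hs0 : 0 < s := by linarith [h.one_lt]
  refine ⟨C ^ (1 / P), fun x r hr f hf => ?_⟩
  have hg : AEMeasurable (fun y => ‖f y‖ₑ ^ P) μ := hf.enorm.pow_const _
  have h1 := hC x r hr _ hg
  rw [← h.lavg_withDensity hD x hr hg, mul_comm, mul_left_comm,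
    ENNReal.mul_le_mul_iff_right (h.lavg_pos hD x hr) (h.lavg_ne_top hD x hr)] at h1
  have e : ∀ y, (‖f y‖ₑ ^ P) ^ (1 / s) = ‖f y‖ₑ ^ (P / s) := fun y => by
    rw [← ENNReal.rpow_mul, mul_one_div]
  simp only [e] at h1
  rw [avgNorm_ofReal (by positivity), avgNorm_ofReal hP, ENNReal.coe_rpow_of_nonneg _ (by positivity),
    ← ENNReal.mul_rpow_of_nonneg _ _ (by positivity)]
  refine le_trans (le_of_eq ?_) (ENNReal.rpow_le_rpow h1 (by positivity))
  rw [← ENNReal.rpow_mul]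
  congr 1
  field_simp

theorem ApWeight.exists_avgNorm_withDensity_le (h : ApWeight μ s v) (hD : HasGrowth μ D) {Q σ : ℝ}
    (hQ : 0 < Q) (hσ : 1 < σ) {C₀ : ℝ≥0} (hRH : ∀ (x : X) (r : ℝ), 0 < r →
      lavg μ (Metric.ball x r) (fun y => v y ^ σ) ≤ C₀ * lavg μ (Metric.ball x r) v ^ σ) :
    ∃ C : ℝ≥0, ∀ (x : X) (r : ℝ), 0 < r → ∀ f : X → 𝕜, AEStronglyMeasurable f μ →
      avgNorm (μ.withDensity v) (ENNReal.ofReal Q) (Metric.ball x r) (Metric.ball x r) f ≤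
        C * avgNorm μ (ENNReal.ofReal (Q * (σ / (σ - 1)))) (Metric.ball x r) (Metric.ball x r) f := by
  obtain ⟨C, hC⟩ := exists_lavg_mul_le hσ h.meas hRH
  have hσ1 : 0 < σ - 1 := by linarith
  have hσ0 : 0 < σ := by linarith
  refine ⟨C ^ (1 / Q), fun x r hr f hf => ?_⟩
  have hg : AEMeasurable (fun y => ‖f y‖ₑ ^ Q) μ := hf.enorm.pow_const _
  have h1 := hC x r hr _ hg
  rw [← h.lavg_withDensity hD x hr hg, ← mul_assoc, mul_comm _ (lavg μ (Metric.ball x r) v),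
    ENNReal.mul_le_mul_iff_right (h.lavg_pos hD x hr) (h.lavg_ne_top hD x hr)] at h1
  have e : ∀ y, (‖f y‖ₑ ^ Q) ^ (σ / (σ - 1)) = ‖f y‖ₑ ^ (Q * (σ / (σ - 1))) := fun y => by
    rw [← ENNReal.rpow_mul]
  simp only [e] at h1
  rw [avgNorm_ofReal hQ, avgNorm_ofReal (by positivity), ENNReal.coe_rpow_of_nonneg _ (by positivity)]
  refine (ENNReal.rpow_le_rpow h1 (by positivity)).trans (le_of_eq ?_)
  rw [ENNReal.mul_rpow_of_nonneg _ _ (by positivity), ← ENNReal.rpow_mul]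
  congr 2
  field_simp

namespace FunctionSpace

variable {E : Type*} [NormedAddCommGroup E] [NormedSpace 𝕜 E]
  (𝔹 : FunctionSpace 𝕜 μ E) {T : ℝ → E →L[𝕜] E}

/-- Averages on a single ball are compared at both ends, so the Gaussian factor between the balls is
untouched. -/
theorem ScaleBound.transfer {ν : Measure X} (hD : HasGrowth μ D) {a b p q : ℝ≥0∞}
    {Ca Cb : ℝ≥0}
    (ha : ∀ (x : X) (r : ℝ), 0 < r → ∀ f : X → 𝕜, AEStronglyMeasurable f μ →
      avgNorm μ a (Metric.ball x r) (Metric.ball x r) f ≤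
        Ca * avgNorm ν p (Metric.ball x r) (Metric.ball x r) f)
    (hb : ∀ (x : X) (r : ℝ), 0 < r → ∀ f : X → 𝕜, AEStronglyMeasurable f μ →
      avgNorm ν q (Metric.ball x r) (Metric.ball x r) f ≤
        Cb * avgNorm μ b (Metric.ball x r) (Metric.ball x r) f)
    (hν : ∀ (x : X) (r : ℝ), 0 < r → ν (Metric.ball x r) ≠ 0)
    (h : 𝔹.ScaleBound μ T 1 a b) : 𝔹.ScaleBound ν T 1 p q := by
  obtain ⟨c, C, hc, hC, h⟩ := h
  refine ⟨c, (Cb + 1) * C * (Ca + 1), hc, by positivity, fun t ht x y g hg hgs => ?_⟩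
  have hρ : 0 < √(1 * t) := Real.sqrt_pos.2 (by linarith)
  have hm : AEStronglyMeasurable (𝔹.fn g : X → 𝕜) μ := 𝔹.aesm _ Measure.AbsolutelyContinuous.rfl
  have hga : MemLp (𝔹.fn g : X → 𝕜) a μ := by
    refine ⟨hm, ?_⟩
    rw [← 𝔹.eLpNorm_of_supp Measure.AbsolutelyContinuous.rfl measurableSet_ball hgs,
      eLpNorm_restrict_eq_avgNorm (hD.pos x _ hρ) (hD.fin x _)]
    refine ENNReal.mul_lt_top (ENNReal.rpow_lt_top_of_nonneg ENNReal.toReal_nonneg (hD.fin x _))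
      ((ha x _ hρ _ hm).trans_lt (ENNReal.mul_lt_top ENNReal.coe_lt_top ?_))
    exact (avgNorm_ne_top (hν x _ hρ) hg).lt_top
  calc _ ≤ Cb * avgNorm μ b (Metric.ball y √(1 * t)) (Metric.ball y √(1 * t))
          (𝔹.fn (T t g) : X → 𝕜) := hb y _ hρ _ (𝔹.aesm _ Measure.AbsolutelyContinuous.rfl)
    _ ≤ Cb * (ENNReal.ofReal (C * Real.exp (-(c * dist x y ^ 2 / t))) *
          (Ca * avgNorm ν p (Metric.ball x √(1 * t)) (Metric.ball x √(1 * t))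
            (𝔹.fn g : X → 𝕜))) :=
        mul_le_mul_right ((h t ht x y g hga hgs).trans (mul_le_mul_right (ha x _ hρ _ hm) _)) _
    _ = ENNReal.ofReal (Cb * C * Ca * Real.exp (-(c * dist x y ^ 2 / t))) *
          avgNorm ν p (Metric.ball x √(1 * t)) (Metric.ball x √(1 * t)) (𝔹.fn g : X → 𝕜) := by
        rw [show (Cb : ℝ) * C * Ca * Real.exp (-(c * dist x y ^ 2 / t)) =
          Cb * (C * Real.exp (-(c * dist x y ^ 2 / t)) * Ca) by ring,
          ENNReal.ofReal_mul (NNReal.coe_nonneg Cb),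
          ENNReal.ofReal_mul (p := C * _) (by positivity),
          ENNReal.ofReal_coe_nnreal, ENNReal.ofReal_coe_nnreal]
        ring
    _ ≤ _ := by
        refine mul_le_mul_left (ENNReal.ofReal_le_ofReal ?_) _
        gcongr <;> linarith

/-- Openness of both weight conditions gives A_{r₁} with `r₁ < p / p₀` and a reverse Hölder exponent
`σ` above the conjugate of `q₀ / p`. Then `a = p / r₁` is above `p₀`, and `b = Q₁ * (σ / (σ - 1))`
is below `q₀` for some `Q₁ > p`. The estimate from `a` to `b` for `μ` transfers to the nondegenerate
pair `p < Q₁`. -/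
theorem weightSet_subset_offSet [Nonempty X] (hD : HasGrowth μ D) (hTtr : 𝔹.TruncationContinuous T)
    (hT : ∀ s t : ℝ, 0 < s → 0 < t → T s ∘L T t = T (s + t)) {w : X → ℝ≥0} (hw : Measurable w)
    (hw0 : weighted μ w ≠ 0) {p₀ q₀ : ℝ≥0∞} (hp₀ : 1 ≤ p₀) (hJ : Ioo p₀ q₀ ⊆ 𝔹.offSet μ T) :
    weightSet μ w p₀ q₀ ⊆ 𝔹.offSet (weighted μ w) T := by
  rintro p ⟨hp, hpq, hA, hR⟩
  have hpt : p ≠ ∞ := (hpq.trans_le le_top).ne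
  have hp₀t : p₀ ≠ ∞ := (hp.trans_le le_top).ne
  have hp1 : 1 ≤ p := hp₀.trans hp.le
  set P := p.toReal with hP
  have hP1 : 1 ≤ P := by
    rw [hP, ← ENNReal.toReal_one]; exact (ENNReal.toReal_le_toReal (by simp) hpt).2 hp1
  have hPp : ENNReal.ofReal P = p := ENNReal.ofReal_toReal hpt
  set P₀ := p₀.toReal with hP₀
  have hP₀1 : 1 ≤ P₀ := by
    rw [hP₀, ← ENNReal.toReal_one]; exact (ENNReal.toReal_le_toReal (by simp) hp₀t).2 hp₀
  have hPp₀ : ENNReal.ofReal P₀ = p₀ := ENNReal.ofReal_toReal hp₀t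
  rw [ENNReal.toReal_div, ← hP, ← hP₀] at hA
  have hAp := hA.apWeight hw hD hw0
  obtain ⟨r₁, hr₁, hAp₁⟩ := hAp.exists_lt hD
  obtain ⟨D', hD'⟩ := hAp.exists_growth hD
  have hr1 := hAp₁.one_lt
  have hνμ : weighted μ w ≪ μ := withDensity_absolutelyContinuous _ _
  obtain ⟨hσ₀, C₀, hC₀⟩ := hR
  set σ₀ := (ENNReal.conjExponent (q₀ / p)).toReal with hσ₀d
  have hRH : ∀ (x : X) (r : ℝ), 0 < r → lavg μ (Metric.ball x r) (fun y => (w y : ℝ≥0∞) ^ σ₀) ≤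
      ((C₀ ^ σ₀ : ℝ≥0) : ℝ≥0∞) * lavg μ (Metric.ball x r) (fun y => (w y : ℝ≥0∞)) ^ σ₀ := by
    intro x r hr
    have h1 := ENNReal.rpow_le_rpow (hC₀ x r hr) (z := σ₀) (by linarith)
    rw [← ENNReal.rpow_mul, one_div_mul_cancel (by linarith), ENNReal.rpow_one,
      ENNReal.mul_rpow_of_nonneg _ _ (by linarith)] at h1
    rwa [ENNReal.coe_rpow_of_nonneg _ (by linarith)]
  obtain ⟨σ, hσ, C₁, hRH₁⟩ := hAp.exists_gt_reverseHolder hD hσ₀ hRH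
  have hσ1 : 1 < σ := hσ₀.trans_lt hσ
  have hσ1' : 0 < σ - 1 := by linarith
  have hconj : 1 < σ / (σ - 1) := by rw [one_lt_div hσ1']; linarith
  -- For `q₀ = ∞` this is only finiteness, and `σ > 1` comes from the Muckenhoupt condition alone.
  -- For finite `q₀` it is the inequality `σ > σ₀ = q₀ / (q₀ - p)`, rearranged.
  have hlt : ENNReal.ofReal (P * (σ / (σ - 1))) < q₀ := by
    rcases eq_or_ne q₀ ∞ with hq | hq
    · rw [hq]; exact ENNReal.ofReal_lt_top
    set Q := q₀.toReal with hQ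
    have hPQ : P < Q := (ENNReal.toReal_lt_toReal hpt hq).2 hpq
    have hσeq : σ₀ = 1 + (Q / P - 1)⁻¹ := by
      have h1 : 1 < q₀ / p := by
        rw [ENNReal.lt_div_iff_mul_lt (Or.inl (by positivity)) (Or.inl hpt), one_mul]; exact hpq
      have h2 : q₀ / p ≠ ∞ := ENNReal.div_ne_top hq (by positivity)
      rw [hσ₀d, ENNReal.conjExponent, ENNReal.toReal_add (by simp)
        (ENNReal.inv_ne_top.2 (tsub_pos_of_lt h1).ne'), ENNReal.toReal_inv,
        ENNReal.toReal_sub_of_le h1.le h2, ENNReal.toReal_div, ENNReal.toReal_one]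
    rw [← ENNReal.ofReal_toReal hq]
    refine (ENNReal.ofReal_lt_ofReal_iff (by linarith)).2 ?_
    rw [← hQ, mul_div_assoc', div_lt_iff₀ hσ1']
    have hQP : 0 < Q - P := by linarith
    have hP0 : 0 < P := by linarith
    have h3 : (Q / P - 1)⁻¹ = P / (Q - P) := by field_simp
    rw [hσeq, h3] at hσ
    have h4 : P / (Q - P) < σ - 1 := by linarith
    rw [div_lt_iff₀ hQP] at h4
    nlinarith
  obtain ⟨Q₁, hQ₁, hQlt⟩ : ∃ Q₁ : ℝ, P < Q₁ ∧ ENNReal.ofReal (Q₁ * (σ / (σ - 1))) < q₀ := by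
    have hc : Continuous fun y : ℝ => ENNReal.ofReal (y * (σ / (σ - 1))) :=
      ENNReal.continuous_ofReal.comp (by fun_prop)
    have h1 : ∀ᶠ y in 𝓝[>] P, ENNReal.ofReal (y * (σ / (σ - 1))) < q₀ :=
      (hc.continuousAt.eventually (gt_mem_nhds hlt)).filter_mono nhdsWithin_le_nhds
    obtain ⟨y, hy, hyP⟩ := (h1.and self_mem_nhdsWithin).exists
    exact ⟨y, hyP, hy⟩
  set a := P / r₁ with ha
  set b := Q₁ * (σ / (σ - 1)) with hb
  have haP : a < P := div_lt_self (by linarith) hr1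
  have hPb : P < b := hQ₁.trans (lt_mul_of_one_lt_right (by linarith) hconj)
  have haP₀ : P₀ < a := by
    rw [ha, lt_div_iff₀ (by linarith)]
    rwa [lt_div_iff₀ (by linarith), mul_comm] at hr₁
  have haJ : ENNReal.ofReal a ∈ 𝔹.offSet μ T := hJ ⟨by
    rw [← hPp₀]; exact (ENNReal.ofReal_lt_ofReal_iff (by linarith)).2 haP₀, by
    refine lt_trans ?_ hpq
    rw [← hPp]; exact (ENNReal.ofReal_lt_ofReal_iff (by linarith)).2 haP⟩
  have hbJ : ENNReal.ofReal b ∈ 𝔹.offSet μ T := hJ ⟨hp.trans (by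
    rw [← hPp]; exact (ENNReal.ofReal_lt_ofReal_iff (by linarith)).2 hPb), hQlt⟩
  have hO := 𝔹.offDiagonal_of_mem_offSet Measure.AbsolutelyContinuous.rfl hD hTtr hT haJ hbJ
    ((ENNReal.ofReal_lt_ofReal_iff (by linarith)).2 (haP.trans hPb))
  have hS := hO.scaleBound 𝔹 Measure.AbsolutelyContinuous.rfl hD
    (ENNReal.one_le_ofReal.2 (by linarith)) (ENNReal.one_le_ofReal.2 (by linarith)) le_rfl
  obtain ⟨Ca, hCa⟩ := hAp₁.exists_avgNorm_le (𝕜 := 𝕜) hD (P := P) (by linarith)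
  obtain ⟨Cb, hCb⟩ := hAp.exists_avgNorm_withDensity_le (𝕜 := 𝕜) hD (Q := Q₁) (by linarith)
    hσ1 hRH₁
  have hS' : 𝔹.ScaleBound (weighted μ w) T 1 (ENNReal.ofReal P) (ENNReal.ofReal Q₁) :=
    hS.transfer 𝔹 hD hCa hCb hD'.pos
  have hO' := hS'.offDiagonal 𝔹 hνμ hD' (ENNReal.one_le_ofReal.2 hP1)
    (ENNReal.one_le_ofReal.2 (by linarith))
  rw [← hPp]
  exact 𝔹.mem_offSet_left (ENNReal.one_le_ofReal.2 hP1)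
    ((ENNReal.ofReal_lt_ofReal_iff (by linarith)).2 hQ₁) hO'

end FunctionSpace

end Transfer

/-! ### Bounded semigroups strongly continuous at 0, and their generators. -/

section Semigroup

variable {𝕜 : Type*} [RCLike 𝕜] {F : Type*} [NormedAddCommGroup F] [NormedSpace 𝕜 F]
  [NormedSpace ℝ F] [IsScalarTower ℝ 𝕜 F] {S : ℝ → F →L[𝕜] F} {C : ℝ}

/-- Semigroups of uniformly bounded operators, strongly continuous at `0`. -/
structure IsBoundedC0 (S : ℝ → F →L[𝕜] F) (C : ℝ) : Prop where
  comp : ∀ s t : ℝ, 0 < s → 0 < t → S s ∘L S t = S (s + t)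
  norm_le : ∀ t : ℝ, 0 < t → ‖S t‖ ≤ C
  tendsto : ∀ f : F, Tendsto (fun t => S t f) (𝓝[>] 0) (𝓝 f)

/-- The orbit of `f`, extended by `f` to negative times. -/
noncomputable def orbit (S : ℝ → F →L[𝕜] F) (f : F) (t : ℝ) : F := if 0 < t then S t f else f

theorem orbit_of_pos (f : F) {t : ℝ} (ht : 0 < t) : orbit S f t = S t f := if_pos ht

theorem orbit_of_nonpos (f : F) {t : ℝ} (ht : t ≤ 0) : orbit S f t = f := if_neg (not_lt.2 ht)

theorem IsBoundedC0.apply_apply (h : IsBoundedC0 S C) {s t : ℝ} (hs : 0 < s) (ht : 0 < t) (f : F) :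
    S s (S t f) = S (s + t) f := by
  rw [← h.comp s t hs ht]; rfl

theorem IsBoundedC0.nonneg (h : IsBoundedC0 S C) : 0 ≤ C :=
  (norm_nonneg _).trans (h.norm_le 1 one_pos)

theorem IsBoundedC0.norm_apply_le (h : IsBoundedC0 S C) {t : ℝ} (ht : 0 < t) (f : F) :
    ‖S t f‖ ≤ C * ‖f‖ :=
  ((S t).le_opNorm f).trans (mul_le_mul_of_nonneg_right (h.norm_le t ht) (norm_nonneg _))

theorem IsBoundedC0.norm_orbit_le (h : IsBoundedC0 S C) (f : F) (t : ℝ) :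
    ‖orbit S f t‖ ≤ (C + 1) * ‖f‖ := by
  have := norm_nonneg f
  have := h.nonneg
  rcases lt_or_ge 0 t with ht | ht
  · rw [orbit_of_pos f ht]
    refine (h.norm_apply_le ht f).trans ?_
    nlinarith
  · rw [orbit_of_nonpos f ht]
    nlinarith

/-- For `0 < s < t`, the increment of the orbit is at most `C * ‖S (t - s) f - f‖`, so continuity at
zero propagates uniformly. The constant extension to negative times gives a continuous function on
the whole line. -/
theorem IsBoundedC0.continuous_orbit (h : IsBoundedC0 S C) (f : F) : Continuous (orbit S f) := by
  refine UniformContinuous.continuous (Metric.uniformContinuous_iff.2 fun ε hε => ?_)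
  have hC := h.nonneg
  have h1 := (Metric.tendsto_nhds.1 (h.tendsto f)) (ε / (C + 1)) (by positivity)
  obtain ⟨δ, hδ, hd⟩ := mem_nhdsGT_iff_exists_Ioo_subset.1 h1
  have hδ : 0 < δ := hδ
  have hd' : ∀ t, 0 < t → t < δ → ‖S t f - f‖ < ε / (C + 1) := fun t h0 ht => by
    have := hd ⟨h0, ht⟩
    simpa only [mem_ofPred_eq, dist_eq_norm] using this
  have hε' : ε / (C + 1) ≤ ε := div_le_self hε.le (by linarith)
  have key : ∀ s t : ℝ, s < t → t - s < δ → ‖orbit S f t - orbit S f s‖ < ε := by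
    intro s t hst hts
    rcases lt_or_ge 0 s with hs | hs
    · rw [orbit_of_pos f hs, orbit_of_pos f (hs.trans hst)]
      have e : S t f = S s (S (t - s) f) := by
        rw [h.apply_apply hs (by linarith)]; congr 2; ring
      rw [e, ← map_sub]
      calc _ ≤ C * ‖S (t - s) f - f‖ := h.norm_apply_le hs _
        _ ≤ C * (ε / (C + 1)) := mul_le_mul_of_nonneg_left (hd' _ (by linarith) hts).le hC
        _ < ε := by
          rw [mul_div_assoc', div_lt_iff₀ (by linarith)]; nlinarith
    · rw [orbit_of_nonpos f hs]
      rcases lt_or_ge 0 t with ht | ht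
      · rw [orbit_of_pos f ht]
        exact (hd' t ht (by linarith)).trans_le hε'
      · rw [orbit_of_nonpos f ht, sub_self, norm_zero]; exact hε
  refine ⟨δ, hδ, fun {a b} hab => ?_⟩
  rw [Real.dist_eq] at hab
  rw [dist_eq_norm]
  rcases lt_trichotomy a b with hlt | rfl | hlt
  · rw [norm_sub_rev]
    exact key a b hlt (by rw [abs_sub_comm] at hab; exact (le_abs_self _).trans_lt hab)
  · rw [sub_self, norm_zero]; exact hε
  · exact key b a hlt ((le_abs_self _).trans_lt hab)

theorem coe_inv_smul (t : ℝ) (x : F) : ((t⁻¹ : ℝ) : 𝕜) • x = t⁻¹ • x :=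
  (RCLike.real_smul_eq_coe_smul (K := 𝕜) t⁻¹ x).symm

/-- The graph of the infinitesimal generator. -/
def generatorGraph (S : ℝ → F →L[𝕜] F) : Submodule 𝕜 (F × F) where
  carrier := {x | Tendsto (fun t : ℝ => ((t⁻¹ : ℝ) : 𝕜) • (S t x.1 - x.1)) (𝓝[>] 0) (𝓝 x.2)}
  add_mem' {x y} hx hy := by
    simp only [mem_ofPred_eq] at hx hy ⊢
    refine (hx.add hy).congr fun t => ?_
    rw [← smul_add]; congr 1
    simp only [Prod.fst_add, map_add]; abel
  zero_mem' := by simp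
  smul_mem' c x hx := by
    simp only [mem_ofPred_eq] at hx ⊢
    refine (hx.const_smul c).congr fun t => ?_
    rw [smul_comm]; congr 1
    simp only [Prod.smul_fst, map_smul, smul_sub]

theorem mem_generatorGraph {x : F × F} : x ∈ generatorGraph S ↔
    Tendsto (fun t : ℝ => t⁻¹ • (S t x.1 - x.1)) (𝓝[>] 0) (𝓝 x.2) := by
  simp only [← coe_inv_smul (𝕜 := 𝕜)]; rfl

theorem hasDerivWithinAt_Ioi_iff_tendsto {u : ℝ → F} {u' : F} {x : ℝ} :
    HasDerivWithinAt u u' (Ioi x) x ↔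
      Tendsto (fun t : ℝ => t⁻¹ • (u (x + t) - u x)) (𝓝[>] 0) (𝓝 u') := by
  rw [hasDerivWithinAt_iff_tendsto_slope' (by simp)]
  have hm : map (fun t => x + t) (𝓝[>] (0 : ℝ)) = 𝓝[>] x := by
    rw [map_add_left_nhdsGT, add_zero]
  rw [← hm, tendsto_map'_iff]
  refine tendsto_congr fun t => ?_
  simp [slope_def_module]

variable [CompleteSpace F]

/-- The right derivative of the orbit of `x.1` at `s` is `S s x.2`, which is continuous; the
fundamental theorem of calculus needs only right derivatives. -/
theorem IsBoundedC0.integral_of_mem_graph (h : IsBoundedC0 S C) {x : F × F}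
    (hx : x ∈ generatorGraph S) {t : ℝ} (ht : 0 < t) :
    ∫ s in (0 : ℝ)..t, orbit S x.2 s = S t x.1 - x.1 := by
  rw [mem_generatorGraph] at hx
  rw [← orbit_of_pos (S := S) x.1 ht, ← orbit_of_nonpos (S := S) x.1 (le_refl (0 : ℝ)),
    orbit_of_nonpos (S := S) x.1 (le_refl (0 : ℝ))]
  have h0 := intervalIntegral.integral_eq_sub_of_hasDeriv_right (f := orbit S x.1)
    (f' := orbit S x.2) (a := 0) (b := t) (h.continuous_orbit _).continuousOn (fun s hs => ?_)
    ((h.continuous_orbit _).intervalIntegrable _ _)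
  · rw [h0, orbit_of_nonpos (S := S) x.1 (le_refl (0 : ℝ))]
  · rw [min_eq_left ht.le] at hs
    have hs0 : 0 < s := hs.1
    rw [hasDerivWithinAt_Ioi_iff_tendsto, orbit_of_pos x.2 hs0]
    refine (((S s).continuous.tendsto _).comp hx).congr' ?_
    filter_upwards [self_mem_nhdsWithin] with τ hτ
    have hτ : 0 < τ := hτ
    rw [Function.comp_apply, orbit_of_pos x.1 hs0, orbit_of_pos x.1 (by linarith : 0 < s + τ),
      ← coe_inv_smul (𝕜 := 𝕜), map_smul, map_sub, h.apply_apply hs0 hτ, coe_inv_smul]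

theorem IsBoundedC0.tendsto_integral (h : IsBoundedC0 S C) (g : F) (a : ℝ) :
    Tendsto (fun t : ℝ => t⁻¹ • ∫ s in a..(a + t), orbit S g s) (𝓝[>] 0) (𝓝 (orbit S g a)) := by
  have hc := h.continuous_orbit g
  have h1 : HasDerivAt (fun t => ∫ s in a..t, orbit S g s) (orbit S g a) a :=
    intervalIntegral.integral_hasDerivAt_right (hc.intervalIntegrable _ _)
      (hc.stronglyMeasurableAtFilter _ _) hc.continuousAt
  have h2 := hasDerivWithinAt_Ioi_iff_tendsto.1 (h1.hasDerivWithinAt (s := Ioi a))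
  simpa using h2

/-- In integrated form, membership in the graph is, for each `t`, an equality of continuous
functions of the pair. This makes the generator closed. -/
theorem IsBoundedC0.mem_graph_iff (h : IsBoundedC0 S C) {x : F × F} :
    x ∈ generatorGraph S ↔ ∀ t : ℝ, 0 < t → ∫ s in (0 : ℝ)..t, orbit S x.2 s = S t x.1 - x.1 := by
  refine ⟨fun hx t ht => h.integral_of_mem_graph hx ht, fun hx => ?_⟩
  rw [mem_generatorGraph]
  have h1 := h.tendsto_integral x.2 0
  rw [orbit_of_nonpos x.2 le_rfl] at h1
  refine h1.congr' ?_
  filter_upwards [self_mem_nhdsWithin] with t ht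
  rw [zero_add, hx t ht]

theorem orbit_sub (f g : F) (t : ℝ) : orbit S f t - orbit S g t = orbit S (f - g) t := by
  rcases lt_or_ge 0 t with ht | ht
  · simp only [orbit_of_pos _ ht, map_sub]
  · simp only [orbit_of_nonpos _ ht]

theorem IsBoundedC0.continuous_integral (h : IsBoundedC0 S C) (t : ℝ) :
    Continuous fun g : F => ∫ s in (0 : ℝ)..t, orbit S g s := by
  have hL : LipschitzWith (Real.toNNReal ((C + 1) * |t|)) fun g : F => ∫ s in (0 : ℝ)..t, orbit S g s := by
    refine LipschitzWith.of_dist_le_mul fun f g => ?_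
    rw [dist_eq_norm, dist_eq_norm, ← intervalIntegral.integral_sub
      ((h.continuous_orbit f).intervalIntegrable _ _) ((h.continuous_orbit g).intervalIntegrable _ _)]
    simp only [orbit_sub]
    refine (intervalIntegral.norm_integral_le_of_norm_le_const fun s _ =>
      h.norm_orbit_le (f - g) s).trans ?_
    rw [Real.coe_toNNReal _ (mul_nonneg (by linarith [h.nonneg]) (abs_nonneg _)), sub_zero]
    exact le_of_eq (by ring)
  exact hL.continuous

theorem IsBoundedC0.isClosed_graph (h : IsBoundedC0 S C) :
    IsClosed (generatorGraph S : Set (F × F)) := by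
  have e : (generatorGraph S : Set (F × F)) = ⋂ (t : ℝ) (_ : 0 < t),
      {x | ∫ s in (0 : ℝ)..t, orbit S x.2 s = S t x.1 - x.1} := by
    ext x
    simp only [mem_iInter, SetLike.mem_coe, h.mem_graph_iff]
    rfl
  rw [e]
  refine isClosed_iInter fun t => isClosed_iInter fun _ => isClosed_eq ?_ ?_
  · exact (h.continuous_integral t).comp continuous_snd
  · exact ((S t).continuous.comp continuous_fst).sub continuous_fst

/-- Applying `S τ` shifts the interval of integration, so the difference quotient is a difference of
two averages of the orbit, near `t` and near `0`. The averages over `[0, t]` tend to `f`, which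
makes the domain dense. -/
theorem IsBoundedC0.integral_mem_graph (h : IsBoundedC0 S C) (f : F) {t : ℝ} (ht : 0 < t) :
    (∫ s in (0 : ℝ)..t, orbit S f s, orbit S f t - f) ∈ generatorGraph S := by
  rw [mem_generatorGraph]
  have hc := h.continuous_orbit f
  have hi : ∀ a b, IntervalIntegrable (orbit S f) volume a b := fun a b => hc.intervalIntegrable a b
  have h1 := (h.tendsto_integral f t).sub (h.tendsto_integral f 0)
  rw [orbit_of_nonpos f le_rfl] at h1
  refine h1.congr' ?_
  filter_upwards [self_mem_nhdsWithin] with τ hτ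
  have hτ : 0 < τ := hτ
  rw [← smul_sub, zero_add]
  congr 1
  have h2 : S τ (∫ s in (0 : ℝ)..t, orbit S f s) = ∫ s in τ..(t + τ), orbit S f s := by
    have h3 := ContinuousLinearMap.intervalIntegral_comp_comm ((S τ).restrictScalars ℝ) (hi 0 t)
    simp only [ContinuousLinearMap.coe_restrictScalars'] at h3
    rw [← h3]
    have h4 := intervalIntegral.integral_comp_add_right (a := 0) (b := t) (orbit S f) τ
    rw [zero_add] at h4
    rw [← h4]
    refine intervalIntegral.integral_congr_ae (ae_of_all _ fun s hs => ?_)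
    rw [uIoc_of_le ht.le] at hs
    rw [orbit_of_pos f hs.1, orbit_of_pos f (by linarith [hs.1]), h.apply_apply hτ hs.1, add_comm]
  have a1 := intervalIntegral.integral_add_adjacent_intervals (hi 0 t) (hi t (t + τ))
  have a2 := intervalIntegral.integral_add_adjacent_intervals (hi 0 τ) (hi τ (t + τ))
  rw [h2, sub_eq_sub_iff_add_eq_add, add_comm (∫ s in t..(t + τ), orbit S f s), a1,
    add_comm (∫ s in τ..(t + τ), orbit S f s), a2]

theorem IsBoundedC0.exists_generator (h : IsBoundedC0 S C) :
    ∃ A : F →ₗ.[𝕜] F, FunctionSpace.IsGenerator S A ∧ Dense (A.domain : Set F) ∧ A.IsClosed := by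
  have hg : (generatorGraph S).toLinearPMap.graph = generatorGraph S := by
    refine Submodule.toLinearPMap_graph_eq _ fun x hx hx0 => ?_
    rw [mem_generatorGraph, hx0] at hx
    simp only [map_zero, sub_zero, smul_zero] at hx
    exact tendsto_nhds_unique hx tendsto_const_nhds
  refine ⟨(generatorGraph S).toLinearPMap, fun f g => ?_, fun f => ?_, ?_⟩
  · rw [hg]; rfl
  · have h1 := h.tendsto_integral f 0
    rw [orbit_of_nonpos f le_rfl] at h1
    refine mem_closure_of_tendsto h1 ?_
    filter_upwards [self_mem_nhdsWithin] with t ht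
    rw [SetLike.mem_coe, Submodule.toLinearPMap_domain, zero_add]
    have h2 := (generatorGraph S).smul_mem ((t⁻¹ : ℝ) : 𝕜) (h.integral_mem_graph f ht)
    exact ⟨_, h2, coe_inv_smul t _⟩
  · rw [LinearPMap.IsClosed, hg]
    exact h.isClosed_graph

end Semigroup

/-! ### From convergence in measure to bounds in L^p. -/

section ConvergenceInMeasure

variable {X : Type*} [MeasurableSpace X] {m : Measure X} {𝕜 : Type*} [RCLike 𝕜]
  {ι : Type*} {l : Filter ι} {p q : ℝ≥0∞}

theorem eLpNorm_le_restrict_add (hq : 1 ≤ q) {A : Set X} (hA : MeasurableSet A) {h : X → 𝕜}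
    (hh : AEStronglyMeasurable h m) :
    eLpNorm h q m ≤ eLpNorm h q (m.restrict A) + eLpNorm h q (m.restrict Aᶜ) := by
  rw [← eLpNorm_indicator_eq_eLpNorm_restrict hA,
    ← eLpNorm_indicator_eq_eLpNorm_restrict hA.compl]
  refine le_trans (le_of_eq ?_) (eLpNorm_add_le (hh.indicator hA) (hh.indicator hA.compl) hq)
  rw [indicator_self_add_compl]

theorem measurableSet_le_norm {h : X → 𝕜} (hh : StronglyMeasurable h) (ε : ℝ) :
    MeasurableSet {x | ε ≤ ‖h x‖} :=
  measurableSet_le measurable_const hh.norm.measurable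

theorem eLpNorm_restrict_small_le {h : X → 𝕜} (hh : StronglyMeasurable h) (ε : ℝ) :
    eLpNorm h p (m.restrict {x | ε ≤ ‖h x‖}ᶜ) ≤ m univ ^ p.toReal⁻¹ * ENNReal.ofReal ε := by
  refine (eLpNorm_le_of_ae_bound (C := ε) ?_).trans (mul_le_mul_left
    (ENNReal.rpow_le_rpow ?_ (inv_nonneg.2 ENNReal.toReal_nonneg)) _)
  · rw [ae_restrict_iff' (measurableSet_le_norm hh ε).compl]
    exact ae_of_all _ fun x hx => (not_le.1 (show ¬ ε ≤ ‖h x‖ from hx)).le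
  · rw [Measure.restrict_apply_univ]; exact measure_mono (subset_univ _)

theorem exists_pos_mul_ofReal_le {M η : ℝ≥0∞} (hM : M ≠ ∞) (hη : η ≠ 0) :
    ∃ ε : ℝ, 0 < ε ∧ M * ENNReal.ofReal ε ≤ η := by
  have h1 : Tendsto (fun ε : ℝ => M * ENNReal.ofReal ε) (𝓝[>] 0) (𝓝 (M * ENNReal.ofReal 0)) :=
    (ENNReal.Tendsto.const_mul (ENNReal.continuous_ofReal.tendsto 0) (Or.inr hM)).mono_left
      nhdsWithin_le_nhds
  rw [ENNReal.ofReal_zero, mul_zero] at h1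
  obtain ⟨ε, h2, h3⟩ := ((h1.eventually (gt_mem_nhds (pos_iff_ne_zero.2 hη))).and
    self_mem_nhdsWithin).exists
  exact ⟨ε, h3, h2.le⟩

/-- Convergence in measure and boundedness in `L^q` imply convergence in `L^p`, `p < q`, on finite
measure spaces. -/
theorem tendsto_eLpNorm_of_bounded [IsFiniteMeasure m] (hp : 1 ≤ p) (hpq : p < q)
    {h : ι → X → 𝕜} (hh : ∀ i, StronglyMeasurable (h i))
    (hm : ∀ ε : ℝ, 0 < ε → Tendsto (fun i => m {x | ε ≤ ‖h i x‖}) l (𝓝 0))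
    {K : ℝ≥0∞} (hK : K ≠ ∞) (hb : ∀ᶠ i in l, eLpNorm (h i) q m ≤ K) :
    Tendsto (fun i => eLpNorm (h i) p m) l (𝓝 0) := by
  have hpt : p ≠ ∞ := (hpq.trans_le le_top).ne
  set e : ℝ := 1 / p.toReal - 1 / q.toReal with he
  have hp0 : 0 < p.toReal := ENNReal.toReal_pos (by positivity) hpt
  have he0 : 0 < e := by
    rw [he, sub_pos, one_div, one_div]
    rcases eq_or_ne q ∞ with rfl | hqt
    · simpa using hp0
    · have := (ENNReal.toReal_lt_toReal hpt hqt).2 hpq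
      exact inv_strictAnti₀ hp0 this
  refine ENNReal.tendsto_nhds_zero.2 fun η hη => ?_
  have hη2 : η / 2 ≠ 0 := (ENNReal.half_pos hη.ne').ne'
  obtain ⟨ε, hε, hεη⟩ := exists_pos_mul_ofReal_le (M := m univ ^ p.toReal⁻¹)
    (ENNReal.rpow_ne_top_of_nonneg (by positivity) (measure_ne_top m _)) hη2
  have h1 : Tendsto (fun i => K * m {x | ε ≤ ‖h i x‖} ^ e) l (𝓝 0) := by
    have h2 := ((ENNReal.continuous_rpow_const (y := e)).tendsto 0).comp (hm ε hε)
    rw [ENNReal.zero_rpow_of_pos he0] at h2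
    have h3 := ENNReal.Tendsto.const_mul (a := K) h2 (Or.inr hK)
    rwa [mul_zero] at h3
  filter_upwards [hb, h1.eventually (gt_mem_nhds (pos_iff_ne_zero.2 hη2))] with i hi hi2
  have hA := measurableSet_le_norm (hh i) ε
  calc eLpNorm (h i) p m ≤ _ :=
        eLpNorm_le_restrict_add hp hA (hh i).aestronglyMeasurable
    _ ≤ η / 2 + η / 2 := by
        refine add_le_add ?_ ((eLpNorm_restrict_small_le (hh i) ε).trans hεη)
        refine (eLpNorm_le_eLpNorm_mul_rpow_measure_univ hpq.le
          (hh i).aestronglyMeasurable).trans (le_trans ?_ hi2.le)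
        rw [Measure.restrict_apply_univ]
        exact mul_le_mul_left ((eLpNorm_mono_measure _ Measure.restrict_le_self).trans hi) _
    _ = η := ENNReal.add_halves η

theorem exists_pos_add_rpow_lt {a c : ℝ≥0∞} (ha : a ≠ ∞) (hc : c ≠ 0) {P : ℝ} (hP : 0 ≤ P) :
    ∃ η : ℝ≥0∞, η ≠ 0 ∧ (a + η) ^ P ≤ a ^ P + c := by
  have h1 : Tendsto (fun η : ℝ≥0∞ => (a + η) ^ P) (𝓝[>] 0) (𝓝 ((a + 0) ^ P)) :=
    (((continuous_const.add continuous_id).tendsto (0 : ℝ≥0∞)).ennrpow_const P).mono_left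
      nhdsWithin_le_nhds
  rw [add_zero] at h1
  have h2 : a ^ P < a ^ P + c := ENNReal.lt_add_right (ENNReal.rpow_ne_top_of_nonneg hP ha) hc
  obtain ⟨η, h3, h4⟩ := ((h1.eventually (gt_mem_nhds h2)).and self_mem_nhdsWithin).exists
  exact ⟨η, (pos_iff_ne_zero.1 h4), h3.le⟩

/-- Functions that are bounded in `L^p` and converge to zero in measure are asymptotically
disjoint from a fixed function. -/
theorem eventually_eLpNorm_add_rpow_le [IsFiniteMeasure m] (hp : 1 ≤ p) (hpt : p ≠ ∞)
    {s : X → 𝕜} (hs : MemLp s p m) {h : ι → X → 𝕜} (hh : ∀ i, StronglyMeasurable (h i))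
    (hm : ∀ ε : ℝ, 0 < ε → Tendsto (fun i => m {x | ε ≤ ‖h i x‖}) l (𝓝 0))
    {K : ℝ≥0∞} (hK : K ≠ ∞) (hb : ∀ᶠ i in l, eLpNorm (h i) p m ≤ K) :
    ∀ᶠ i in l, eLpNorm (s + h i) p m ^ p.toReal ≤ eLpNorm s p m ^ p.toReal + K ^ p.toReal + 1 := by
  have hp0 : 0 < p.toReal := ENNReal.toReal_pos (by positivity) hpt
  obtain ⟨η₁, hη₁, h₁⟩ := exists_pos_add_rpow_lt (P := p.toReal) hs.eLpNorm_ne_top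
    (c := 1 / 2) (by simp) hp0.le
  obtain ⟨η₂, hη₂, h₂⟩ := exists_pos_add_rpow_lt (P := p.toReal) hK (c := 1 / 2) (by simp) hp0.le
  obtain ⟨ε, hε, hεη⟩ := exists_pos_mul_ofReal_le (M := m univ ^ p.toReal⁻¹)
    (ENNReal.rpow_ne_top_of_nonneg (by positivity) (measure_ne_top m _)) hη₁
  -- The space splits into the set where `h i` is at least `ε` and its complement. The first has
  -- measure tending to zero, so `s` is negligible there by absolute continuity of its integral; on
  -- the second, `h i` is uniformly small.
  have hsm : Tendsto (fun i => eLpNorm s p (m.restrict {x | ε ≤ ‖h i x‖})) l (𝓝 0) := by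
    have hfin : ∫⁻ x, ‖s x‖ₑ ^ p.toReal ∂m ≠ ∞ := by
      rw [← eLpNorm_rpow_toReal hp hpt]
      exact ENNReal.rpow_ne_top_of_nonneg hp0.le hs.eLpNorm_ne_top
    have h3 := tendsto_setLIntegral_zero hfin (hm ε hε)
    have h4 := ((ENNReal.continuous_rpow_const (y := 1 / p.toReal)).tendsto 0).comp h3
    rw [ENNReal.zero_rpow_of_pos (by positivity)] at h4
    refine h4.congr fun i => ?_
    rw [Function.comp_apply, eLpNorm_eq_lintegral_rpow_enorm_toReal (by positivity) hpt]
  filter_upwards [hb, hsm.eventually (gt_mem_nhds (pos_iff_ne_zero.2 hη₂))] with i hi hi2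
  set A := {x | ε ≤ ‖h i x‖} with hA
  have hAm : MeasurableSet A := measurableSet_le_norm (hh i) ε
  have hsplit : eLpNorm (s + h i) p m ^ p.toReal =
      eLpNorm (s + h i) p (m.restrict A) ^ p.toReal +
        eLpNorm (s + h i) p (m.restrict Aᶜ) ^ p.toReal := by
    rw [eLpNorm_rpow_toReal hp hpt, eLpNorm_rpow_toReal hp hpt, eLpNorm_rpow_toReal hp hpt,
      lintegral_add_compl _ hAm]
  have hA1 : eLpNorm (s + h i) p (m.restrict A) ≤ K + η₂ := by
    refine (eLpNorm_add_le hs.1.restrict (hh i).aestronglyMeasurable hp).trans ?_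
    rw [add_comm]
    exact add_le_add ((eLpNorm_mono_measure _ Measure.restrict_le_self).trans hi) hi2.le
  have hA2 : eLpNorm (s + h i) p (m.restrict Aᶜ) ≤ eLpNorm s p m + η₁ := by
    refine (eLpNorm_add_le hs.1.restrict (hh i).aestronglyMeasurable hp).trans ?_
    exact add_le_add (eLpNorm_mono_measure _ Measure.restrict_le_self)
      ((eLpNorm_restrict_small_le (hh i) ε).trans hεη)
  calc _ ≤ (K + η₂) ^ p.toReal + (eLpNorm s p m + η₁) ^ p.toReal := by
        rw [hsplit]
        exact add_le_add (ENNReal.rpow_le_rpow hA1 hp0.le) (ENNReal.rpow_le_rpow hA2 hp0.le)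
    _ ≤ (K ^ p.toReal + 1 / 2) + (eLpNorm s p m ^ p.toReal + 1 / 2) := add_le_add h₂ h₁
    _ = eLpNorm s p m ^ p.toReal + K ^ p.toReal + (1 / 2 + 1 / 2) := by ring
    _ = _ := by rw [ENNReal.add_halves]

end ConvergenceInMeasure

/-! ### Density of indicator functions of bounded sets. -/

section Density

variable {X : Type*} [MetricSpace X] [MeasurableSpace X] [OpensMeasurableSpace X]
  {ν : Measure X} {𝕜 : Type*} [RCLike 𝕜] {p : ℝ≥0∞} [Fact (1 ≤ p)]

/-- The indicator functions of measurable subsets of balls generate `L^p`. -/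
theorem mem_of_indicatorConstLp_mem (hpt : p ≠ ∞) (x₀ : X)
    (M : Submodule 𝕜 (Lp 𝕜 p ν)) (hM : IsClosed (M : Set (Lp 𝕜 p ν)))
    (h : ∀ (r : ℝ) (A : Set X) (hA : MeasurableSet A) (hν : ν A ≠ ∞), 0 < r →
      A ⊆ Metric.ball x₀ r → indicatorConstLp p hA hν (1 : 𝕜) ∈ M) (f : Lp 𝕜 p ν) : f ∈ M := by
  refine Lp.induction hpt (fun f => f ∈ M) (fun c s hs hνs => ?_) (fun f g hf hg _ h1 h2 =>
    M.add_mem h1 h2) hM f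
  rw [Lp.simpleFunc.coe_indicatorConst]
  have hc : indicatorConstLp p hs hνs.ne c = c • indicatorConstLp p hs hνs.ne (1 : 𝕜) := by
    refine Lp.ext ?_
    filter_upwards [indicatorConstLp_coeFn (p := p) (hs := hs) (hμs := hνs.ne) (c := c),
      indicatorConstLp_coeFn (p := p) (hs := hs) (hμs := hνs.ne) (c := (1 : 𝕜)),
      Lp.coeFn_smul c (indicatorConstLp p hs hνs.ne (1 : 𝕜))] with y h1 h2 h3
    rw [h1, h3, Pi.smul_apply, h2]
    by_cases hy : y ∈ s <;> simp [hy]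
  rw [hc]
  refine M.smul_mem c ?_
  have hsn : ∀ n : ℕ, MeasurableSet (s ∩ Metric.ball x₀ ((n : ℝ) + 1)) := fun n =>
    hs.inter measurableSet_ball
  have hsf : ∀ n : ℕ, ν (s ∩ Metric.ball x₀ ((n : ℝ) + 1)) ≠ ∞ := fun n =>
    ((measure_mono inter_subset_left).trans_lt hνs).ne
  have hlim : Tendsto (fun n : ℕ => indicatorConstLp p (hsn n) (hsf n) (1 : 𝕜)) atTop
      (𝓝 (indicatorConstLp p hs hνs.ne (1 : 𝕜))) := by
    refine tendsto_indicatorConstLp_set hpt ?_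
    have e : ∀ n : ℕ, symmDiff (s ∩ Metric.ball x₀ ((n : ℝ) + 1)) s =
        s \ Metric.ball x₀ ((n : ℝ) + 1) := by
      intro n; ext y; simp only [mem_symmDiff, mem_inter_iff, Set.mem_sdiff]; tauto
    simp only [e]
    have h1 := tendsto_measure_iInter_atTop (μ := ν)
      (s := fun n : ℕ => s \ Metric.ball x₀ ((n : ℝ) + 1))
      (fun n => (hs.diff measurableSet_ball).nullMeasurableSet)
      (fun a b hab => sdiff_subset_sdiff_right (Metric.ball_subset_ball (by
        have : (a : ℝ) ≤ b := by exact_mod_cast hab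
        linarith)))
      ⟨0, ((measure_mono sdiff_subset).trans_lt hνs).ne⟩
    have h2 : ⋂ n : ℕ, s \ Metric.ball x₀ ((n : ℝ) + 1) = ∅ := by
      refine eq_empty_of_forall_notMem fun y hy => ?_
      obtain ⟨n, hn⟩ := exists_nat_gt (dist y x₀)
      exact (mem_iInter.1 hy n).2 (by rw [Metric.mem_ball]; linarith)
    rwa [h2, measure_empty] at h1
  exact hM.mem_of_tendsto hlim (Eventually.of_forall fun n =>
    h _ _ (hsn n) (hsf n) (by positivity) inter_subset_right)

end Density

/-- With `a = 2 ^ j * r / √t`, which is bounded below for `t ≤ t₀`, all growing factors are at most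
powers of `1 + a`. The Gaussian absorbs one power more than needed, and the gained `a⁻¹` is the
factor `√t * (1 / 2) ^ j / r`: small in `t` and summable in `j`. -/
theorem exists_annulus_bound {D : ℕ} {θ₁ θ₂ c C r t₀ : ℝ} (hθ₁ : 0 < θ₁) (hθ₂ : 0 < θ₂) (hc : 0 < c)
    (hC : 0 < C) (hr : 0 < r) (ht₀ : 0 < t₀) :
    ∃ K : ℝ, 0 < K ∧ ∀ t : ℝ, 0 < t → t ≤ t₀ → ∀ j : ℕ,
      (2 * 2 ^ (j + 1)) ^ D * (C * (2 : ℝ) ^ (j * θ₁) * dec (2 ^ j * r / √t) ^ θ₂ *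
        Real.exp (-(c * 4 ^ j * r ^ 2 / t))) ≤ K * √t * (1 / 2) ^ j := by
  obtain ⟨K, hK, hKb⟩ := exists_rpow_le_exp_sq ((D : ℝ) + θ₁ + θ₂ + 1) hc
  set b := r / √t₀ with hb
  have hst₀ : 0 < √t₀ := Real.sqrt_pos.2 ht₀
  have hb0 : 0 < b := by positivity
  refine ⟨4 ^ D * C * (1 / b) ^ ((D : ℝ) + θ₁) * (1 + 1 / b) ^ θ₂ * K / r, by positivity,
    fun t ht htt j => ?_⟩
  have hst : 0 < √t := Real.sqrt_pos.2 ht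
  set a := 2 ^ j * r / √t with ha
  have ha0 : 0 < a := by positivity
  have hba : 2 ^ j * b ≤ a := by
    rw [ha, hb, mul_div_assoc']
    exact div_le_div_of_nonneg_left (by positivity) hst (Real.sqrt_le_sqrt htt)
  have h2j : (1 : ℝ) ≤ 2 ^ j := one_le_pow₀ (by norm_num)
  have hba1 : b ≤ a := (le_mul_of_one_le_left hb0.le h2j).trans hba
  have h2a : (2 : ℝ) ^ j ≤ (1 + a) * (1 / b) := by
    rw [mul_one_div, le_div_iff₀ hb0]; linarith
  have hdec : dec a ≤ (1 + a) * (1 + 1 / b) := by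
    have h1b : 0 < 1 / b := by positivity
    refine max_le (by nlinarith) ?_
    have : a⁻¹ ≤ 1 / b := by rw [one_div]; exact inv_anti₀ hb0 hba1
    nlinarith
  have hexp : c * 4 ^ j * r ^ 2 / t = c * a ^ 2 := by
    rw [ha, div_pow, mul_pow, Real.sq_sqrt ht.le, ← pow_mul, mul_comm j 2, pow_mul]
    norm_num; ring
  have e1 : (2 * 2 ^ (j + 1) : ℝ) ^ D = 4 ^ D * (2 ^ j) ^ (D : ℝ) := by
    rw [Real.rpow_natCast, ← mul_pow, pow_succ]; congr 1; ring
  have e2 : (2 : ℝ) ^ (j * θ₁) = (2 ^ j) ^ θ₁ := by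
    rw [Real.rpow_mul (by norm_num), Real.rpow_natCast]
  have hKa := hKb a ha0.le
  have hdec0 : 0 ≤ dec a := zero_le_one.trans (one_le_dec ha0)
  rw [hexp, e1, e2]
  calc 4 ^ D * (2 ^ j) ^ (D : ℝ) * (C * (2 ^ j) ^ θ₁ * dec a ^ θ₂ * Real.exp (-(c * a ^ 2)))
      = 4 ^ D * C * (2 ^ j) ^ ((D : ℝ) + θ₁) * dec a ^ θ₂ * Real.exp (-(c * a ^ 2)) := by
        rw [Real.rpow_add (by positivity)]; ring
    _ ≤ 4 ^ D * C * ((1 + a) * (1 / b)) ^ ((D : ℝ) + θ₁) * ((1 + a) * (1 + 1 / b)) ^ θ₂ *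
          Real.exp (-(c * a ^ 2)) := by
        gcongr
    _ = 4 ^ D * C * (1 / b) ^ ((D : ℝ) + θ₁) * (1 + 1 / b) ^ θ₂ *
          ((1 + a) ^ ((D : ℝ) + θ₁ + θ₂ + 1) * (1 + a)⁻¹ * Real.exp (-(c * a ^ 2))) := by
        rw [Real.mul_rpow (by positivity) (by positivity),
          Real.mul_rpow (by positivity) (by positivity),
          Real.rpow_add (by positivity) _ 1, Real.rpow_one, Real.rpow_add (by positivity) _ θ₂]
        field_simp
    _ ≤ 4 ^ D * C * (1 / b) ^ ((D : ℝ) + θ₁) * (1 + 1 / b) ^ θ₂ *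
          (K * Real.exp (c * a ^ 2) * a⁻¹ * Real.exp (-(c * a ^ 2))) := by
        gcongr; linarith
    _ = _ := by
        rw [Real.exp_neg, ha]
        have := Real.exp_ne_zero (c * (2 ^ j * r / √t) ^ 2)
        rw [one_div_pow]
        field_simp

/-! ### Tails away from the support. -/

namespace FunctionSpace

variable {X : Type*} [MetricSpace X] [MeasurableSpace X] [BorelSpace X]
  {𝕜 : Type*} [RCLike 𝕜] {μ : Measure X} {E : Type*}
  [NormedAddCommGroup E] [NormedSpace 𝕜 E] (𝔹 : FunctionSpace 𝕜 μ E)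
  {ν : Measure X} {D : ℕ} {T : ℝ → E →L[𝕜] E} {p q : ℝ≥0∞}

/-- The annuli with `j ≥ 2` cover the complement of the fourfold ball, and the estimates from the
ball into them sum geometrically with an extra factor `√t`. -/
theorem OffDiagonal.exists_tail_le (hν : ν ≪ μ) (hD : HasGrowth ν D) (hq : 1 ≤ q)
    (h : 𝔹.OffDiagonal ν T p q) (x : X) {r t₀ : ℝ} (hr : 0 < r) (ht₀ : 0 < t₀) :
    ∃ M : ℝ≥0∞, M ≠ ∞ ∧ ∀ t : ℝ, 0 < t → t ≤ t₀ → ∀ g : E, MemLp (𝔹.fn g : X → 𝕜) p ν →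
      𝔹.Supp g (Metric.ball x r) →
      eLpNorm (𝔹.fn (T t g) : X → 𝕜) q (ν.restrict (Metric.ball x (4 * r))ᶜ) ≤
        M * ENNReal.ofReal √t * eLpNorm (𝔹.fn g : X → 𝕜) p ν := by
  obtain ⟨θ₁, θ₂, c, C, hθ₁, hθ₂, hc, hC, h⟩ := h
  obtain ⟨K, hK, hKb⟩ := exists_annulus_bound (D := D) hθ₁ hθ₂ hc hC hr ht₀
  set V := ν (Metric.ball x r) with hV
  have hV0 : V ≠ 0 := hD.pos x r hr
  have hVt : V ≠ ∞ := hD.fin x r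
  have hmb : ∀ s : ℝ, MeasurableSet (Metric.ball x s) := fun s => measurableSet_ball
  set M₀ := ENNReal.ofReal K * V ^ (1 / q).toReal * (V ^ (1 / p).toReal)⁻¹ with hM₀
  have hM₀t : M₀ ≠ ∞ := ENNReal.mul_ne_top (ENNReal.mul_ne_top ENNReal.ofReal_ne_top
    (ENNReal.rpow_ne_top_of_nonneg ENNReal.toReal_nonneg hVt))
    (ENNReal.inv_ne_top.2 (ENNReal.rpow_pos (pos_iff_ne_zero.2 hV0) hVt).ne')
  refine ⟨M₀ * 2, ENNReal.mul_ne_top hM₀t (by simp), fun t ht htt g hg hgs => ?_⟩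
  set N := eLpNorm (𝔹.fn g : X → 𝕜) p ν with hN
  have hann : ∀ j : ℕ, 2 ≤ j → eLpNorm (𝔹.fn (T t g) : X → 𝕜) q (ν.restrict (annulus x r j)) ≤
      M₀ * ENNReal.ofReal √t * N * ENNReal.ofReal ((1 / 2) ^ j) := by
    intro j hj
    have h1 := ((h t ht x r hr g hg).2 j hj).2
    rw [𝔹.trunc_eq_of_supp (hmb r) hgs, avgNorm_eq_mul hVt,
      𝔹.eLpNorm_of_supp hν (hmb r) hgs] at h1
    have hF0 := hD.pos x (2 ^ (j + 1) * r) (by positivity)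
    have hFt := hD.fin x (2 ^ (j + 1) * r)
    have h2j : (1 : ℝ) ≤ 2 ^ (j + 1) := one_le_pow₀ (by norm_num)
    have hone : 1 ≤ ENNReal.ofReal ((2 * 2 ^ (j + 1)) ^ D) :=
      ENNReal.one_le_ofReal.2 (one_le_pow₀ (by linarith))
    rw [eLpNorm_restrict_eq_avgNorm hF0 hFt]
    calc _ ≤ (ENNReal.ofReal ((2 * 2 ^ (j + 1)) ^ D) * V ^ (1 / q).toReal) * _ := by
          refine mul_le_mul' ?_ h1
          refine (ENNReal.rpow_le_rpow (hD.growth x r _ hr h2j) ENNReal.toReal_nonneg).trans ?_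
          rw [ENNReal.mul_rpow_of_nonneg _ _ ENNReal.toReal_nonneg]
          exact mul_le_mul_left (rpow_one_div_le hone hq) _
      _ = ENNReal.ofReal ((2 * 2 ^ (j + 1)) ^ D * (C * (2 : ℝ) ^ (j * θ₁) *
            dec (2 ^ j * r / √t) ^ θ₂ * Real.exp (-(c * 4 ^ j * r ^ 2 / t)))) *
            (V ^ (1 / q).toReal * ((V ^ (1 / p).toReal)⁻¹ * N)) := by
          rw [ENNReal.ofReal_mul (p := (2 * 2 ^ (j + 1)) ^ D) (by positivity)]; ring
      _ ≤ ENNReal.ofReal (K * √t * (1 / 2) ^ j) *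
            (V ^ (1 / q).toReal * ((V ^ (1 / p).toReal)⁻¹ * N)) :=
          mul_le_mul_left (ENNReal.ofReal_le_ofReal (hKb t ht htt j)) _
      _ = _ := by
          rw [ENNReal.ofReal_mul (by positivity), ENNReal.ofReal_mul hK.le, hM₀]; ring
  refine eLpNorm_le_of_forall_ball (𝔹.aesm _ hν) _ x fun n => ?_
  obtain ⟨J, hJ⟩ : ∃ J : ℕ, (n : ℝ) / r < 2 ^ J := pow_unbounded_of_one_lt _ (by norm_num)
  rw [div_lt_iff₀ hr] at hJ
  have hcov : Metric.ball x n ∩ (Metric.ball x (4 * r))ᶜ ⊆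
      ⋃ j ∈ (Finset.range J).filter (2 ≤ ·), annulus x r j := by
    rintro y ⟨hy1, hy2⟩
    rw [Metric.mem_ball] at hy1
    rw [mem_compl_iff, Metric.mem_ball, not_lt] at hy2
    have hd : 1 ≤ dist y x / r := by rw [le_div_iff₀ hr]; linarith
    obtain ⟨j, hj1, hj2⟩ := exists_nat_pow_near hd (by norm_num : (1 : ℝ) < 2)
    rw [le_div_iff₀ hr] at hj1
    rw [div_lt_iff₀ hr] at hj2
    have hj : 2 ≤ j := by
      by_contra hcon
      have h3 : (2 : ℝ) ^ (j + 1) ≤ 2 ^ 2 := pow_le_pow_right₀ (by norm_num) (by omega)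
      nlinarith
    have hjJ : j < J := by
      refine (pow_lt_pow_iff_right₀ (by norm_num : (1 : ℝ) < 2)).1 ?_
      refine lt_of_mul_lt_mul_right ?_ hr.le
      linarith
    refine mem_iUnion₂.2 ⟨j, by simp [hj, hjJ], hj2, ?_⟩
    rw [Metric.mem_ball, not_lt]; exact hj1
  refine (eLpNorm_restrict_le_sum hq _ _ (annulus x r) (fun j => measurableSet_annulus x r j) hcov
    (𝔹.aesm _ hν)).trans ?_
  calc _ ≤ ∑ j ∈ (Finset.range J).filter (2 ≤ ·),
        M₀ * ENNReal.ofReal √t * N * ENNReal.ofReal ((1 / 2) ^ j) := by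
        refine Finset.sum_le_sum fun j hj => ?_
        refine (eLpNorm_mono_measure _ (Measure.restrict_mono inter_subset_left le_rfl)).trans ?_
        exact hann j (Finset.mem_filter.1 hj).2
    _ ≤ M₀ * ENNReal.ofReal √t * N * ∑' j : ℕ, ENNReal.ofReal ((1 / 2) ^ j) := by
        rw [← Finset.mul_sum]
        exact mul_le_mul_right (ENNReal.sum_le_tsum _) _
    _ = _ := by
        rw [← ENNReal.ofReal_tsum_of_nonneg (fun j => by positivity) summable_geometric_two,
          tsum_geometric_two, ENNReal.ofReal_ofNat]
        ring

/-- For fixed `t`, the operator `T_t` maps `L^p` functions supported in a ball into `L^q`. -/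
theorem OffDiagonal.exists_le (hν : ν ≪ μ) (hD : HasGrowth ν D) (hq : 1 ≤ q)
    (h : 𝔹.OffDiagonal ν T p q) (x : X) {r t : ℝ} (hr : 0 < r) (ht : 0 < t) :
    ∃ M : ℝ≥0∞, M ≠ ∞ ∧ ∀ g : E, MemLp (𝔹.fn g : X → 𝕜) p ν → 𝔹.Supp g (Metric.ball x r) →
      eLpNorm (𝔹.fn (T t g) : X → 𝕜) q ν ≤ M * eLpNorm (𝔹.fn g : X → 𝕜) p ν := by
  obtain ⟨M, hM, htail⟩ := h.exists_tail_le 𝔹 hν hD hq x hr ht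
  obtain ⟨θ₁, θ₂, c, C, hθ₁, hθ₂, hc, hC, h⟩ := h
  have h4r : 0 < 4 * r := by linarith
  set V := ν (Metric.ball x (4 * r)) with hV
  have hV0 : V ≠ 0 := hD.pos x _ h4r
  have hVt : V ≠ ∞ := hD.fin x _
  refine ⟨V ^ (1 / q).toReal * (ENNReal.ofReal (C * dec (4 * r / √t) ^ θ₂) *
    (V ^ (1 / p).toReal)⁻¹) + M * ENNReal.ofReal √t, ?_, fun g hg hgs => ?_⟩
  · have h1 := (ENNReal.rpow_pos (p := (1 / p).toReal) (pos_iff_ne_zero.2 hV0) hVt).ne'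
    exact ENNReal.add_ne_top.2 ⟨ENNReal.mul_ne_top
      (ENNReal.rpow_ne_top_of_nonneg ENNReal.toReal_nonneg hVt)
      (ENNReal.mul_ne_top ENNReal.ofReal_ne_top (ENNReal.inv_ne_top.2 h1)),
      ENNReal.mul_ne_top hM ENNReal.ofReal_ne_top⟩
  refine (eLpNorm_le_restrict_add hq (A := Metric.ball x (4 * r)) measurableSet_ball
    (𝔹.aesm _ hν)).trans ?_
  rw [add_mul]
  refine add_le_add ?_ (htail t ht le_rfl g hg hgs)
  have hgs' := hgs.mono 𝔹 (Metric.ball_subset_ball (by linarith : r ≤ 4 * r))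
  have h1 := (h t ht x (4 * r) h4r g hg).1
  rw [𝔹.trunc_eq_of_supp measurableSet_ball hgs', avgNorm_eq_mul hVt p,
    𝔹.eLpNorm_of_supp hν measurableSet_ball hgs'] at h1
  rw [eLpNorm_restrict_eq_avgNorm hV0 hVt, mul_assoc]
  refine mul_le_mul_right (h1.trans (le_of_eq ?_)) _
  ring

end FunctionSpace

section ContinuitySubmodule

variable {𝕜 : Type*} [RCLike 𝕜] {F : Type*} [NormedAddCommGroup F] [NormedSpace 𝕜 F]

/-- The vectors on which a family of operators is strongly continuous at `0`. -/
def continuitySubmodule (S : ℝ → F →L[𝕜] F) : Submodule 𝕜 F where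
  carrier := {f | Tendsto (fun t => S t f) (𝓝[>] 0) (𝓝 f)}
  add_mem' {x y} hx hy := by
    simp only [mem_ofPred_eq, map_add] at hx hy ⊢
    exact hx.add hy
  zero_mem' := by simp
  smul_mem' c x hx := by
    simp only [mem_ofPred_eq, map_smul] at hx ⊢
    exact hx.const_smul c

theorem mem_continuitySubmodule {S : ℝ → F →L[𝕜] F} {f : F} :
    f ∈ continuitySubmodule S ↔ Tendsto (fun t => S t f - f) (𝓝[>] 0) (𝓝 0) := by
  rw [tendsto_sub_nhds_zero_iff]; rfl

theorem isClosed_continuitySubmodule {S : ℝ → F →L[𝕜] F} {C : ℝ}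
    (h : ∀ t : ℝ, 0 < t → ‖S t‖ ≤ C) : IsClosed (continuitySubmodule S : Set F) := by
  have hC : 0 ≤ C := (norm_nonneg _).trans (h 1 one_pos)
  refine isClosed_of_closure_subset fun f hf => ?_
  rw [SetLike.mem_coe, mem_continuitySubmodule, Metric.tendsto_nhds]
  intro ε hε
  obtain ⟨g, hg, hfg⟩ := Metric.mem_closure_iff.1 hf (ε / (2 * (C + 1))) (by positivity)
  rw [SetLike.mem_coe, mem_continuitySubmodule, Metric.tendsto_nhds] at hg
  rw [dist_eq_norm, lt_div_iff₀ (by positivity)] at hfg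
  filter_upwards [hg (ε / 2) (by positivity), self_mem_nhdsWithin] with t ht ht0
  rw [dist_zero_right] at ht ⊢
  have h1 : ‖S t (f - g)‖ ≤ C * ‖f - g‖ :=
    ((S t).le_opNorm _).trans (mul_le_mul_of_nonneg_right (h t ht0) (norm_nonneg _))
  calc ‖S t f - f‖ = ‖S t (f - g) + (S t g - g) - (f - g)‖ := by rw [map_sub]; congr 1; abel
    _ ≤ ‖S t (f - g)‖ + ‖S t g - g‖ + ‖f - g‖ :=
        (norm_sub_le _ _).trans (add_le_add (norm_add_le _ _) le_rfl)
    _ < ε := by nlinarith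

end ContinuitySubmodule

/-! ### Extension of the semigroup to L^p(ν), and convergence on bounded indicators. -/

namespace FunctionSpace

variable {X : Type*} [MetricSpace X] [MeasurableSpace X] [BorelSpace X]
  {𝕜 : Type*} [RCLike 𝕜] {μ : Measure X} {E : Type*}
  [NormedAddCommGroup E] [NormedSpace 𝕜 E] (𝔹 : FunctionSpace 𝕜 μ E)
  {ν : Measure X} {D : ℕ} {T : ℝ → E →L[𝕜] E} {p q : ℝ≥0∞}

theorem memLp_add (hν : ν ≪ μ) {f g : E} (hf : MemLp (𝔹.fn f : X → 𝕜) p ν)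
    (hg : MemLp (𝔹.fn g : X → 𝕜) p ν) : MemLp (𝔹.fn (f + g) : X → 𝕜) p ν :=
  (memLp_congr_ae (hν.ae_le (𝔹.fn_add f g))).2 (hf.add hg)

/-- The elements of the function space that belong to `L^p(ν)`. -/
def lpPart (hν : ν ≪ μ) (p : ℝ≥0∞) : Submodule 𝕜 E where
  carrier := {f | MemLp (𝔹.fn f : X → 𝕜) p ν}
  add_mem' hf hg := 𝔹.memLp_add hν hf hg
  zero_mem' := (memLp_congr_ae (hν.ae_le 𝔹.fn_zero)).2 MemLp.zero'
  smul_mem' c f hf := (memLp_congr_ae (hν.ae_le (𝔹.fn_smul c f))).2 (MemLp.const_smul hf c)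

theorem mem_lpPart (hν : ν ≪ μ) {f : E} :
    f ∈ 𝔹.lpPart hν p ↔ MemLp (𝔹.fn f : X → 𝕜) p ν := Iff.rfl

theorem memLp_lpPart (hν : ν ≪ μ) (f : 𝔹.lpPart hν p) : MemLp (𝔹.fn f.1 : X → 𝕜) p ν :=
  (𝔹.mem_lpPart hν).1 f.2

/-- The canonical map into `L^p(ν)`. -/
noncomputable def lpMap (hν : ν ≪ μ) (p : ℝ≥0∞) : 𝔹.lpPart hν p →ₗ[𝕜] Lp 𝕜 p ν where
  toFun f := MemLp.toLp (𝔹.fn f.1 : X → 𝕜) (𝔹.memLp_lpPart hν f)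
  map_add' f g := (MemLp.toLp_congr _ ((𝔹.memLp_lpPart hν f).add (𝔹.memLp_lpPart hν g))
    (hν.ae_le (𝔹.fn_add f.1 g.1))).trans (MemLp.toLp_add _ _)
  map_smul' c f := (MemLp.toLp_congr _ ((𝔹.memLp_lpPart hν f).const_smul c)
    (hν.ae_le (𝔹.fn_smul c f.1))).trans (MemLp.toLp_const_smul _ _)

theorem norm_lpMap [Fact (1 ≤ p)] (hν : ν ≪ μ) (f : 𝔹.lpPart hν p) :
    ‖𝔹.lpMap hν p f‖ = (eLpNorm (𝔹.fn f.1 : X → 𝕜) p ν).toReal :=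
  Lp.norm_toLp _ (𝔹.memLp_lpPart hν f)

/-- Indicator functions of measurable subsets of the ball `B(x₀, r)`. -/
def IsBoundedIndicator (x₀ : X) (r : ℝ) (g : E) : Prop :=
  ∃ A : Set X, MeasurableSet A ∧ A ⊆ Metric.ball x₀ r ∧
    (𝔹.fn g : X → 𝕜) =ᵐ[μ] A.indicator fun _ => (1 : 𝕜)

variable {𝔹} in
theorem IsBoundedIndicator.supp {x₀ : X} {r : ℝ} {g : E} (h : 𝔹.IsBoundedIndicator x₀ r g) :
    𝔹.Supp g (Metric.ball x₀ r) := by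
  obtain ⟨A, hA, hAr, hg⟩ := h
  filter_upwards [hg] with y hy
  by_cases hB : y ∈ Metric.ball x₀ r
  · rw [indicator_of_mem hB]
  · rw [indicator_of_notMem hB, hy, indicator_of_notMem (fun h => hB (hAr h))]

variable {𝔹} in
theorem IsBoundedIndicator.memLp {x₀ : X} {r : ℝ} {g : E} (h : 𝔹.IsBoundedIndicator x₀ r g)
    (hν : ν ≪ μ) (hfin : ν (Metric.ball x₀ r) ≠ ∞) (p : ℝ≥0∞) : MemLp (𝔹.fn g : X → 𝕜) p ν := by
  obtain ⟨A, hA, hAr, hg⟩ := h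
  exact (memLp_congr_ae (hν.ae_le hg)).2 (memLp_indicator_const p hA _
    (Or.inr ((measure_mono hAr).trans_lt hfin.lt_top).ne))

/-- A closed subspace of `L^p(ν)` that contains the indicator functions of bounded sets is the
whole space. -/
theorem mem_of_boundedIndicators [Fact (1 ≤ p)] (hν : ν ≪ μ) (hpt : p ≠ ∞) (x₀ : X)
    (hμfin : ∀ r : ℝ, μ (Metric.ball x₀ r) ≠ ∞) (hfin : ∀ r : ℝ, ν (Metric.ball x₀ r) ≠ ∞)
    (M : Submodule 𝕜 (Lp 𝕜 p ν)) (hM : IsClosed (M : Set (Lp 𝕜 p ν)))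
    (h : ∀ r : ℝ, 0 < r → ∀ g : 𝔹.lpPart hν p, 𝔹.IsBoundedIndicator x₀ r g.1 →
      𝔹.lpMap hν p g ∈ M) (f : Lp 𝕜 p ν) : f ∈ M := by
  refine mem_of_indicatorConstLp_mem hpt x₀ M hM (fun r A hA hνA hr hAr => ?_) f
  obtain ⟨g, hg⟩ := 𝔹.exists_indicator A hA ((measure_mono hAr).trans_lt (hμfin r).lt_top)
  have hb : 𝔹.IsBoundedIndicator x₀ r g := ⟨A, hA, hAr, hg⟩
  have h1 := h r hr ⟨g, hb.memLp hν (hfin r) p⟩ hb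
  rwa [show 𝔹.lpMap hν p ⟨g, hb.memLp hν (hfin r) p⟩ = indicatorConstLp p hA hνA (1 : 𝕜) from
    MemLp.toLp_congr (hb.memLp hν (hfin r) p) _ (hν.ae_le hg)] at h1

theorem memLp_apply (hν : ν ≪ μ) (hp : p ∈ 𝔹.boundedSet ν T) {t : ℝ} (ht : 0 < t) {f : E}
    (hf : MemLp (𝔹.fn f : X → 𝕜) p ν) : MemLp (𝔹.fn (T t f) : X → 𝕜) p ν := by
  obtain ⟨-, C, hC⟩ := hp
  exact ⟨𝔹.aesm _ hν, (hC t ht f hf).trans_lt (ENNReal.mul_lt_top ENNReal.coe_lt_top hf.2)⟩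

/-- The operator `T_t`, on the elements of the function space that belong to `L^p(ν)`. -/
def applyLp (hν : ν ≪ μ) (hp : p ∈ 𝔹.boundedSet ν T) {t : ℝ} (ht : 0 < t) :
    𝔹.lpPart hν p →ₗ[𝕜] 𝔹.lpPart hν p :=
  (T t : E →ₗ[𝕜] E).restrict fun _ hf => 𝔹.memLp_apply hν hp ht hf

theorem coe_applyLp (hν : ν ≪ μ) (hp : p ∈ 𝔹.boundedSet ν T) {t : ℝ} (ht : 0 < t)
    (f : 𝔹.lpPart hν p) : (𝔹.applyLp hν hp ht f : E) = T t f.1 := rfl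

/-- The extension of a uniformly bounded semigroup to `L^p(ν)`. -/
theorem exists_extension [Fact (1 ≤ p)] (hν : ν ≪ μ) (hpt : p ≠ ∞) (x₀ : X)
    (hμfin : ∀ r : ℝ, μ (Metric.ball x₀ r) ≠ ∞) (hfin : ∀ r : ℝ, ν (Metric.ball x₀ r) ≠ ∞)
    (hT : ∀ s t : ℝ, 0 < s → 0 < t → T s ∘L T t = T (s + t)) (hp : p ∈ 𝔹.boundedSet ν T) :
    ∃ S : ℝ → Lp 𝕜 p ν →L[𝕜] Lp 𝕜 p ν,
      (∀ (t : ℝ) (ht : 0 < t) (f : 𝔹.lpPart hν p),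
        S t (𝔹.lpMap hν p f) = 𝔹.lpMap hν p (𝔹.applyLp hν hp ht f)) ∧
      (∀ s t : ℝ, 0 < s → 0 < t → S s ∘L S t = S (s + t)) ∧
      ∃ C : ℝ, ∀ t : ℝ, 0 < t → ‖S t‖ ≤ C := by
  have hdense : DenseRange (𝔹.lpMap hν p) := by
    intro f
    have h1 := 𝔹.mem_of_boundedIndicators hν hpt x₀ hμfin hfin
      (LinearMap.range (𝔹.lpMap hν p)).topologicalClosure
      (Submodule.isClosed_topologicalClosure _)
      (fun r _ g _ => Submodule.le_topologicalClosure _ (LinearMap.mem_range_self _ g)) f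
    rw [← SetLike.mem_coe, Submodule.topologicalClosure_coe, LinearMap.coe_range] at h1
    exact h1
  let U : ∀ t : ℝ, 0 < t → 𝔹.lpPart hν p →ₗ[𝕜] Lp 𝕜 p ν := fun t ht =>
    (𝔹.lpMap hν p).comp (𝔹.applyLp hν hp ht)
  have hU : ∀ (t : ℝ) (ht : 0 < t) (f : 𝔹.lpPart hν p),
      U t ht f = 𝔹.lpMap hν p (𝔹.applyLp hν hp ht f) := fun t ht f => rfl
  obtain ⟨C, hC⟩ := hp.2
  -- Besides continuity, this bound makes the extension well defined: `ν` is only absolutely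
  -- continuous with respect to `μ`, so `lpMap` need not be injective.
  have hbound : ∀ (t : ℝ) (ht : 0 < t) (f : 𝔹.lpPart hν p),
      ‖U t ht f‖ ≤ (C : ℝ) * ‖𝔹.lpMap hν p f‖ := by
    intro t ht f
    have hf := 𝔹.memLp_lpPart hν f
    rw [hU, norm_lpMap, norm_lpMap, coe_applyLp]
    have h1 := ENNReal.toReal_mono (ENNReal.mul_ne_top ENNReal.coe_ne_top hf.eLpNorm_ne_top)
      (hC t ht f.1 hf)
    rwa [ENNReal.toReal_mul, ENNReal.coe_toReal] at h1
  classical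
  let S : ℝ → Lp 𝕜 p ν →L[𝕜] Lp 𝕜 p ν := fun t =>
    if ht : 0 < t then (U t ht).extendOfNorm (𝔹.lpMap hν p) else 0
  have hS : ∀ (t : ℝ) (ht : 0 < t), S t = (U t ht).extendOfNorm (𝔹.lpMap hν p) := fun t ht =>
    dif_pos ht
  have hSe : ∀ (t : ℝ) (ht : 0 < t) (f : 𝔹.lpPart hν p),
      S t (𝔹.lpMap hν p f) = 𝔹.lpMap hν p (𝔹.applyLp hν hp ht f) := by
    intro t ht f
    rw [hS t ht, LinearMap.extendOfNorm_eq hdense ⟨C, hbound t ht⟩, hU]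
  refine ⟨S, hSe, fun s t hs ht => ?_, C, fun t ht => ?_⟩
  · refine ContinuousLinearMap.ext fun f => ?_
    refine hdense.induction_on (p := fun f => (S s ∘L S t) f = S (s + t) f) f
      (isClosed_eq (S s ∘L S t).continuous (S (s + t)).continuous) fun f => ?_
    rw [ContinuousLinearMap.comp_apply, hSe t ht, hSe s hs, hSe (s + t) (by linarith)]
    refine congrArg _ (Subtype.ext ?_)
    rw [coe_applyLp, coe_applyLp, coe_applyLp, ← hT s t hs ht]; rfl
  · rw [hS t ht]
    exact LinearMap.opNorm_extendOfNorm_le hdense (NNReal.coe_nonneg C) (hbound t ht)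

/-- `T_t g → g` as `t → 0`, locally in measure. -/
def TendstoLocally (ν : Measure X) (T : ℝ → E →L[𝕜] E) (x₀ : X) (g : E) : Prop :=
  ∀ ρ ε : ℝ, 0 < ε → Tendsto (fun t => ν.restrict (Metric.ball x₀ ρ)
    {y | ε ≤ ‖(𝔹.fn (T t g - g) : X → 𝕜) y‖}) (𝓝[>] 0) (𝓝 0)

/-- Convergence in L^r(μ) implies convergence in `μ`-measure, and absolute continuity of the
integral of `w` over a ball carries it over to the weighted measure. Nothing else of the strong
continuity on L^r(μ) enters the proof. -/
theorem StronglyContinuous.tendstoLocally {r : ℝ≥0∞} [Fact (1 ≤ r)] {w : X → ℝ≥0}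
    (h : 𝔹.StronglyContinuous μ r T) (x₀ : X)
    (hfin : ∀ ρ : ℝ, ∫⁻ y in Metric.ball x₀ ρ, (w y : ℝ≥0∞) ∂μ ≠ ∞)
    {g : E} (hg : MemLp (𝔹.fn g : X → 𝕜) r μ) : 𝔹.TendstoLocally (weighted μ w) T x₀ g := by
  obtain ⟨S, hS⟩ := h
  intro ρ ε hε
  have h0 := tendstoInMeasure_of_tendsto_Lp (hS.tendsto (hg.toLp (𝔹.fn g)))
  rw [tendstoInMeasure_iff_norm] at h0
  have h1 := h0 ε hε
  have h2 : Tendsto (fun t => μ {y | ε ≤ ‖(𝔹.fn (T t g - g) : X → 𝕜) y‖}) (𝓝[>] 0) (𝓝 0) := by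
    refine h1.congr' ?_
    filter_upwards [self_mem_nhdsWithin] with t ht
    refine measure_congr (eventuallyEq_set.2 ?_)
    filter_upwards [hS.extends_T t ht g hg, hg.coeFn_toLp, 𝔹.fn_sub (T t g) g] with y h3 h4 h5
    show ε ≤ ‖_‖ ↔ ε ≤ ‖_‖
    rw [h3, h4, h5, Pi.sub_apply]
  have h3 : Tendsto (fun t => (μ.restrict (Metric.ball x₀ ρ))
      {y | ε ≤ ‖(𝔹.fn (T t g - g) : X → 𝕜) y‖}) (𝓝[>] 0) (𝓝 0) :=
    tendsto_of_tendsto_of_tendsto_of_le_of_le tendsto_const_nhds h2 (fun _ => zero_le)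
      fun t => Measure.restrict_apply_le _ _
  refine (tendsto_setLIntegral_zero (hfin ρ) h3).congr fun t => ?_
  rw [weighted, restrict_withDensity measurableSet_ball,
    withDensity_apply _ (measurableSet_le_norm (𝔹.fn (T t g - g)).stronglyMeasurable ε)]

theorem eLpNorm_sub_restrict_compl (hν : ν ≪ μ) {A B : Set X} (hA : MeasurableSet A) {f g : E}
    (hg : 𝔹.Supp g B) (hBA : B ⊆ A) :
    eLpNorm (𝔹.fn (f - g) : X → 𝕜) p (ν.restrict Aᶜ) =
      eLpNorm (𝔹.fn f : X → 𝕜) p (ν.restrict Aᶜ) := by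
  refine eLpNorm_congr_ae ?_
  rw [EventuallyEq, ae_restrict_iff' hA.compl]
  filter_upwards [hν.ae_le (𝔹.fn_sub f g), hν.ae_le hg] with y h1 h2 hy
  rw [h1, Pi.sub_apply, h2, indicator_of_notMem (fun h => hy (hBA h)), sub_zero]

theorem eLpNorm_fn_sub_le (hν : ν ≪ μ) (hq : 1 ≤ q) (f g : E) :
    eLpNorm (𝔹.fn (f - g) : X → 𝕜) q ν ≤
      eLpNorm (𝔹.fn f : X → 𝕜) q ν + eLpNorm (𝔹.fn g : X → 𝕜) q ν := by
  rw [eLpNorm_congr_ae (hν.ae_le (𝔹.fn_sub f g))]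
  exact eLpNorm_sub_le (𝔹.aesm _ hν) (𝔹.aesm _ hν) hq

theorem exists_bound_sub (hν : ν ≪ μ) (hp : p ∈ 𝔹.boundedSet ν T) {g : E}
    (hg : MemLp (𝔹.fn g : X → 𝕜) p ν) :
    ∃ K : ℝ≥0∞, K ≠ ∞ ∧ ∀ t : ℝ, 0 < t → eLpNorm (𝔹.fn (T t g - g) : X → 𝕜) p ν ≤ K := by
  obtain ⟨hp1, C, hC⟩ := hp
  refine ⟨C * eLpNorm (𝔹.fn g : X → 𝕜) p ν + eLpNorm (𝔹.fn g : X → 𝕜) p ν,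
    ENNReal.add_ne_top.2 ⟨ENNReal.mul_ne_top ENNReal.coe_ne_top hg.eLpNorm_ne_top,
      hg.eLpNorm_ne_top⟩, fun t ht => ?_⟩
  exact (𝔹.eLpNorm_fn_sub_le hν hp1 _ _).trans (add_le_add (hC t ht g hg) le_rfl)

theorem tendsto_mul_sqrt {M : ℝ≥0∞} (hM : M ≠ ∞) {N : ℝ≥0∞} (hN : N ≠ ∞) :
    Tendsto (fun t : ℝ => M * ENNReal.ofReal √t * N) (𝓝[>] 0) (𝓝 0) := by
  have h1 : Tendsto (fun t : ℝ => ENNReal.ofReal √t) (𝓝[>] 0) (𝓝 (ENNReal.ofReal √0)) :=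
    ((ENNReal.continuous_ofReal.comp Real.continuous_sqrt).tendsto 0).mono_left nhdsWithin_le_nhds
  have h2 := ENNReal.Tendsto.mul_const (ENNReal.Tendsto.const_mul h1 (Or.inr hM)) (Or.inr hN)
  simpa using h2

theorem OffDiagonal.tendsto_tail (hν : ν ≪ μ) (hD : HasGrowth ν D) (hp : 1 ≤ p)
    (h : 𝔹.OffDiagonal ν T p p) {x₀ : X} {r : ℝ} (hr : 0 < r) {g : E}
    (hg : MemLp (𝔹.fn g : X → 𝕜) p ν) (hgs : 𝔹.Supp g (Metric.ball x₀ r)) :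
    Tendsto (fun t => eLpNorm (𝔹.fn (T t g - g) : X → 𝕜) p
      (ν.restrict (Metric.ball x₀ (4 * r))ᶜ)) (𝓝[>] 0) (𝓝 0) := by
  obtain ⟨M, hM, htail⟩ := h.exists_tail_le 𝔹 hν hD hp x₀ hr one_pos
  refine tendsto_of_tendsto_of_tendsto_of_le_of_le' tendsto_const_nhds
    (tendsto_mul_sqrt hM hg.eLpNorm_ne_top) (Eventually.of_forall fun _ => zero_le) ?_
  filter_upwards [Ioc_mem_nhdsGT one_pos] with t ht
  rw [𝔹.eLpNorm_sub_restrict_compl hν measurableSet_ball hgs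
    (Metric.ball_subset_ball (by linarith))]
  exact htail t ht.1 ht.2 g hg hgs

/-- Strong convergence in `L^p` from boundedness in `L^q`, `q > p`. -/
theorem OffDiagonal.tendsto_eLpNorm_sub (hν : ν ≪ μ) (hD : HasGrowth ν D) (hp : 1 ≤ p)
    (h : 𝔹.OffDiagonal ν T p p) (hpq : p < q) (hq : q ∈ 𝔹.boundedSet ν T) {x₀ : X} {r : ℝ}
    (hr : 0 < r) {g : E} (hg : MemLp (𝔹.fn g : X → 𝕜) q ν) (hgs : 𝔹.Supp g (Metric.ball x₀ r))
    (hconv : 𝔹.TendstoLocally ν T x₀ g) :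
    Tendsto (fun t => eLpNorm (𝔹.fn (T t g - g) : X → 𝕜) p ν) (𝓝[>] 0) (𝓝 0) := by
  have hgp : MemLp (𝔹.fn g : X → 𝕜) p ν :=
    𝔹.memLp_of_supp hν measurableSet_ball (hD.fin x₀ r) hgs hpq.le hg
  obtain ⟨K, hK, hb⟩ := 𝔹.exists_bound_sub hν hq hg
  have : IsFiniteMeasure (ν.restrict (Metric.ball x₀ (4 * r))) :=
    ⟨by simpa using (hD.fin x₀ (4 * r)).lt_top⟩
  have h1 := tendsto_eLpNorm_of_bounded (m := ν.restrict (Metric.ball x₀ (4 * r)))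
    (l := 𝓝[>] (0 : ℝ)) (h := fun t => (𝔹.fn (T t g - g) : X → 𝕜)) hp hpq
    (fun t => (𝔹.fn (T t g - g)).stronglyMeasurable) (hconv (4 * r)) hK (by
      filter_upwards [self_mem_nhdsWithin] with t ht
      exact (eLpNorm_mono_measure _ Measure.restrict_le_self).trans (hb t ht))
  have h2 := h1.add (h.tendsto_tail 𝔹 hν hD hp hr hgp hgs)
  rw [add_zero] at h2
  exact tendsto_of_tendsto_of_tendsto_of_le_of_le tendsto_const_nhds h2 (fun _ => zero_le)
    fun t => eLpNorm_le_restrict_add hp measurableSet_ball (𝔹.aesm _ hν)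

/-- A positive time `s` of smoothing replaces the missing higher integrability. On the fourfold
ball, `T t g - g` tends to zero in the smaller exponent `p`, which `T s` improves to `q`; outside
that ball it tends to zero in L^q already, and `T s` is bounded there. -/
theorem OffDiagonal.tendsto_eLpNorm_apply_sub (hν : ν ≪ μ) (hD : HasGrowth ν D) (hp : 1 ≤ p)
    (h : 𝔹.OffDiagonal ν T p q) (hpq : p < q) (hq : q ∈ 𝔹.boundedSet ν T) {x₀ : X} {r : ℝ}
    (hr : 0 < r) {g : E} (hg : MemLp (𝔹.fn g : X → 𝕜) q ν) (hgs : 𝔹.Supp g (Metric.ball x₀ r))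
    (hconv : 𝔹.TendstoLocally ν T x₀ g) {s : ℝ} (hs : 0 < s) :
    Tendsto (fun t => eLpNorm (𝔹.fn (T s (T t g - g)) : X → 𝕜) q ν) (𝓝[>] 0) (𝓝 0) := by
  have hq1 := hp.trans hpq.le
  set A := Metric.ball x₀ (4 * r) with hA
  have hAm : MeasurableSet A := measurableSet_ball
  obtain ⟨M, hM, hMs⟩ := h.exists_le 𝔹 hν hD hq1 x₀ (by linarith : 0 < 4 * r) hs
  have h1 := (h.mono 𝔹 hν hD hp le_rfl hp hpq.le).tendsto_eLpNorm_sub 𝔹 hν hD hp hpq hq hr hg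
    hgs hconv
  have h2 := (h.mono 𝔹 hν hD hp hpq.le hq1 le_rfl).tendsto_tail 𝔹 hν hD hq1 hr hg hgs
  obtain ⟨K, hK, hb⟩ := 𝔹.exists_bound_sub hν hq hg
  obtain ⟨-, C, hC⟩ := hq
  have h3 := (ENNReal.Tendsto.const_mul h1 (Or.inr hM)).add
    (ENNReal.Tendsto.const_mul (a := (C : ℝ≥0∞)) h2 (Or.inr ENNReal.coe_ne_top))
  rw [mul_zero, mul_zero, add_zero] at h3
  refine tendsto_of_tendsto_of_tendsto_of_le_of_le' tendsto_const_nhds h3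
    (Eventually.of_forall fun _ => zero_le) ?_
  filter_upwards [self_mem_nhdsWithin] with t ht
  set u := T t g - g with hu
  have huq : MemLp (𝔹.fn u : X → 𝕜) q ν := ⟨𝔹.aesm _ hν, (hb t ht).trans_lt hK.lt_top⟩
  have hsum : u = 𝔹.trunc A u + 𝔹.trunc Aᶜ u := by
    rw [← 𝔹.trunc_union hAm hAm.compl disjoint_compl_right, union_compl_self]
    exact (𝔹.trunc_eq_of_supp MeasurableSet.univ (by rw [Supp, indicator_univ])).symm
  have htA := 𝔹.memLp_trunc hν hAm (huq.restrict A)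
  have htc := 𝔹.memLp_trunc hν hAm.compl (huq.restrict Aᶜ)
  have hsA := 𝔹.supp_trunc hAm Subset.rfl u
  have htAp := 𝔹.memLp_of_supp hν hAm (hD.fin x₀ _) hsA hpq.le htA
  calc eLpNorm (𝔹.fn (T s u) : X → 𝕜) q ν
      = eLpNorm (𝔹.fn (T s (𝔹.trunc A u) + T s (𝔹.trunc Aᶜ u)) : X → 𝕜) q ν := by
        rw [← map_add, ← hsum]
    _ ≤ _ := 𝔹.eLpNorm_fn_add_le _ _ hν hq1
    _ ≤ _ := by
        refine add_le_add ((hMs _ htAp hsA).trans (mul_le_mul_right ?_ _))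
          ((hC s hs _ htc).trans (mul_le_mul_right ?_ _))
        · rw [𝔹.eLpNorm_trunc hν hAm]
          exact eLpNorm_mono_measure _ Measure.restrict_le_self
        · rw [𝔹.eLpNorm_trunc hν hAm.compl]

end FunctionSpace

/-- For `P > 1`, `N ^ (1 / P)` is negligible against `N`; this makes averages of almost disjoint
functions small. -/
theorem exists_nat_rpow_inv_le {c η P : ℝ} (hc : 0 ≤ c) (hη : 0 < η) (hP : 1 < P) :
    ∃ N : ℕ, 0 < N ∧ ((N : ℝ) * c) ^ (1 / P) ≤ N * η := by
  have h1 := ((tendsto_rpow_atTop (by linarith : 0 < P - 1)).comp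
    tendsto_natCast_atTop_atTop).eventually_ge_atTop (c / η ^ P)
  obtain ⟨N, hN, hN0⟩ := (h1.and (eventually_gt_atTop 0)).exists
  have hN1 : (0 : ℝ) < N := by exact_mod_cast hN0
  refine ⟨N, hN0, ?_⟩
  rw [Function.comp_apply, div_le_iff₀ (Real.rpow_pos_of_pos hη _),
    Real.rpow_sub_one hN1.ne', div_mul_eq_mul_div, le_div_iff₀ hN1, mul_comm] at hN
  calc ((N : ℝ) * c) ^ (1 / P) ≤ ((N : ℝ) ^ P * η ^ P) ^ (1 / P) :=
        Real.rpow_le_rpow (by positivity) hN (by positivity)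
    _ = N * η := by
        rw [← Real.mul_rpow hN1.le hη.le, ← Real.rpow_mul (by positivity),
          mul_one_div_cancel (by linarith), Real.rpow_one]

/-! ### Strong continuity at every finite exponent of the off-diagonal set. -/

namespace FunctionSpace

variable {X : Type*} [MetricSpace X] [MeasurableSpace X] [BorelSpace X]
  {𝕜 : Type*} [RCLike 𝕜] {μ : Measure X} {E : Type*}
  [NormedAddCommGroup E] [NormedSpace 𝕜 E] (𝔹 : FunctionSpace 𝕜 μ E)
  {ν : Measure X} {D : ℕ} {T : ℝ → E →L[𝕜] E} {p q : ℝ≥0∞}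

/-- `S` agrees with `T` on the elements of the function space that belong to `L^p(ν)`. -/
def Extends (hν : ν ≪ μ) (hp : p ∈ 𝔹.boundedSet ν T) [Fact (1 ≤ p)]
    (S : ℝ → Lp 𝕜 p ν →L[𝕜] Lp 𝕜 p ν) : Prop :=
  ∀ (t : ℝ) (ht : 0 < t) (f : 𝔹.lpPart hν p),
    S t (𝔹.lpMap hν p f) = 𝔹.lpMap hν p (𝔹.applyLp hν hp ht f)

theorem lpMap_mem_continuitySubmodule [Fact (1 ≤ p)] {hν : ν ≪ μ} {hp : p ∈ 𝔹.boundedSet ν T}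
    {S : ℝ → Lp 𝕜 p ν →L[𝕜] Lp 𝕜 p ν} (hS : 𝔹.Extends hν hp S) (g : 𝔹.lpPart hν p)
    (h : Tendsto (fun t => eLpNorm (𝔹.fn (T t g.1 - g.1) : X → 𝕜) p ν) (𝓝[>] 0) (𝓝 0)) :
    𝔹.lpMap hν p g ∈ continuitySubmodule S := by
  rw [mem_continuitySubmodule, tendsto_zero_iff_norm_tendsto_zero]
  have h1 := (ENNReal.tendsto_toReal ENNReal.zero_ne_top).comp h
  rw [ENNReal.toReal_zero] at h1
  refine h1.congr' ?_
  filter_upwards [self_mem_nhdsWithin] with t ht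
  rw [hS t ht, ← map_sub, norm_lpMap]
  rfl

theorem lpMap_mem_of_offDiagonal_lt [Fact (1 ≤ p)] {hν : ν ≪ μ} {hp : p ∈ 𝔹.boundedSet ν T}
    {S : ℝ → Lp 𝕜 p ν →L[𝕜] Lp 𝕜 p ν} (hS : 𝔹.Extends hν hp S) (hD : HasGrowth ν D)
    (h : 𝔹.OffDiagonal ν T p q) (hpq : p < q) (hq : q ∈ 𝔹.boundedSet ν T) {x₀ : X} {r : ℝ}
    (hr : 0 < r) (g : 𝔹.lpPart hν p) (hg : 𝔹.IsBoundedIndicator x₀ r g.1)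
    (hconv : 𝔹.TendstoLocally ν T x₀ g.1) : 𝔹.lpMap hν p g ∈ continuitySubmodule S :=
  𝔹.lpMap_mem_continuitySubmodule hS g ((h.mono 𝔹 hν hD hp.1 le_rfl hp.1 hpq.le).tendsto_eLpNorm_sub
    𝔹 hν hD hp.1 hpq hq hr (hg.memLp hν (hD.fin x₀ r) q) hg.supp hconv)

/-- As the operators commute, `T t (T s g) - T s g` equals `T s (T t g - g)`, which tends to zero by
smoothing. -/
theorem applyLp_mem_of_offDiagonal_gt [Fact (1 ≤ p)] {hν : ν ≪ μ} {hp : p ∈ 𝔹.boundedSet ν T}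
    {S : ℝ → Lp 𝕜 p ν →L[𝕜] Lp 𝕜 p ν} (hS : 𝔹.Extends hν hp S) (hD : HasGrowth ν D)
    (hT : ∀ s t : ℝ, 0 < s → 0 < t → T s ∘L T t = T (s + t))
    (h : 𝔹.OffDiagonal ν T q p) (hq : 1 ≤ q) (hqp : q < p) {x₀ : X} {r : ℝ}
    (hr : 0 < r) (g : 𝔹.lpPart hν p) (hg : 𝔹.IsBoundedIndicator x₀ r g.1)
    (hconv : 𝔹.TendstoLocally ν T x₀ g.1) {s : ℝ} (hs : 0 < s) :
    𝔹.lpMap hν p (𝔹.applyLp hν hp hs g) ∈ continuitySubmodule S := by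
  refine 𝔹.lpMap_mem_continuitySubmodule hS _ ((h.tendsto_eLpNorm_apply_sub 𝔹 hν hD hq hqp hp hr
    (𝔹.memLp_lpPart hν g) hg.supp hconv hs).congr' ?_)
  filter_upwards [self_mem_nhdsWithin] with t ht
  have h1 : T s (T t g.1) = T t (T s g.1) := by
    rw [← ContinuousLinearMap.comp_apply, ← ContinuousLinearMap.comp_apply, hT s t hs ht,
      hT t s ht hs, add_comm]
  rw [coe_applyLp, map_sub, h1]

/-- A Banach–Saks argument by hand, with `u` a sum of `N` differences `T t g - g`. Each new time is
taken so small that the new difference is almost disjoint from the sum so far on the fourfold ball,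
where p-th powers then add up to `N * c`, and has norm below `ε` outside. By construction `u + N •
g` is a sum of vectors `T t g`, hence lies in `M`. -/
theorem exists_averages [Fact (1 ≤ p)] {hν : ν ≪ μ} {hp : p ∈ 𝔹.boundedSet ν T} (hpt : p ≠ ∞)
    (hD : HasGrowth ν D) (h : 𝔹.OffDiagonal ν T p p) {x₀ : X} {r : ℝ}
    (hr : 0 < r) (g : 𝔹.lpPart hν p) (hg : 𝔹.IsBoundedIndicator x₀ r g.1)
    (hconv : 𝔹.TendstoLocally ν T x₀ g.1) (M : Submodule 𝕜 (Lp 𝕜 p ν))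
    (hM : ∀ (t : ℝ) (ht : 0 < t), 𝔹.lpMap hν p (𝔹.applyLp hν hp ht g) ∈ M) :
    ∃ c : ℝ≥0∞, c ≠ ∞ ∧ ∀ ε : ℝ≥0∞, ε ≠ 0 → ∀ N : ℕ, ∃ u : 𝔹.lpPart hν p,
      𝔹.lpMap hν p (u + (N : 𝕜) • g) ∈ M ∧
      eLpNorm (𝔹.fn u.1 : X → 𝕜) p (ν.restrict (Metric.ball x₀ (4 * r))) ^ p.toReal ≤ N * c ∧
      eLpNorm (𝔹.fn u.1 : X → 𝕜) p (ν.restrict (Metric.ball x₀ (4 * r))ᶜ) ≤ N * ε := by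
  have hp0 : 0 < p.toReal := ENNReal.toReal_pos (zero_lt_one.trans_le hp.1).ne' hpt
  have hgp := 𝔹.memLp_lpPart hν g
  obtain ⟨K, hK, hb⟩ := 𝔹.exists_bound_sub hν hp hgp
  have hfm : IsFiniteMeasure (ν.restrict (Metric.ball x₀ (4 * r))) :=
    ⟨by simpa using (hD.fin x₀ (4 * r)).lt_top⟩
  have hres : ∀ A : Set X, ν.restrict A ≪ μ := fun A =>
    Measure.absolutelyContinuous_of_le Measure.restrict_le_self |>.trans hν
  refine ⟨K ^ p.toReal + 1, ENNReal.add_ne_top.2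
    ⟨ENNReal.rpow_ne_top_of_nonneg hp0.le hK, ENNReal.one_ne_top⟩, fun ε hε N => ?_⟩
  induction N with
  | zero =>
    refine ⟨0, by simp, ?_, ?_⟩
    · rw [Submodule.coe_zero, eLpNorm_congr_ae ((hres _).ae_le 𝔹.fn_zero), eLpNorm_zero,
        ENNReal.zero_rpow_of_pos hp0]
      exact zero_le
    · rw [Submodule.coe_zero, eLpNorm_congr_ae ((hres _).ae_le 𝔹.fn_zero), eLpNorm_zero]
      exact zero_le
  | succ N ih =>
    obtain ⟨u, hu, huA, huc⟩ := ih
    have h1 := eventually_eLpNorm_add_rpow_le (m := ν.restrict (Metric.ball x₀ (4 * r)))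
      (l := 𝓝[>] (0 : ℝ)) (h := fun t => (𝔹.fn (T t g.1 - g.1) : X → 𝕜)) hp.1 hpt
      ((𝔹.memLp_lpPart hν u).restrict _)
      (fun t => (𝔹.fn (T t g.1 - g.1)).stronglyMeasurable) (hconv (4 * r)) hK (by
        filter_upwards [self_mem_nhdsWithin] with t ht
        exact (eLpNorm_mono_measure _ Measure.restrict_le_self).trans (hb t ht))
    have h2 := (h.tendsto_tail 𝔹 hν hD hp.1 hr hgp hg.supp).eventually
      (gt_mem_nhds (pos_iff_ne_zero.2 hε))
    obtain ⟨t, h1, h2, ht⟩ := (h1.and (h2.and self_mem_nhdsWithin)).exists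
    have ht : 0 < t := ht
    have hadd := 𝔹.fn_add u.1 (T t g.1 - g.1)
    refine ⟨u + (𝔹.applyLp hν hp ht g - g), ?_, ?_, ?_⟩
    · have e : u + (𝔹.applyLp hν hp ht g - g) + ((N + 1 : ℕ) : 𝕜) • g =
          (u + (N : 𝕜) • g) + 𝔹.applyLp hν hp ht g := by
        push_cast; rw [add_smul, one_smul]; abel
      rw [e, map_add]
      exact M.add_mem hu (hM t ht)
    · show eLpNorm (𝔹.fn (u.1 + (T t g.1 - g.1)) : X → 𝕜) p _ ^ _ ≤ _
      rw [eLpNorm_congr_ae ((hres _).ae_le hadd)]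
      refine h1.trans ?_
      push_cast
      rw [add_mul, one_mul, ← add_assoc]
      gcongr
    · show eLpNorm (𝔹.fn (u.1 + (T t g.1 - g.1)) : X → 𝕜) p _ ≤ _
      refine (𝔹.eLpNorm_fn_add_le _ _ (hres _) hp.1).trans ?_
      push_cast
      rw [add_mul, one_mul]
      exact add_le_add huc h2.le

/-- The exponent `p` may be the largest available one, so boundedness in a higher exponent cannot be
used. Averages of vectors `T t g` lie in the closed space of vectors of continuity, and their
distance to `g` is at most `((N * c) ^ (1 / p) + N * ε) / N`. This is small for large `N` because `p
> q ≥ 1`. -/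
theorem lpMap_mem_of_offDiagonal_gt [Fact (1 ≤ p)] {hν : ν ≪ μ} {hp : p ∈ 𝔹.boundedSet ν T}
    {S : ℝ → Lp 𝕜 p ν →L[𝕜] Lp 𝕜 p ν} (hS : 𝔹.Extends hν hp S) {C : ℝ}
    (hC : ∀ t : ℝ, 0 < t → ‖S t‖ ≤ C) (hD : HasGrowth ν D)
    (hT : ∀ s t : ℝ, 0 < s → 0 < t → T s ∘L T t = T (s + t)) (hpt : p ≠ ∞)
    (h : 𝔹.OffDiagonal ν T q p) (hq : 1 ≤ q) (hqp : q < p) {x₀ : X} {r : ℝ}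
    (hr : 0 < r) (g : 𝔹.lpPart hν p) (hg : 𝔹.IsBoundedIndicator x₀ r g.1)
    (hconv : 𝔹.TendstoLocally ν T x₀ g.1) : 𝔹.lpMap hν p g ∈ continuitySubmodule S := by
  have hP : 1 < p.toReal := by
    rw [← ENNReal.toReal_one]
    exact (ENNReal.toReal_lt_toReal ENNReal.one_ne_top hpt).2 (hq.trans_lt hqp)
  obtain ⟨c, hc, hu⟩ := 𝔹.exists_averages hpt hD (h.mono 𝔹 hν hD hq hqp.le hp.1 le_rfl) hr g hg
    hconv (continuitySubmodule S) (fun t ht =>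
      𝔹.applyLp_mem_of_offDiagonal_gt hS hD hT h hq hqp hr g hg hconv ht)
  rw [← SetLike.mem_coe, ← (isClosed_continuitySubmodule hC).closure_eq]
  refine Metric.mem_closure_iff.2 fun η hη => ?_
  obtain ⟨N, hN, hNb⟩ := exists_nat_rpow_inv_le (c := c.toReal) ENNReal.toReal_nonneg
    (by positivity : 0 < η / 4) hP
  obtain ⟨u, hm, huA, huc⟩ := hu (ENNReal.ofReal (η / 4)) (by simpa using hη) N
  have hN1 : (0 : ℝ) < N := by exact_mod_cast hN
  have hN2 : (N : 𝕜) ≠ 0 := by exact_mod_cast hN.ne'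
  refine ⟨(N : 𝕜)⁻¹ • 𝔹.lpMap hν p (u + (N : 𝕜) • g), Submodule.smul_mem _ _ hm, ?_⟩
  have e : (N : 𝕜)⁻¹ • 𝔹.lpMap hν p (u + (N : 𝕜) • g) =
      (N : 𝕜)⁻¹ • 𝔹.lpMap hν p u + 𝔹.lpMap hν p g := by
    rw [map_add, map_smul, smul_add, inv_smul_smul₀ hN2]
  have hnorm : ‖𝔹.lpMap hν p u‖ ≤ N * (η / 4) + N * (η / 4) := by
    rw [norm_lpMap]
    refine ENNReal.toReal_le_of_le_ofReal (by positivity) ?_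
    rw [ENNReal.ofReal_add (by positivity) (by positivity)]
    refine (eLpNorm_le_restrict_add hp.1 (measurableSet_ball (x := x₀) (ε := 4 * r))
      (𝔹.aesm _ hν)).trans (add_le_add ?_ ?_)
    · refine le_trans ?_ (ENNReal.ofReal_le_ofReal hNb)
      rw [← ENNReal.ofReal_rpow_of_nonneg (by positivity) (by positivity),
        ENNReal.ofReal_mul hN1.le, ENNReal.ofReal_natCast, ENNReal.ofReal_toReal hc, one_div,
        ENNReal.le_rpow_inv_iff (by linarith)]
      exact huA
    · rw [ENNReal.ofReal_mul hN1.le, ENNReal.ofReal_natCast]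
      exact huc
  rw [e, dist_comm, dist_eq_norm, add_sub_cancel_right, norm_smul, norm_inv, RCLike.norm_natCast,
    inv_mul_lt_iff₀ hN1]
  nlinarith

/-- Strong continuity on `L^p(ν)`, and the existence of the generator, for the exponents for which
off-diagonal estimates hold. -/
theorem hasGenerator_of_mem_offSet [Fact (1 ≤ p)] (hν : ν ≪ μ) (hD : HasGrowth ν D)
    (hTtr : 𝔹.TruncationContinuous T)
    (hT : ∀ s t : ℝ, 0 < s → 0 < t → T s ∘L T t = T (s + t)) (x₀ : X)
    (hμfin : ∀ r : ℝ, μ (Metric.ball x₀ r) ≠ ∞)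
    (hconv : ∀ r : ℝ, ∀ g : E, 𝔹.IsBoundedIndicator x₀ r g → 𝔹.TendstoLocally ν T x₀ g)
    (hpJ : p ∈ 𝔹.offSet ν T) (hpt : p ≠ ∞) : 𝔹.HasGenerator ν p T := by
  have : Nonempty X := ⟨x₀⟩
  have hsub := 𝔹.offSet_subset_boundedSet hν hD hTtr
  have hp := hsub hpJ
  obtain ⟨S, hS, hcomp, C, hC⟩ := 𝔹.exists_extension hν hpt x₀ hμfin (hD.fin x₀) hT hp
  have hS : 𝔹.Extends hν hp S := hS
  have hcont : ∀ f : Lp 𝕜 p ν, f ∈ continuitySubmodule S := by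
    refine fun f => 𝔹.mem_of_boundedIndicators hν hpt x₀ hμfin (hD.fin x₀) _
      (isClosed_continuitySubmodule hC) (fun r hr g hg => ?_) f
    obtain ⟨q, hp1, hq1, ⟨hpq, h⟩ | ⟨hqp, h⟩⟩ := id hpJ
    · exact 𝔹.lpMap_mem_of_offDiagonal_lt hS hD h hpq
        (hsub ⟨p, hq1, hp1, Or.inr ⟨hpq, h⟩⟩) hr g hg (hconv r _ hg)
    · exact 𝔹.lpMap_mem_of_offDiagonal_gt hS hC hD hT hpt h hq1 hqp hr g hg (hconv r _ hg)
  have hB : IsBoundedC0 S C := ⟨hcomp, hC, hcont⟩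
  refine ⟨S, ⟨fun t ht f hf => ?_, hcomp, hcont⟩, hB.exists_generator⟩
  have h1 := hS t ht ⟨f, hf⟩
  have h2 : S t (hf.toLp (𝔹.fn f)) = (𝔹.memLp_apply hν hp ht hf).toLp (𝔹.fn (T t f)) := h1
  rw [h2]
  exact MemLp.coeFn_toLp _

end FunctionSpace

/-! ### The case of a vanishing weighted measure. -/

namespace FunctionSpace

section ZeroMeasure

variable {X : Type*} [MetricSpace X] [MeasurableSpace X]
  {𝕜 : Type*} [RCLike 𝕜] {μ : Measure X} {E : Type*}
  [NormedAddCommGroup E] [NormedSpace 𝕜 E] (𝔹 : FunctionSpace 𝕜 μ E)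
  {T : ℝ → E →L[𝕜] E} {p q : ℝ≥0∞}

theorem offDiagonal_zero (p q : ℝ≥0∞) : 𝔹.OffDiagonal 0 T p q :=
  ⟨1, 1, 1, 1, one_pos, one_pos, one_pos, one_pos, fun t ht x r hr f hf => by simp [avgNorm]⟩

theorem offSet_zero : 𝔹.offSet 0 T = Icc 1 ∞ := by
  ext p
  refine ⟨fun ⟨_, hp, _⟩ => ⟨hp, le_top⟩, fun hp => ?_⟩
  rcases eq_or_ne p ∞ with rfl | hpt
  · exact ⟨1, hp.1, le_rfl, Or.inr ⟨ENNReal.one_lt_top, 𝔹.offDiagonal_zero _ _⟩⟩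
  · exact ⟨∞, hp.1, le_top, Or.inl ⟨hpt.lt_top, 𝔹.offDiagonal_zero _ _⟩⟩

theorem boundedSet_zero : 𝔹.boundedSet 0 T = Icc 1 ∞ := by
  ext p
  exact ⟨fun ⟨hp, _⟩ => ⟨hp, le_top⟩, fun hp => ⟨hp.1, 0, fun t _ f _ => by simp⟩⟩

theorem characterizes_zero (J : Set ℝ≥0∞) :
    𝔹.CharacterizesOffDiagonal 0 T J ↔ J = 𝔹.offSet 0 T := by
  rw [offSet_zero]
  constructor
  · rintro ⟨hJ, h⟩
    refine hJ.antisymm fun p hp => ?_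
    rcases eq_or_ne p ∞ with rfl | hpt
    · exact ((h 1 ∞ le_rfl ENNReal.one_lt_top).1 (𝔹.offDiagonal_zero _ _)).2
    · exact ((h p ∞ hp.1 hpt.lt_top).1 (𝔹.offDiagonal_zero _ _)).1
  · rintro rfl
    exact ⟨Subset.rfl, fun p q hp hpq => ⟨fun _ => ⟨⟨hp, le_top⟩, ⟨hp.trans hpq.le, le_top⟩⟩,
      fun _ => 𝔹.offDiagonal_zero _ _⟩⟩

theorem hasGenerator_zero [Fact (1 ≤ p)] : 𝔹.HasGenerator 0 p T := by
  have hsub : Subsingleton (Lp 𝕜 p (0 : Measure X)) :=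
    ⟨fun f g => Lp.ext (by rw [ae_zero]; exact eventually_bot)⟩
  have h : IsBoundedC0 (fun _ : ℝ => (0 : Lp 𝕜 p (0 : Measure X) →L[𝕜] Lp 𝕜 p (0 : Measure X))) 0 :=
    ⟨fun s t _ _ => by simp, fun t _ => by simp, fun f => by
      rw [Subsingleton.elim f 0]; simp⟩
  exact ⟨_, ⟨fun t ht f hf => by rw [ae_zero]; exact eventually_bot, h.comp, h.tendsto⟩,
    h.exists_generator⟩

end ZeroMeasure

end FunctionSpace

end OffDiag

/-! ### The theorem. -/

theorem mainTheorem9 {X : Type*} [MetricSpace X] [Nonempty X] [MeasurableSpace X] [BorelSpace X]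
    (μ : MeasureTheory.Measure X) (hμ : OffDiag.IsDoubling μ)
    {𝕜 : Type*} [RCLike 𝕜]
    {E : Type*} [NormedAddCommGroup E] [NormedSpace 𝕜 E] [CompleteSpace E]
    (𝔹 : OffDiag.FunctionSpace 𝕜 μ E)
    (T : ℝ → E →L[𝕜] E)
    (hT : ∀ s t : ℝ, 0 < s → 0 < t → T s ∘L T t = T (s + t))
    (hTtr : 𝔹.TruncationContinuous T)
    (w : X → ℝ≥0) (hw : Measurable w)
    (hwint : MeasureTheory.LocallyIntegrable (fun x => (w x : ℝ)) μ)
    (p₀ q₀ : ℝ≥0∞) (hp₀ : 1 ≤ p₀) (hpq : p₀ < q₀)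
    (hJ : Set.Ioo p₀ q₀ ⊆ 𝔹.offSet μ T)
    (hW : (OffDiag.weightSet μ w p₀ q₀).Nonempty) :
    (∀ J : Set ℝ≥0∞, 𝔹.CharacterizesOffDiagonal (OffDiag.weighted μ w) T J ↔
        J = 𝔹.offSet (OffDiag.weighted μ w) T) ∧
      (𝔹.offSet (OffDiag.weighted μ w) T).OrdConnected ∧
      (𝔹.boundedSet (OffDiag.weighted μ w) T).OrdConnected ∧
      OffDiag.weightSet μ w p₀ q₀ ⊆ 𝔹.offSet (OffDiag.weighted μ w) T ∧
      𝔹.offSet (OffDiag.weighted μ w) T ⊆ 𝔹.boundedSet (OffDiag.weighted μ w) T ∧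
      OffDiag.realInterior (𝔹.offSet (OffDiag.weighted μ w) T) =
        OffDiag.realInterior (𝔹.boundedSet (OffDiag.weighted μ w) T) ∧
      ∀ (r : ℝ≥0∞) [Fact (1 ≤ r)], r ∈ Set.Ioo p₀ q₀ → 𝔹.StronglyContinuous μ r T →
        ∀ (p : ℝ≥0∞) [Fact (1 ≤ p)], p ∈ 𝔹.offSet (OffDiag.weighted μ w) T → p ≠ ∞ →
          𝔹.HasGenerator (OffDiag.weighted μ w) p T := by
  obtain ⟨p₁, hp₁⟩ := id hW
  obtain ⟨x₀⟩ := id ‹Nonempty X›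
  -- As `0 * ∞ = 0`, the class A_s admits weights that vanish almost everywhere. Then all norms are
  -- zero, every estimate holds, and both exponent sets are `[1, ∞]`.
  by_cases h0 : OffDiag.weighted μ w = 0
  · rw [h0, 𝔹.boundedSet_zero]
    have hJ0 := 𝔹.offSet_zero (T := T)
    refine ⟨𝔹.characterizes_zero, ?_, Set.ordConnected_Icc, ?_, hJ0.subset, by rw [hJ0], ?_⟩
    · rw [hJ0]; exact Set.ordConnected_Icc
    · rw [hJ0]; exact fun p hp => ⟨hp₀.trans hp.1.le, le_top⟩
    · exact fun _ _ _ _ p _ _ _ => 𝔹.hasGenerator_zero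
  have hμ0 : μ ≠ 0 := by
    rintro rfl
    exact h0 (MeasureTheory.withDensity_zero_left _)
  obtain ⟨D, hD⟩ := hμ.exists_hasGrowth fun x r hr => hμ.ball_pos hμ0 x hr
  have hA := hp₁.2.2.1.apWeight hw hD h0
  obtain ⟨D', hD'⟩ : ∃ D', OffDiag.HasGrowth (OffDiag.weighted μ w) D' := hA.exists_growth hD
  have hν : OffDiag.weighted μ w ≪ μ := MeasureTheory.withDensity_absolutelyContinuous _ _
  have hsub := 𝔹.weightSet_subset_offSet hD hTtr hT hw h0 hp₀ hJ
  have hne := hW.mono hsub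
  refine ⟨𝔹.characterizes_iff hν hD' hTtr hT hne, 𝔹.ordConnected_offSet hν hD' hTtr hT,
    𝔹.ordConnected_boundedSet hν hD' hTtr hne, hsub, 𝔹.offSet_subset_boundedSet hν hD' hTtr,
    𝔹.realInterior_offSet_eq hν hD' hTtr hne, fun r _ _ hS p _ hp hpt => ?_⟩
  exact 𝔹.hasGenerator_of_mem_offSet hν hD' hTtr hT x₀ (hD.fin x₀) (fun ρ g hg =>
    OffDiag.FunctionSpace.StronglyContinuous.tendstoLocally 𝔹 hS x₀ (hA.setLIntegral_ne_top hD x₀)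
      (hg.memLp MeasureTheory.Measure.AbsolutelyContinuous.rfl (hD.fin x₀ ρ) r)) hp hpt
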